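/- **Setting.** Let $G$ be a locally compact second countable group, $H$ a closed subgroup, $X=H\backslash G$, let $\Gamma$ be a lattice in $G$, and $Y=G/\Gamma$. Let $m,\rho$ be left Haar measures on $G,H$, with $m$ normalised so that the induced invariant measure $\mu$ on $Y$ is a probability measure. Fix a measurable section $\mathsf s:X\to G$ of $\mathsf p_X:g\mapsto Hg$ that is bounded on compact sets, and let $\xi$ be the measure on $X$ with $\int_G f\,dm=\int_X\int_H f(h\,\mathsf s(x))\,d\rho(h)\,d\xi(x)$. Let $\{G_t\}$ be an increasing family of compact subsets of $G$ and $t_0\in\mathbb R$; put $H_t=H\cap G_t$ and $H_t[u,v]=H\cap uG_tv^{-1}$. Define $$\pi_X(\lambda_t)\phi(x)=\frac1{\rho(H_t)}\sum_{\gamma\in\Gamma\cap G_t}\phi(x\gamma),\qquad \pi_X(\lambda^G_t)\phi(x)=\frac1{\rho(H_t)}\int_{G_t}\phi(xg)\,dm(g),$$ $$\pi_Y(\beta^{g_1,g_2}_t)F(y)=\frac1{\rho(H_t[g_1,g_2])}\int_{H_t[g_1,g_2]}F(h^{-1}y)\,d\rho(h).$$ Let $1\le p<q\le\infty$ and $l\in\mathbb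 Z_{\ge0}$. For a compact set $D$, $L^q_l(D)^+$ is the cone of nonnegative functions supported in $D$ whose Sobolev norm $\|\cdot\|_{L^q_l(D)}$ (the sum of the $L^q$-norms of the distributional derivatives of order at most $l$, computed in a finite system of charts covering $D$ with a subordinate partition of unity) is finite; for $l=0$ it is $L^q(D)^+$ with the norm of $L^q(\xi)$, respectively $L^q(\mu)$. When $l\ge1$, $G$ is assumed to be a connected Lie group with a Riemannian metric. A compact domain in $Y$ is a compact set which is the closure of its interior, the boundary of this interior being $\mu$-null. **Standing hypotheses.** * (CA1) For every compact $\Omega\subset G$ there is $c>0$ with $\Omega G_t\Omega\subset G_{t+c}$ for all $t\ge t_0$. * (CA2) $\rho(H_t)>0$ for $t\ge t_0$, and $\sup_{t\ge t_0}\rho(H_{t+c})/\rho(H_t)<\infty$ for every $c>0$. * (HA1) There are a basis $\{O_\varepsilon\}_{\varepsilon\in(0,1]}$ of symmetric neighbourhoods of $e$ in $G$ and $c>0$ with $O_\varepsilon G_tO_\varepsilon\subset G_{t+c\varepsilon}$ for all $\varepsilon\in(0,1)$, $t\ge t_0$. Moreover there are $\kappa,d\in\mathbb R$ such that for all small $\varepsilon$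 there is a nonnegative $\chi_\varepsilon\in C_c(H)$ with $\operatorname{supp}\chi_\varepsilon\subset O_\varepsilon$, $\int_H\chi_\varepsilon\,d\rho=1$ and $\|\chi_\varepsilon\|_{L^q(H)}\ll\varepsilon^{-\kappa}$, and every compact $\Omega\subset G$ is covered, for every $\varepsilon\in(0,1)$, by $O_\Omega(\varepsilon^{-d})$ translates $vO_\varepsilon$. * (HS) Every $x\in X$ has a neighbourhood $U$ with a section $\sigma:U\to G$ of $\mathsf p_X$ and $L>0$ such that $\sigma(y')\in\sigma(y)O_{L\varepsilon}$ whenever $y,y'\in U$, $y'\in yO_\varepsilon$, $L\varepsilon\le1$. When $l\ge1$, (HA1) and (HS) are replaced by the following assumption only: $O_\varepsilon G_tO_\varepsilon\subset G_{t+c\varepsilon}$ for some $c>0$ and all $\varepsilon\in(0,1)$, $t\ge t_0$, where $O_\varepsilon$ is the symmetric $\varepsilon$-neighbourhood of $e$ for the Riemannian metric, i.e. the set of $g$ such that $g$ and $g^{-1}$ are both at distance less than $\varepsilon$ from $e$. **Further hypotheses.** * (HA2) with $r=q/(q-1)$: for every $u\in G$ and compact $\Omega\subset G$ there are $c,\theta>0$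 such that for all $t\ge t_0$, $\varepsilon\in(0,1)$, $$\Big(\int_\Omega\big(\rho(H_{t+\varepsilon}[u,v])-\rho(H_t[u,v])\big)^r\,dm(v)\Big)^{1/r}\le c\,\varepsilon^\theta\rho(H_t).$$ * (HA2′) with $r=pq/(q-p)$: for every compact $\Omega\subset G$ there are $c,\theta>0$ such that for all $t\ge t_0$, $\varepsilon\in(0,1)$, $$\Big(\int_{\Omega\times\Omega}\big(\rho(H_{t+\varepsilon}[u,v])-\rho(H_t[u,v])\big)^r\,dm(u)\,dm(v)\Big)^{1/r}\le c\,\varepsilon^\theta\rho(H_t).$$ * (E) For every compact $K\subset G$ and every compact domain $B\subset Y$ there are $\sigma>0$, $C$, $t_1$ such that for all $g_1,g_2\in K$, $F\in L^q_l(B)^+$ and $t\ge t_1$, $$\Big\|\pi_Y(\beta^{g_1,g_2}_t)F-\int_YF\,d\mu\Big\|_{L^p(B)}\le C e^{-\sigma t}\|F\|_{L^q_l(B)}.$$ (For $q=\infty$ read $r=1$ in (HA2) and $r=p$ in (HA2′).) **Theorem.** Assume the standing hypotheses. 1. If (HA2), (HA2′) and (E) hold, then for every compact $D\subset X$, every $\phi\in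 L^q_l(D)^+$ and almost every $x\in D$ there are $\delta>0$ and $C$ such that $|\pi_X(\lambda_t)\phi(x)-\pi_X(\lambda^G_t)\phi(x)|\le C e^{-\delta t}$ for all $t\ge t_0$. 2. Suppose that (HA2), (HA2′) and (E) hold uniformly: the exponent $\theta$ in (HA2) does not depend on $u,\Omega$ and the constant $c$ there is uniform for $u$ in compact sets; $\theta$ in (HA2′) does not depend on $\Omega$; $\sigma$ in (E) does not depend on $K,B$. Then there is $\delta>0$ such that for every compact $D\subset X$ there is a constant $M$ (depending on $D$, $p$, $q$, $l$ and the given data, but not on $\phi$) with the following property: for every $\phi\in L^q_l(D)^+$ there is a function $C(\phi,\cdot)\in L^p(D)$ with $$|\pi_X(\lambda_t)\phi(x)-\pi_X(\lambda^G_t)\phi(x)|\le C(\phi,x)\,e^{-\delta t}\quad\text{for almost every }x\in D\text{ and all }t\ge t_0,$$ $$\|C(\phi,\cdot)\|_{L^p(D)}\le M\,\|\phi\|_{L^q_l(D)}.$$ In particular $\delta$ is independent of $D$, $\phi$ and $x$. -/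

import Mathlib

open MeasureTheory Set Filter Topology
open scoped ENNReal NNReal Manifold ContDiff Pointwise Bundle

noncomputable section

/-! ### The space of right cosets `H \ G` -/

section RightCosets

variable {G : Type*} [Group G]

/-- The homogeneous space `H \ G` of right cosets `H g`. -/
def RightQuotient (H : Subgroup G) : Type _ := Quotient (QuotientGroup.rightRel H)

namespace RightQuotient

/-- The projection `g ↦ H g`. -/
def proj (H : Subgroup G) (g : G) : RightQuotient H :=
  Quotient.mk (QuotientGroup.rightRel H) g

/-- The right action `(H a) · g = H (a g)`. -/
def act {H : Subgroup G} (x : RightQuotient H) (g : G) : RightQuotient H :=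
  Quotient.map (· * g) (fun a b (hab : QuotientGroup.rightRel H a b) => by
    change QuotientGroup.rightRel H (a * g) (b * g)
    rw [QuotientGroup.rightRel_apply] at hab ⊢
    simpa [mul_assoc] using hab) x

/-- The quotient topology. -/
instance [TopologicalSpace G] (H : Subgroup G) : TopologicalSpace (RightQuotient H) :=
  inferInstanceAs (TopologicalSpace (Quotient (QuotientGroup.rightRel H)))

instance [TopologicalSpace G] (H : Subgroup G) : MeasurableSpace (RightQuotient H) :=
  borel (RightQuotient H)

instance [TopologicalSpace G] (H : Subgroup G) : BorelSpace (RightQuotient H) := ⟨rfl⟩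

end RightQuotient

end RightCosets

/-- A compact domain: a compact set that is the closure of its interior, the boundary of the
interior having measure zero. -/
def IsCompactDomain {Z : Type*} [TopologicalSpace Z] [MeasurableSpace Z] (ν : Measure Z)
    (B : Set Z) : Prop :=
  IsCompact B ∧ B = closure (interior B) ∧ ν (frontier (interior B)) = 0

/-! ### Sobolev norms -/

section Sobolev

/-- The partial derivative in the `i`-th coordinate direction. -/
def partialD {d : ℕ} (i : Fin d) (f : EuclideanSpace ℝ (Fin d) → ℝ) :
    EuclideanSpace ℝ (Fin d) → ℝ :=
  fun x => fderiv ℝ f x (EuclideanSpace.single i 1)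

/-- The iterated partial derivative for the multi-index `α`. -/
def multiD {d : ℕ} (α : Fin d → ℕ) (f : EuclideanSpace ℝ (Fin d) → ℝ) :
    EuclideanSpace ℝ (Fin d) → ℝ :=
  (List.finRange d).foldr (fun i g => (partialD i)^[α i] g) f

/-- `v` is the distributional derivative of `u` for the multi-index `α`. -/
def IsWeakDeriv {d : ℕ} (α : Fin d → ℕ) (u v : EuclideanSpace ℝ (Fin d) → ℝ) : Prop :=
  LocallyIntegrable u ∧ LocallyIntegrable v ∧
    ∀ η : EuclideanSpace ℝ (Fin d) → ℝ, ContDiff ℝ ∞ η → HasCompactSupport η →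
      ∫ x, u x * multiD α η x = (-1 : ℝ) ^ (∑ i, α i) * ∫ x, v x * η x

/-- The Sobolev norm `∑_{|α| ≤ l} ‖D^α u‖_q` on `ℝ^d`; it is infinite when some distributional
derivative of order at most `l` does not exist as a function in `L^q`. -/
def sobolevNorm {d : ℕ} (l : ℕ) (q : ℝ≥0∞) (u : EuclideanSpace ℝ (Fin d) → ℝ) : ℝ≥0∞ :=
  ∑ k ∈ Finset.range (l + 1), ∑ α ∈ Finset.piAntidiag (Finset.univ : Finset (Fin d)) k,
    ⨅ (v : EuclideanSpace ℝ (Fin d) → ℝ) (_ : IsWeakDeriv α u v), eLpNorm v q volume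

variable {n : ℕ} {G Z : Type*} [TopologicalSpace G] [ChartedSpace (EuclideanSpace ℝ (Fin n)) G]
  [TopologicalSpace Z]

/-- A smooth coordinate chart `κ : ℝ^d → Z` of a quotient `pr : G → Z` of a manifold `G`, where `Z`
carries the smooth structure that makes `pr` a submersion: `κ` is a homeomorphism onto an open set,
it is smooth (it lifts locally to smooth maps to `G`), and its inverse is smooth (it is smooth
after composition with `pr`). -/
structure IsQuotientChart (n : ℕ) {G Z : Type*} [TopologicalSpace G]
    [ChartedSpace (EuclideanSpace ℝ (Fin n)) G] [TopologicalSpace Z] (pr : G → Z) {d : ℕ}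
    (κ : EuclideanSpace ℝ (Fin d) → Z) : Prop where
  isOpenEmbedding : IsOpenEmbedding κ
  smooth : ∀ z, ∃ U ∈ 𝓝 z, ∃ σ : EuclideanSpace ℝ (Fin d) → G,
    ContMDiffOn (𝓡 d) (𝓡 n) ∞ σ U ∧ ∀ w ∈ U, pr (σ w) = κ w
  smooth_inv : ∃ τ : Z → EuclideanSpace ℝ (Fin d), (∀ z, τ (κ z) = z) ∧
    ContMDiffOn (𝓡 n) (𝓡 d) ∞ (τ ∘ pr) (pr ⁻¹' range κ)

/-- A finite system of coordinate charts covering `D`, with a smooth partition of unity on `D`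
subordinate to it. -/
structure ChartSystem (n : ℕ) {G Z : Type*} [TopologicalSpace G]
    [ChartedSpace (EuclideanSpace ℝ (Fin n)) G] [TopologicalSpace Z] (pr : G → Z) (d k : ℕ)
    (D : Set Z) where
  chart : Fin k → EuclideanSpace ℝ (Fin d) → Z
  ψ : Fin k → Z → ℝ
  isChart : ∀ i, IsQuotientChart n pr (chart i)
  smooth : ∀ i, ContMDiff (𝓡 n) 𝓘(ℝ, ℝ) ∞ (ψ i ∘ pr)
  nonneg : ∀ i z, 0 ≤ ψ i z
  tsupport_subset : ∀ i, tsupport (ψ i) ⊆ range (chart i)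
  sum_eq_one : ∀ z ∈ D, ∑ i, ψ i z = 1

/-- The Sobolev norm of a function supported in `D`, computed in a system of charts. -/
def ChartSystem.norm {pr : G → Z} {d k : ℕ} {D : Set Z} (𝒞 : ChartSystem n pr d k D) (l : ℕ)
    (q : ℝ≥0∞) (φ : Z → ℝ) : ℝ≥0∞ :=
  ∑ i, sobolevNorm l q (fun w => φ (𝒞.chart i w) * 𝒞.ψ i (𝒞.chart i w))

/-- `N` is one of the (mutually equivalent) Sobolev norms of `L^q_l(D)`. -/
def IsSobolevNorm (n : ℕ) {G Z : Type*} [TopologicalSpace G]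
    [ChartedSpace (EuclideanSpace ℝ (Fin n)) G] [TopologicalSpace Z] (pr : G → Z) (l : ℕ)
    (q : ℝ≥0∞) (D : Set Z) (N : (Z → ℝ) → ℝ≥0∞) : Prop :=
  ∃ (d k : ℕ) (𝒞 : ChartSystem n pr d k D), N = 𝒞.norm l q

/-- `N` is the norm of `L^q(D)`; it is only applied to functions vanishing outside `D`. -/
def IsLebesgueNorm {Z : Type*} [MeasurableSpace Z] (ν : Measure Z) (q : ℝ≥0∞) (_D : Set Z)
    (N : (Z → ℝ) → ℝ≥0∞) : Prop :=
  N = fun φ => eLpNorm φ q ν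

/-- The cone of nonnegative functions supported in `D` with finite norm `N`. -/
def PositiveCone {Z : Type*} [MeasurableSpace Z] (ν : Measure Z) (D : Set Z)
    (N : (Z → ℝ) → ℝ≥0∞) : Set (Z → ℝ) :=
  {φ | AEStronglyMeasurable φ ν ∧ (∀ z, 0 ≤ φ z) ∧ (∀ z, z ∉ D → φ z = 0) ∧ N φ ≠ ⊤}

/-- The set of elements at distance less than `ε` from the identity (together with their inverses,
which makes it symmetric), for the distance of a Riemannian metric on `G`. -/
def riemannianNhd (n : ℕ) (G : Type*) [Group G] [TopologicalSpace G]
    [ChartedSpace (EuclideanSpace ℝ (Fin n)) G] [IsManifold (𝓡 n) ∞ G]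
    [Bundle.RiemannianBundle (fun x : G => TangentSpace (𝓡 n) x)] (ε : ℝ) : Set G :=
  {g | Manifold.riemannianEDist (𝓡 n) 1 g < ENNReal.ofReal ε ∧
    Manifold.riemannianEDist (𝓡 n) 1 g⁻¹ < ENNReal.ofReal ε}

end Sobolev

/-! ### The groups, the spaces and the measures -/

/-- A closed subgroup `H` and a lattice `Γ` of `G`, the spaces `X = H \ G` and `Y = G / Γ`, the
measures `m`, `ρ`, `ξ`, `μ` on `G`, `H`, `X`, `Y`, a section `s` of `G → X`, and an increasing family
of compact sets `G_t`. -/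
structure DualitySetting (G : Type*) [Group G] [TopologicalSpace G] [MeasurableSpace G] where
  H : Subgroup G
  isClosed_H : IsClosed (H : Set G)
  Γ : Subgroup G
  discrete_Γ : DiscreteTopology Γ
  /-- left Haar measure on `G` -/
  m : Measure G
  haar_m : m.IsHaarMeasure
  /-- left Haar measure on `H` -/
  ρ : Measure H
  haar_ρ : ρ.IsHaarMeasure
  /-- the `G`-invariant probability measure on `G / Γ` induced by `m` -/
  μ : Measure (G ⧸ Γ)
  invariant_μ : SMulInvariantMeasure G (G ⧸ Γ) μ
  prob_μ : IsProbabilityMeasure μ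
  induced_μ : ∃ 𝓕 : Set G, IsFundamentalDomain Γ.op 𝓕 m ∧
    μ = (m.restrict 𝓕).map (fun g : G => (g : G ⧸ Γ))
  /-- a measurable section of `G → H \ G`, bounded on compact sets -/
  s : RightQuotient H → G
  measurable_s : Measurable s
  proj_s : ∀ x, RightQuotient.proj H (s x) = x
  bounded_s : ∀ D, IsCompact D → IsCompact (closure (s '' D))
  /-- the measure on `H \ G` that decomposes `m` along the section -/
  ξ : Measure (RightQuotient H)
  decomposition : ∀ f : G → ℝ≥0∞, Measurable f →
    ∫⁻ g, f g ∂m = ∫⁻ x, ∫⁻ h : H, f (h * s x) ∂ρ ∂ξ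
  /-- the sets `G_t` -/
  ball : ℝ → Set G
  monotone_ball : Monotone ball
  isCompact_ball : ∀ t, IsCompact (ball t)
  /-- the initial time `t_0` -/
  t₀ : ℝ

namespace DualitySetting

variable {G : Type*} [Group G] [TopologicalSpace G] [MeasurableSpace G] (S : DualitySetting G)

/-- The space `X = H \ G`. -/
abbrev X : Type _ := RightQuotient S.H

/-- The space `Y = G / Γ`. -/
abbrev Y : Type _ := G ⧸ S.Γ

/-- The projection `G → X`. -/
def projX (g : G) : S.X := RightQuotient.proj S.H g

/-- The projection `G → Y`. -/
def projY (g : G) : S.Y := (g : G ⧸ S.Γ)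

/-- `H_t[u, v] = H ∩ u G_t v⁻¹`. -/
def skewBall (t : ℝ) (u v : G) : Set S.H := {h | u⁻¹ * (h : G) * v ∈ S.ball t}

/-- `ρ(H_t[u, v])`. -/
def skewVol (t : ℝ) (u v : G) : ℝ := S.ρ.real (S.skewBall t u v)

/-- `ρ(H_t)`. -/
def vol (t : ℝ) : ℝ := S.ρ.real {h : S.H | (h : G) ∈ S.ball t}

/-- The discrete averages `π_X(λ_t) φ (x) = ρ(H_t)⁻¹ ∑_{γ ∈ Γ ∩ G_t} φ(x γ)` (a finite sum). -/
def discreteAvg (t : ℝ) (φ : S.X → ℝ) (x : S.X) : ℝ :=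
  (S.vol t)⁻¹ * ∑ᶠ γ ∈ (S.Γ : Set G) ∩ S.ball t, φ (x.act γ)

/-- The continuous averages `π_X(λ^G_t) φ (x) = ρ(H_t)⁻¹ ∫_{G_t} φ(x g) dm(g)`. -/
def continuousAvg (t : ℝ) (φ : S.X → ℝ) (x : S.X) : ℝ :=
  (S.vol t)⁻¹ * ∫ g in S.ball t, φ (x.act g) ∂S.m

/-- The averages `π_Y(β_t^{u,v}) F (y) = ρ(H_t[u,v])⁻¹ ∫_{H_t[u,v]} F(h⁻¹ y) dρ(h)`. -/
def betaAvg (t : ℝ) (u v : G) (F : S.Y → ℝ) (y : S.Y) : ℝ :=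
  (S.skewVol t u v)⁻¹ * ∫ h in S.skewBall t u v, F ((h : G)⁻¹ • y) ∂S.ρ

/-! ### Regularity of the sets `G_t` -/

/-- Coarse admissibility of the sets `G_t`. -/
def CA1 : Prop := ∀ Ω : Set G, IsCompact Ω → ∃ c > 0, ∀ t ≥ S.t₀,
  Ω * S.ball t * Ω ⊆ S.ball (t + c)

/-- Coarse volume growth of the sets `H_t` (whose volumes are positive for `t ≥ t₀`). -/
def CA2 : Prop := (∀ t ≥ S.t₀, 0 < S.vol t) ∧
  ∀ c > 0, ∃ C : ℝ, ∀ t ≥ S.t₀, S.vol (t + c) / S.vol t ≤ C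

/-- `{O_ε}`, `0 < ε ≤ 1`, is a basis of symmetric neighbourhoods of the identity. -/
def IsSymmetricBasis (O : ℝ → Set G) : Prop :=
  (∀ ε ∈ Ioc (0 : ℝ) 1, O ε ∈ 𝓝 (1 : G) ∧ (O ε)⁻¹ = O ε) ∧
    ∀ U ∈ 𝓝 (1 : G), ∃ ε ∈ Ioc (0 : ℝ) 1, O ε ⊆ U

/-- The sets `G_t` are Lipschitz well-rounded for the neighbourhoods `O_ε`. -/
def LipschitzBalls (O : ℝ → Set G) : Prop :=
  ∃ c > 0, ∀ ε ∈ Ioo (0 : ℝ) 1, ∀ t ≥ S.t₀, O ε * S.ball t * O ε ⊆ S.ball (t + c * ε)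

/-- Existence of approximate identities on `H` with polynomially growing `L^q`-norm. -/
def HasBumps (O : ℝ → Set G) (q : ℝ≥0∞) : Prop :=
  ∃ κ C ε₀ : ℝ, 0 < ε₀ ∧ ∀ ε ∈ Ioo (0 : ℝ) ε₀, ∃ χ : S.H → ℝ,
    Continuous χ ∧ HasCompactSupport χ ∧ (∀ h, 0 ≤ χ h) ∧
    (∀ h ∈ tsupport χ, (h : G) ∈ O ε) ∧ ∫ h, χ h ∂S.ρ = 1 ∧
    eLpNorm χ q S.ρ ≤ ENNReal.ofReal (C * ε ^ (-κ))

/-- Compact sets are covered by polynomially many translates of `O_ε`. -/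
def HasCovers (O : ℝ → Set G) : Prop :=
  ∃ d : ℝ, ∀ Ω : Set G, IsCompact Ω → ∃ C : ℝ, ∀ ε ∈ Ioo (0 : ℝ) 1, ∃ T : Finset G,
    (T.card : ℝ) ≤ C * ε ^ (-d) ∧ Ω ⊆ ⋃ v ∈ T, v • O ε

/-- Every point of `X` has a neighbourhood with a section that is Lipschitz with respect to the
neighbourhoods `O_ε`. -/
def HasLipschitzSections (O : ℝ → Set G) : Prop :=
  ∀ x : S.X, ∃ U ∈ 𝓝 x, ∃ σ : S.X → G, (∀ y ∈ U, S.projX (σ y) = y) ∧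
    ∃ L > 0, ∀ ε ∈ Ioc (0 : ℝ) 1, L * ε ≤ 1 → ∀ y ∈ U, ∀ g ∈ O ε, y.act g ∈ U →
      σ (y.act g) ∈ σ y • O (L * ε)

/-- Hölder bound, in `L^r(Ω)`, for `v ↦ ρ(H_{t+ε}[u,v]) - ρ(H_t[u,v])` with `u` fixed. -/
def HolderAt (r : ℝ≥0∞) (u : G) (Ω : Set G) (c θ : ℝ) : Prop :=
  ∀ t ≥ S.t₀, ∀ ε ∈ Ioo (0 : ℝ) 1,
    eLpNorm (fun v => S.skewVol (t + ε) u v - S.skewVol t u v) r (S.m.restrict Ω) ≤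
      ENNReal.ofReal (c * ε ^ θ * S.vol t)

/-- Hölder bound, in `L^r(Ω × Ω)`, for `(u, v) ↦ ρ(H_{t+ε}[u,v]) - ρ(H_t[u,v])`. -/
def HolderOn (r : ℝ≥0∞) (Ω : Set G) (c θ : ℝ) : Prop :=
  ∀ t ≥ S.t₀, ∀ ε ∈ Ioo (0 : ℝ) 1,
    eLpNorm (fun w : G × G => S.skewVol (t + ε) w.1 w.2 - S.skewVol t w.1 w.2) r
      ((S.m.restrict Ω).prod (S.m.restrict Ω)) ≤ ENNReal.ofReal (c * ε ^ θ * S.vol t)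

/-- Average Hölder admissibility with `u` fixed; constant and exponent may depend on `u`, `Ω`. -/
def HA2 (r : ℝ≥0∞) : Prop :=
  ∀ u : G, ∀ Ω : Set G, IsCompact Ω → ∃ c > 0, ∃ θ > 0, S.HolderAt r u Ω c θ

/-- The same with a fixed exponent, and a constant that is uniform for `u` in compact sets. -/
def HA2Uniform (r : ℝ≥0∞) : Prop :=
  ∃ θ > 0, ∀ K Ω : Set G, IsCompact K → IsCompact Ω → ∃ c > 0, ∀ u ∈ K, S.HolderAt r u Ω c θ

/-- Average Hölder admissibility; constant and exponent may depend on `Ω`. -/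
def HA2' (r : ℝ≥0∞) : Prop :=
  ∀ Ω : Set G, IsCompact Ω → ∃ c > 0, ∃ θ > 0, S.HolderOn r Ω c θ

/-- The same with a fixed exponent. -/
def HA2'Uniform (r : ℝ≥0∞) : Prop :=
  ∃ θ > 0, ∀ Ω : Set G, IsCompact Ω → ∃ c > 0, S.HolderOn r Ω c θ

/-! ### The mean ergodic theorem for `β_t` and the conclusions.
Below `NY B N` means that `N` is a norm of the function space on `B ⊆ Y`; similarly `NX` for `X`. -/

/-- The quantitative mean ergodic theorem on `B`, with respect to the norm of `L^p(B)`, with rate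
`e^{-σ t}`, uniformly over `g₁, g₂ ∈ K`, for all sufficiently large `t`. -/
def MeanBound (p : ℝ≥0∞) (NY : Set S.Y → ((S.Y → ℝ) → ℝ≥0∞) → Prop) (σ : ℝ)
    (K : Set G) (B : Set S.Y) : Prop :=
  ∃ N, NY B N ∧ ∃ C t₁ : ℝ, ∀ g₁ ∈ K, ∀ g₂ ∈ K, ∀ F ∈ PositiveCone S.μ B N, ∀ t ≥ t₁,
    eLpNorm (fun y => S.betaAvg t g₁ g₂ F y - ∫ z, F z ∂S.μ) p (S.μ.restrict B) ≤
      ENNReal.ofReal (C * Real.exp (-σ * t)) * N F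

/-- Exponential rate in the mean ergodic theorem, possibly depending on the compact sets. -/
def ExpMeanErgodic (p : ℝ≥0∞) (NY : Set S.Y → ((S.Y → ℝ) → ℝ≥0∞) → Prop) : Prop :=
  ∀ K : Set G, IsCompact K → ∀ B : Set S.Y, IsCompactDomain S.μ B →
    ∃ σ > 0, S.MeanBound p NY σ K B

/-- Exponential rate in the mean ergodic theorem, with one exponent for all compact sets. -/
def ExpMeanErgodicUniform (p : ℝ≥0∞) (NY : Set S.Y → ((S.Y → ℝ) → ℝ≥0∞) → Prop) : Prop :=
  ∃ σ > 0, ∀ K : Set G, IsCompact K → ∀ B : Set S.Y, IsCompactDomain S.μ B →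
    S.MeanBound p NY σ K B

/-- The two averages are exponentially close at almost every point of every compact set. -/
def PointwiseClose (NX : Set S.X → ((S.X → ℝ) → ℝ≥0∞) → Prop) : Prop :=
  ∀ D : Set S.X, IsCompact D → ∀ N, NX D N → ∀ φ ∈ PositiveCone S.ξ D N,
    ∀ᵐ x ∂(S.ξ.restrict D), ∃ δ > 0, ∃ C : ℝ, ∀ t ≥ S.t₀,
      |S.discreteAvg t φ x - S.continuousAvg t φ x| ≤ C * Real.exp (-δ * t)

/-- The two averages are exponentially close almost everywhere, with one exponent `δ`, and with a
constant `C(φ, x)` whose `L^p(D)`-norm is bounded by a multiple of the norm of `φ`. -/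
def UniformlyClose (p : ℝ≥0∞) (NX : Set S.X → ((S.X → ℝ) → ℝ≥0∞) → Prop) : Prop :=
  ∃ δ > 0, ∀ D : Set S.X, IsCompact D → ∀ N, NX D N → ∃ M : ℝ≥0, ∀ φ ∈ PositiveCone S.ξ D N,
    ∃ C : S.X → ℝ, MemLp C p (S.ξ.restrict D) ∧ eLpNorm C p (S.ξ.restrict D) ≤ M * N φ ∧
      ∀ᵐ x ∂(S.ξ.restrict D), ∀ t ≥ S.t₀,
        |S.discreteAvg t φ x - S.continuousAvg t φ x| ≤ C x * Real.exp (-δ * t)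

/-- The common shape of the result in Lebesgue and in Sobolev spaces, with the exponents
`r = q / (q - 1)` and `r = p q / (q - p)` (limits are taken when `q = ∞`). -/
def Conclusion (p q : ℝ≥0∞) (NY : Set S.Y → ((S.Y → ℝ) → ℝ≥0∞) → Prop)
    (NX : Set S.X → ((S.X → ℝ) → ℝ≥0∞) → Prop) : Prop :=
  (S.HA2 (1 - q⁻¹)⁻¹ → S.HA2' (p⁻¹ - q⁻¹)⁻¹ → S.ExpMeanErgodic p NY → S.PointwiseClose NX) ∧
  (S.HA2Uniform (1 - q⁻¹)⁻¹ → S.HA2'Uniform (p⁻¹ - q⁻¹)⁻¹ → S.ExpMeanErgodicUniform p NY →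
    S.UniformlyClose p NX)

end DualitySetting

end

set_option linter.unusedSectionVars false
set_option linter.unusedSimpArgs false

noncomputable section

/-! Lift `φ` to a nonnegative function `f` of compact support on `G` whose integrals over the cosets
`Hg` are the values of `φ` (`IsLift`). For `u` above `x`, the sum over `Γ ∩ G_t` becomes the sum
over `γ ∈ Γ ∩ G_t` of `∫_H f(h⁻¹uγ) dρ(h)`. Insert `1 = ∫ b(v⁻¹g) dm(v)`, where `b` is a symmetric
probability density at scale `1/k`. Where `b(v⁻¹h⁻¹uγ) ≠ 0`, the elements `γ` and `u⁻¹hv` agree up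
to a factor at scale `1/k`. By well-roundedness of `G_t`, the condition `γ ∈ G_t` can therefore be
exchanged for `h ∈ H_t[u,v]` at the price of moving `t` by `O(1/k)`. The sum over `γ` is then
unrestricted: it is the periodization on `Y` of `f` localised near `v`, evaluated at `h⁻¹uΓ`, and
the integral over `h` is an unnormalised average `β_t^{u,v}` of it. Replacing this average by its
mean gives `mainTerm`. The integral of `φ(xg)` over `G_t` is squeezed by the same main term without
any ergodic error (`cInt_le`, `mainTerm_le_cInt`), while the lattice sum carries the deviation from
the mean (`dSum_le`, `mainTerm_le_dSum`).

The mean ergodic theorem is an `L^p` statement on `Y` for fixed parameters, but here `u` is both a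
parameter and the point of evaluation. So the parameter `u` is replaced by a nearby `w`, and the
inequality is averaged against the density `b(w⁻¹u)` (`le_add_errTerm`). Bounding that density by
its supremum, which is at most a multiple of `k^κ`, decouples `w` from `u`. Jensen and Fubini then
give an `L^p` bound for the error at each time (`lintegral_errTerm_rpow_le`), of size `k^{2κ}
e^{-σt} ρ(H_t)`, the second factor `k^κ` being the cost of the norm of the periodized localisation.

At the times `a log k` with `aσ ≥ 2κ + 3` these errors are `O(k^{-3} ρ(H_t))` in `L^p`, so a single
`L^p` function `Z` dominates `k` times all of the normalised errors (`exists_errTerm_bound`).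
Consecutive times differ by at most `a/k`. Both sums are monotone in `t`, and the main term varies
by `O(k^{-θ} ρ(H_t))` over such a window by Hölder's inequality and the Hölder admissibility at `u`
(`mainTerm_add_le`). Since `k` is comparable to `e^{t/a}`, this is an exponential rate with exponent
`min θ 1 / a` (`exists_pointwise_bound`).

To return to `X`, disintegrate `m` along the section: for almost every `x`, almost every `h s(x)` is
a good point of `G`. The first conclusion uses one such `h`. The second averages over `h` in a
compact neighbourhood of the identity, which turns the `L^p` bound for `Z` on `G` into one on `D`.

The function spaces enter only through `Liftable`: lifts exist, and the norms of their periodized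
localisations grow polynomially in `k`. For Lebesgue spaces (`liftable_lebesgue`) the weights are
normalised indicators, and periodization has boundedly many terms. For Sobolev spaces
(`liftable_sobolev`) the weights are smooth with polynomially growing derivatives. In a chart of `Y`
the periodization is a finite sum of smooth multiples of Sobolev functions on charts of `X`, pulled
back along submersions. Such pullbacks are bounded (`exists_sobBound_mul_comp`) because the
submersions push Lebesgue measure to a measure of bounded density (`PushBound`) and the chain rule
passes to weak derivatives by mollification. -/

namespace DualitySetting

/-! ### Periodization and unfolding on `G / Γ`. -/

section Unfolding

variable {G : Type*} [Group G] [TopologicalSpace G] [MeasurableSpace G] (S : DualitySetting G)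

instance : S.m.IsHaarMeasure := S.haar_m
instance : S.ρ.IsHaarMeasure := S.haar_ρ
instance : IsProbabilityMeasure S.μ := S.prob_μ
instance : SMulInvariantMeasure G (G ⧸ S.Γ) S.μ := S.invariant_μ
instance : DiscreteTopology S.Γ := S.discrete_Γ
instance : IsClosed (S.H : Set G) := S.isClosed_H

/-- The function `gΓ ↦ ∑_γ f(gγ)` on `G / Γ`. -/
def periodize (f : G → ℝ≥0∞) (y : S.Y) : ℝ≥0∞ :=
  ∑' γ : S.Γ, f (Quotient.out y * γ)

/-- The chosen representative of `gΓ` differs from `g` by a lattice element, which only reindexes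
the sum. -/
lemma periodize_projY (f : G → ℝ≥0∞) (g : G) :
    S.periodize f (S.projY g) = ∑' γ : S.Γ, f (g * γ) := by
  obtain ⟨γ₀, h⟩ := QuotientGroup.mk_out_eq_mul S.Γ g
  have h' : Quotient.out (S.projY g) = g * γ₀ := h
  unfold periodize
  rw [h', ← (Equiv.mulLeft γ₀).tsum_eq (fun γ : S.Γ => f (g * γ))]
  simp [mul_assoc]

lemma projY_surjective : Function.Surjective S.projY := QuotientGroup.mk_surjective

lemma smul_projY (a g : G) : a • S.projY g = S.projY (a * g) := rfl

lemma periodize_smul (f : G → ℝ≥0∞) (a : G) (y : S.Y) :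
    S.periodize f (a • y) = S.periodize (fun g => f (a * g)) y := by
  obtain ⟨g, rfl⟩ := S.projY_surjective y
  rw [smul_projY, periodize_projY, periodize_projY]
  simp [mul_assoc]

lemma measurable_projY : Measurable S.projY := measurable_quotient_mk''

variable [IsTopologicalGroup G] [T2Space G]
    [LocallyCompactSpace G] [SecondCountableTopology G] [BorelSpace G]

instance : Countable S.Γ := TopologicalSpace.separableSpace_iff_countable.1 inferInstance

instance : LocallyCompactSpace S.H := S.isClosed_H.isClosedEmbedding_subtypeVal.locallyCompactSpace

instance : SecondCountableTopology S.H :=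
  inferInstanceAs (SecondCountableTopology (S.H : Set G))

instance : SigmaFinite S.ρ :=
  @Measure.IsHaarMeasure.sigmaFinite S.H _ _ _ S.ρ S.haar_ρ
    sigmaCompactSpace_of_locallyCompact_secondCountable

lemma measurable_periodize {f : G → ℝ≥0∞} (hf : Measurable f) : Measurable (S.periodize f) := by
  refine measurable_from_quotient.2 ?_
  have : (S.periodize f ∘ Quotient.mk'') = fun g : G => ∑' γ : S.Γ, f (g * γ) := by
    ext g; exact S.periodize_projY f g
  rw [this]
  exact Measurable.tsum fun γ => hf.comp (measurable_mul_const _)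

instance : MeasurableConstSMul G (G ⧸ S.Γ) where
  measurable_const_smul a := by
    refine measurable_from_quotient.2 ?_
    exact S.measurable_projY.comp (measurable_const_mul a)

instance : OpensMeasurableSpace S.Y where
  borel_le := by
    refine MeasurableSpace.generateFrom_le fun U hU => ?_
    exact measurableSet_quotient.2 (hU.preimage continuous_quotient_mk').measurableSet

lemma continuous_projY : Continuous S.projY := continuous_quotient_mk'

lemma finite_lattice_inter {K : Set G} (hK : IsCompact K) : {γ : S.Γ | (γ : G) ∈ K}.Finite := by
  have hcl : IsClosed (S.Γ : Set G) := Subgroup.isClosed_of_discrete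
  have h1 : IsCompact {γ : S.Γ | (γ : G) ∈ K} :=
    hcl.isClosedEmbedding_subtypeVal.isCompact_preimage hK
  exact h1.finite_of_discrete

/-- The number of lattice translates meeting a compact set is bounded. -/
lemma exists_card_bound {K : Set G} (hK : IsCompact K) :
    ∃ N : ℕ, ∀ (g : G), {γ : S.Γ | g * γ ∈ K}.Finite ∧ {γ : S.Γ | g * γ ∈ K}.ncard ≤ N := by
  have hfin := S.finite_lattice_inter (hK.inv.mul hK)
  refine ⟨{γ : S.Γ | (γ : G) ∈ K⁻¹ * K}.ncard, fun g => ?_⟩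
  by_cases hne : {γ : S.Γ | g * γ ∈ K}.Nonempty
  · obtain ⟨γ₀, h₀⟩ := hne
    -- Dividing by one solution `γ₀` sends all solutions into the finite set `Γ ∩ K⁻¹K`, which no
    -- longer depends on `g`.
    have hmaps : MapsTo (fun γ => γ₀⁻¹ * γ) {γ : S.Γ | g * γ ∈ K} {γ : S.Γ | (γ : G) ∈ K⁻¹ * K} := by
      intro γ hγ
      refine Set.mem_mul.2 ⟨(g * γ₀)⁻¹, Set.inv_mem_inv.2 h₀, g * γ, hγ, ?_⟩
      simp [mul_assoc]
    have hinj : Set.InjOn (fun γ : S.Γ => γ₀⁻¹ * γ) {γ : S.Γ | g * γ ∈ K} :=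
      fun a _ b _ hab => mul_left_cancel hab
    exact ⟨Set.Finite.of_injOn hmaps hinj hfin, Set.ncard_le_ncard_of_injOn _ hmaps hinj hfin⟩
  · rw [Set.not_nonempty_iff_eq_empty] at hne
    simp [hne]

lemma exists_periodize_indicator_bound {K : Set G} (hK : IsCompact K) :
    ∃ N : ℕ, ∀ y, S.periodize (K.indicator 1) y ≤ N := by
  obtain ⟨N, hN⟩ := S.exists_card_bound hK
  refine ⟨N, fun y => ?_⟩
  obtain ⟨g, rfl⟩ := S.projY_surjective y
  rw [periodize_projY]
  have : (fun γ : S.Γ => K.indicator (1 : G → ℝ≥0∞) (g * γ)) =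
      {γ : S.Γ | g * γ ∈ K}.indicator (fun _ => 1) := by
    ext γ; simp [indicator]
  obtain ⟨h1, h2⟩ := hN g
  rw [this, ← tsum_subtype, ENNReal.tsum_const, mul_one]
  have h4 : ENat.card {γ : S.Γ | g * γ ∈ K} = ({γ : S.Γ | g * γ ∈ K}.ncard : ℕ∞) := by
    rw [h1.cast_ncard_eq]; rfl
  rw [h4]
  exact_mod_cast h2

/-- The unfolding formula. -/
theorem lintegral_periodize {f : G → ℝ≥0∞} (hf : Measurable f) :
    ∫⁻ y, S.periodize f y ∂S.μ = ∫⁻ g, f g ∂S.m := by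
  obtain ⟨F, hF, hμ⟩ := S.induced_μ
  have hmk : Measurable (fun g : G => (g : G ⧸ S.Γ)) := S.measurable_projY
  -- Unfolding holds for `m'` by construction, so the task is to show `m' = m`. Invariance of `μ`
  -- makes `m'` left invariant, and uniqueness of Haar measure applies. Invariance of `m` on the
  -- right is never needed.
  set m' : Measure G := Measure.sum fun γ : S.Γ => (S.m.restrict F).map (fun g => g * (γ : G)) with hm'
  have key : ∀ f : G → ℝ≥0∞, Measurable f → ∫⁻ y, S.periodize f y ∂S.μ = ∫⁻ g, f g ∂m' := by
    intro f hf
    rw [hμ, lintegral_map (S.measurable_periodize hf) hmk, hm', lintegral_sum_measure]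
    have : ∀ g : G, S.periodize f (g : G ⧸ S.Γ) = ∑' γ : S.Γ, f (g * γ) := S.periodize_projY f
    simp_rw [this]
    rw [lintegral_tsum (f := fun (γ : S.Γ) a => f (a * γ))
      fun γ => (hf.comp (measurable_mul_const (γ : G))).aemeasurable]
    refine tsum_congr fun γ => ?_
    rw [lintegral_map hf (measurable_mul_const _)]
  have hinv : m'.IsMulLeftInvariant := by
    constructor
    intro a
    ext A hA
    rw [Measure.map_apply (measurable_const_mul a) hA, ← lintegral_indicator_one hA,
      ← lintegral_indicator_one (measurable_const_mul a hA),
      ← key _ (measurable_one.indicator hA), ← key _ (measurable_one.indicator (measurable_const_mul a hA))]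
    have hmp := measurePreserving_smul a S.μ
    rw [← hmp.lintegral_comp (S.measurable_periodize (measurable_one.indicator hA))]
    simp_rw [periodize_smul]
    rfl
  have hfin : IsFiniteMeasureOnCompacts m' := by
    constructor
    intro K hK
    rw [← lintegral_indicator_one hK.measurableSet, ← key _ (measurable_one.indicator hK.measurableSet)]
    obtain ⟨N, hN⟩ := S.exists_periodize_indicator_bound hK
    calc _ ≤ ∫⁻ _, (N : ℝ≥0∞) ∂S.μ := lintegral_mono hN
      _ < ⊤ := by simp
  have huniq := Measure.isMulLeftInvariant_eq_smul m' S.m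
  set c := m'.haarScalarFactor S.m
  have hF1 : S.m F = 1 := by
    have h1 : S.μ univ = 1 := measure_univ
    rw [hμ, Measure.map_apply hmk MeasurableSet.univ] at h1
    simpa using h1
  -- The constant is read off on the fundamental domain, where every translate with `γ ≠ 1`
  -- contributes zero by almost disjointness.
  have hc : (c : ℝ≥0∞) = 1 := by
    obtain ⟨A, hAF, hA, hAe⟩ := hF.nullMeasurableSet.exists_measurable_subset_ae_eq
    have hmA : S.m A = 1 := by rw [measure_congr hAe, hF1]
    have h2 : m' A = c := by
      rw [huniq]; simp [hmA]
    rw [← h2, hm', Measure.sum_apply _ hA, tsum_eq_single 1]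
    · simp [Measure.restrict_apply₀' hF.nullMeasurableSet, inter_eq_left.2 hAF, hmA]
    · intro γ hγ
      rw [Measure.map_apply (measurable_mul_const _) hA,
        Measure.restrict_apply₀' hF.nullMeasurableSet]
      have hj : (1 : S.Γ.op) ≠ ⟨MulOpposite.op (γ : G)⁻¹, by simp⟩ := by
        intro h
        apply hγ
        have := congrArg (fun z : S.Γ.op => MulOpposite.unop (z : Gᵐᵒᵖ)) h
        simp only [OneMemClass.coe_one, MulOpposite.unop_one] at this
        ext
        simpa using this.symm
      have hd := hF.aedisjoint hj
      refine measure_mono_null ?_ hd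
      rintro g ⟨h1, h2⟩
      refine ⟨by simpa using h2, ?_⟩
      refine Set.mem_smul_set.2 ⟨g * γ, hAF h1, ?_⟩
      change (g * γ) * (γ : G)⁻¹ = g
      simp
  rw [key f hf, huniq]
  have : c = 1 := by exact_mod_cast hc
  rw [this, one_smul]

end Unfolding

end DualitySetting

namespace DualitySetting

/-! ### Squeezing lattice sums and integrals over `G_t` by a common main term. -/

section Sandwich

variable {G : Type*} [Group G] [TopologicalSpace G] [MeasurableSpace G] (S : DualitySetting G)

/-- The `H`-invariant function `g ↦ ∫_H f(h⁻¹g) dρ(h)`. -/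
def cosetInt (f : G → ℝ≥0∞) (g : G) : ℝ≥0∞ := ∫⁻ h : S.H, f ((h : G)⁻¹ * g) ∂S.ρ

/-- The sum of `cosetInt f` over the lattice points in `G_t`, translated by `u`. -/
def dSum (t : ℝ) (f : G → ℝ≥0∞) (u : G) : ℝ≥0∞ :=
  ∑' γ : S.Γ, (S.ball t).indicator 1 (γ : G) * S.cosetInt f (u * γ)

/-- The integral of `cosetInt f` over `u G_t`. -/
def cInt (t : ℝ) (f : G → ℝ≥0∞) (u : G) : ℝ≥0∞ := ∫⁻ g in S.ball t, S.cosetInt f (u * g) ∂S.m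

/-- The total mass of the localisation of `f` near `v`. -/
def dens (f b : G → ℝ≥0∞) (v : G) : ℝ≥0∞ := ∫⁻ g, f g * b (v⁻¹ * g) ∂S.m

/-- The common main term of the discrete and of the continuous averages. -/
def mainTerm (t : ℝ) (f b : G → ℝ≥0∞) (u : G) : ℝ≥0∞ :=
  ∫⁻ v, S.ρ (S.skewBall t u v) * S.dens f b v ∂S.m

/-- The integral over `H_t[w, v]` of the periodization of the localisation of `f` near `v`. -/
def pieceInt (t : ℝ) (f b : G → ℝ≥0∞) (w v : G) (y : S.Y) : ℝ≥0∞ :=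
  ∫⁻ h in S.skewBall t w v, S.periodize (fun g => f g * b (v⁻¹ * g)) ((h : G)⁻¹ • y) ∂S.ρ

/-- The deviation of `pieceInt` from its mean. -/
def err (t : ℝ) (f b : G → ℝ≥0∞) (w v : G) (y : S.Y) : ℝ≥0∞ :=
  (S.pieceInt t f b w v y - S.ρ (S.skewBall t w v) * S.dens f b v) +
    (S.ρ (S.skewBall t w v) * S.dens f b v - S.pieceInt t f b w v y)

/-- The superposition of the deviations over `v`, and over `w` close to `u`. -/
def errTerm (t : ℝ) (f b : G → ℝ≥0∞) (u : G) : ℝ≥0∞ :=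
  ∫⁻ w, b (w⁻¹ * u) * ∫⁻ v, S.err t f b w v (S.projY u) ∂S.m ∂S.m

variable [IsTopologicalGroup G] [T2Space G]
    [LocallyCompactSpace G] [SecondCountableTopology G] [BorelSpace G]

lemma measurable_cosetInt {f : G → ℝ≥0∞} (hf : Measurable f) : Measurable (S.cosetInt f) := by
  unfold cosetInt
  refine Measurable.lintegral_prod_left' (f := fun z : S.H × G => f ((z.1 : G)⁻¹ * z.2)) ?_
  fun_prop

lemma measurableSet_skewBall_prod (t : ℝ) :
    MeasurableSet {z : S.H × G × G | (z.2.1)⁻¹ * (z.1 : G) * z.2.2 ∈ S.ball t} := by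
  have : Measurable (fun z : S.H × G × G => (z.2.1)⁻¹ * (z.1 : G) * z.2.2) := by fun_prop
  exact this (S.isCompact_ball t).measurableSet

lemma measurableSet_skewBall (t : ℝ) (u v : G) : MeasurableSet (S.skewBall t u v) := by
  have : Measurable (fun h : S.H => u⁻¹ * (h : G) * v) := by fun_prop
  exact this (S.isCompact_ball t).measurableSet

lemma measurable_skewBall (t : ℝ) : Measurable fun z : G × G => S.ρ (S.skewBall t z.1 z.2) := by
  have := measurable_measure_prodMk_right (μ := S.ρ) (S.measurableSet_skewBall_prod t)
  exact this

lemma measurable_dens {f b : G → ℝ≥0∞} (hf : Measurable f) (hb : Measurable b) :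
    Measurable (S.dens f b) := by
  unfold dens
  refine Measurable.lintegral_prod_left' (f := fun z : G × G => f z.1 * b (z.2⁻¹ * z.1)) ?_
  fun_prop

lemma measurable_periodize_prod {α : Type*} [MeasurableSpace α] {F : α × G → ℝ≥0∞}
    (hF : Measurable F) :
    Measurable fun z : α × G => S.periodize (fun g => F (z.1, g)) (S.projY z.2) := by
  simp_rw [periodize_projY]
  refine Measurable.tsum fun γ => ?_
  exact hF.comp (measurable_fst.prodMk (measurable_snd.mul_const _))

lemma measurable_pieceInt (t : ℝ) {f b : G → ℝ≥0∞} (hf : Measurable f) (hb : Measurable b) :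
    Measurable fun z : (G × G) × G => S.pieceInt t f b z.1.1 z.1.2 (S.projY z.2) := by
  unfold pieceInt
  simp_rw [← lintegral_indicator (S.measurableSet_skewBall t _ _), smul_projY]
  refine Measurable.lintegral_prod_left' (f := fun z : S.H × (G × G) × G =>
    (S.skewBall t z.2.1.1 z.2.1.2).indicator (fun h : S.H => S.periodize
      (fun g => f g * b (z.2.1.2⁻¹ * g)) (S.projY ((h : G)⁻¹ * z.2.2))) z.1) ?_
  have h1 : Measurable fun z : S.H × (G × G) × G => S.periodize
      (fun g => f g * b (z.2.1.2⁻¹ * g)) (S.projY ((z.1 : G)⁻¹ * z.2.2)) := by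
    have := S.measurable_periodize_prod (F := fun z : G × G => f z.2 * b (z.1⁻¹ * z.2)) (by fun_prop)
    exact this.comp (f := fun z : S.H × (G × G) × G => (z.2.1.2, (z.1 : G)⁻¹ * z.2.2)) (by fun_prop)
  have h2 : MeasurableSet {z : S.H × (G × G) × G | z.1 ∈ S.skewBall t z.2.1.1 z.2.1.2} := by
    have : Measurable (fun z : S.H × (G × G) × G => (z.2.1.1)⁻¹ * (z.1 : G) * z.2.1.2) := by fun_prop
    exact this (S.isCompact_ball t).measurableSet
  exact h1.indicator h2

lemma measurable_err (t : ℝ) {f b : G → ℝ≥0∞} (hf : Measurable f) (hb : Measurable b) :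
    Measurable fun z : (G × G) × G => S.err t f b z.1.1 z.1.2 (S.projY z.2) := by
  have h1 := S.measurable_pieceInt t hf hb
  have h2 : Measurable fun z : (G × G) × G =>
      S.ρ (S.skewBall t z.1.1 z.1.2) * S.dens f b z.1.2 :=
    ((S.measurable_skewBall t).comp measurable_fst).mul
      ((S.measurable_dens hf hb).comp (by fun_prop))
  unfold err
  exact (h1.sub h2).add (h2.sub h1)

/-- A family `b` of weights at one scale: a symmetric probability density supported in `P`. -/
structure IsWeight (b : G → ℝ≥0∞) (P : Set G) : Prop where
  measurable : Measurable b
  symm : ∀ g, b g⁻¹ = b g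
  lintegral_eq_one : ∫⁻ g, b g ∂S.m = 1
  mem_of_ne_zero : ∀ g, b g ≠ 0 → g ∈ P
  one_mem : (1 : G) ∈ P
  inv_mem : ∀ g ∈ P, g⁻¹ ∈ P

variable {S} {b : G → ℝ≥0∞} {P : Set G} (hb : S.IsWeight b P)

include hb in
lemma IsWeight.lintegral_inv_mul (g : G) : ∫⁻ v, b (v⁻¹ * g) ∂S.m = 1 := by
  have : ∀ v, b (v⁻¹ * g) = b (g⁻¹ * v) := fun v => by rw [← hb.symm]; simp
  simp_rw [this]
  rw [lintegral_mul_left_eq_self (μ := S.m) b g⁻¹, hb.lintegral_eq_one]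

include hb in
-- The translates of the weight form a partition of unity: by symmetry and left invariance, `∫
-- b(v⁻¹g) dm(v) = 1` for every `g`.
lemma cosetInt_eq_lintegral {f : G → ℝ≥0∞} (hf : Measurable f) (g : G) :
    S.cosetInt f g = ∫⁻ v, ∫⁻ h : S.H, f ((h : G)⁻¹ * g) * b (v⁻¹ * ((h : G)⁻¹ * g)) ∂S.ρ ∂S.m := by
  have hb' := hb.measurable
  rw [lintegral_lintegral_swap (by fun_prop)]
  unfold cosetInt
  refine lintegral_congr fun h => ?_
  rw [lintegral_const_mul _ (by fun_prop), hb.lintegral_inv_mul, mul_one]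

lemma pieceInt_projY (t : ℝ) {f b : G → ℝ≥0∞} (hf : Measurable f) (hb : Measurable b) (w v u : G) :
    S.pieceInt t f b w v (S.projY u) = ∑' γ : S.Γ, ∫⁻ h : S.H, (S.skewBall t w v).indicator 1 h *
      (f ((h : G)⁻¹ * (u * γ)) * b (v⁻¹ * ((h : G)⁻¹ * (u * γ)))) ∂S.ρ := by
  have hm := S.measurableSet_skewBall t w v
  unfold pieceInt
  simp_rw [smul_projY, periodize_projY]
  rw [lintegral_tsum (fun γ => by fun_prop)]
  refine tsum_congr fun γ => ?_
  rw [← lintegral_indicator hm]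
  refine lintegral_congr fun h => ?_
  by_cases hh : h ∈ S.skewBall t w v <;> simp [hh, mul_assoc]

include hb in
lemma dSum_eq {f : G → ℝ≥0∞} (hf : Measurable f) (t : ℝ) (u : G) :
    S.dSum t f u = ∫⁻ v, ∑' γ : S.Γ, ∫⁻ h : S.H, (S.ball t).indicator 1 (γ : G) *
      (f ((h : G)⁻¹ * (u * γ)) * b (v⁻¹ * ((h : G)⁻¹ * (u * γ)))) ∂S.ρ ∂S.m := by
  have hb' := hb.measurable
  rw [lintegral_tsum]
  · unfold dSum
    refine tsum_congr fun γ => ?_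
    rw [cosetInt_eq_lintegral hb hf, ← lintegral_const_mul]
    · refine lintegral_congr fun v => ?_
      rw [lintegral_const_mul]
      fun_prop
    · refine Measurable.lintegral_prod_left' (f := fun z : S.H × G =>
        f ((z.1 : G)⁻¹ * (u * γ)) * b (z.2⁻¹ * ((z.1 : G)⁻¹ * (u * γ)))) ?_
      fun_prop
  · intro γ
    refine (Measurable.lintegral_prod_left' (f := fun z : S.H × G =>
        (S.ball t).indicator 1 (γ : G) *
        (f ((z.1 : G)⁻¹ * (u * γ)) * b (z.2⁻¹ * ((z.1 : G)⁻¹ * (u * γ))))) ?_).aemeasurable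
    fun_prop

include hb in
-- On the support of the integrand, `w⁻¹hv` is the product of `w⁻¹u ∈ P`, of `γ ∈ G_t` and of the
-- inverse of `v⁻¹h⁻¹uγ ∈ P`. Thus the constraint on `γ` implies one on `h`, and the sum over `γ`
-- can be released to the whole lattice.
lemma dSum_le_lintegral_pieceInt {f : G → ℝ≥0∞} (hf : Measurable f) {t t' : ℝ}
    (hP : P * S.ball t * P ⊆ S.ball t') {u w : G} (hw : w⁻¹ * u ∈ P) :
    S.dSum t f u ≤ ∫⁻ v, S.pieceInt t' f b w v (S.projY u) ∂S.m := by
  rw [dSum_eq hb hf]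
  refine lintegral_mono fun v => ?_
  rw [pieceInt_projY _ hf hb.measurable]
  refine ENNReal.tsum_le_tsum fun γ => lintegral_mono fun h => ?_
  by_cases hγ : (γ : G) ∈ S.ball t
  · by_cases h0 : b (v⁻¹ * ((h : G)⁻¹ * (u * γ))) = 0
    · simp [h0]
    · have hmem : h ∈ S.skewBall t' w v := by
        refine hP ?_
        have : w⁻¹ * (h : G) * v = (w⁻¹ * u) * γ * (v⁻¹ * ((h : G)⁻¹ * (u * γ)))⁻¹ := by group
        rw [this]
        exact Set.mul_mem_mul (Set.mul_mem_mul hw hγ) (hb.inv_mem _ (hb.mem_of_ne_zero _ h0))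
      simp [hγ, hmem]
  · simp [hγ]

include hb in
-- The same factorisation solved for `γ`: the constraint on `h` gives back the constraint on `γ` at
-- a slightly later time.
lemma lintegral_pieceInt_le_dSum {f : G → ℝ≥0∞} (hf : Measurable f) {t t' : ℝ}
    (hP : P * S.ball t * P ⊆ S.ball t') {u w : G} (hw : w⁻¹ * u ∈ P) :
    ∫⁻ v, S.pieceInt t f b w v (S.projY u) ∂S.m ≤ S.dSum t' f u := by
  rw [dSum_eq hb hf]
  refine lintegral_mono fun v => ?_
  rw [pieceInt_projY _ hf hb.measurable]
  refine ENNReal.tsum_le_tsum fun γ => lintegral_mono fun h => ?_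
  by_cases hγ : h ∈ S.skewBall t w v
  · by_cases h0 : b (v⁻¹ * ((h : G)⁻¹ * (u * γ))) = 0
    · simp [h0]
    · have hmem : (γ : G) ∈ S.ball t' := by
        refine hP ?_
        have : (γ : G) = (w⁻¹ * u)⁻¹ * (w⁻¹ * (h : G) * v) * (v⁻¹ * ((h : G)⁻¹ * (u * γ))) := by group
        rw [this]
        exact Set.mul_mem_mul (Set.mul_mem_mul (hb.inv_mem _ hw) hγ) (hb.mem_of_ne_zero _ h0)
      simp [hγ, hmem]
  · simp [hγ]

include hb in
lemma skewBall_subset {t t' : ℝ} (hP : P * S.ball t * P ⊆ S.ball t') {u w : G}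
    (hw : w⁻¹ * u ∈ P) (v : G) : S.skewBall t u v ⊆ S.skewBall t' w v := by
  intro h hh
  refine hP ?_
  have : w⁻¹ * (h : G) * v = (w⁻¹ * u) * (u⁻¹ * h * v) * 1 := by group
  rw [this]
  exact Set.mul_mem_mul (Set.mul_mem_mul hw hh) hb.one_mem

lemma pieceInt_le (t : ℝ) (f b : G → ℝ≥0∞) (w v : G) (y : S.Y) :
    S.pieceInt t f b w v y ≤ S.ρ (S.skewBall t w v) * S.dens f b v + S.err t f b w v y := by
  refine (le_add_tsub (b := S.ρ (S.skewBall t w v) * S.dens f b v)).trans ?_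
  unfold err
  gcongr
  exact le_self_add

lemma le_pieceInt (t : ℝ) (f b : G → ℝ≥0∞) (w v : G) (y : S.Y) :
    S.ρ (S.skewBall t w v) * S.dens f b v ≤ S.pieceInt t f b w v y + S.err t f b w v y := by
  refine (le_add_tsub (b := S.pieceInt t f b w v y)).trans ?_
  unfold err
  gcongr
  exact le_add_self

lemma measurable_err_right (t : ℝ) {f b : G → ℝ≥0∞} (hf : Measurable f) (hb : Measurable b)
    (u w : G) : Measurable fun v => S.err t f b w v (S.projY u) :=
  (S.measurable_err t hf hb).comp (f := fun v : G => ((w, v), u)) (by fun_prop)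

lemma measurable_lintegral_err (t : ℝ) {f b : G → ℝ≥0∞} (hf : Measurable f) (hb : Measurable b) :
    Measurable fun z : G × G => ∫⁻ v, S.err t f b z.1 v (S.projY z.2) ∂S.m := by
  refine Measurable.lintegral_prod_left' (f := fun z : G × G × G =>
    S.err t f b z.2.1 z.1 (S.projY z.2.2)) ?_
  exact (S.measurable_err t hf hb).comp (f := fun z : G × G × G => ((z.2.1, z.1), z.2.2))
    (by fun_prop)

include hb in
/-- Averaging an inequality over `w` close to `u`. -/
lemma le_add_errTerm {f : G → ℝ≥0∞} {t : ℝ} {u : G} {A B : ℝ≥0∞}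
    (h : ∀ w, w⁻¹ * u ∈ P → A ≤ B + ∫⁻ v, S.err t f b w v (S.projY u) ∂S.m) :
    A ≤ B + S.errTerm t f b u := by
  have hb' := hb.measurable
  have hm : Measurable fun w => b (w⁻¹ * u) := by fun_prop
  calc A = ∫⁻ w, b (w⁻¹ * u) * A ∂S.m := by
        rw [lintegral_mul_const _ hm, hb.lintegral_inv_mul, one_mul]
    _ ≤ ∫⁻ w, (b (w⁻¹ * u) * B + b (w⁻¹ * u) * ∫⁻ v, S.err t f b w v (S.projY u) ∂S.m) ∂S.m := by
        refine lintegral_mono fun w => ?_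
        by_cases h0 : b (w⁻¹ * u) = 0
        · simp [h0]
        · rw [← mul_add]
          exact mul_le_mul_right (h w (hb.mem_of_ne_zero _ h0)) _
    _ = B + S.errTerm t f b u := by
        rw [lintegral_add_left (by fun_prop), lintegral_mul_const _ hm, hb.lintegral_inv_mul, one_mul]
        rfl

include hb in
/-- Upper bound for the discrete sums. -/
lemma dSum_le {f : G → ℝ≥0∞} (hf : Measurable f) {t t' t'' : ℝ}
    (hP : P * S.ball t * P ⊆ S.ball t') (hP' : P * S.ball t' * P ⊆ S.ball t'') (u : G) :
    S.dSum t f u ≤ S.mainTerm t'' f b u + S.errTerm t' f b u := by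
  -- Two thickenings are spent: from `t` to `t'` in trading `γ` for `h`, and from `t'` to `t''` in
  -- moving the main term from `w` back to `u`.
  refine le_add_errTerm hb fun w hw => (dSum_le_lintegral_pieceInt hb hf hP hw).trans ?_
  have hd := S.measurable_dens hf hb.measurable
  unfold mainTerm
  rw [← lintegral_add_right _ (measurable_err_right t' hf hb.measurable u w)]
  refine lintegral_mono fun v => (pieceInt_le t' f b w v _).trans ?_
  have hw' : u⁻¹ * w ∈ P := by simpa using hb.inv_mem _ hw
  gcongr
  exact skewBall_subset hb hP' hw' v

include hb in
/-- Lower bound for the discrete sums. -/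
lemma mainTerm_le_dSum {f : G → ℝ≥0∞} (hf : Measurable f) {t t' t'' : ℝ}
    (hP : P * S.ball t * P ⊆ S.ball t') (hP' : P * S.ball t' * P ⊆ S.ball t'') (u : G) :
    S.mainTerm t f b u ≤ S.dSum t'' f u + S.errTerm t' f b u := by
  refine le_add_errTerm hb fun w hw => ?_
  refine le_trans ?_ (add_le_add_left (lintegral_pieceInt_le_dSum hb hf hP' hw) _)
  unfold mainTerm
  rw [← lintegral_add_right _ (measurable_err_right t' hf hb.measurable u w)]
  refine lintegral_mono fun v => le_trans ?_ (le_pieceInt t' f b w v _)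
  gcongr
  exact skewBall_subset hb hP hw v

include hb in
-- Substituting `hg` for `g` separates the three integrations. Unlike a lattice sum, the integral
-- over `G` needs no equidistribution, so its comparison with the main term has no error term.
lemma cInt_eq {f : G → ℝ≥0∞} (hf : Measurable f) (t : ℝ) (u : G) :
    S.cInt t f u = ∫⁻ v, ∫⁻ h : S.H, ∫⁻ g, (S.ball t).indicator 1 (u⁻¹ * (h * g)) *
      (f g * b (v⁻¹ * g)) ∂S.m ∂S.ρ ∂S.m := by
  have hb' := hb.measurable
  have hm := (S.isCompact_ball t).measurableSet
  have hi : Measurable ((S.ball t).indicator (1 : G → ℝ≥0∞)) := measurable_one.indicator hm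
  have h1 : S.cInt t f u = ∫⁻ g, (S.ball t).indicator 1 (u⁻¹ * g) * S.cosetInt f g ∂S.m := by
    unfold cInt
    rw [← lintegral_indicator hm, ← lintegral_mul_left_eq_self (μ := S.m) _ u⁻¹]
    refine lintegral_congr fun g => ?_
    by_cases hg : u⁻¹ * g ∈ S.ball t <;> simp [hg]
  rw [h1]
  have h2 : ∀ g, (S.ball t).indicator 1 (u⁻¹ * g) * S.cosetInt f g = ∫⁻ v, ∫⁻ h : S.H,
      (S.ball t).indicator 1 (u⁻¹ * g) *
        (f ((h : G)⁻¹ * g) * b (v⁻¹ * ((h : G)⁻¹ * g))) ∂S.ρ ∂S.m := by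
    intro g
    rw [cosetInt_eq_lintegral hb hf, ← lintegral_const_mul]
    · refine lintegral_congr fun v => ?_
      rw [lintegral_const_mul]
      fun_prop
    · refine Measurable.lintegral_prod_left' (f := fun z : S.H × G =>
        f ((z.1 : G)⁻¹ * g) * b (z.2⁻¹ * ((z.1 : G)⁻¹ * g))) ?_
      fun_prop
  simp_rw [h2]
  rw [lintegral_lintegral_swap]
  · refine lintegral_congr fun v => ?_
    rw [lintegral_lintegral_swap (by fun_prop)]
    refine lintegral_congr fun h => ?_
    rw [← lintegral_mul_left_eq_self (μ := S.m) _ (h : G)]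
    simp
  · refine (Measurable.lintegral_prod_right' (f := fun z : (G × G) × S.H =>
      (S.ball t).indicator 1 (u⁻¹ * z.1.1) *
        (f ((z.2 : G)⁻¹ * z.1.1) * b (z.1.2⁻¹ * ((z.2 : G)⁻¹ * z.1.1)))) ?_).aemeasurable
    fun_prop

lemma mainTerm_eq {f b : G → ℝ≥0∞} (hf : Measurable f) (hb : Measurable b) (t : ℝ) (u : G) :
    S.mainTerm t f b u = ∫⁻ v, ∫⁻ h : S.H, ∫⁻ g, (S.skewBall t u v).indicator 1 h *
      (f g * b (v⁻¹ * g)) ∂S.m ∂S.ρ ∂S.m := by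
  unfold mainTerm
  refine lintegral_congr fun v => ?_
  have hm := S.measurableSet_skewBall t u v
  have : ∀ h : S.H, ∫⁻ g, (S.skewBall t u v).indicator 1 h * (f g * b (v⁻¹ * g)) ∂S.m =
      (S.skewBall t u v).indicator 1 h * S.dens f b v := by
    intro h
    rw [lintegral_const_mul]
    · rfl
    · fun_prop
  simp_rw [this]
  rw [lintegral_mul_const _ (measurable_one.indicator hm), lintegral_indicator_one hm]

include hb in
-- On the support of the weight, `u⁻¹hg` and `u⁻¹hv` differ by `v⁻¹g ∈ P` on the right, so one
-- thickening suffices.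
lemma cInt_le {f : G → ℝ≥0∞} (hf : Measurable f) {t t' : ℝ}
    (hP : P * S.ball t * P ⊆ S.ball t') (u : G) : S.cInt t f u ≤ S.mainTerm t' f b u := by
  rw [cInt_eq hb hf, mainTerm_eq hf hb.measurable]
  refine lintegral_mono fun v => lintegral_mono fun h => lintegral_mono fun g => ?_
  by_cases hg : u⁻¹ * (h * g) ∈ S.ball t
  · by_cases h0 : b (v⁻¹ * g) = 0
    · simp [h0]
    · have hmem : h ∈ S.skewBall t' u v := by
        refine hP ?_
        have : u⁻¹ * (h : G) * v = 1 * (u⁻¹ * (h * g)) * (v⁻¹ * g)⁻¹ := by group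
        rw [this]
        exact Set.mul_mem_mul (Set.mul_mem_mul hb.one_mem hg)
          (hb.inv_mem _ (hb.mem_of_ne_zero _ h0))
      simp [hg, hmem]
  · simp [hg]

include hb in
lemma mainTerm_le_cInt {f : G → ℝ≥0∞} (hf : Measurable f) {t t' : ℝ}
    (hP : P * S.ball t * P ⊆ S.ball t') (u : G) : S.mainTerm t f b u ≤ S.cInt t' f u := by
  rw [cInt_eq hb hf, mainTerm_eq hf hb.measurable]
  refine lintegral_mono fun v => lintegral_mono fun h => lintegral_mono fun g => ?_
  by_cases hg : h ∈ S.skewBall t u v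
  · by_cases h0 : b (v⁻¹ * g) = 0
    · simp [h0]
    · have hmem : u⁻¹ * (h * g) ∈ S.ball t' := by
        refine hP ?_
        have : u⁻¹ * (h * g) = 1 * (u⁻¹ * (h : G) * v) * (v⁻¹ * g) := by group
        rw [this]
        exact Set.mul_mem_mul (Set.mul_mem_mul hb.one_mem hg) (hb.mem_of_ne_zero _ h0)
      simp [hg, hmem]
  · simp [hg]

end Sandwich

end DualitySetting

namespace DualitySetting

/-! ### Variation of the main term, and deviations as ergodic averages. -/

section Estimates

variable {G : Type*} [Group G] [TopologicalSpace G] [MeasurableSpace G] (S : DualitySetting G)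
variable [IsTopologicalGroup G] [T2Space G]
    [LocallyCompactSpace G] [SecondCountableTopology G] [BorelSpace G]

lemma isCompact_preimage_coe {K : Set G} (hK : IsCompact K) : IsCompact {h : S.H | (h : G) ∈ K} :=
  S.isClosed_H.isClosedEmbedding_subtypeVal.isCompact_preimage hK

lemma isCompact_skewBall (t : ℝ) (u v : G) : IsCompact (S.skewBall t u v) := by
  have h := S.isCompact_preimage_coe
    ((isCompact_singleton (x := u)).mul ((S.isCompact_ball t).mul (isCompact_singleton (x := v⁻¹))))
  convert h using 1
  ext h
  simp only [skewBall, mem_ofPred_eq, Set.singleton_mul, Set.mul_singleton, Set.mem_image]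
  constructor
  · intro hh
    exact ⟨u⁻¹ * h, ⟨_, hh, by group⟩, by group⟩
  · rintro ⟨_, ⟨z, hz, rfl⟩, h2⟩
    rw [← h2]
    simpa using hz

lemma measure_skewBall_ne_top (t : ℝ) (u v : G) : S.ρ (S.skewBall t u v) ≠ ⊤ :=
  (S.isCompact_skewBall t u v).measure_lt_top.ne

lemma ofReal_skewVol (t : ℝ) (u v : G) :
    ENNReal.ofReal (S.skewVol t u v) = S.ρ (S.skewBall t u v) :=
  ofReal_measureReal (S.measure_skewBall_ne_top t u v)

lemma skewVol_nonneg (t : ℝ) (u v : G) : 0 ≤ S.skewVol t u v := measureReal_nonneg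

lemma skewBall_mono {t t' : ℝ} (h : t ≤ t') (u v : G) : S.skewBall t u v ⊆ S.skewBall t' u v :=
  fun _ hh => S.monotone_ball h hh

lemma skewVol_mono {t t' : ℝ} (h : t ≤ t') (u v : G) : S.skewVol t u v ≤ S.skewVol t' u v :=
  measureReal_mono (S.skewBall_mono h u v) (S.measure_skewBall_ne_top t' u v)

lemma vol_eq (t : ℝ) : S.vol t = S.skewVol t 1 1 := by
  simp [vol, skewVol, skewBall]

lemma vol_mono {t t' : ℝ} (h : t ≤ t') : S.vol t ≤ S.vol t' := by
  rw [vol_eq, vol_eq]; exact S.skewVol_mono h 1 1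

lemma measurable_skewVol (t : ℝ) (u : G) : Measurable (S.skewVol t u) :=
  ((S.measurable_skewBall t).comp (f := fun v : G => (u, v)) (by fun_prop)).ennreal_toReal

/-- The volumes `ρ(H_t[u,v])` are comparable to `ρ(H_t)`, for `u, v` in a compact set. -/
lemma exists_skewVol_le (h1 : S.CA1) (h2 : S.CA2) {K : Set G} (hK : IsCompact K) :
    ∃ C > 0, ∀ t ≥ S.t₀, ∀ u ∈ K, ∀ v ∈ K, S.skewVol t u v ≤ C * S.vol t := by
  obtain ⟨c, hc, hK'⟩ := h1 (K ∪ K⁻¹) (hK.union hK.inv)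
  obtain ⟨C, hC⟩ := h2.2 c hc
  refine ⟨max C 1, by positivity, fun t ht u hu v hv => ?_⟩
  have hpos := h2.1 t ht
  have h3 : S.skewVol t u v ≤ S.vol (t + c) := by
    rw [vol_eq]
    refine measureReal_mono ?_ (S.measure_skewBall_ne_top _ _ _)
    intro h hh
    simp only [skewBall, mem_ofPred_eq, inv_one, one_mul, mul_one] at hh ⊢
    refine hK' t ht ?_
    have : (h : G) = u * (u⁻¹ * h * v) * v⁻¹ := by group
    rw [this]
    exact Set.mul_mem_mul (Set.mul_mem_mul (Or.inl hu) hh) (Or.inr (by simpa using hv))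
  have h4 := hC t ht
  rw [div_le_iff₀ hpos] at h4
  calc _ ≤ _ := h3
    _ ≤ _ := h4
    _ ≤ _ := by gcongr; exact le_max_left _ _

variable {S}

/-- Hölder's inequality for the correlation of two functions against a symmetric weight. -/
lemma lintegral_enorm_mul_dens_le {b : G → ℝ≥0∞} {P : Set G} (hb : S.IsWeight b P)
    {D f : G → ℝ} (hD : Measurable D) (hf : Measurable f) {r q : ℝ≥0∞}
    [hrq : r.HolderTriple q 1] {K : Set G}
    (hKf : ∀ v, v ∉ K → S.dens (fun g => ‖f g‖ₑ) b v = 0) :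
    ∫⁻ v, ‖D v‖ₑ * S.dens (fun g => ‖f g‖ₑ) b v ∂S.m ≤
      eLpNorm D r (S.m.restrict K) * eLpNorm f q S.m := by
  have hbm := hb.measurable
  have hfm : Measurable fun g => ‖f g‖ₑ := hf.enorm
  -- Hölder's inequality is applied on the product, for the measure with density `b(v⁻¹g)` on `K ×
  -- G`. Its marginals are `m` restricted to `K` and a measure at most `m`, so the norms of `D` and
  -- `f` separate with no loss depending on the scale of `b`.
  set ν : Measure (G × G) := ((S.m.restrict K).prod S.m).withDensity (fun z => b (z.1⁻¹ * z.2))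
    with hν
  have hdm : Measurable fun z : G × G => b (z.1⁻¹ * z.2) := by fun_prop
  have h1 : ν.map Prod.fst = S.m.restrict K := by
    ext A hA
    rw [Measure.map_apply measurable_fst hA, hν, withDensity_apply _ (measurable_fst hA),
      ← lintegral_indicator (measurable_fst hA), lintegral_prod _ (by
        exact (hdm.indicator (measurable_fst hA)).aemeasurable)]
    have : ∀ v, ∫⁻ g, (Prod.fst ⁻¹' A).indicator (fun z : G × G => b (z.1⁻¹ * z.2)) (v, g) ∂S.m =
        A.indicator 1 v := by
      intro v
      by_cases hv : v ∈ A
      · simp only [indicator, mem_preimage, hv, if_true]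
        rw [lintegral_mul_left_eq_self (μ := S.m) b v⁻¹, hb.lintegral_eq_one]
        rfl
      · simp [indicator, hv]
    simp_rw [this]
    rw [lintegral_indicator_one hA]
  have h2 : ν.map Prod.snd ≤ S.m := by
    refine Measure.le_iff.2 fun A hA => ?_
    rw [Measure.map_apply measurable_snd hA, hν, withDensity_apply _ (measurable_snd hA),
      ← lintegral_indicator (measurable_snd hA), lintegral_prod_symm _ (by
        exact (hdm.indicator (measurable_snd hA)).aemeasurable), ← lintegral_indicator_one hA]
    refine lintegral_mono fun g => ?_
    by_cases hg : g ∈ A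
    · simp only [indicator, mem_preimage, hg, if_true, Pi.one_apply]
      refine (setLIntegral_le_lintegral _ _).trans ?_
      rw [hb.lintegral_inv_mul]
    · simp [indicator, hg]
  have h3 : ∫⁻ v, ‖D v‖ₑ * S.dens (fun g => ‖f g‖ₑ) b v ∂S.m =
      eLpNorm ((fun z : G × G => D z.1) • (fun z : G × G => f z.2)) 1 ν := by
    rw [eLpNorm_one_eq_lintegral_enorm, hν, lintegral_withDensity_eq_lintegral_mul _ hdm (by
      exact ((hD.comp measurable_fst).mul (hf.comp measurable_snd)).enorm),
      lintegral_prod _ (by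
        exact (hdm.mul ((hD.comp measurable_fst).mul (hf.comp measurable_snd)).enorm).aemeasurable)]
    rw [← setLIntegral_eq_of_support_subset (s := K)]
    · refine lintegral_congr fun v => ?_
      unfold dens
      rw [← lintegral_const_mul _ (by fun_prop)]
      refine lintegral_congr fun g => ?_
      simp [enorm_mul]
      ring
    · intro v hv
      by_contra h
      exact hv (by simp [hKf v h])
  rw [h3]
  refine (eLpNorm_smul_le_mul_eLpNorm (p := r) (q := q)
    (hf.comp measurable_snd).aestronglyMeasurable
    (hD.comp measurable_fst).aestronglyMeasurable).trans ?_
  rw [← eLpNorm_map_measure hD.aestronglyMeasurable measurable_fst.aemeasurable, h1,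
    ← eLpNorm_map_measure hf.aestronglyMeasurable measurable_snd.aemeasurable]
  gcongr

lemma dens_eq_zero {f b : G → ℝ≥0∞} {P Ω : Set G} (hb : S.IsWeight b P)
    (hf : ∀ g, g ∉ Ω → f g = 0) {v : G} (hv : v ∉ Ω * P) (g : G) : f g * b (v⁻¹ * g) = 0 := by
  by_contra h
  rw [mul_eq_zero, not_or] at h
  apply hv
  refine Set.mem_mul.2 ⟨g, by_contra fun hg => h.1 (hf g hg), (v⁻¹ * g)⁻¹,
    hb.inv_mem _ (hb.mem_of_ne_zero _ h.2), by group⟩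

/-- The variation of the main term in time, controlled by the Hölder admissibility at `u`. -/
lemma mainTerm_add_le {b : G → ℝ≥0∞} {P Ω : Set G} (hb : S.IsWeight b P)
    {f : G → ℝ} (hf : Measurable f) (hΩ : ∀ g, g ∉ Ω → f g = 0) {q : ℝ≥0∞} (hq : 1 < q)
    {K : Set G} (hPK : Ω * P ⊆ K) {u : G} {c θ : ℝ}
    (hH : S.HolderAt (1 - q⁻¹)⁻¹ u K c θ) {t ε : ℝ} (ht : S.t₀ ≤ t) (hε : ε ∈ Ioo (0 : ℝ) 1) :
    S.mainTerm (t + ε) (fun g => ‖f g‖ₑ) b u ≤ S.mainTerm t (fun g => ‖f g‖ₑ) b u +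
      ENNReal.ofReal (c * ε ^ θ * S.vol t) * eLpNorm f q S.m := by
  have hrq : ((1 - q⁻¹)⁻¹).HolderTriple q 1 := ⟨by
    rw [inv_inv, inv_one]; exact tsub_add_cancel_of_le (ENNReal.inv_le_one.2 hq.le)⟩
  have hdm := S.measurable_dens (f := fun g => ‖f g‖ₑ) hf.enorm hb.measurable
  have hKf : ∀ v, v ∉ K → S.dens (fun g => ‖f g‖ₑ) b v = 0 := by
    intro v hv
    unfold dens
    rw [lintegral_congr (dens_eq_zero hb (fun g hg => by simp [hΩ g hg]) fun h => hv (hPK h))]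
    simp
  have key := lintegral_enorm_mul_dens_le hb (D := fun v => S.skewVol (t + ε) u v - S.skewVol t u v)
    ((S.measurable_skewVol _ _).sub (S.measurable_skewVol _ _)) hf (r := (1 - q⁻¹)⁻¹) (q := q)
    hKf
  have hle : t ≤ t + ε := by linarith [hε.1]
  calc S.mainTerm (t + ε) (fun g => ‖f g‖ₑ) b u
      = ∫⁻ v, (S.ρ (S.skewBall t u v) * S.dens (fun g => ‖f g‖ₑ) b v +
          ‖S.skewVol (t + ε) u v - S.skewVol t u v‖ₑ * S.dens (fun g => ‖f g‖ₑ) b v) ∂S.m := by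
        unfold mainTerm
        refine lintegral_congr fun v => ?_
        rw [← add_mul]
        congr 1
        rw [← S.ofReal_skewVol, ← S.ofReal_skewVol, Real.enorm_eq_ofReal
          (sub_nonneg.2 (S.skewVol_mono hle u v)), ← ENNReal.ofReal_add (S.skewVol_nonneg _ _ _)
          (sub_nonneg.2 (S.skewVol_mono hle u v))]
        congr 1; ring
    _ = S.mainTerm t (fun g => ‖f g‖ₑ) b u + ∫⁻ v, ‖S.skewVol (t + ε) u v - S.skewVol t u v‖ₑ *
          S.dens (fun g => ‖f g‖ₑ) b v ∂S.m := by
        rw [lintegral_add_right]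
        · rfl
        · exact (((S.measurable_skewVol _ _).sub (S.measurable_skewVol _ _)).enorm).mul hdm
    _ ≤ _ := by
        gcongr
        refine key.trans ?_
        gcongr
        exact hH t ht ε hε

lemma lintegral_dens {b : G → ℝ≥0∞} {P : Set G} (hb : S.IsWeight b P)
    {f : G → ℝ≥0∞} (hf : Measurable f) : ∫⁻ v, S.dens f b v ∂S.m = ∫⁻ g, f g ∂S.m := by
  have hbm := hb.measurable
  unfold dens
  rw [lintegral_lintegral_swap (by fun_prop)]
  refine lintegral_congr fun g => ?_
  rw [lintegral_const_mul _ (by fun_prop), hb.lintegral_inv_mul, mul_one]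

lemma mainTerm_le {b : G → ℝ≥0∞} {P Ω : Set G} (hb : S.IsWeight b P)
    {f : G → ℝ≥0∞} (hf : Measurable f) (hΩ : ∀ g, g ∉ Ω → f g = 0)
    {K : Set G} (hPK : Ω * P ⊆ K) {u : G} {t A : ℝ} (hA : ∀ v ∈ K, S.skewVol t u v ≤ A) :
    S.mainTerm t f b u ≤ ENNReal.ofReal A * ∫⁻ g, f g ∂S.m := by
  rw [← lintegral_dens hb hf, ← lintegral_const_mul _ (S.measurable_dens hf hb.measurable)]
  refine lintegral_mono fun v => ?_
  by_cases hv : v ∈ K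
  · dsimp only
    gcongr
    rw [← S.ofReal_skewVol]
    exact ENNReal.ofReal_le_ofReal (hA v hv)
  · have : S.dens f b v = 0 := by
      unfold dens
      rw [lintegral_congr (dens_eq_zero hb hΩ fun h => hv (hPK h))]
      simp
    simp [this]

variable (S)

/-- The periodized indicator of a null set has integral zero by unfolding, and its term at `γ = 1`
sees the exceptional set. -/
lemma ae_of_ae_projY {p : S.Y → Prop} (h : ∀ᵐ u ∂S.m, p (S.projY u)) : ∀ᵐ y ∂S.μ, p y := by
  obtain ⟨Z, hZ, hZm, hZ0⟩ := exists_measurable_superset_of_null (ae_iff.1 h)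
  have h1 := S.lintegral_periodize (f := Z.indicator 1) (measurable_one.indicator hZm)
  rw [lintegral_indicator_one hZm, hZ0,
    lintegral_eq_zero_iff (S.measurable_periodize (measurable_one.indicator hZm))] at h1
  filter_upwards [h1] with y hy
  obtain ⟨u, rfl⟩ := S.projY_surjective y
  by_contra hp
  rw [Pi.zero_apply, periodize_projY, ENNReal.tsum_eq_zero] at hy
  have := hy 1
  have hu : u ∈ Z := hZ hp
  simp [hu] at this

lemma quasiMeasurePreserving_projY : Measure.QuasiMeasurePreserving S.projY S.m S.μ := by
  refine ⟨S.measurable_projY, Measure.AbsolutelyContinuous.mk fun Z hZ hZ0 => ?_⟩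
  rw [Measure.map_apply S.measurable_projY hZ]
  have hm : MeasurableSet (S.projY ⁻¹' Z) := S.measurable_projY hZ
  rw [← lintegral_indicator_one hm, ← S.lintegral_periodize (measurable_one.indicator hm)]
  rw [← compl_compl Z, ← mem_ae_iff] at hZ0
  rw [lintegral_eq_zero_iff (S.measurable_periodize (measurable_one.indicator hm))]
  filter_upwards [hZ0] with y hy
  obtain ⟨u, rfl⟩ := S.projY_surjective y
  rw [periodize_projY, Pi.zero_apply, ENNReal.tsum_eq_zero]
  intro γ
  have : S.projY (u * γ) = S.projY u := by
    simp [projY]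
  rw [indicator_of_notMem]
  simpa [this] using hy

lemma measurable_err_Y (t : ℝ) {f b : G → ℝ≥0∞} (hf : Measurable f) (hb : Measurable b) (w v : G) :
    Measurable (S.err t f b w v) := by
  refine measurable_from_quotient.2 ?_
  exact (S.measurable_err t hf hb).comp (f := fun u => ((w, v), u)) (by fun_prop)

lemma measurable_pieceInt_right (t : ℝ) {f b : G → ℝ≥0∞} (hf : Measurable f) (hb : Measurable b)
    (w v : G) : Measurable fun u => S.pieceInt t f b w v (S.projY u) :=
  (S.measurable_pieceInt t hf hb).comp (f := fun u => ((w, v), u)) (by fun_prop)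

/-- Right translations preserve null sets of Haar measure and `Γ` is countable, so two functions
equal almost everywhere agree along almost every whole orbit `uΓ`. -/
lemma periodize_mul_left_eq_of_ae {f f' : G → ℝ≥0∞} (h : f =ᵐ[S.m] f') :
    S.periodize f =ᵐ[S.μ] S.periodize f' := by
  refine S.ae_of_ae_projY ?_
  have : ∀ᵐ u ∂S.m, ∀ γ : S.Γ, f (u * γ) = f' (u * γ) := by
    rw [ae_all_iff]
    intro γ
    have h0 := (measure_mul_right_null S.m (s := {u | ¬ f u = f' u}) (γ : G)).2 (ae_iff.1 h)
    exact ae_iff.2 h0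
  filter_upwards [this] with u hu
  rw [periodize_projY, periodize_projY]
  exact tsum_congr hu

/-- By Fubini, invariance of `μ` and unfolding, the integral of `pieceInt` over `Y` is exactly
`ρ(H_t[w,v])` times `dens`, hence finite. -/
lemma lintegral_pieceInt_lt_top {f b : G → ℝ≥0∞} (hf : Measurable f)
    (hb : Measurable b) (t : ℝ) (w v : G) (hfin : S.dens f b v ≠ ⊤) :
    ∀ᵐ u ∂S.m, S.pieceInt t f b w v (S.projY u) ≠ ⊤ := by
  have hfm : Measurable (S.periodize (fun g => f g * b (v⁻¹ * g))) :=
    S.measurable_periodize (by fun_prop)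
  have hmY : Measurable (S.pieceInt t f b w v) :=
    measurable_from_quotient.2 (S.measurable_pieceInt_right t hf hb w v)
  refine S.quasiMeasurePreserving_projY.ae (p := fun y => S.pieceInt t f b w v y ≠ ⊤) ?_
  -- integrate over a fundamental domain
  obtain ⟨F, hF, hμ⟩ := S.induced_μ
  have h1 : ∫⁻ y, S.pieceInt t f b w v y ∂S.μ = S.ρ (S.skewBall t w v) * S.dens f b v := by
    have h2 : ∫⁻ y, S.pieceInt t f b w v y ∂S.μ =
        ∫⁻ u in F, S.pieceInt t f b w v (S.projY u) ∂S.m := by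
      rw [hμ]; exact lintegral_map hmY S.measurable_projY
    rw [h2]
    unfold pieceInt
    rw [lintegral_lintegral_swap]
    · have h3 : ∀ h : S.H, ∫⁻ u in F, S.periodize (fun g => f g * b (v⁻¹ * g))
          ((h : G)⁻¹ • S.projY u) ∂S.m = S.dens f b v := by
        intro h
        have h4 : ∫⁻ y, S.periodize (fun g => f g * b (v⁻¹ * g)) ((h : G)⁻¹ • y) ∂S.μ =
            ∫⁻ u in F, S.periodize (fun g => f g * b (v⁻¹ * g)) ((h : G)⁻¹ • S.projY u) ∂S.m := by
          rw [hμ]; exact lintegral_map (hfm.comp (measurable_const_smul (h : G)⁻¹)) S.measurable_projY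
        rw [← h4, (measurePreserving_smul (h : G)⁻¹ S.μ).lintegral_comp hfm,
          S.lintegral_periodize (by fun_prop)]
        rfl
      simp_rw [h3]
      rw [lintegral_const, Measure.restrict_apply_univ, mul_comm]
    · have := S.measurable_periodize_prod (α := G) (F := fun z : G × G => f z.2 * b (v⁻¹ * z.2))
        (by fun_prop)
      exact (this.comp (f := fun z : G × S.H => ((1 : G), (z.2 : G)⁻¹ * z.1))
        (by fun_prop)).aemeasurable
  have h5 : ∀ᵐ y ∂S.μ, S.pieceInt t f b w v y < ⊤ := by
    refine ae_lt_top hmY ?_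
    rw [h1]
    exact ENNReal.mul_ne_top (S.measure_skewBall_ne_top _ _ _) hfin
  filter_upwards [h5] with y hy using hy.ne

/-- The deviation `err` is the normalised deviation of the averages `betaAvg`. -/
lemma ae_err_eq {f f₁ b : G → ℝ≥0∞} (hf : Measurable f) (hff₁ : f =ᵐ[S.m] f₁)
    (hb : Measurable b) (t : ℝ) (w v : G) (hfin : S.dens f b v ≠ ⊤) :
    ∀ᵐ y ∂S.μ, S.err t f b w v y = ‖S.skewVol t w v * (S.betaAvg t w v
      (fun y => (S.periodize (fun g => f₁ g * b (v⁻¹ * g)) y).toReal) y -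
      ∫ z, (S.periodize (fun g => f₁ g * b (v⁻¹ * g)) z).toReal ∂S.μ)‖ₑ := by
  -- Two versions are carried along. The function `f` is Borel, as Fubini requires. The function
  -- `f₁` stands for the lift itself: the norm in the ergodic hypothesis is evaluated on an actual
  -- function, so that hypothesis is to be applied to the periodization of `f₁`, while the deviation
  -- is formed with `f`.
  set F := S.periodize (fun g => f g * b (v⁻¹ * g)) with hF
  set F₁ := S.periodize (fun g => f₁ g * b (v⁻¹ * g)) with hF₁
  have hfm : Measurable F := S.measurable_periodize (by fun_prop)
  have hFF : F =ᵐ[S.μ] F₁ := by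
    refine S.periodize_mul_left_eq_of_ae ?_
    filter_upwards [hff₁] with g hg
    rw [hg]
  have hdens : ∫⁻ y, F y ∂S.μ = S.dens f b v := S.lintegral_periodize (by fun_prop)
  have hint : ∫ z, (F₁ z).toReal ∂S.μ = (S.dens f b v).toReal := by
    rw [← hdens, ← integral_toReal hfm.aemeasurable (ae_lt_top hfm (by rwa [hdens]))]
    refine integral_congr_ae ?_
    filter_upwards [hFF] with y hy
    rw [hy]
  refine S.ae_of_ae_projY ?_
  have hnull : ∀ᵐ u ∂S.m, F (S.projY u) = F₁ (S.projY u) := S.quasiMeasurePreserving_projY.ae hFF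
  have hfinF : ∀ᵐ u ∂S.m, F (S.projY u) ≠ ⊤ :=
    S.quasiMeasurePreserving_projY.ae ((ae_lt_top hfm (by rwa [hdens])).mono fun _ h => h.ne)
  -- The averages evaluate the function along an `H`-orbit, which may be a null set. Fubini on `G ×
  -- H`, with `m` invariant under each `h`, gives the comparison along almost every orbit.
  have hprod : ∀ᵐ u ∂S.m, ∀ᵐ h : S.H ∂S.ρ, F ((h : G)⁻¹ • S.projY u) = F₁ ((h : G)⁻¹ • S.projY u) ∧
      F ((h : G)⁻¹ • S.projY u) ≠ ⊤ := by
    obtain ⟨Z, hZ, hZm, hZ0⟩ := exists_measurable_superset_of_null (ae_iff.1 (hnull.and hfinF))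
    have hm2 : MeasurableSet {z : G × S.H | (z.2 : G)⁻¹ * z.1 ∈ Z} := by
      have : Measurable fun z : G × S.H => (z.2 : G)⁻¹ * z.1 := by fun_prop
      exact this hZm
    have : (S.m.prod S.ρ) {z : G × S.H | (z.2 : G)⁻¹ * z.1 ∈ Z} = 0 := by
      rw [Measure.prod_apply_symm hm2]
      refine lintegral_eq_zero_of_ae_eq_zero (ae_of_all _ fun h => ?_)
      change S.m ((fun u => (h : G)⁻¹ * u) ⁻¹' Z) = 0
      rw [measure_preimage_mul, hZ0]
    have h2 := Measure.ae_ae_of_ae_prod (show ∀ᵐ z ∂(S.m.prod S.ρ), (z.2 : G)⁻¹ * z.1 ∉ Z by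
      rw [ae_iff]; simpa using this)
    filter_upwards [h2] with u hu
    filter_upwards [hu] with h hh
    by_contra hcon
    exact hh (hZ hcon)
  filter_upwards [hprod, S.lintegral_pieceInt_lt_top hf hb t w v hfin] with u hu hufin
  have hmF : AEMeasurable (fun h : S.H => F ((h : G)⁻¹ • S.projY u))
      (S.ρ.restrict (S.skewBall t w v)) := by
    refine (Measurable.comp (hfm.comp S.measurable_projY) (f := fun h : S.H => (h : G)⁻¹ * u)
      (by fun_prop)).aemeasurable
  have hI : ∫ h in S.skewBall t w v, (F₁ ((h : G)⁻¹ • S.projY u)).toReal ∂S.ρ =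
      (S.pieceInt t f b w v (S.projY u)).toReal := by
    unfold pieceInt
    rw [← integral_toReal hmF]
    · refine integral_congr_ae ?_
      filter_upwards [ae_restrict_of_ae hu] with h hh
      rw [hh.1]
    · filter_upwards [ae_restrict_of_ae hu] with h hh using hh.2.lt_top
  have hB : S.skewVol t w v * S.betaAvg t w v (fun y => (F₁ y).toReal) (S.projY u) =
      (S.pieceInt t f b w v (S.projY u)).toReal := by
    unfold betaAvg
    rw [hI]
    -- When the skew ball is null the normalised average is zero by the convention `0⁻¹ = 0`, but so
    -- is the unnormalised integral.
    by_cases h0 : S.skewVol t w v = 0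
    · have : S.ρ (S.skewBall t w v) = 0 := by rw [← ofReal_skewVol, h0, ENNReal.ofReal_zero]
      have h1 : S.pieceInt t f b w v (S.projY u) = 0 := setLIntegral_measure_zero _ _ this
      simp [h0, h1]
    · rw [mul_inv_cancel_left₀ h0]
  rw [mul_sub, hB, hint]
  unfold err
  set L := S.pieceInt t f b w v (S.projY u)
  rw [← ofReal_skewVol, ← ENNReal.ofReal_toReal hfin, ← ENNReal.ofReal_mul (S.skewVol_nonneg _ _ _),
    ← ENNReal.ofReal_toReal hufin, ENNReal.toReal_ofReal ENNReal.toReal_nonneg,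
    ENNReal.toReal_ofReal ENNReal.toReal_nonneg]
  set x := L.toReal
  have hx : 0 ≤ x := ENNReal.toReal_nonneg
  set y := S.skewVol t w v * (S.dens f b v).toReal
  have hy : 0 ≤ y := mul_nonneg (S.skewVol_nonneg _ _ _) ENNReal.toReal_nonneg
  rw [← ENNReal.ofReal_sub _ hy, ← ENNReal.ofReal_sub _ hx, Real.enorm_eq_ofReal_abs]
  rcases le_total x y with hxy | hxy
  · rw [ENNReal.ofReal_of_nonpos (sub_nonpos.2 hxy), zero_add, abs_of_nonpos (sub_nonpos.2 hxy),
      neg_sub]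
  · rw [ENNReal.ofReal_of_nonpos (p := y - x) (sub_nonpos.2 hxy), add_zero,
      abs_of_nonneg (sub_nonneg.2 hxy)]

/-- The `L^p`-norm of a function on a compact part of `G`, pulled back from `Y`. -/
lemma exists_lintegral_projY_le {Ω₁ : Set G} (hΩ₁ : IsCompact Ω₁) : ∃ N : ℝ≥0, ∀ B : Set S.Y,
    S.projY '' Ω₁ ⊆ B → ∀ f : S.Y → ℝ≥0∞, Measurable f →
      ∫⁻ u in Ω₁, f (S.projY u) ∂S.m ≤ N * ∫⁻ y in B, f y ∂S.μ := by
  obtain ⟨N, hN⟩ := S.exists_periodize_indicator_bound hΩ₁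
  refine ⟨N, fun B hB f hf => ?_⟩
  have hm := hΩ₁.measurableSet
  -- The preimage of this image in `G` is `Ω₁Γ`, which is closed as the product of a compact and a
  -- closed set.
  have hBm : MeasurableSet (S.projY '' Ω₁) := by
    refine measurableSet_quotient.2 ?_
    have : (Quotient.mk'' ⁻¹' (S.projY '' Ω₁) : Set G) = Ω₁ * (S.Γ : Set G) := by
      ext g
      simp only [mem_preimage, mem_image, Set.mem_mul]
      constructor
      · rintro ⟨u, hu, h⟩
        have : u⁻¹ * g ∈ S.Γ := QuotientGroup.eq.1 h
        exact ⟨u, hu, _, this, by group⟩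
      · rintro ⟨u, hu, γ, hγ, rfl⟩
        exact ⟨u, hu, QuotientGroup.eq.2 (by simpa using hγ)⟩
    rw [this]
    exact (IsClosed.mul_left_of_isCompact Subgroup.isClosed_of_discrete hΩ₁).measurableSet
  have hfm : Measurable (Ω₁.indicator fun u => f (S.projY u)) :=
    (hf.comp S.measurable_projY).indicator hm
  rw [← lintegral_indicator hm, ← S.lintegral_periodize hfm]
  have h1 : ∀ y, S.periodize (Ω₁.indicator fun u => f (S.projY u)) y ≤
      N * (S.projY '' Ω₁).indicator f y := by
    intro y
    obtain ⟨u, rfl⟩ := S.projY_surjective y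
    have h2 : ∀ γ : S.Γ, (Ω₁.indicator fun u => f (S.projY u)) (u * γ) =
        Ω₁.indicator 1 (u * γ) * (S.projY '' Ω₁).indicator f (S.projY u) := by
      intro γ
      have hγ : S.projY (u * γ) = S.projY u := by simp [projY]
      by_cases hu : u * γ ∈ Ω₁
      · have : S.projY u ∈ S.projY '' Ω₁ := ⟨_, hu, hγ⟩
        simp [hu, this, hγ]
      · simp [hu]
    rw [periodize_projY]
    simp_rw [h2]
    rw [ENNReal.tsum_mul_right, ← periodize_projY]
    gcongr
    exact hN _
  refine (lintegral_mono h1).trans ?_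
  rw [lintegral_const_mul _ (hf.indicator hBm), lintegral_indicator hBm]
  gcongr
  rfl

end Estimates

end DualitySetting

namespace DualitySetting

/-! ### `L^p` bounds for the error at one time, and compact domains in `Y`. -/

section ErrorBounds

variable {G : Type*} [Group G] [TopologicalSpace G] [MeasurableSpace G] {S : DualitySetting G}
variable [IsTopologicalGroup G] [T2Space G]
    [LocallyCompactSpace G] [SecondCountableTopology G] [BorelSpace G]

/-- Jensen's inequality for powers on a finite measure space. -/
lemma lintegral_rpow_le_measure_rpow_mul {α : Type*} [MeasurableSpace α] {ν : Measure α}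
    {f : α → ℝ≥0∞} (hf : Measurable f) {P : ℝ} (hP : 1 ≤ P) :
    (∫⁻ x, f x ∂ν) ^ P ≤ ν univ ^ (P - 1) * ∫⁻ x, f x ^ P ∂ν := by
  have hP0 : 0 < P := by linarith
  have h := eLpNorm'_le_eLpNorm'_mul_rpow_measure_univ (p := 1) (q := P) (μ := ν) one_pos hP
    hf.aestronglyMeasurable
  simp only [eLpNorm', enorm_eq_self, ENNReal.rpow_one, div_one] at h
  calc (∫⁻ x, f x ∂ν) ^ P ≤ ((∫⁻ x, f x ^ P ∂ν) ^ (1 / P) * ν univ ^ (1 - 1 / P)) ^ P := by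
        gcongr
    _ = _ := by
        rw [ENNReal.mul_rpow_of_nonneg _ _ hP0.le, ← ENNReal.rpow_mul, ← ENNReal.rpow_mul,
          one_div_mul_cancel hP0.ne', ENNReal.rpow_one, mul_comm]
        congr 2
        field_simp

lemma measurable_errTerm (t : ℝ) {f b : G → ℝ≥0∞} (hf : Measurable f) (hb : Measurable b) :
    Measurable (S.errTerm t f b) := by
  unfold errTerm
  refine Measurable.lintegral_prod_left' (f := fun z : G × G =>
    b (z.1⁻¹ * z.2) * ∫⁻ v, S.err t f b z.1 v (S.projY z.2) ∂S.m) ?_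
  exact Measurable.mul (by fun_prop) (measurable_lintegral_err t hf hb)

lemma err_eq_zero {f b : G → ℝ≥0∞} {P Ω : Set G} (hb : S.IsWeight b P)
    (hf : ∀ g, g ∉ Ω → f g = 0) {v : G} (hv : v ∉ Ω * P) (t : ℝ) (w : G) (y : S.Y) :
    S.err t f b w v y = 0 := by
  have h := dens_eq_zero hb hf hv
  have h1 : (fun g => f g * b (v⁻¹ * g)) = fun _ => 0 := funext h
  have h2 : S.dens f b v = 0 := by unfold dens; simp [h]
  have h3 : S.pieceInt t f b w v y = 0 := by
    have h4 : S.periodize (fun g => f g * b (v⁻¹ * g)) = fun _ => 0 := by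
      rw [h1]; ext; simp [periodize]
    unfold pieceInt
    rw [h4]
    simp
  simp [err, h2, h3]

/-- Replacing the density `b(w⁻¹u)` by its supremum lets `(w, v)` range over a fixed compact product
independently of `u`. Jensen on this finite measure space moves the `p`-th power inside, and after
Fubini the bound at each fixed `(w, v)` can be used. -/
lemma lintegral_errTerm_rpow_le {f b : G → ℝ≥0∞} {P Ω Ω₁ K₁ K₂ : Set G} (hb : S.IsWeight b P)
    (hf : Measurable f) (hΩ : ∀ g, g ∉ Ω → f g = 0) (hΩ₁ : MeasurableSet Ω₁)
    (hK₁ : IsCompact K₁) (hK₂ : IsCompact K₂) (h₁ : Ω₁ * P ⊆ K₁) (h₂ : Ω * P ⊆ K₂)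
    {β Q : ℝ≥0∞} (hβ : ∀ g, b g ≤ β) {p : ℝ} (hp : 1 ≤ p) (t : ℝ)
    (hQ : ∀ w ∈ K₁, ∀ v ∈ K₂, ∫⁻ u in Ω₁, S.err t f b w v (S.projY u) ^ p ∂S.m ≤ Q ^ p) :
    ∫⁻ u in Ω₁, S.errTerm t f b u ^ p ∂S.m ≤ (β * (S.m K₁ * S.m K₂) * Q) ^ p := by
  have hp0 : 0 ≤ p := by linarith
  set ν := (S.m.restrict K₁).prod (S.m.restrict K₂) with hν
  set V := S.m K₁ * S.m K₂ with hV
  have hνV : ν univ = V := by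
    rw [hν, ← univ_prod_univ, Measure.prod_prod]; simp [hV]
  have hVt : V ≠ ⊤ := ENNReal.mul_ne_top hK₁.measure_lt_top.ne hK₂.measure_lt_top.ne
  have hm := S.measurable_err t hf hb.measurable
  have hsec : ∀ u, Measurable fun z : G × G => S.err t f b z.1 z.2 (S.projY u) := fun u =>
    hm.comp (f := fun z : G × G => (z, u)) (by fun_prop)
  have step1 : ∀ u ∈ Ω₁, S.errTerm t f b u ≤ β * ∫⁻ z, S.err t f b z.1 z.2 (S.projY u) ∂ν := by
    intro u hu
    rw [hν, lintegral_prod _ (hsec u).aemeasurable, ← lintegral_const_mul _ (by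
      exact Measurable.lintegral_prod_right' (f := fun z : G × G =>
        S.err t f b z.1 z.2 (S.projY u)) (hsec u))]
    unfold errTerm
    rw [← setLIntegral_eq_of_support_subset (s := K₁)]
    · refine lintegral_mono fun w => ?_
      refine mul_le_mul' (hβ _) (le_of_eq ?_)
      rw [← setLIntegral_eq_of_support_subset (s := K₂)]
      intro v hv
      by_contra h
      exact hv (err_eq_zero hb hΩ (fun h' => h (h₂ h')) t w _)
    · intro w hw
      refine h₁ (Set.mem_mul.2 ⟨u, hu, (w⁻¹ * u)⁻¹, hb.inv_mem _ (hb.mem_of_ne_zero _ ?_), by group⟩)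
      intro h0
      exact hw (by simp [h0])
  calc ∫⁻ u in Ω₁, S.errTerm t f b u ^ p ∂S.m
      ≤ ∫⁻ u in Ω₁, β ^ p * V ^ (p - 1) * ∫⁻ z, S.err t f b z.1 z.2 (S.projY u) ^ p ∂ν ∂S.m := by
        refine setLIntegral_mono' hΩ₁ fun u hu => ?_
        refine (ENNReal.rpow_le_rpow (step1 u hu) hp0).trans ?_
        rw [ENNReal.mul_rpow_of_nonneg _ _ hp0, mul_assoc]
        gcongr
        have := lintegral_rpow_le_measure_rpow_mul (ν := ν) (hsec u) hp
        rwa [hνV] at this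
    _ = β ^ p * V ^ (p - 1) * ∫⁻ z, ∫⁻ u in Ω₁, S.err t f b z.1 z.2 (S.projY u) ^ p ∂S.m ∂ν := by
        rw [lintegral_const_mul]
        · rw [lintegral_lintegral_swap]
          exact ((hm.comp (f := fun z : G × G × G => ((z.2.1, z.2.2), z.1))
            (by fun_prop)).pow_const p).aemeasurable
        · refine Measurable.lintegral_prod_left' (f := fun z : (G × G) × G =>
            S.err t f b z.1.1 z.1.2 (S.projY z.2) ^ p) ?_
          exact hm.pow_const p
    _ ≤ β ^ p * V ^ (p - 1) * ∫⁻ z, Q ^ p ∂ν := by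
        refine mul_le_mul' le_rfl (lintegral_mono_ae ?_)
        rw [hν, Measure.prod_restrict]
        filter_upwards [ae_restrict_mem (hK₁.measurableSet.prod hK₂.measurableSet)] with z hz
        exact hQ _ hz.1 _ hz.2
    _ ≤ _ := by
        rw [lintegral_const, hνV, ENNReal.mul_rpow_of_nonneg _ _ hp0,
          ENNReal.mul_rpow_of_nonneg _ _ hp0]
        have : V ^ (p - 1) * V ≤ V ^ p := by
          rcases eq_or_ne V 0 with h0 | h0
          · simp [h0]
          · conv_lhs => rw [← ENNReal.rpow_one V, ← ENNReal.rpow_mul, one_mul,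
              ← ENNReal.rpow_add _ _ h0 hVt, sub_add_cancel]
        calc _ = β ^ p * (V ^ (p - 1) * V) * Q ^ p := by ring
          _ ≤ _ := by gcongr

/-- The `L^p`-norm of the deviations on a compact subset of `G`. -/
lemma lintegral_err_rpow_le {f f₁ b : G → ℝ≥0∞} (hf : Measurable f) (hff₁ : f =ᵐ[S.m] f₁)
    (hb : Measurable b) (t : ℝ) (w v : G) (hfin : S.dens f b v ≠ ⊤) {p : ℝ≥0∞} (hp : 1 ≤ p)
    (hpt : p ≠ ⊤) {Ω₁ : Set G} {B : Set S.Y} {N : ℝ≥0}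
    (hN : ∀ F : S.Y → ℝ≥0∞, Measurable F →
      ∫⁻ u in Ω₁, F (S.projY u) ∂S.m ≤ N * ∫⁻ y in B, F y ∂S.μ) :
    ∫⁻ u in Ω₁, S.err t f b w v (S.projY u) ^ p.toReal ∂S.m ≤
      (max (N : ℝ≥0∞) 1 * (ENNReal.ofReal (S.skewVol t w v) * eLpNorm (fun y => S.betaAvg t w v
      (fun y => (S.periodize (fun g => f₁ g * b (v⁻¹ * g)) y).toReal) y -
      ∫ z, (S.periodize (fun g => f₁ g * b (v⁻¹ * g)) z).toReal ∂S.μ) p (S.μ.restrict B))) ^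
        p.toReal := by
  have hp1 : 1 ≤ p.toReal := by
    rw [← ENNReal.toReal_one]; exact ENNReal.toReal_mono hpt hp
  have hp0 : p ≠ 0 := (zero_lt_one.trans_le hp).ne'
  refine (hN (fun y => S.err t f b w v y ^ p.toReal)
    ((S.measurable_err_Y t hf hb w v).pow_const _)).trans ?_
  have h1 := S.ae_err_eq hf hff₁ hb t w v hfin
  rw [lintegral_congr_ae (ae_restrict_of_ae (h1.mono fun y hy => by
    show _ = _
    rw [hy, enorm_mul, ENNReal.mul_rpow_of_nonneg _ _ (by linarith)]))]
  rw [lintegral_const_mul' _ _ (by simp)]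
  rw [eLpNorm_eq_lintegral_rpow_enorm_toReal hp0 hpt, ENNReal.mul_rpow_of_nonneg _ _ (by linarith),
    ENNReal.mul_rpow_of_nonneg _ _ (by linarith), ← ENNReal.rpow_mul,
    one_div_mul_cancel (by linarith), ENNReal.rpow_one,
    Real.enorm_eq_ofReal (S.skewVol_nonneg _ _ _)]
  gcongr
  -- The maximum with one is what allows `N` to be absorbed into a `p`-th power, since `p ≥ 1`.
  have : (1 : ℝ≥0∞) ≤ max (N : ℝ≥0∞) 1 := le_max_right _ _
  calc (N : ℝ≥0∞) ≤ max (N : ℝ≥0∞) 1 := le_max_left _ _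
    _ = max (N : ℝ≥0∞) 1 ^ (1 : ℝ) := by simp
    _ ≤ _ := ENNReal.rpow_le_rpow_of_exponent_le this hp1

variable (S)

/-- On a compact neighbourhood of a point only finitely many lattice elements contribute, so the sum
is locally a finite sum of continuous functions. -/
lemma continuous_periodize {ψ : G → ℝ} (hψ : Continuous ψ) (hc : HasCompactSupport ψ) :
    ∃ F : S.Y → ℝ, Continuous F ∧ ∀ g, F (S.projY g) = ∑' γ : S.Γ, ψ (g * γ) := by
  have hfun : Continuous fun g : G => ∑' γ : S.Γ, ψ (g * γ) := by
    rw [continuous_iff_continuousAt]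
    intro g₀
    obtain ⟨V, hV, hVn⟩ := exists_compact_mem_nhds g₀
    have hfin := S.finite_lattice_inter (hV.inv.mul hc)
    have : ∀ g ∈ V, ∑' γ : S.Γ, ψ (g * γ) = ∑ γ ∈ hfin.toFinset, ψ (g * γ) := by
      intro g hg
      refine tsum_eq_sum fun γ hγ => ?_
      by_contra h
      apply hγ
      rw [Set.Finite.mem_toFinset]
      exact Set.mem_mul.2 ⟨g⁻¹, Set.inv_mem_inv.2 hg, g * γ, subset_tsupport _ h, by group⟩
    have h2 : Continuous fun g : G => ∑ γ ∈ hfin.toFinset, ψ (g * γ) := by fun_prop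
    exact h2.continuousAt.congr (Filter.eventually_of_mem hVn fun g hg => (this g hg).symm)
  have hinv : ∀ a b : G, (QuotientGroup.leftRel S.Γ) a b →
      ∑' γ : S.Γ, ψ (a * γ) = ∑' γ : S.Γ, ψ (b * γ) := by
    intro a b hab
    rw [QuotientGroup.leftRel_apply] at hab
    rw [← (Equiv.mulLeft (⟨a⁻¹ * b, hab⟩ : S.Γ)).tsum_eq (fun γ : S.Γ => ψ (a * γ))]
    simp [mul_assoc]
  exact ⟨Quotient.lift _ hinv, hfun.quotient_lift hinv, fun g => rfl⟩

/-- Compact sets are contained in compact domains. -/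
lemma exists_isCompactDomain {Ω : Set G} (hΩ : IsCompact Ω) :
    ∃ B, IsCompactDomain S.μ B ∧ S.projY '' Ω ⊆ B := by
  obtain ⟨ψ, hψ1, -, hψc, hψ01⟩ := exists_continuous_one_zero_of_isCompact hΩ
    (isClosed_empty (X := G)) (disjoint_empty _)
  obtain ⟨F, hF, hFψ⟩ := S.continuous_periodize ψ.continuous hψc
  have hsum : ∀ g, Summable fun γ : S.Γ => ψ (g * γ) := by
    intro g
    refine summable_of_hasFiniteSupport ?_
    refine (S.finite_lattice_inter ((isCompact_singleton (x := g⁻¹)).mul hψc)).subset ?_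
    intro γ hγ
    exact Set.mem_mul.2 ⟨g⁻¹, rfl, g * γ, subset_tsupport _ hγ, by group⟩
  -- The domain is the closure of a superlevel set of the periodized bump `F`. Only countably many
  -- level sets have positive measure, so a level `r < 1` with null level set exists; as `F ≥ 1` on
  -- the image of `Ω`, that image lies above it.
  have hcount := Measure.countable_meas_level_set_pos (μ := S.μ) (hF.measurable)
  obtain ⟨r, hr, hr0⟩ : ∃ r ∈ Ioo (0 : ℝ) 1, S.μ {y | F y = r} = 0 := by
    by_contra! hcon
    have h1 : Ioo (0 : ℝ) 1 ⊆ {t : ℝ | 0 < S.μ {a | F a = t}} := fun r hr =>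
      pos_iff_ne_zero.2 (hcon r hr)
    exact (Cardinal.Real.Ioo_countable_iff.not.2 (by norm_num)) (hcount.mono h1)
  have hge : IsClosed {y | r ≤ F y} := isClosed_le continuous_const hF
  have hgt : IsOpen {y | r < F y} := isOpen_lt continuous_const hF
  have hcpt : IsCompact {y | r ≤ F y} := by
    refine (hψc.isCompact.image S.continuous_projY).of_isClosed_subset hge ?_
    intro y hy
    obtain ⟨g, rfl⟩ := S.projY_surjective y
    by_contra hcon
    have : F (S.projY g) = 0 := by
      rw [hFψ]
      convert tsum_zero with γ
      by_contra h
      exact hcon ⟨g * γ, subset_tsupport _ h, by simp [projY]⟩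
    rw [mem_ofPred_eq, this] at hy
    linarith [hr.1]
  have hclsub : closure {y | r < F y} ⊆ {y | r ≤ F y} :=
    closure_minimal (fun y (hy : r < F y) => hy.le) hge
  refine ⟨closure {y | r < F y}, ⟨hcpt.of_isClosed_subset isClosed_closure hclsub, ?_, ?_⟩, ?_⟩
  · refine subset_antisymm (closure_mono hgt.subset_interior_closure) ?_
    exact closure_minimal interior_subset isClosed_closure
  · refine measure_mono_null ?_ hr0
    intro y hy
    have h1 : y ∈ closure {y | r < F y} :=
      closure_minimal interior_subset isClosed_closure (frontier_subset_closure hy)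
    have h2 : y ∉ {y | r < F y} := by
      intro h
      have := hgt.subset_interior_closure h
      rw [frontier, interior_interior] at hy
      exact hy.2 this
    exact le_antisymm (not_lt.1 h2) (hclsub h1)
  · rintro _ ⟨g, hg, rfl⟩
    refine subset_closure ?_
    change r < F (S.projY g)
    rw [hFψ]
    refine hr.2.trans_le ?_
    have h1 := (hsum g).le_tsum 1 (fun γ _ => (hψ01 _).1)
    simpa [hψ1 hg] using h1

end ErrorBounds

end DualitySetting

namespace DualitySetting

/-! ### Summing the errors along logarithmic times. -/

section Core

variable {G : Type*} [Group G] [TopologicalSpace G] [MeasurableSpace G]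

/-- A sequence of weights, the `k`-th one at scale `1 / k`, which grow polynomially in `k`. -/
structure WeightFamily (S : DualitySetting G) where
  b : ℕ → G → ℝ≥0∞
  P : ℕ → Set G
  K₀ : Set G
  k₀ : ℕ
  κ : ℝ
  β : ℝ
  c : ℝ
  one_le_k₀ : 1 ≤ k₀
  κ_nonneg : 0 ≤ κ
  c_pos : 0 < c
  isWeight : ∀ k ≥ k₀, S.IsWeight (b k) (P k)
  le : ∀ k ≥ k₀, ∀ g, b k g ≤ ENNReal.ofReal (β * (k : ℝ) ^ κ)
  isCompact_K₀ : IsCompact K₀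
  subset : ∀ k ≥ k₀, P k ⊆ K₀
  thick : ∀ k ≥ k₀, ∀ t ≥ S.t₀, P k * S.ball t * P k ⊆ S.ball (t + c / k)

/-- `lift φ` is a function on `G`, supported in `Ω`, whose integrals over the cosets of `H` are the
values of `φ`, with control of norms. -/
structure IsLift (S : DualitySetting G) (q : ℝ≥0∞) (cone : Set (S.X → ℝ)) (N : (S.X → ℝ) → ℝ≥0∞)
    (Ω : Set G) (lift : (S.X → ℝ) → G → ℝ) (C : ℝ≥0) : Prop where
  aestronglyMeasurable : ∀ φ ∈ cone, AEStronglyMeasurable (lift φ) S.m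
  nonneg : ∀ φ ∈ cone, ∀ g, 0 ≤ lift φ g
  eq_zero : ∀ φ ∈ cone, ∀ g, g ∉ Ω → lift φ g = 0
  cosetInt_eq : ∀ φ ∈ cone, ∀ g,
    S.cosetInt (fun g => ENNReal.ofReal (lift φ g)) g = ENNReal.ofReal (φ (S.projX g))
  eLpNorm_le : ∀ φ ∈ cone, eLpNorm (lift φ) q S.m ≤ C * N φ

/-- Polynomial control of the norm on `Y` of the periodized localisations of the lifts. -/
def LiftControl {S : DualitySetting G} (A : S.WeightFamily) (cone : Set (S.X → ℝ))
    (N : (S.X → ℝ) → ℝ≥0∞) (lift : (S.X → ℝ) → G → ℝ) (N' : (S.Y → ℝ) → ℝ≥0∞) (K : Set G)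
    (C : ℝ≥0) : Prop :=
  ∀ φ ∈ cone, ∀ k ≥ A.k₀, ∀ v ∈ K,
    N' (fun y => (S.periodize (fun g => ENNReal.ofReal (lift φ g) * A.b k (v⁻¹ * g)) y).toReal) ≤
      C * ENNReal.ofReal ((k : ℝ) ^ A.κ) * N φ

variable {S : DualitySetting G}
variable [IsTopologicalGroup G] [T2Space G]
    [LocallyCompactSpace G] [SecondCountableTopology G] [BorelSpace G]

/-- On a fixed compact support the `L^1`-norm is controlled by the `L^q`-norm. This gives finiteness
of the densities and the crude bounds at bounded times. -/
lemma exists_lintegral_enorm_le {Ω : Set G} (hΩ : IsCompact Ω) {q : ℝ≥0∞} (hq : 1 ≤ q) :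
    ∃ C : ℝ≥0, ∀ f : G → ℝ, Measurable f → (∀ g, g ∉ Ω → f g = 0) →
      ∫⁻ g, ‖f g‖ₑ ∂S.m ≤ C * eLpNorm f q S.m := by
  have hV : S.m Ω ^ (1 / (1 : ℝ≥0∞).toReal - 1 / q.toReal) ≠ ⊤ := by
    refine ENNReal.rpow_ne_top_of_nonneg ?_ hΩ.measure_lt_top.ne
    rcases eq_or_ne q ⊤ with rfl | hqt
    · simp
    · have : 1 ≤ q.toReal := by
        rw [← ENNReal.toReal_one]; exact ENNReal.toReal_mono hqt hq
      simp only [ENNReal.toReal_one, div_one, sub_nonneg]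
      rw [div_le_one (by linarith)]
      exact this
  refine ⟨(S.m Ω ^ (1 / (1 : ℝ≥0∞).toReal - 1 / q.toReal)).toNNReal, fun f hf hz => ?_⟩
  rw [ENNReal.coe_toNNReal hV]
  have h1 : ∫⁻ g, ‖f g‖ₑ ∂S.m = eLpNorm f 1 (S.m.restrict Ω) := by
    rw [eLpNorm_one_eq_lintegral_enorm, setLIntegral_eq_of_support_subset]
    intro g hg
    by_contra h
    exact hg (by simp [hz g h])
  rw [h1, mul_comm]
  refine (eLpNorm_le_eLpNorm_mul_rpow_measure_univ hq hf.aestronglyMeasurable).trans ?_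
  rw [Measure.restrict_apply_univ]
  gcongr
  exact Measure.restrict_le_self

lemma dens_ne_top {b f : G → ℝ≥0∞} {β : ℝ} (hβ : ∀ g, b g ≤ ENNReal.ofReal β)
    (hfin : ∫⁻ g, f g ∂S.m ≠ ⊤) (v : G) : S.dens f b v ≠ ⊤ := by
  refine ne_top_of_le_ne_top (ENNReal.mul_ne_top hfin (ENNReal.ofReal_ne_top (r := β))) ?_
  rw [← lintegral_mul_const' _ _ ENNReal.ofReal_ne_top]
  exact lintegral_mono fun g => mul_le_mul' le_rfl (hβ _)

lemma ofReal_lift_ae_eq {q : ℝ≥0∞} {cone : Set (S.X → ℝ)} {N : (S.X → ℝ) → ℝ≥0∞} {Ω : Set G}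
    {lift : (S.X → ℝ) → G → ℝ} {C : ℝ≥0} (hL : IsLift S q cone N Ω lift C) {φ : S.X → ℝ}
    (hφ : φ ∈ cone) {f : G → ℝ} (hff : f =ᵐ[S.m] lift φ) :
    (fun g => ‖f g‖ₑ) =ᵐ[S.m] fun g => ENNReal.ofReal (lift φ g) := by
  filter_upwards [hff] with g hg
  rw [hg, Real.enorm_eq_ofReal (hL.nonneg φ hφ g)]

lemma toReal_periodize_mem_cone {q : ℝ≥0∞} {cone : Set (S.X → ℝ)} {N : (S.X → ℝ) → ℝ≥0∞}
    {Ω : Set G} {lift : (S.X → ℝ) → G → ℝ} {C : ℝ≥0} (hL : IsLift S q cone N Ω lift C)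
    {φ : S.X → ℝ} (hφ : φ ∈ cone) {b : G → ℝ≥0∞} (hb : Measurable b) {B : Set S.Y}
    (hB : S.projY '' Ω ⊆ B) {N' : (S.Y → ℝ) → ℝ≥0∞} (v : G)
    (hN' : N' (fun y => (S.periodize (fun g => ENNReal.ofReal (lift φ g) * b (v⁻¹ * g)) y).toReal)
      ≠ ⊤) :
    (fun y => (S.periodize (fun g => ENNReal.ofReal (lift φ g) * b (v⁻¹ * g)) y).toReal) ∈
      PositiveCone S.μ B N' := by
  refine ⟨?_, fun _ => ENNReal.toReal_nonneg, ?_, hN'⟩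
  · obtain ⟨f, hf, hff⟩ := hL.aestronglyMeasurable φ hφ
    refine ⟨fun y => (S.periodize (fun g => ENNReal.ofReal (f g) * b (v⁻¹ * g)) y).toReal, ?_, ?_⟩
    · have := hf.measurable
      exact (S.measurable_periodize (by fun_prop)).ennreal_toReal.stronglyMeasurable
    · have h : (fun g => ENNReal.ofReal (lift φ g) * b (v⁻¹ * g)) =ᵐ[S.m]
          fun g => ENNReal.ofReal (f g) * b (v⁻¹ * g) := by
        filter_upwards [hff] with g hg
        rw [hg]
      filter_upwards [S.periodize_mul_left_eq_of_ae h] with y hy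
      rw [hy]
  · intro y hy
    obtain ⟨u, rfl⟩ := S.projY_surjective y
    dsimp only
    rw [periodize_projY, ENNReal.tsum_eq_zero.2, ENNReal.toReal_zero]
    intro γ
    have : u * γ ∉ Ω := fun h => hy (hB ⟨u * γ, h, by simp [projY]⟩)
    rw [hL.eq_zero φ hφ _ this]
    simp

/-- Summing the deviations over a sequence of times tending to infinity at a logarithmic rate. -/
lemma exists_errTerm_bound (A : S.WeightFamily) (h1 : S.CA1) (h2 : S.CA2) {p q : ℝ≥0∞}
    (hp : 1 ≤ p) (hpt : p ≠ ⊤) (hq : 1 ≤ q) {σ a : ℝ} (hσ : 0 < σ) (ha : 2 * A.κ + 3 ≤ a * σ)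
    {Ω Ω₁ : Set G} (hΩ : IsCompact Ω) (hΩ₁ : IsCompact Ω₁) {B : Set S.Y}
    (hBΩ : S.projY '' Ω ⊆ B) (hBΩ₁ : S.projY '' Ω₁ ⊆ B) {N' : (S.Y → ℝ) → ℝ≥0∞} {Cm t₁ : ℝ}
    (hmean : ∀ g₁ ∈ (Ω ∪ Ω₁) * A.K₀, ∀ g₂ ∈ (Ω ∪ Ω₁) * A.K₀, ∀ F ∈ PositiveCone S.μ B N', ∀ t ≥ t₁,
      eLpNorm (fun y => S.betaAvg t g₁ g₂ F y - ∫ z, F z ∂S.μ) p (S.μ.restrict B) ≤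
        ENNReal.ofReal (Cm * Real.exp (-σ * t)) * N' F)
    {D : Set S.X} {N : (S.X → ℝ) → ℝ≥0∞} {lift : (S.X → ℝ) → G → ℝ} {CL C' : ℝ≥0}
    (hL : IsLift S q (PositiveCone S.ξ D N) N Ω lift CL)
    (hC' : LiftControl A (PositiveCone S.ξ D N) N lift N' ((Ω ∪ Ω₁) * A.K₀) C')
    {s : ℕ → ℝ} {k₁ : ℕ} (hk₁ : A.k₀ ≤ k₁) {C₃ : ℝ} (hs₀ : ∀ k ≥ k₁, S.t₀ ≤ s k)
    (hs₁ : ∀ k ≥ k₁, t₁ ≤ s k) (hs : ∀ k ≥ k₁, a * Real.log k - C₃ ≤ s k) :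
    ∃ C : ℝ≥0, ∀ φ ∈ PositiveCone S.ξ D N, ∀ f : G → ℝ, Measurable f → f =ᵐ[S.m] lift φ →
      (∀ g, g ∉ Ω → f g = 0) → ∃ Z : G → ℝ≥0∞, Measurable Z ∧
        ∫⁻ u in Ω₁, Z u ^ p.toReal ∂S.m ≤ (C * N φ) ^ p.toReal ∧
        ∀ k ≥ k₁, ∀ u, S.errTerm (s k) (fun g => ‖f g‖ₑ) (A.b k) u ≤
          Z u * ENNReal.ofReal (S.vol (s k) / k) := by
  have hp1 : 1 ≤ p.toReal := by
    rw [← ENNReal.toReal_one]; exact ENNReal.toReal_mono hpt hp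
  set K := (Ω ∪ Ω₁) * A.K₀ with hKdef
  have hK : IsCompact K := (hΩ.union hΩ₁).mul A.isCompact_K₀
  obtain ⟨Cv, hCv0, hCv⟩ := exists_skewVol_le S h1 h2 hK
  obtain ⟨n, hn⟩ := S.exists_lintegral_projY_le hΩ₁
  obtain ⟨Cf, hCf⟩ := exists_lintegral_enorm_le (S := S) hΩ hq
  set V : ℝ≥0∞ := S.m K * S.m K with hV
  have hVt : V ≠ ⊤ := ENNReal.mul_ne_top hK.measure_lt_top.ne hK.measure_lt_top.ne
  set M : ℝ := |A.β| * (Cv * (|Cm| * Real.exp (σ * C₃))) with hM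
  have hM0 : 0 ≤ M := by positivity
  -- All factors independent of `k` and `φ`: the volume comparison and the ergodic constant in `M`,
  -- the measure of the parameter space, the multiplicity of `G → Y` over `Ω₁`, and the constant of
  -- the lift.
  set C₅ : ℝ≥0∞ := ENNReal.ofReal M * V * max (n : ℝ≥0∞) 1 * C' with hC₅
  have hC₅t : C₅ ≠ ⊤ := by
    rw [hC₅]
    refine ENNReal.mul_ne_top (ENNReal.mul_ne_top (ENNReal.mul_ne_top ENNReal.ofReal_ne_top hVt) ?_)
      ENNReal.coe_ne_top
    simp
  have hsum : Summable fun k : ℕ => ((k : ℝ) ^ 2)⁻¹ := 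
    Real.summable_nat_pow_inv.2 (by norm_num)
  set Sg : ℝ≥0∞ := ∑' k : ℕ, ENNReal.ofReal ((k : ℝ) ^ 2)⁻¹ with hSg
  have hSgt : Sg ≠ ⊤ := hsum.tsum_ofReal_ne_top
  refine ⟨(max Sg 1 * C₅).toNNReal, fun φ hφ f hf hff hfΩ => ?_⟩
  rw [ENNReal.coe_toNNReal (ENNReal.mul_ne_top (by simp [hSgt]) hC₅t)]
  have hNφ : N φ ≠ ⊤ := hφ.2.2.2
  set fe : G → ℝ≥0∞ := fun g => ‖f g‖ₑ with hfe
  have hfem : Measurable fe := hf.enorm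
  have hfeΩ : ∀ g, g ∉ Ω → fe g = 0 := fun g hg => by simp [hfe, hfΩ g hg]
  have hfin : ∫⁻ g, fe g ∂S.m ≠ ⊤ := by
    refine ne_top_of_le_ne_top ?_ (hCf f hf hfΩ)
    rw [eLpNorm_congr_ae hff]
    exact ENNReal.mul_ne_top ENNReal.coe_ne_top (ne_top_of_le_ne_top
      (ENNReal.mul_ne_top ENNReal.coe_ne_top hNφ) (hL.eLpNorm_le φ hφ))
  -- the estimate at one time
  have key : ∀ k ≥ k₁, ∫⁻ u in Ω₁, S.errTerm (s k) fe (A.b k) u ^ p.toReal ∂S.m ≤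
      (C₅ * ENNReal.ofReal (((k : ℝ) ^ 3)⁻¹ * S.vol (s k)) * N φ) ^ p.toReal := by
    intro k hk
    have hk0 : A.k₀ ≤ k := hk₁.trans hk
    have hkpos : (0 : ℝ) < k := by
      have := A.one_le_k₀.trans hk0
      exact_mod_cast this
    have hb := A.isWeight k hk0
    have hvol := h2.1 _ (hs₀ k hk)
    have hΩP : Ω * A.P k ⊆ K := Set.mul_subset_mul subset_union_left (A.subset k hk0)
    have hΩ₁P : Ω₁ * A.P k ⊆ K := Set.mul_subset_mul subset_union_right (A.subset k hk0)
    have hest := lintegral_errTerm_rpow_le hb hfem hfeΩ hΩ₁.measurableSet hK hK hΩ₁P hΩP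
      (β := ENNReal.ofReal (A.β * (k : ℝ) ^ A.κ))
      (Q := max (n : ℝ≥0∞) 1 * (ENNReal.ofReal (Cv * S.vol (s k)) *
        (ENNReal.ofReal (Cm * Real.exp (-σ * s k)) *
          (C' * ENNReal.ofReal ((k : ℝ) ^ A.κ) * N φ))))
      (A.le k hk0) hp1 (s k) (by
        intro w hw v hv
        have hd := dens_ne_top (b := A.b k) (A.le k hk0) hfin v
        refine (lintegral_err_rpow_le hfem (ofReal_lift_ae_eq hL hφ hff) hb.measurable (s k) w v hd
          hp hpt (hn B hBΩ₁)).trans ?_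
        have hNF := hC' φ hφ k hk0 v hv
        have hcone := toReal_periodize_mem_cone hL hφ hb.measurable hBΩ (N' := N') v
          (ne_top_of_le_ne_top (ENNReal.mul_ne_top (ENNReal.mul_ne_top ENNReal.coe_ne_top
            ENNReal.ofReal_ne_top) hNφ) hNF)
        gcongr
        · exact hCv _ (hs₀ k hk) w hw v hv
        · refine (hmean w hw v hv _ hcone _ (hs₁ k hk)).trans ?_
          gcongr)
    refine hest.trans (ENNReal.rpow_le_rpow ?_ (by linarith))
    -- Along times at least `a log k - C₃`, exponential decay in time becomes polynomial decay in
    -- `k`.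
    have hexp : Real.exp (-σ * s k) ≤ Real.exp (σ * C₃) * (k : ℝ) ^ (-(a * σ)) := by
      rw [Real.rpow_def_of_pos hkpos, ← Real.exp_add]
      apply Real.exp_le_exp.2
      have := hs k hk
      nlinarith
    have hreal : |A.β| * (k : ℝ) ^ A.κ * (Cv * S.vol (s k)) * (|Cm| * Real.exp (-σ * s k)) *
        (k : ℝ) ^ A.κ ≤ M * (((k : ℝ) ^ 3)⁻¹ * S.vol (s k)) := by
      have hk1 : (1 : ℝ) ≤ k := by
        have := A.one_le_k₀.trans hk0
        exact_mod_cast this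
      -- One factor `k^κ` is the supremum of the weight, the other the norm of the periodized
      -- localisation. The choice of `a` makes the total exponent `2κ - aσ` at most `-3`.
      have h3 : (k : ℝ) ^ A.κ * (k : ℝ) ^ (-(a * σ)) * (k : ℝ) ^ A.κ ≤ ((k : ℝ) ^ 3)⁻¹ := by
        rw [← Real.rpow_add hkpos, ← Real.rpow_add hkpos]
        have : ((k : ℝ) ^ 3)⁻¹ = (k : ℝ) ^ (-3 : ℝ) := by
          rw [Real.rpow_neg hkpos.le]; norm_cast
        rw [this]
        exact Real.rpow_le_rpow_of_exponent_le hk1 (by linarith)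
      calc _ ≤ |A.β| * (k : ℝ) ^ A.κ * (Cv * S.vol (s k)) *
            (|Cm| * (Real.exp (σ * C₃) * (k : ℝ) ^ (-(a * σ)))) * (k : ℝ) ^ A.κ := by gcongr
        _ = M * ((k : ℝ) ^ A.κ * (k : ℝ) ^ (-(a * σ)) * (k : ℝ) ^ A.κ) * S.vol (s k) := by
            rw [hM]; ring
        _ ≤ M * ((k : ℝ) ^ 3)⁻¹ * S.vol (s k) := by gcongr
        _ = _ := by ring
    have hk' : (0 : ℝ) ≤ (k : ℝ) ^ A.κ := by positivity
    calc _ ≤ ENNReal.ofReal (|A.β| * (k : ℝ) ^ A.κ) * V * (max (n : ℝ≥0∞) 1 *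
          (ENNReal.ofReal (Cv * S.vol (s k)) * (ENNReal.ofReal (|Cm| * Real.exp (-σ * s k)) *
          (C' * ENNReal.ofReal ((k : ℝ) ^ A.κ) * N φ)))) := by
          gcongr
          · exact le_abs_self _
          · exact le_abs_self _
      _ = V * max (n : ℝ≥0∞) 1 * C' * ENNReal.ofReal (|A.β| * (k : ℝ) ^ A.κ * (Cv * S.vol (s k)) *
          (|Cm| * Real.exp (-σ * s k)) * (k : ℝ) ^ A.κ) * N φ := by
          rw [ENNReal.ofReal_mul (p := |A.β| * (k : ℝ) ^ A.κ * (Cv * S.vol (s k)) *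
            (|Cm| * Real.exp (-σ * s k))) (by positivity),
            ENNReal.ofReal_mul (q := |Cm| * Real.exp (-σ * s k)) (by positivity),
            ENNReal.ofReal_mul (q := Cv * S.vol (s k)) (by positivity)]
          generalize ENNReal.ofReal (|A.β| * (k : ℝ) ^ A.κ) = x₁
          generalize ENNReal.ofReal (Cv * S.vol (s k)) = x₂
          generalize ENNReal.ofReal (|Cm| * Real.exp (-σ * s k)) = x₃
          ring
      _ ≤ V * max (n : ℝ≥0∞) 1 * C' * ENNReal.ofReal (M * (((k : ℝ) ^ 3)⁻¹ * S.vol (s k))) * N φ := by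
          gcongr
      _ = _ := by
          rw [ENNReal.ofReal_mul hM0, hC₅]
          ring
  -- superposition
  set W : ℕ → G → ℝ≥0∞ := fun k u => if k₁ ≤ k then
    (ENNReal.ofReal (k / S.vol (s k)) * S.errTerm (s k) fe (A.b k) u) ^ p.toReal else 0 with hW
  have hWm : ∀ k, Measurable (W k) := by
    intro k
    by_cases hk : k₁ ≤ k
    · simp only [hW, hk, if_true]
      exact ((measurable_errTerm _ hfem (A.isWeight k (hk₁.trans hk)).measurable).const_mul _).pow_const _
    · simp only [hW, hk, if_false]; exact measurable_const
  -- The dominating function is the `ℓ^p` sum over `k` of the errors multiplied by `k / ρ(H_{s k})`.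
  -- It dominates every term, and its `p`-th power is integrable because the surviving factor
  -- `k^{-2}` is summable.
  refine ⟨fun u => (∑' k, W k u) ^ (1 / p.toReal), (Measurable.tsum hWm).pow_const _, ?_, ?_⟩
  · have h3 : ∀ u, ((∑' k, W k u) ^ (1 / p.toReal)) ^ p.toReal = ∑' k, W k u := by
      intro u
      rw [← ENNReal.rpow_mul, one_div_mul_cancel (by linarith), ENNReal.rpow_one]
    simp_rw [h3]
    rw [lintegral_tsum fun k => (hWm k).aemeasurable]
    have h4 : ∀ k, ∫⁻ u in Ω₁, W k u ∂S.m ≤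
        ENNReal.ofReal ((k : ℝ) ^ 2)⁻¹ * (C₅ * N φ) ^ p.toReal := by
      intro k
      by_cases hk : k₁ ≤ k
      · have hk0 : A.k₀ ≤ k := hk₁.trans hk
        have hk1 : (1 : ℝ) ≤ k := by
          have := A.one_le_k₀.trans hk0
          exact_mod_cast this
        have hvol := h2.1 _ (hs₀ k hk)
        simp only [hW, hk, if_true]
        simp_rw [ENNReal.mul_rpow_of_nonneg (ENNReal.ofReal (k / S.vol (s k))) _
          (show 0 ≤ p.toReal by linarith)]
        rw [lintegral_const_mul' _ _ (by simp)]
        refine (mul_le_mul' le_rfl (key k hk)).trans ?_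
        rw [← ENNReal.mul_rpow_of_nonneg _ _ (by linarith)]
        have h5 : ENNReal.ofReal (k / S.vol (s k)) *
            (C₅ * ENNReal.ofReal (((k : ℝ) ^ 3)⁻¹ * S.vol (s k)) * N φ) =
            ENNReal.ofReal ((k : ℝ) ^ 2)⁻¹ * (C₅ * N φ) := by
          have : ((k : ℝ) ^ 2)⁻¹ = k / S.vol (s k) * (((k : ℝ) ^ 3)⁻¹ * S.vol (s k)) := by
            field_simp
          rw [this, ENNReal.ofReal_mul (p := k / S.vol (s k)) (by positivity)]
          generalize ENNReal.ofReal (k / S.vol (s k)) = x₁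
          ring
        rw [h5, ENNReal.mul_rpow_of_nonneg (ENNReal.ofReal ((k : ℝ) ^ 2)⁻¹) _ (by linarith)]
        gcongr
        -- For numbers at most one the `p`-th power only helps, so summability of `k^{-2}` itself
        -- suffices.
        have h6 : ENNReal.ofReal ((k : ℝ) ^ 2)⁻¹ ≤ 1 := by
          rw [ENNReal.ofReal_le_one]
          exact inv_le_one_of_one_le₀ (one_le_pow₀ hk1)
        calc _ ≤ ENNReal.ofReal ((k : ℝ) ^ 2)⁻¹ ^ (1 : ℝ) :=
              ENNReal.rpow_le_rpow_of_exponent_ge h6 hp1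
          _ = _ := by simp
      · simp [hW, hk]
    refine (ENNReal.tsum_le_tsum h4).trans ?_
    rw [ENNReal.tsum_mul_right, mul_assoc (max Sg 1),
      ENNReal.mul_rpow_of_nonneg (max Sg 1) _ (show 0 ≤ p.toReal by linarith)]
    gcongr
    calc Sg ≤ max Sg 1 := le_max_left _ _
      _ = max Sg 1 ^ (1 : ℝ) := by simp
      _ ≤ _ := ENNReal.rpow_le_rpow_of_exponent_le (le_max_right _ _) hp1
  · intro k hk u
    have hkpos : (0 : ℝ) < k := by
      have := A.one_le_k₀.trans (hk₁.trans hk)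
      exact_mod_cast this
    have hvol := h2.1 _ (hs₀ k hk)
    have h7 : W k u ≤ ∑' k, W k u := ENNReal.le_tsum k
    have h8 : ENNReal.ofReal (k / S.vol (s k)) * S.errTerm (s k) fe (A.b k) u ≤
        (∑' k, W k u) ^ (1 / p.toReal) := by
      have := ENNReal.rpow_le_rpow h7 (show 0 ≤ 1 / p.toReal by positivity)
      simp only [hW, hk, if_true] at this ⊢
      rwa [← ENNReal.rpow_mul, mul_one_div_cancel (by linarith), ENNReal.rpow_one] at this
    calc S.errTerm (s k) fe (A.b k) u = (ENNReal.ofReal (k / S.vol (s k)) *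
          S.errTerm (s k) fe (A.b k) u) * ENNReal.ofReal (S.vol (s k) / k) := by
          rw [mul_right_comm, ← ENNReal.ofReal_mul (by positivity)]
          have : (k : ℝ) / S.vol (s k) * (S.vol (s k) / k) = 1 := by field_simp
          rw [this, ENNReal.ofReal_one, one_mul]
      _ ≤ _ := by gcongr

end Core

end DualitySetting

namespace DualitySetting

/-! ### From logarithmic times to all times. -/

section PointwiseBound

variable {G : Type*} [Group G] [TopologicalSpace G] [MeasurableSpace G] {S : DualitySetting G}
variable [IsTopologicalGroup G] [T2Space G]
    [LocallyCompactSpace G] [SecondCountableTopology G] [BorelSpace G]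

lemma dSum_mono {t t' : ℝ} (h : t ≤ t') (f : G → ℝ≥0∞) (u : G) : S.dSum t f u ≤ S.dSum t' f u := by
  refine ENNReal.tsum_le_tsum fun γ => mul_le_mul' ?_ le_rfl
  exact indicator_le_indicator_of_subset (S.monotone_ball h) (fun _ => zero_le) _

lemma cInt_mono {t t' : ℝ} (h : t ≤ t') (f : G → ℝ≥0∞) (u : G) : S.cInt t f u ≤ S.cInt t' f u :=
  lintegral_mono_set (S.monotone_ball h)

lemma mainTerm_mono {t t' : ℝ} (h : t ≤ t') (f b : G → ℝ≥0∞) (u : G) :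
    S.mainTerm t f b u ≤ S.mainTerm t' f b u :=
  lintegral_mono fun v => mul_le_mul' (measure_mono (S.skewBall_mono h u v)) le_rfl

/-- Comparison of the discrete and continuous sums on a short interval of times. -/
lemma dSum_cInt_close (A : S.WeightFamily) {f : G → ℝ} (hf : Measurable f) {Ω K : Set G}
    (hΩ : ∀ g, g ∉ Ω → f g = 0) (hK : Ω * A.K₀ ⊆ K) {q : ℝ≥0∞} (hq : 1 < q) {u : G} {cH θ : ℝ}
    (hH : S.HolderAt (1 - q⁻¹)⁻¹ u K cH θ) {k : ℕ} (hk : A.k₀ ≤ k) {τ a t : ℝ} (ha : 0 ≤ a)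
    (hτ : S.t₀ ≤ τ - 2 * A.c / k) (hsmall : (a + 4 * A.c) / k < 1) (ht : t ∈ Icc τ (τ + a / k)) :
    S.dSum t (fun g => ‖f g‖ₑ) u ≤ S.cInt t (fun g => ‖f g‖ₑ) u +
      (ENNReal.ofReal (cH * ((a + 4 * A.c) / k) ^ θ * S.vol (τ - 2 * A.c / k)) * eLpNorm f q S.m +
        S.errTerm (τ + (a + A.c) / k) (fun g => ‖f g‖ₑ) (A.b k) u) ∧
    S.cInt t (fun g => ‖f g‖ₑ) u ≤ S.dSum t (fun g => ‖f g‖ₑ) u +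
      (ENNReal.ofReal (cH * ((a + 4 * A.c) / k) ^ θ * S.vol (τ - 2 * A.c / k)) * eLpNorm f q S.m +
        S.errTerm (τ - A.c / k) (fun g => ‖f g‖ₑ) (A.b k) u) := by
  have hkpos : (0 : ℝ) < k := by
    have := A.one_le_k₀.trans hk
    exact_mod_cast this
  have hc := A.c_pos
  set fe : G → ℝ≥0∞ := fun g => ‖f g‖ₑ with hfe
  have hfem : Measurable fe := hf.enorm
  have hb := A.isWeight k hk
  have hd : 0 < A.c / k := by positivity
  have ha' : 0 ≤ a / k := by positivity
  obtain ⟨d, hdd⟩ : ∃ d, d = A.c / k := ⟨_, rfl⟩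
  rw [← hdd] at hd ⊢
  have e1 : 2 * A.c / k = 2 * d := by rw [hdd]; ring
  have e2 : (a + 4 * A.c) / k = a / k + 4 * d := by rw [hdd]; ring
  have e3 : (a + A.c) / k = a / k + d := by rw [hdd]; ring
  rw [e1] at hτ
  rw [e2] at hsmall
  rw [e1, e2, e3]
  set α := a / k
  -- The window for `t` has length `α = a/k`. Each end is widened by two thickenings of size `d =
  -- c/k`, so the main term is compared at `τ - 2d` and `τ + α + 2d`, a distance `α + 4d`.
  have hmain := mainTerm_add_le hb hf hΩ hq
    ((Set.mul_subset_mul_left (A.subset k hk)).trans hK) hH (t := τ - 2 * d) (ε := α + 4 * d) hτ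
    ⟨by linarith, hsmall⟩
  have e4 : τ - 2 * d + (α + 4 * d) = τ + α + 2 * d := by ring
  rw [e4] at hmain
  have thick : ∀ t t' : ℝ, S.t₀ ≤ t → t' = t + d → A.P k * S.ball t * A.P k ⊆ S.ball t' := by
    rintro t _ ht rfl
    rw [hdd]
    exact A.thick k hk t ht
  obtain ⟨ht1, ht2⟩ := ht
  constructor
  · calc S.dSum t fe u ≤ S.dSum (τ + α) fe u := dSum_mono ht2 _ _
      _ ≤ S.mainTerm (τ + α + 2 * d) fe (A.b k) u + S.errTerm (τ + (α + d)) fe (A.b k) u :=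
          dSum_le hb hfem (thick _ _ (by linarith) (by ring)) (thick _ _ (by linarith) (by ring)) u
      _ ≤ _ := by
          rw [← add_assoc (S.cInt t fe u)]
          gcongr
          refine hmain.trans ?_
          gcongr
          calc S.mainTerm (τ - 2 * d) fe (A.b k) u ≤ S.mainTerm (τ - d) fe (A.b k) u :=
                mainTerm_mono (by linarith) _ _ _
            _ ≤ S.cInt τ fe u := mainTerm_le_cInt hb hfem (thick _ _ (by linarith) (by ring)) u
            _ ≤ _ := cInt_mono ht1 _ _
  · calc S.cInt t fe u ≤ S.cInt (τ + α) fe u := cInt_mono ht2 _ _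
      _ ≤ S.mainTerm (τ + α + d) fe (A.b k) u :=
          cInt_le hb hfem (thick _ _ (by linarith) (by ring)) u
      _ ≤ S.mainTerm (τ + α + 2 * d) fe (A.b k) u := mainTerm_mono (by linarith) _ _ _
      _ ≤ _ := hmain
      _ ≤ (S.dSum τ fe u + S.errTerm (τ - d) fe (A.b k) u) + _ := by
          gcongr
          exact mainTerm_le_dSum hb hfem (thick _ _ (by linarith) (by ring))
            (thick _ _ (by linarith) (by ring)) u
      _ ≤ _ := by
          rw [add_assoc, add_comm (S.errTerm _ _ _ _)]
          gcongr
          exact dSum_mono ht1 _ _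

/-- Crude bounds for the discrete and continuous sums at one time. -/
lemma dSum_cInt_le (A : S.WeightFamily) {f : G → ℝ} (hf : Measurable f) {Ω K : Set G}
    (hΩ : ∀ g, g ∉ Ω → f g = 0) (hK : Ω * A.K₀ ⊆ K) {u : G} {k : ℕ} (hk : A.k₀ ≤ k) {τ α M : ℝ}
    (ha : 0 ≤ α) (hτ : S.t₀ ≤ τ) (hM : ∀ v ∈ K, S.skewVol (τ + α + 2 * (A.c / k)) u v ≤ M) :
    S.dSum τ (fun g => ‖f g‖ₑ) u ≤ ENNReal.ofReal M * ∫⁻ g, ‖f g‖ₑ ∂S.m +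
        S.errTerm (τ + α + A.c / k) (fun g => ‖f g‖ₑ) (A.b k) u ∧
      S.cInt τ (fun g => ‖f g‖ₑ) u ≤ ENNReal.ofReal M * ∫⁻ g, ‖f g‖ₑ ∂S.m := by
  have hkpos : (0 : ℝ) < k := by
    have := A.one_le_k₀.trans hk
    exact_mod_cast this
  have hc := A.c_pos
  set fe : G → ℝ≥0∞ := fun g => ‖f g‖ₑ with hfe
  have hfem : Measurable fe := hf.enorm
  have hfeΩ : ∀ g, g ∉ Ω → fe g = 0 := fun g hg => by simp [hfe, hΩ g hg]
  have hb := A.isWeight k hk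
  have hd : 0 < A.c / k := by positivity
  set d := A.c / k with hdd
  have thick : ∀ t t' : ℝ, S.t₀ ≤ t → t' = t + d → A.P k * S.ball t * A.P k ⊆ S.ball t' := by
    rintro t _ ht rfl
    exact A.thick k hk t ht
  have hmain : S.mainTerm (τ + α + 2 * d) fe (A.b k) u ≤ ENNReal.ofReal M * ∫⁻ g, fe g ∂S.m :=
    mainTerm_le hb hfem hfeΩ ((Set.mul_subset_mul_left (A.subset k hk)).trans hK) hM
  constructor
  · calc S.dSum τ fe u ≤ S.dSum (τ + α) fe u := dSum_mono (by linarith) _ _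
      _ ≤ S.mainTerm (τ + α + 2 * d) fe (A.b k) u + S.errTerm (τ + α + d) fe (A.b k) u :=
          dSum_le hb hfem (thick _ _ (by linarith) (by ring)) (thick _ _ (by linarith) (by ring)) u
      _ ≤ _ := by gcongr
  · calc S.cInt τ fe u ≤ S.cInt (τ + α) fe u := cInt_mono (by linarith) _ _
      _ ≤ S.mainTerm (τ + α + d) fe (A.b k) u :=
          cInt_le hb hfem (thick _ _ (by linarith) (by ring)) u
      _ ≤ S.mainTerm (τ + α + 2 * d) fe (A.b k) u := mainTerm_mono (by linarith) _ _ _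
      _ ≤ _ := hmain

/-- The comparison of the discrete and continuous sums on `G`. -/
theorem exists_pointwise_bound (A : S.WeightFamily) (h1 : S.CA1) (h2 : S.CA2) {p q : ℝ≥0∞}
    (hp : 1 ≤ p) (hpt : p ≠ ⊤) (hq : 1 < q) {σ a : ℝ} (hσ : 0 < σ) (ha : 2 * A.κ + 3 ≤ a * σ)
    {Ω Ω₁ : Set G} (hΩ : IsCompact Ω) (hΩ₁ : IsCompact Ω₁) {B : Set S.Y}
    (hBΩ : S.projY '' Ω ⊆ B) (hBΩ₁ : S.projY '' Ω₁ ⊆ B) {N' : (S.Y → ℝ) → ℝ≥0∞} {Cm t₁ : ℝ}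
    (hmean : ∀ g₁ ∈ (Ω ∪ Ω₁) * A.K₀, ∀ g₂ ∈ (Ω ∪ Ω₁) * A.K₀, ∀ F ∈ PositiveCone S.μ B N', ∀ t ≥ t₁,
      eLpNorm (fun y => S.betaAvg t g₁ g₂ F y - ∫ z, F z ∂S.μ) p (S.μ.restrict B) ≤
        ENNReal.ofReal (Cm * Real.exp (-σ * t)) * N' F)
    {D : Set S.X} {N : (S.X → ℝ) → ℝ≥0∞} {lift : (S.X → ℝ) → G → ℝ} {CL C' : ℝ≥0}
    (hL : IsLift S q (PositiveCone S.ξ D N) N Ω lift CL)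
    (hC' : LiftControl A (PositiveCone S.ξ D N) N lift N' ((Ω ∪ Ω₁) * A.K₀) C') :
    ∃ C₂ : ℝ≥0, ∃ C₁ : ℝ → ℝ → ℝ≥0, ∀ φ ∈ PositiveCone S.ξ D N, ∀ f : G → ℝ, Measurable f →
      f =ᵐ[S.m] lift φ → (∀ g, g ∉ Ω → f g = 0) → ∃ Z : G → ℝ≥0∞, Measurable Z ∧
        ∫⁻ u in Ω₁, Z u ^ p.toReal ∂S.m ≤ (C₂ * N φ) ^ p.toReal ∧
        ∀ u ∈ Ω₁, ∀ θ > 0, ∀ cH, S.HolderAt (1 - q⁻¹)⁻¹ u ((Ω ∪ Ω₁) * A.K₀) cH θ → ∀ t ≥ S.t₀,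
          S.cInt t (fun g => ‖f g‖ₑ) u ≠ ⊤ ∧
          S.dSum t (fun g => ‖f g‖ₑ) u ≤ S.cInt t (fun g => ‖f g‖ₑ) u +
            (C₁ cH θ * N φ + Z u) * ENNReal.ofReal (S.vol t * Real.exp (-(min θ 1 / a) * t)) ∧
          S.cInt t (fun g => ‖f g‖ₑ) u ≤ S.dSum t (fun g => ‖f g‖ₑ) u +
            (C₁ cH θ * N φ + Z u) * ENNReal.ofReal (S.vol t * Real.exp (-(min θ 1 / a) * t)) := by
  have hp1 : 1 ≤ p.toReal := by
    rw [← ENNReal.toReal_one]; exact ENNReal.toReal_mono hpt hp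
  have hκ := A.κ_nonneg
  have hc := A.c_pos
  have ha0 : 0 < a := by
    by_contra h
    have : a * σ ≤ 0 := mul_nonpos_of_nonpos_of_nonneg (not_lt.1 h) hσ.le
    linarith
  set K := (Ω ∪ Ω₁) * A.K₀ with hKdef
  have hK : IsCompact K := (hΩ.union hΩ₁).mul A.isCompact_K₀
  have hΩK : Ω * A.K₀ ⊆ K := Set.mul_subset_mul_right subset_union_left
  have h1K₀ : (1 : G) ∈ A.K₀ := A.subset A.k₀ le_rfl (A.isWeight A.k₀ le_rfl).one_mem
  have hΩ₁K : Ω₁ ⊆ K := fun u hu => Set.mem_mul.2 ⟨u, Or.inr hu, 1, h1K₀, mul_one u⟩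
  obtain ⟨Cv, hCv0, hCv⟩ := exists_skewVol_le S h1 h2 hK
  obtain ⟨Cf, hCf⟩ := exists_lintegral_enorm_le (S := S) hΩ hq.le
  obtain ⟨C₄, hC₄⟩ := h2.2 (a + 4 * A.c) (by positivity)
  -- the starting index
  obtain ⟨k₁, hk₁1, hk₁2, hk₁3⟩ : ∃ k₁ : ℕ, A.k₀ ≤ k₁ ∧ (a + 4 * A.c) / k₁ < 1 ∧
      max S.t₀ t₁ + 2 * A.c ≤ a * Real.log k₁ := by
    have l1 : Tendsto (fun k : ℕ => (a + 4 * A.c) / (k : ℝ)) atTop (𝓝 0) :=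
      tendsto_const_div_atTop_nhds_zero_nat _
    have l2 : Tendsto (fun k : ℕ => a * Real.log k) atTop atTop :=
      (Real.tendsto_log_atTop.comp tendsto_natCast_atTop_atTop).const_mul_atTop ha0
    obtain ⟨k₁, h⟩ := ((eventually_ge_atTop A.k₀).and ((l1.eventually_lt_const one_pos).and
      (l2.eventually_ge_atTop (max S.t₀ t₁ + 2 * A.c)))).exists
    exact ⟨k₁, h.1, h.2.1, h.2.2⟩
  have hk₁pos : 1 ≤ k₁ := A.one_le_k₀.trans hk₁1
  have hτ : ∀ k ≥ k₁, max S.t₀ t₁ ≤ a * Real.log k - 2 * A.c / k := by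
    intro k hk
    have hk1 : (1 : ℝ) ≤ k := by exact_mod_cast hk₁pos.trans hk
    have hlog : a * Real.log k₁ ≤ a * Real.log k := by
      have : (k₁ : ℝ) ≤ k := by exact_mod_cast hk
      have h0 : (0 : ℝ) < k₁ := by exact_mod_cast hk₁pos
      gcongr
    have : 2 * A.c / k ≤ 2 * A.c := div_le_self (by positivity) hk1
    linarith
  have hτ' : ∀ k ≥ k₁, 0 < A.c / k ∧ 0 < a / k ∧ 2 * A.c / k = 2 * (A.c / k) ∧
      (a + A.c) / k = a / k + A.c / k ∧ A.c / k ≤ A.c := by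
    intro k hk
    have hk1 : (1 : ℝ) ≤ k := by exact_mod_cast hk₁pos.trans hk
    exact ⟨by positivity, by positivity, by ring, by ring, div_le_self hc.le hk1⟩
  -- Two sequences of error times are needed: one just after each window for bounding the lattice
  -- sum from above, one just before it for bounding it from below. The offset `C₃` is zero in the
  -- first case and absorbs `c/k` in the second.
  obtain ⟨Cp, hCp⟩ := exists_errTerm_bound A h1 h2 hp hpt hq.le hσ ha hΩ hΩ₁ hBΩ hBΩ₁ hmean hL hC'
    (s := fun k => a * Real.log k + (a + A.c) / k) (k₁ := k₁) hk₁1 (C₃ := 0)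
    (fun k hk => by
      have h3 := hτ k hk; have h4 := hτ' k hk
      linarith [le_max_left S.t₀ t₁])
    (fun k hk => by
      have h3 := hτ k hk; have h4 := hτ' k hk
      linarith [le_max_right S.t₀ t₁])
    (fun k hk => by have h4 := hτ' k hk; linarith)
  obtain ⟨Cn, hCn⟩ := exists_errTerm_bound A h1 h2 hp hpt hq.le hσ ha hΩ hΩ₁ hBΩ hBΩ₁ hmean hL hC'
    (s := fun k => a * Real.log k - A.c / k) (k₁ := k₁) hk₁1 (C₃ := A.c)
    (fun k hk => by
      have h3 := hτ k hk; have h4 := hτ' k hk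
      linarith [le_max_left S.t₀ t₁])
    (fun k hk => by
      have h3 := hτ k hk; have h4 := hτ' k hk
      linarith [le_max_right S.t₀ t₁])
    (fun k hk => by have h4 := hτ' k hk; linarith)
  -- volumes
  have hvol0 : 0 < S.vol S.t₀ := h2.1 _ le_rfl
  have hvolt : ∀ t ≥ S.t₀, 0 < S.vol t := h2.1
  set C₆ := max C₄ 1 with hC₆
  have hC₆0 : 0 < C₆ := by positivity
  have hvol : ∀ k ≥ k₁, S.vol (a * Real.log k + (a + A.c) / k) ≤
      C₆ * S.vol (a * Real.log k - 2 * A.c / k) := by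
    intro k hk
    have h3 := hτ k hk
    have h4 := hτ' k hk
    have ht0 : S.t₀ ≤ a * Real.log k - 2 * A.c / k := (le_max_left _ _).trans h3
    have h5 := hC₄ _ ht0
    rw [div_le_iff₀ (hvolt _ ht0)] at h5
    have hk1 : (1 : ℝ) ≤ k := by exact_mod_cast hk₁pos.trans hk
    have h6 : a / k ≤ a := div_le_self ha0.le hk1
    calc _ ≤ S.vol (a * Real.log k - 2 * A.c / k + (a + 4 * A.c)) := S.vol_mono (by linarith)
      _ ≤ _ := h5
      _ ≤ _ := by
        gcongr
        · exact (hvolt _ ht0).le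
        · exact le_max_left _ _
  set T := a * Real.log k₁ with hT
  have hT0 : 0 ≤ T := by
    have : (1 : ℝ) ≤ k₁ := by exact_mod_cast hk₁pos
    have := Real.log_nonneg this
    positivity
  -- constants
  set A₁ : ℝ := max (2 * C₆) (S.vol (T + (a + A.c) / k₁) / S.vol S.t₀ * Real.exp (T / a)) with hA₁
  have hA₁0 : 0 ≤ A₁ := le_max_of_le_left (by positivity)
  set Mv : ℝ := Cv * S.vol (T + a / k₁ + 2 * (A.c / k₁)) with hMv
  set B₁ : ℝ → ℝ → ℝ := fun cH θ => max (|cH| * (2 * (a + 4 * A.c)) ^ θ)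
    (|Mv| * Cf / S.vol S.t₀ * Real.exp (T / a)) with hB₁
  have hB₁0 : ∀ cH θ, 0 ≤ B₁ cH θ := fun cH θ => le_max_of_le_left (by positivity)
  -- Only `C₁` sees the Hölder data `cH, θ`. The function `Z` and its norm constant are fixed before
  -- `u`, `θ` and `cH` are given, so the statement serves both the pointwise and the uniform
  -- conclusion.
  refine ⟨A₁.toNNReal * (Cp + Cn), fun cH θ => (B₁ cH θ).toNNReal * CL, fun φ hφ f hf hff hfΩ => ?_⟩
  obtain ⟨Zp, hZpm, hZp, hZp'⟩ := hCp φ hφ f hf hff hfΩ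
  obtain ⟨Zn, hZnm, hZn, hZn'⟩ := hCn φ hφ f hf hff hfΩ
  have hNφ : N φ ≠ ⊤ := hφ.2.2.2
  have hfq : eLpNorm f q S.m ≤ CL * N φ := by
    rw [eLpNorm_congr_ae hff]; exact hL.eLpNorm_le φ hφ
  refine ⟨fun u => ENNReal.ofReal A₁ * max (Zp u) (Zn u), (hZpm.max hZnm).const_mul _, ?_, ?_⟩
  · have hmax : ∀ u, (ENNReal.ofReal A₁ * max (Zp u) (Zn u)) ^ p.toReal ≤
        ENNReal.ofReal A₁ ^ p.toReal * (Zp u ^ p.toReal + Zn u ^ p.toReal) := by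
      intro u
      rw [ENNReal.mul_rpow_of_nonneg _ _ (by linarith)]
      gcongr
      rcases le_total (Zp u) (Zn u) with h | h
      · rw [max_eq_right h]; exact le_add_self
      · rw [max_eq_left h]; exact le_self_add
    refine (lintegral_mono hmax).trans ?_
    rw [lintegral_const_mul _ (by fun_prop), lintegral_add_left (by fun_prop)]
    have e : ((A₁.toNNReal * (Cp + Cn) : ℝ≥0) : ℝ≥0∞) * N φ =
        ENNReal.ofReal A₁ * (Cp * N φ + Cn * N φ) := by
      rw [ENNReal.coe_mul, ENNReal.coe_add, ENNReal.ofReal]; ring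
    rw [e, ENNReal.mul_rpow_of_nonneg _ _ (show 0 ≤ p.toReal by linarith)]
    gcongr
    exact (add_le_add hZp hZn).trans (ENNReal.add_rpow_le_rpow_add _ _ hp1)
  · intro u hu θ hθ cH hH t ht
    set fe : G → ℝ≥0∞ := fun g => ‖f g‖ₑ with hfe
    have hvt := hvolt t ht
    -- finiteness
    have hM₁ : ∀ τ ≥ S.t₀, S.cInt τ fe u ≠ ⊤ := by
      intro τ hτ0
      have h3 := hτ' k₁ le_rfl
      refine ne_top_of_le_ne_top ?_ (dSum_cInt_le A hf hfΩ hΩK hk₁1 (τ := τ) (α := a / k₁)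
        (M := Cv * S.vol (τ + a / k₁ + 2 * (A.c / k₁))) h3.2.1.le hτ0
        (fun v hv => hCv _ (by linarith) u (hΩ₁K hu) v hv)).2
      exact ENNReal.mul_ne_top ENNReal.ofReal_ne_top (ne_top_of_le_ne_top
        (ENNReal.mul_ne_top ENNReal.coe_ne_top (ne_top_of_le_ne_top (ENNReal.mul_ne_top
          ENNReal.coe_ne_top hNφ) hfq)) (hCf f hf hfΩ))
    refine ⟨hM₁ t ht, ?_⟩
    set δ := min θ 1 / a with hδ
    have hδ1 : δ ≤ 1 / a := by rw [hδ]; gcongr; exact min_le_right _ _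
    have hδθ : δ ≤ θ / a := by rw [hδ]; gcongr; exact min_le_left _ _
    have hδ0 : 0 < δ := by rw [hδ]; positivity
    have hcoe : (((B₁ cH θ).toNNReal * CL : ℝ≥0) : ℝ≥0∞) * N φ =
        ENNReal.ofReal (B₁ cH θ) * (CL * N φ) := by
      rw [ENNReal.coe_mul, ENNReal.ofReal]; ring
    rw [hcoe]
    rcases le_or_gt T t with hTt | hTt
    · -- large times
      have ht0 : 0 ≤ t := hT0.trans hTt
      -- With this index, `a log k ≤ t ≤ a log (k+1) ≤ a log k + a/k`, and `e^{t/a} < k + 1 ≤ 2k`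
      -- turns `1/k` into the rate `2e^{-t/a}`.
      set k := ⌊Real.exp (t / a)⌋₊ with hkdef
      have hexp : (k₁ : ℝ) ≤ Real.exp (t / a) := by
        have h0 : (0 : ℝ) < k₁ := by exact_mod_cast hk₁pos
        rw [← Real.exp_log h0]
        apply Real.exp_le_exp.2
        rw [le_div_iff₀ ha0]
        linarith
      have hk : k₁ ≤ k := Nat.le_floor hexp
      have hk1 : (1 : ℝ) ≤ k := by exact_mod_cast hk₁pos.trans hk
      have hkpos : (0 : ℝ) < k := by linarith
      have hkle : (k : ℝ) ≤ Real.exp (t / a) := Nat.floor_le (Real.exp_pos _).le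
      have hklt : Real.exp (t / a) < k + 1 := Nat.lt_floor_add_one _
      have hinv : (1 : ℝ) / k ≤ 2 * Real.exp (-(t / a)) := by
        rw [Real.exp_neg, ← div_eq_mul_inv, div_le_div_iff₀ hkpos (Real.exp_pos _)]
        linarith
      have htk : t ∈ Icc (a * Real.log k) (a * Real.log k + a / k) := by
        constructor
        · have : Real.log k ≤ t / a := by
            rw [Real.log_le_iff_le_exp hkpos]; exact hkle
          rw [le_div_iff₀ ha0] at this
          linarith
        · have h5 : t / a ≤ Real.log (k + 1) := by
            rw [Real.le_log_iff_exp_le (by positivity)]; exact hklt.le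
          have h6 : Real.log (k + 1) ≤ Real.log k + 1 / k := by
            have : (k : ℝ) + 1 = k * (1 + 1 / k) := by field_simp
            rw [this, Real.log_mul (by positivity) (by positivity)]
            have := Real.log_le_sub_one_of_pos (show (0 : ℝ) < 1 + 1 / k by positivity)
            linarith
          have h7 : t / a ≤ Real.log k + 1 / k := h5.trans h6
          rw [div_le_iff₀ ha0] at h7
          have : (Real.log k + 1 / k) * a = a * Real.log k + a / k := by ring
          linarith
      have hτk := (le_max_left S.t₀ t₁).trans (hτ k hk)
      have h4 := hτ' k hk
      have hclose := dSum_cInt_close A hf hfΩ hΩK hq hH (hk₁1.trans hk) ha0.le hτk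
        (lt_of_le_of_lt (div_le_div_of_nonneg_left (by positivity) (by exact_mod_cast hk₁pos)
          (by exact_mod_cast hk)) hk₁2) htk
      have hvk : S.vol (a * Real.log k - 2 * A.c / k) ≤ S.vol t :=
        S.vol_mono (by linarith [htk.1])
      have hE0 : 0 < Real.exp (-δ * t) := Real.exp_pos _
      -- the first error
      have hΔ : ENNReal.ofReal (cH * ((a + 4 * A.c) / k) ^ θ *
          S.vol (a * Real.log k - 2 * A.c / k)) * eLpNorm f q S.m ≤
          ENNReal.ofReal (B₁ cH θ) * (CL * N φ) * ENNReal.ofReal (S.vol t * Real.exp (-δ * t)) := by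
        have h5 : ((a + 4 * A.c) / k) ^ θ ≤ (2 * (a + 4 * A.c)) ^ θ * Real.exp (-δ * t) := by
          calc ((a + 4 * A.c) / k) ^ θ ≤ (2 * (a + 4 * A.c) * Real.exp (-(t / a))) ^ θ := by
                gcongr
                calc (a + 4 * A.c) / k = (a + 4 * A.c) * (1 / k) := by ring
                  _ ≤ (a + 4 * A.c) * (2 * Real.exp (-(t / a))) := by gcongr
                  _ = _ := by ring
            _ = (2 * (a + 4 * A.c)) ^ θ * Real.exp (-(θ / a) * t) := by
                rw [Real.mul_rpow (by positivity) (by positivity), ← Real.exp_mul]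
                congr 2; ring
            _ ≤ _ := by gcongr
        have h6 : cH * ((a + 4 * A.c) / k) ^ θ * S.vol (a * Real.log k - 2 * A.c / k) ≤
            B₁ cH θ * (S.vol t * Real.exp (-δ * t)) := by
          calc _ ≤ |cH| * ((2 * (a + 4 * A.c)) ^ θ * Real.exp (-δ * t)) * S.vol t := by
                gcongr
                · exact (hvolt _ hτk).le
                · exact le_abs_self _
            _ = (|cH| * (2 * (a + 4 * A.c)) ^ θ) * (S.vol t * Real.exp (-δ * t)) := by ring
            _ ≤ _ := by gcongr; exact le_max_left _ _
        calc _ ≤ ENNReal.ofReal (B₁ cH θ * (S.vol t * Real.exp (-δ * t))) * (CL * N φ) := by gcongr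
          _ = _ := by rw [ENNReal.ofReal_mul (hB₁0 _ _)]; ring
      -- the second error
      have hZ : ∀ (s : ℝ) (z : ℝ≥0∞), z ≤ max (Zp u) (Zn u) →
          s ≤ a * Real.log k + (a + A.c) / k →
          z * ENNReal.ofReal (S.vol s / k) ≤ ENNReal.ofReal A₁ * max (Zp u) (Zn u) *
            ENNReal.ofReal (S.vol t * Real.exp (-δ * t)) := by
        intro s z hz hs
        have h5 : S.vol s / k ≤ A₁ * (S.vol t * Real.exp (-δ * t)) := by
          calc S.vol s / k = S.vol s * (1 / k) := by ring
            _ ≤ (C₆ * S.vol t) * (2 * Real.exp (-(t / a))) := by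
                gcongr
                exact (S.vol_mono hs).trans ((hvol k hk).trans (by gcongr))
            _ = (2 * C₆) * (S.vol t * Real.exp (-(t / a))) := by ring
            _ ≤ A₁ * (S.vol t * Real.exp (-δ * t)) := by
                gcongr
                · exact le_max_left _ _
                · have : δ * t ≤ 1 / a * t := by gcongr
                  have e : 1 / a * t = t / a := by ring
                  linarith
        calc _ ≤ max (Zp u) (Zn u) * ENNReal.ofReal (A₁ * (S.vol t * Real.exp (-δ * t))) := by gcongr
          _ = _ := by rw [ENNReal.ofReal_mul hA₁0]; ring
      constructor
      · refine hclose.1.trans ?_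
        rw [add_mul]
        gcongr
        exact (hZp' k hk u).trans (hZ _ _ (le_max_left _ _) le_rfl)
      · refine hclose.2.trans ?_
        rw [add_mul]
        gcongr
        exact (hZn' k hk u).trans (hZ _ _ (le_max_right _ _) (by linarith))
    · -- bounded times
      have h4 := hτ' k₁ le_rfl
      have hT1 : S.t₀ ≤ T := by
        have := (le_max_left S.t₀ t₁).trans (hτ k₁ le_rfl)
        linarith
      have hcr := dSum_cInt_le A hf hfΩ hΩK hk₁1 (τ := T) (α := a / k₁) (M := Mv) (u := u) h4.2.1.le hT1
        (fun v hv => hCv _ (by linarith) u (hΩ₁K hu) v hv)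
      have e1 : T + a / k₁ + A.c / k₁ = T + (a + A.c) / k₁ := by rw [h4.2.2.2.1]; ring
      rw [e1] at hcr
      -- For `t < T` the target `ρ(H_t) e^{-δt}` is bounded below by a positive constant, so the
      -- crude bounds at the single time `T` are enough by monotonicity.
      have hlow : Real.exp (-(T / a)) * S.vol S.t₀ ≤ S.vol t * Real.exp (-δ * t) := by
        rw [mul_comm]
        gcongr
        · exact S.vol_mono ht
        · have h5 : δ * t ≤ δ * T := by gcongr
          have h6 : δ * T ≤ 1 / a * T := by gcongr
          have e : 1 / a * T = T / a := by ring
          linarith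
      have h7 : ∀ x : ℝ, 0 ≤ x → x ≤ x / S.vol S.t₀ * Real.exp (T / a) *
          (S.vol t * Real.exp (-δ * t)) := by
        intro x hx
        calc x = x / S.vol S.t₀ * Real.exp (T / a) * (Real.exp (-(T / a)) * S.vol S.t₀) := by
              have : Real.exp (T / a) * Real.exp (-(T / a)) = 1 := by
                rw [← Real.exp_add]; simp
              field_simp
              linear_combination -x * this
          _ ≤ _ := by gcongr
      have hmainb : ENNReal.ofReal Mv * ∫⁻ g, fe g ∂S.m ≤ ENNReal.ofReal (B₁ cH θ) * (CL * N φ) *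
          ENNReal.ofReal (S.vol t * Real.exp (-δ * t)) := by
        have h8 : |Mv| * Cf ≤ B₁ cH θ * (S.vol t * Real.exp (-δ * t)) := by
          refine (h7 _ (by positivity)).trans ?_
          gcongr
          exact le_max_right _ _
        calc _ ≤ ENNReal.ofReal |Mv| * (Cf * (CL * N φ)) := by
              gcongr
              · exact le_abs_self _
              · exact (hCf f hf hfΩ).trans (by gcongr)
          _ = ENNReal.ofReal (|Mv| * Cf) * (CL * N φ) := by
              rw [ENNReal.ofReal_mul (abs_nonneg _), ENNReal.ofReal_coe_nnreal]; ring
          _ ≤ ENNReal.ofReal (B₁ cH θ * (S.vol t * Real.exp (-δ * t))) * (CL * N φ) := by gcongr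
          _ = _ := by rw [ENNReal.ofReal_mul (hB₁0 _ _)]; ring
      constructor
      · refine (dSum_mono hTt.le _ _).trans (hcr.1.trans ?_)
        refine le_trans ?_ le_add_self
        rw [add_mul]
        gcongr
        refine (hZp' k₁ le_rfl u).trans ?_
        have hk₁' : (1 : ℝ) ≤ k₁ := by exact_mod_cast hk₁pos
        have hv' : 0 ≤ S.vol (T + (a + A.c) / k₁) := by rw [vol_eq]; exact S.skewVol_nonneg _ _ _
        have h9 : S.vol (T + (a + A.c) / k₁) / k₁ ≤ A₁ * (S.vol t * Real.exp (-δ * t)) := by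
          refine (div_le_self hv' hk₁').trans ((h7 _ hv').trans ?_)
          gcongr
          exact le_max_right _ _
        calc _ ≤ max (Zp u) (Zn u) * ENNReal.ofReal (A₁ * (S.vol t * Real.exp (-δ * t))) := by
              gcongr
              exact le_max_left _ _
          _ = _ := by rw [ENNReal.ofReal_mul hA₁0]; ring
      · refine (cInt_mono hTt.le _ _).trans (hcr.2.trans ?_)
        refine le_trans ?_ le_add_self
        rw [add_mul]
        exact hmainb.trans le_self_add

end PointwiseBound

end DualitySetting

namespace DualitySetting

/-! ### Passing between functions on `G` and averages on `X`. -/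

section Transfer

variable {G : Type*} [Group G] [TopologicalSpace G] [MeasurableSpace G] {S : DualitySetting G}

lemma projX_coe_mul (h : S.H) (g : G) : S.projX (h * g) = S.projX g := by
  refine Quotient.sound ?_
  change QuotientGroup.rightRel S.H _ _
  rw [QuotientGroup.rightRel_apply]
  simp [mul_assoc]

lemma projX_s (x : S.X) : S.projX (S.s x) = x := S.proj_s x

lemma projX_eq_iff {g g' : G} : S.projX g = S.projX g' ↔ g' * g⁻¹ ∈ S.H := by
  exact (Quotient.eq (r := QuotientGroup.rightRel S.H)).trans QuotientGroup.rightRel_apply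

lemma projX_surjective : Function.Surjective S.projX := fun x => ⟨S.s x, projX_s x⟩

lemma continuous_projX : Continuous S.projX := continuous_quotient_mk'

variable [IsTopologicalGroup G]

lemma isOpenMap_projX : IsOpenMap S.projX := by
  intro U hU
  refine isOpen_coinduced.2 ?_
  have : S.projX ⁻¹' (S.projX '' U) = ⋃ h : S.H, (fun g => (h : G) * g) ⁻¹' U := by
    ext g
    simp only [mem_preimage, mem_image, mem_iUnion]
    constructor
    · rintro ⟨g', hg', h⟩
      refine ⟨⟨g' * g⁻¹, ?_⟩, by simpa using hg'⟩
      exact projX_eq_iff.1 h.symm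
    · rintro ⟨h, hh⟩
      exact ⟨_, hh, projX_coe_mul h g⟩
  change IsOpen (S.projX ⁻¹' (S.projX '' U))
  rw [this]
  exact isOpen_iUnion fun h => hU.preimage (continuous_const_mul _)

instance [T2Space G] : T2Space (RightQuotient S.H) := by
  have hq : IsOpenQuotientMap S.projX := ⟨projX_surjective, continuous_projX, isOpenMap_projX⟩
  rw [t2Space_iff_of_isOpenQuotientMap hq]
  have : {q : G × G | S.projX q.1 = S.projX q.2} = (fun q : G × G => q.2 * q.1⁻¹) ⁻¹' S.H := by
    ext q
    exact projX_eq_iff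
  rw [this]
  exact S.isClosed_H.preimage (by fun_prop)

variable [T2Space G] [LocallyCompactSpace G] [SecondCountableTopology G] [BorelSpace G]

lemma measurable_projX : Measurable S.projX := continuous_projX.measurable

lemma measurable_coe_mul_s : Measurable fun z : S.X × S.H => (z.2 : G) * S.s z.1 :=
  (measurable_subtype_coe.comp measurable_snd).mul (S.measurable_s.comp measurable_fst)

/-- The decomposition of `m` along the section, applied to a null Borel set, says that almost every
fibre meets it in a null set. -/
lemma ae_ae_coe_mul_s {P : G → Prop} (h : ∀ᵐ u ∂S.m, P u) :
    ∀ᵐ x ∂S.ξ, ∀ᵐ h ∂S.ρ, P ((h : S.H) * S.s x) := by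
  obtain ⟨Z, hZ, hZm, hZ0⟩ := exists_measurable_superset_of_null (ae_iff.1 h)
  have h1 := S.decomposition (Z.indicator 1) (measurable_one.indicator hZm)
  have hm : Measurable fun z : S.X × S.H => Z.indicator (1 : G → ℝ≥0∞) ((z.2 : G) * S.s z.1) :=
    (measurable_one.indicator hZm).comp measurable_coe_mul_s
  rw [lintegral_indicator_one hZm, hZ0, eq_comm, lintegral_eq_zero_iff hm.lintegral_prod_right'] at h1
  filter_upwards [h1] with x hx
  filter_upwards [(lintegral_eq_zero_iff (hm.comp measurable_prodMk_left)).1 hx] with h hh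
  by_contra hP
  have : (h : G) * S.s x ∈ Z := hZ hP
  simp [this] at hh

/-- Individual cosets may be null, so equality almost everywhere must be averaged: Fubini on `G ×
H`, with `m` invariant under each left translation by `h`. -/
lemma cosetInt_congr_ae {f f' : G → ℝ≥0∞} (h : f =ᵐ[S.m] f') :
    S.cosetInt f =ᵐ[S.m] S.cosetInt f' := by
  obtain ⟨Z, hZ, hZm, hZ0⟩ := exists_measurable_superset_of_null (ae_iff.1 h)
  have hm : Measurable fun z : G × S.H => Z.indicator (1 : G → ℝ≥0∞) ((z.2 : G)⁻¹ * z.1) :=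
    (measurable_one.indicator hZm).comp (by fun_prop)
  have h1 : ∫⁻ g, ∫⁻ h : S.H, Z.indicator (1 : G → ℝ≥0∞) ((h : G)⁻¹ * g) ∂S.ρ ∂S.m = 0 := by
    rw [lintegral_lintegral_swap hm.aemeasurable]
    have : ∀ h : S.H, ∫⁻ g, Z.indicator (1 : G → ℝ≥0∞) ((h : G)⁻¹ * g) ∂S.m = 0 := fun h => by
      rw [lintegral_mul_left_eq_self (μ := S.m) (Z.indicator (1 : G → ℝ≥0∞)) (h : G)⁻¹,
        lintegral_indicator_one hZm, hZ0]
    simp [this]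
  rw [lintegral_eq_zero_iff hm.lintegral_prod_right'] at h1
  filter_upwards [h1] with g hg
  unfold cosetInt
  refine lintegral_congr_ae ?_
  filter_upwards [(lintegral_eq_zero_iff (hm.comp measurable_prodMk_left)).1 hg] with h hh
  by_contra hP
  have : (h : G)⁻¹ * g ∈ Z := hZ hP
  simp [this] at hh

lemma ae_forall_mul_lattice {P : G → Prop} (h : ∀ᵐ u ∂S.m, P u) :
    ∀ᵐ u ∂S.m, ∀ γ : S.Γ, P (u * γ) := by
  rw [ae_all_iff]
  intro γ
  have h0 := (measure_mul_right_null S.m (s := {u | ¬ P u}) (γ : G)).2 (ae_iff.1 h)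
  exact ae_iff.2 h0

/-- The lattice sum samples the coset integrals on the orbit `uΓ`, so equality with `φ` is needed at
every point of that orbit; countability of `Γ` provides this for almost every `u`. -/
lemma dSum_eq_ofReal {φ : S.X → ℝ} (hφ : ∀ z, 0 ≤ φ z) {f : G → ℝ≥0∞} {u : G}
    (hu : ∀ γ : S.Γ, S.cosetInt f (u * γ) = ENNReal.ofReal (φ (S.projX (u * γ)))) (t : ℝ) :
    S.dSum t f u =
      ENNReal.ofReal (∑ᶠ γ ∈ (S.Γ : Set G) ∩ S.ball t, φ ((S.projX u).act γ)) := by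
  have hfin := S.finite_lattice_inter (S.isCompact_ball t)
  have e1 : ∑ᶠ γ ∈ (S.Γ : Set G) ∩ S.ball t, φ ((S.projX u).act γ) =
      ∑ᶠ γ ∈ {γ : S.Γ | (γ : G) ∈ S.ball t}, φ (S.projX (u * γ)) := by
    have himg : (S.Γ : Set G) ∩ S.ball t = (fun γ : S.Γ => (γ : G)) '' {γ : S.Γ | (γ : G) ∈ S.ball t} := by
      ext g
      simp only [mem_inter_iff, SetLike.mem_coe, mem_image, mem_ofPred_eq]
      constructor
      · rintro ⟨h1, h2⟩
        exact ⟨⟨g, h1⟩, h2, rfl⟩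
      · rintro ⟨γ, h1, rfl⟩
        exact ⟨γ.2, h1⟩
    rw [himg, finsum_mem_image Subtype.val_injective.injOn]
    rfl
  rw [e1, finsum_mem_eq_finite_toFinset_sum _ hfin, ENNReal.ofReal_sum_of_nonneg (fun _ _ => hφ _)]
  unfold dSum
  rw [tsum_eq_sum (s := hfin.toFinset)]
  · refine Finset.sum_congr rfl fun γ hγ => ?_
    have : (γ : G) ∈ S.ball t := by simpa using hγ
    simp [this, hu]
  · intro γ hγ
    have : (γ : G) ∉ S.ball t := by simpa using hγ
    simp [this]

/-- The integrand `g ↦ φ(xg)` inherits almost everywhere measurability from the Borel function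
`cosetInt f`. Finiteness of the integral is required because the Bochner integral of a nonintegrable
function is zero. -/
lemma cInt_eq_ofReal {φ : S.X → ℝ} (hφ : ∀ z, 0 ≤ φ z) {f : G → ℝ≥0∞} (hf : Measurable f)
    (hae : S.cosetInt f =ᵐ[S.m] fun g => ENNReal.ofReal (φ (S.projX g))) {t : ℝ} {u : G}
    (hfin : S.cInt t f u ≠ ⊤) :
    S.cInt t f u = ENNReal.ofReal (∫ g in S.ball t, φ ((S.projX u).act g) ∂S.m) := by
  have h1 : ∀ᵐ g ∂S.m, S.cosetInt f (u * g) = ENNReal.ofReal (φ (S.projX (u * g))) :=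
    (measurePreserving_mul_left S.m u).quasiMeasurePreserving.ae hae
  have h2 : AEMeasurable (fun g => φ ((S.projX u).act g)) (S.m.restrict (S.ball t)) := by
    have hm := S.measurable_cosetInt hf
    refine ⟨fun g => (S.cosetInt f (u * g)).toReal, by fun_prop, ?_⟩
    filter_upwards [ae_restrict_of_ae h1] with g hg
    rw [hg, ENNReal.toReal_ofReal (hφ _)]; rfl
  rw [integral_eq_lintegral_of_nonneg_ae (ae_of_all _ fun _ => hφ _) h2.aestronglyMeasurable]
  have h3 : ∫⁻ g in S.ball t, ENNReal.ofReal (φ ((S.projX u).act g)) ∂S.m = S.cInt t f u := by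
    unfold cInt
    refine lintegral_congr_ae ?_
    filter_upwards [ae_restrict_of_ae h1] with g hg
    rw [hg]; rfl
  rw [h3, ENNReal.ofReal_toReal hfin]

lemma ofReal_abs_avg_sub_le {φ : S.X → ℝ} (hφ : ∀ z, 0 ≤ φ z) {f : G → ℝ≥0∞} (hf : Measurable f)
    (hae : S.cosetInt f =ᵐ[S.m] fun g => ENNReal.ofReal (φ (S.projX g))) {t : ℝ} {u : G}
    (hu : ∀ γ : S.Γ, S.cosetInt f (u * γ) = ENNReal.ofReal (φ (S.projX (u * γ))))
    (hfin : S.cInt t f u ≠ ⊤) (hvol : 0 < S.vol t) {E : ℝ≥0∞} {r : ℝ} (hr : 0 < r)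
    (h1 : S.dSum t f u ≤ S.cInt t f u + E * ENNReal.ofReal (S.vol t * r))
    (h2 : S.cInt t f u ≤ S.dSum t f u + E * ENNReal.ofReal (S.vol t * r)) :
    ENNReal.ofReal |S.discreteAvg t φ (S.projX u) - S.continuousAvg t φ (S.projX u)| ≤
      E * ENNReal.ofReal r := by
  rcases eq_or_ne E ⊤ with rfl | hE
  · rw [ENNReal.top_mul (by simpa using hr)]; exact le_top
  rw [cInt_eq_ofReal hφ hf hae hfin, dSum_eq_ofReal hφ hu, ← ENNReal.ofReal_toReal hE,
    ← ENNReal.ofReal_mul ENNReal.toReal_nonneg] at h1 h2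
  rw [← ENNReal.ofReal_toReal hE, ← ENNReal.ofReal_mul ENNReal.toReal_nonneg]
  have hd : 0 ≤ ∑ᶠ γ ∈ (S.Γ : Set G) ∩ S.ball t, φ ((S.projX u).act γ) :=
    finsum_nonneg fun _ => finsum_nonneg fun _ => hφ _
  have hc : 0 ≤ ∫ g in S.ball t, φ ((S.projX u).act g) ∂S.m := integral_nonneg fun _ => hφ _
  have he : 0 ≤ E.toReal * (S.vol t * r) := by positivity
  rw [← ENNReal.ofReal_add hc he, ENNReal.ofReal_le_ofReal_iff (by positivity)] at h1
  rw [← ENNReal.ofReal_add hd he, ENNReal.ofReal_le_ofReal_iff (by positivity)] at h2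
  refine ENNReal.ofReal_le_ofReal ?_
  unfold discreteAvg continuousAvg
  rw [← mul_sub, abs_mul, abs_of_pos (inv_pos.2 hvol), inv_mul_le_iff₀ hvol, abs_le]
  constructor <;> linarith

/-- The functions in the cones on `X` have lifts to `G` with controlled periodizations. -/
def Liftable (S : DualitySetting G) (A : S.WeightFamily) (q : ℝ≥0∞)
    (NY : Set S.Y → ((S.Y → ℝ) → ℝ≥0∞) → Prop) (NX : Set S.X → ((S.X → ℝ) → ℝ≥0∞) → Prop) : Prop :=
  ∀ D, IsCompact D → ∀ N, NX D N → ∃ (Ω : Set G) (lift : (S.X → ℝ) → G → ℝ) (C : ℝ≥0),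
    IsCompact Ω ∧ IsLift S q (PositiveCone S.ξ D N) N Ω lift C ∧
    ∀ B, IsCompactDomain S.μ B → S.projY '' Ω ⊆ B → ∀ N', NY B N' → ∀ K, IsCompact K →
      ∃ C', LiftControl A (PositiveCone S.ξ D N) N lift N' K C'

/-- The Fubini arguments want a Borel function, whereas the norm control concerns the lift itself.
Changing the lift on a null set disturbs the coset integrals only above a null set of `G`. -/
lemma exists_borel_lift {q : ℝ≥0∞} {cone : Set (S.X → ℝ)} {N : (S.X → ℝ) → ℝ≥0∞} {Ω : Set G}
    (hΩ : IsCompact Ω) {lift : (S.X → ℝ) → G → ℝ} {C : ℝ≥0} (hL : IsLift S q cone N Ω lift C)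
    {φ : S.X → ℝ} (hφ : φ ∈ cone) :
    ∃ f : G → ℝ, Measurable f ∧ f =ᵐ[S.m] lift φ ∧ (∀ g, g ∉ Ω → f g = 0) ∧
      S.cosetInt (fun g => ‖f g‖ₑ) =ᵐ[S.m] fun g => ENNReal.ofReal (φ (S.projX g)) := by
  have hm := hL.aestronglyMeasurable φ hφ
  have hff : Ω.indicator (hm.mk _) =ᵐ[S.m] lift φ := by
    filter_upwards [hm.ae_eq_mk] with g hg
    by_cases h : g ∈ Ω
    · simp [h, hg]
    · simp [h, hL.eq_zero φ hφ g h]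
  refine ⟨Ω.indicator (hm.mk _), hm.stronglyMeasurable_mk.measurable.indicator hΩ.measurableSet,
    hff, fun g hg => by simp [hg], ?_⟩
  refine (cosetInt_congr_ae (ofReal_lift_ae_eq hL hφ hff)).trans (ae_of_all _ fun g => ?_)
  exact hL.cosetInt_eq φ hφ g

lemma exists_compact_nhd_one :
    ∃ W : Set S.H, IsCompact W ∧ W ∈ 𝓝 1 ∧ W⁻¹ = W := by
  obtain ⟨W, hW, hWc⟩ := exists_compact_mem_nhds (1 : S.H)
  refine ⟨W ∩ W⁻¹, hW.inter hW.inv, Filter.inter_mem hWc ?_, by simp [Set.inter_comm]⟩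
  have := inv_mem_nhds_one S.H hWc
  exact this

lemma isCompact_coe_mul_closure {W : Set S.H} (hW : IsCompact W) {D : Set S.X} (hD : IsCompact D) :
    IsCompact ((fun h : S.H => (h : G)) '' W * closure (S.s '' D)) :=
  (hW.image continuous_subtype_val).mul (S.bounded_s D hD)

lemma coe_mul_s_mem {W : Set S.H} {D : Set S.X} {h : S.H} (hh : h ∈ W) {x : S.X} (hx : x ∈ D) :
    (h : G) * S.s x ∈ (fun h : S.H => (h : G)) '' W * closure (S.s '' D) :=
  Set.mul_mem_mul ⟨h, hh, rfl⟩ (subset_closure ⟨x, hx, rfl⟩)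

/-- Integration over `W s(D)`. -/
lemma lintegral_lintegral_coe_mul_s_le {W : Set S.H} (hW : IsCompact W) {D : Set S.X}
    (hD : IsCompact D) {F : G → ℝ≥0∞} (hF : Measurable F) :
    ∫⁻ x in D, ∫⁻ h in W, F (h * S.s x) ∂S.ρ ∂S.ξ ≤
      ∫⁻ u in (fun h : S.H => (h : G)) '' W * closure (S.s '' D), F u ∂S.m := by
  have hΩ := isCompact_coe_mul_closure hW hD
  rw [← lintegral_indicator hΩ.measurableSet, S.decomposition _ (hF.indicator hΩ.measurableSet),
    ← lintegral_indicator hD.measurableSet]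
  refine lintegral_mono fun x => ?_
  by_cases hx : x ∈ D
  · rw [indicator_of_mem hx, ← lintegral_indicator hW.measurableSet]
    refine lintegral_mono fun h => ?_
    by_cases hh : h ∈ W
    · rw [indicator_of_mem hh, indicator_of_mem (coe_mul_s_mem hh hx)]
    · simp [hh]
  · simp [hx]

/-- The tube `W s(D)` lies in a compact set, so it has finite Haar measure, and its mass controls
`ρ(W) ξ(D)` with `ρ(W) > 0`. -/
lemma measure_compact_X_lt_top {D : Set S.X} (hD : IsCompact D) : S.ξ D < ⊤ := by
  obtain ⟨W, hW, hWn, -⟩ := exists_compact_nhd_one (S := S)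
  have h := lintegral_lintegral_coe_mul_s_le (S := S) hW hD (F := 1) measurable_one
  simp only [Pi.one_apply, lintegral_const, Measure.restrict_apply_univ, one_mul] at h
  have h2 := h.trans_lt (isCompact_coe_mul_closure hW hD).measure_lt_top
  have h3 : S.ρ W ≠ 0 := (Measure.measure_pos_of_mem_nhds S.ρ hWn).ne'
  by_contra hcon
  rw [not_lt, top_le_iff] at hcon
  rw [hcon, ENNReal.mul_top h3] at h2
  exact lt_irrefl _ h2

end Transfer

end DualitySetting

namespace DualitySetting

/-! ### The two conclusions, from liftability. -/

section Conclusion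

variable {G : Type*} [Group G] [TopologicalSpace G] [MeasurableSpace G] {S : DualitySetting G}
variable [IsTopologicalGroup G] [T2Space G] [LocallyCompactSpace G] [SecondCountableTopology G]
  [BorelSpace G]

/-- The comparison of the averages on `X`, at almost every point and with a superposition parameter
`h` in a neighbourhood `W` of the identity of `H`. -/
theorem exists_avg_bound (A : S.WeightFamily) (h1 : S.CA1) (h2 : S.CA2) {p q : ℝ≥0∞}
    (hp : 1 ≤ p) (hpt : p ≠ ⊤) (hq : 1 < q) {σ a : ℝ} (hσ : 0 < σ) (ha : 2 * A.κ + 3 ≤ a * σ)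
    {Ω Ω₁ : Set G} (hΩ : IsCompact Ω) (hΩ₁ : IsCompact Ω₁) {B : Set S.Y}
    (hBΩ : S.projY '' Ω ⊆ B) (hBΩ₁ : S.projY '' Ω₁ ⊆ B) {N' : (S.Y → ℝ) → ℝ≥0∞} {Cm t₁ : ℝ}
    (hmean : ∀ g₁ ∈ (Ω ∪ Ω₁) * A.K₀, ∀ g₂ ∈ (Ω ∪ Ω₁) * A.K₀, ∀ F ∈ PositiveCone S.μ B N', ∀ t ≥ t₁,
      eLpNorm (fun y => S.betaAvg t g₁ g₂ F y - ∫ z, F z ∂S.μ) p (S.μ.restrict B) ≤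
        ENNReal.ofReal (Cm * Real.exp (-σ * t)) * N' F)
    {D : Set S.X} (hD : IsCompact D) {W : Set S.H} (hW : IsCompact W)
    (hΩ₁W : Ω₁ = (fun h : S.H => (h : G)) '' W * closure (S.s '' D))
    {N : (S.X → ℝ) → ℝ≥0∞} {lift : (S.X → ℝ) → G → ℝ} {CL C' : ℝ≥0}
    (hL : IsLift S q (PositiveCone S.ξ D N) N Ω lift CL)
    (hC' : LiftControl A (PositiveCone S.ξ D N) N lift N' ((Ω ∪ Ω₁) * A.K₀) C') :
    ∃ C₂ : ℝ≥0, ∃ C₁ : ℝ → ℝ → ℝ≥0, ∀ φ ∈ PositiveCone S.ξ D N, ∃ Z : G → ℝ≥0∞, Measurable Z ∧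
        ∫⁻ x in D, ∫⁻ h in W, Z (((h : S.H) : G) * S.s x) ^ p.toReal ∂S.ρ ∂S.ξ ≤ (C₂ * N φ) ^ p.toReal ∧
        ∀ᵐ x ∂(S.ξ.restrict D), ∀ᵐ h ∂(S.ρ.restrict W), Z (((h : S.H) : G) * S.s x) ≠ ⊤ ∧ ∀ θ > 0, ∀ cH,
          S.HolderAt (1 - q⁻¹)⁻¹ (h * S.s x) ((Ω ∪ Ω₁) * A.K₀) cH θ → ∀ t ≥ S.t₀,
          ENNReal.ofReal |S.discreteAvg t φ x - S.continuousAvg t φ x| ≤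
            (C₁ cH θ * N φ + Z (h * S.s x)) * ENNReal.ofReal (Real.exp (-(min θ 1 / a) * t)) := by
  obtain ⟨C₂, C₁, hC⟩ := exists_pointwise_bound A h1 h2 hp hpt hq hσ ha hΩ hΩ₁ hBΩ hBΩ₁ hmean hL hC'
  refine ⟨C₂, C₁, fun φ hφ => ?_⟩
  obtain ⟨f, hf, hff, hfΩ, hae⟩ := exists_borel_lift hΩ hL hφ
  obtain ⟨Z, hZm, hZ, hmain⟩ := hC φ hφ f hf hff hfΩ
  have hp1 : 0 < p.toReal := ENNReal.toReal_pos (by positivity) hpt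
  refine ⟨Z, hZm, ?_, ?_⟩
  · refine (lintegral_lintegral_coe_mul_s_le hW hD (hZm.pow_const _)).trans ?_
    rw [← hΩ₁W]; exact hZ
  · have hfin : ∀ᵐ u ∂(S.m.restrict Ω₁), Z u ≠ ⊤ := by
      have : ∫⁻ u in Ω₁, Z u ^ p.toReal ∂S.m ≠ ⊤ := ne_top_of_le_ne_top
        (ENNReal.rpow_ne_top_of_nonneg hp1.le (ENNReal.mul_ne_top ENNReal.coe_ne_top hφ.2.2.2)) hZ
      filter_upwards [ae_lt_top (hZm.pow_const _) this] with u hu h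
      simp [h, hp1] at hu
    rw [ae_restrict_iff' hΩ₁.measurableSet] at hfin
    -- The exceptional set of `u` is fixed here once and for all; it depends neither on `t` nor on
    -- the Hölder data.
    have h3 := ae_ae_coe_mul_s ((ae_forall_mul_lattice hae).and hfin)
    filter_upwards [ae_restrict_of_ae h3, ae_restrict_mem hD.measurableSet] with x hx hxD
    filter_upwards [ae_restrict_of_ae hx, ae_restrict_mem hW.measurableSet] with h hh hhW
    have hmem : (h : G) * S.s x ∈ Ω₁ := by rw [hΩ₁W]; exact coe_mul_s_mem hhW hxD
    have hproj : S.projX (h * S.s x) = x := by rw [projX_coe_mul, projX_s]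
    refine ⟨hh.2 hmem, fun θ hθ cH hH t ht => ?_⟩
    obtain ⟨h4, h5, h6⟩ := hmain _ hmem θ hθ cH hH t ht
    have := ofReal_abs_avg_sub_le hφ.2.1 hf.enorm hae hh.1 h4 (h2.1 t ht) (Real.exp_pos _) h5 h6
    rwa [hproj] at this

/-- Above almost every `x` a good point `h s(x)` exists because `ρ(W) > 0`. Hölder admissibility is
then invoked at this one point `u = h s(x)`, and so its exponent may depend on `x`. -/
theorem pointwiseClose_of_liftable (A : S.WeightFamily) (h1 : S.CA1) (h2 : S.CA2) {p q : ℝ≥0∞}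
    (hp : 1 ≤ p) (hpq : p < q) {NY : Set S.Y → ((S.Y → ℝ) → ℝ≥0∞) → Prop}
    {NX : Set S.X → ((S.X → ℝ) → ℝ≥0∞) → Prop} (hLift : Liftable S A q NY NX)
    (hH : S.HA2 (1 - q⁻¹)⁻¹) (hE : S.ExpMeanErgodic p NY) : S.PointwiseClose NX := by
  intro D hD N hN φ hφ
  obtain ⟨Ω, lift, CL, hΩ, hL, hB⟩ := hLift D hD N hN
  obtain ⟨W, hW, hWn, -⟩ := exists_compact_nhd_one (S := S)
  set Ω₁ := (fun h : S.H => (h : G)) '' W * closure (S.s '' D) with hΩ₁d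
  have hΩ₁ : IsCompact Ω₁ := isCompact_coe_mul_closure hW hD
  obtain ⟨B, hBd, hBs⟩ := S.exists_isCompactDomain (hΩ.union hΩ₁)
  rw [image_union, union_subset_iff] at hBs
  have hK : IsCompact ((Ω ∪ Ω₁) * A.K₀) := (hΩ.union hΩ₁).mul A.isCompact_K₀
  obtain ⟨σ, hσ, N', hN', Cm, t₁, hmean⟩ := hE _ hK B hBd
  obtain ⟨C', hC'⟩ := hB B hBd hBs.1 N' hN' _ hK
  have hκ := A.κ_nonneg
  obtain ⟨C₂, C₁, hC⟩ := exists_avg_bound A h1 h2 hp hpq.ne_top (hp.trans_lt hpq) hσ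
    (a := (2 * A.κ + 3) / σ) (by rw [div_mul_cancel₀ _ hσ.ne']) hΩ hΩ₁ hBs.1 hBs.2 hmean hD hW rfl
    hL hC'
  obtain ⟨Z, -, -, hZ⟩ := hC φ hφ
  filter_upwards [hZ] with x hx
  have : (ae (S.ρ.restrict W)).NeBot := by
    rw [ae_neBot, Ne, Measure.restrict_eq_zero]
    exact (Measure.measure_pos_of_mem_nhds S.ρ hWn).ne'
  obtain ⟨h, hfin, hh⟩ := hx.exists
  obtain ⟨c, -, θ, hθ, hHold⟩ := hH (h * S.s x) _ hK
  refine ⟨min θ 1 / ((2 * A.κ + 3) / σ), by positivity,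
    (C₁ c θ * N φ + Z (h * S.s x)).toReal, fun t ht => ?_⟩
  have h5 := hh θ hθ c hHold t ht
  have hE : C₁ c θ * N φ + Z (h * S.s x) ≠ ⊤ :=
    ENNReal.add_ne_top.2 ⟨ENNReal.mul_ne_top ENNReal.coe_ne_top hφ.2.2.2, hfin⟩
  rw [← ENNReal.ofReal_toReal hE, ← ENNReal.ofReal_mul ENNReal.toReal_nonneg,
    ENNReal.ofReal_le_ofReal_iff (by positivity)] at h5
  exact h5

/-- A single `h` would give no norm bound in `x`. The left side of the estimate does not depend on
`h`, so the estimate can be averaged in the `p`-th power over `h ∈ W`, and the `L^p` bound on `G`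
descends to `D`. Uniform Hölder admissibility supplies one constant for all `u = h s(x)`. -/
theorem uniformlyClose_of_liftable (A : S.WeightFamily) (h1 : S.CA1) (h2 : S.CA2) {p q : ℝ≥0∞}
    (hp : 1 ≤ p) (hpq : p < q) {NY : Set S.Y → ((S.Y → ℝ) → ℝ≥0∞) → Prop}
    {NX : Set S.X → ((S.X → ℝ) → ℝ≥0∞) → Prop} (hLift : Liftable S A q NY NX)
    (hH : S.HA2Uniform (1 - q⁻¹)⁻¹) (hE : S.ExpMeanErgodicUniform p NY) :
    S.UniformlyClose p NX := by
  obtain ⟨σ, hσ, hE⟩ := hE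
  obtain ⟨θ, hθ, hH⟩ := hH
  have hκ := A.κ_nonneg
  have hpt : p ≠ ⊤ := hpq.ne_top
  have hp0 : 0 < p.toReal := ENNReal.toReal_pos (by positivity) hpt
  have hp00 : p ≠ 0 := (zero_lt_one.trans_le hp).ne'
  refine ⟨min θ 1 / ((2 * A.κ + 3) / σ), by positivity, fun D hD N hN => ?_⟩
  obtain ⟨Ω, lift, CL, hΩ, hL, hB⟩ := hLift D hD N hN
  obtain ⟨W, hW, hWn, -⟩ := exists_compact_nhd_one (S := S)
  have hρ0 : S.ρ W ≠ 0 := (Measure.measure_pos_of_mem_nhds S.ρ hWn).ne'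
  have hρt : S.ρ W ≠ ⊤ := hW.measure_lt_top.ne
  set Ω₁ := (fun h : S.H => (h : G)) '' W * closure (S.s '' D) with hΩ₁d
  have hΩ₁ : IsCompact Ω₁ := isCompact_coe_mul_closure hW hD
  obtain ⟨B, hBd, hBs⟩ := S.exists_isCompactDomain (hΩ.union hΩ₁)
  rw [image_union, union_subset_iff] at hBs
  have hK : IsCompact ((Ω ∪ Ω₁) * A.K₀) := (hΩ.union hΩ₁).mul A.isCompact_K₀
  obtain ⟨N', hN', Cm, t₁, hmean⟩ := hE _ hK B hBd
  obtain ⟨C', hC'⟩ := hB B hBd hBs.1 N' hN' _ hK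
  obtain ⟨C₂, C₁, hC⟩ := exists_avg_bound A h1 h2 hp hpt (hp.trans_lt hpq) hσ
    (a := (2 * A.κ + 3) / σ) (by rw [div_mul_cancel₀ _ hσ.ne']) hΩ hΩ₁ hBs.1 hBs.2 hmean hD hW rfl
    hL hC'
  obtain ⟨c, -, hHold⟩ := hH Ω₁ _ hΩ₁ hK
  have hξ : S.ξ D ≠ ⊤ := (measure_compact_X_lt_top hD).ne
  have hξ' : S.ξ D ^ (1 / p.toReal) ≠ ⊤ := ENNReal.rpow_ne_top_of_nonneg (by positivity) hξ
  have hρ' : (S.ρ W)⁻¹ ^ (1 / p.toReal) ≠ ⊤ :=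
    ENNReal.rpow_ne_top_of_nonneg (by positivity) (ENNReal.inv_ne_top.2 hρ0)
  refine ⟨C₁ c θ * (S.ξ D ^ (1 / p.toReal)).toNNReal + ((S.ρ W)⁻¹ ^ (1 / p.toReal)).toNNReal * C₂,
    fun φ hφ => ?_⟩
  obtain ⟨Z, hZm, hZp, hZ⟩ := hC φ hφ
  have hNφ : N φ ≠ ⊤ := hφ.2.2.2
  -- `V` is the fibre mean of `Z ^ p`. The required function is `C(φ, x) = e₁ + V(x)^{1/p}`, with
  -- the Hölder contribution in the constant `e₁`.
  set V : S.X → ℝ≥0∞ := fun x => (S.ρ W)⁻¹ * ∫⁻ h in W, Z (((h : S.H) : G) * S.s x) ^ p.toReal ∂S.ρ with hV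
  have hVm : Measurable V := by
    have := ((hZm.comp (measurable_coe_mul_s (S := S))).pow_const p.toReal).lintegral_prod_right'
      (ν := S.ρ.restrict W)
    exact this.const_mul _
  have hVint : ∫⁻ x in D, V x ∂S.ξ ≤ (S.ρ W)⁻¹ * (C₂ * N φ) ^ p.toReal := by
    rw [hV, lintegral_const_mul' _ _ (ENNReal.inv_ne_top.2 hρ0)]
    gcongr
  have hVfin : ∀ᵐ x ∂(S.ξ.restrict D), V x < ⊤ := by
    refine ae_lt_top hVm (ne_top_of_le_ne_top ?_ hVint)
    exact ENNReal.mul_ne_top (ENNReal.inv_ne_top.2 hρ0) (ENNReal.rpow_ne_top_of_nonneg hp0.le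
      (ENNReal.mul_ne_top ENNReal.coe_ne_top hNφ))
  set e₁ : ℝ := (C₁ c θ * N φ).toReal with he₁
  set g : S.X → ℝ := fun x => (V x ^ (1 / p.toReal)).toReal with hg
  have hgm : Measurable g := (hVm.pow_const _).ennreal_toReal
  have hnorm : eLpNorm (fun x => e₁ + g x) p (S.ξ.restrict D) ≤
      ((C₁ c θ * (S.ξ D ^ (1 / p.toReal)).toNNReal +
        ((S.ρ W)⁻¹ ^ (1 / p.toReal)).toNNReal * C₂ : ℝ≥0) : ℝ≥0∞) * N φ := by
    refine (eLpNorm_add_le (f := fun _ => e₁) (g := g) aestronglyMeasurable_const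
      hgm.aestronglyMeasurable hp).trans ?_
    rw [ENNReal.coe_add, ENNReal.coe_mul, ENNReal.coe_mul, ENNReal.coe_toNNReal hξ',
      ENNReal.coe_toNNReal hρ', add_mul]
    gcongr
    · rw [eLpNorm_const' _ hp00 hpt, Measure.restrict_apply_univ, he₁,
        Real.enorm_eq_ofReal ENNReal.toReal_nonneg, ENNReal.ofReal_toReal
          (ENNReal.mul_ne_top ENNReal.coe_ne_top hNφ)]
      exact le_of_eq (by ring)
    · rw [eLpNorm_eq_lintegral_rpow_enorm_toReal hp00 hpt]
      calc _ ≤ (∫⁻ x in D, V x ∂S.ξ) ^ (1 / p.toReal) := by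
            gcongr with x
            rw [hg, Real.enorm_eq_ofReal ENNReal.toReal_nonneg]
            calc _ ≤ (V x ^ (1 / p.toReal)) ^ p.toReal := by
                  gcongr
                  exact ENNReal.ofReal_toReal_le
              _ = V x := by
                  rw [← ENNReal.rpow_mul, one_div, inv_mul_cancel₀ hp0.ne', ENNReal.rpow_one]
        _ ≤ ((S.ρ W)⁻¹ * (C₂ * N φ) ^ p.toReal) ^ (1 / p.toReal) := by gcongr
        _ = _ := by
            rw [ENNReal.mul_rpow_of_nonneg _ _ (by positivity), ← ENNReal.rpow_mul, one_div,
              mul_inv_cancel₀ hp0.ne', ENNReal.rpow_one, mul_assoc]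
  refine ⟨fun x => e₁ + g x, ⟨(hgm.const_add _).aestronglyMeasurable, hnorm.trans_lt ?_⟩, hnorm, ?_⟩
  · exact (ENNReal.mul_ne_top ENNReal.coe_ne_top hNφ).lt_top
  filter_upwards [hZ, hVfin, ae_restrict_mem hD.measurableSet] with x hx hxV hxD t ht
  set δ := min θ 1 / ((2 * A.κ + 3) / σ) with hδ
  set d := |S.discreteAvg t φ x - S.continuousAvg t φ x| with hd
  have hexp : Real.exp (-δ * t) * Real.exp (δ * t) = 1 := by rw [← Real.exp_add]; simp
  -- Truncated subtraction isolates a quantity that is constant in `h` and lies below `Z(h s(x))`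
  -- for almost every `h`, hence below the mean over `W`.
  have key : (ENNReal.ofReal (d * Real.exp (δ * t)) - C₁ c θ * N φ) ^ p.toReal ≤ V x := by
    have h6 : ∀ᵐ h ∂(S.ρ.restrict W), (ENNReal.ofReal (d * Real.exp (δ * t)) - C₁ c θ * N φ) ^ p.toReal
        ≤ Z (((h : S.H) : G) * S.s x) ^ p.toReal := by
      filter_upwards [hx, ae_restrict_mem hW.measurableSet] with h hh hhW
      have h7 := hh.2 θ hθ c (hHold _ (coe_mul_s_mem hhW hxD)) t ht
      gcongr
      rw [tsub_le_iff_left]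
      calc ENNReal.ofReal (d * Real.exp (δ * t)) =
            ENNReal.ofReal d * ENNReal.ofReal (Real.exp (δ * t)) :=
            ENNReal.ofReal_mul (abs_nonneg _)
        _ ≤ ((C₁ c θ * N φ + Z (h * S.s x)) * ENNReal.ofReal (Real.exp (-δ * t))) *
            ENNReal.ofReal (Real.exp (δ * t)) := by gcongr
        _ = _ := by
            rw [mul_assoc, ← ENNReal.ofReal_mul (Real.exp_pos _).le, hexp, ENNReal.ofReal_one,
              mul_one]
    have h8 := lintegral_mono_ae h6
    rw [lintegral_const, Measure.restrict_apply_univ] at h8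
    calc _ = (S.ρ W)⁻¹ * ((ENNReal.ofReal (d * Real.exp (δ * t)) - C₁ c θ * N φ) ^ p.toReal *
          S.ρ W) := by
          rw [mul_comm _ (S.ρ W), ← mul_assoc, ENNReal.inv_mul_cancel hρ0 hρt, one_mul]
      _ ≤ _ := mul_le_mul' le_rfl h8
  have h9 : ENNReal.ofReal (d * Real.exp (δ * t)) ≤ C₁ c θ * N φ + V x ^ (1 / p.toReal) := by
    rw [← tsub_le_iff_left]
    calc _ = ((ENNReal.ofReal (d * Real.exp (δ * t)) - C₁ c θ * N φ) ^ p.toReal) ^ (1 / p.toReal) := by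
          rw [← ENNReal.rpow_mul, one_div, mul_inv_cancel₀ hp0.ne', ENNReal.rpow_one]
      _ ≤ _ := by gcongr
  have hVx : V x ^ (1 / p.toReal) ≠ ⊤ := ENNReal.rpow_ne_top_of_nonneg (by positivity) hxV.ne
  have hCN : C₁ c θ * N φ ≠ ⊤ := ENNReal.mul_ne_top ENNReal.coe_ne_top hNφ
  have h10 : d * Real.exp (δ * t) ≤ e₁ + g x := by
    rw [he₁, hg, ← ENNReal.toReal_add hCN hVx]
    exact (ENNReal.ofReal_le_iff_le_toReal (ENNReal.add_ne_top.2 ⟨hCN, hVx⟩)).1 h9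
  calc d = d * Real.exp (δ * t) * Real.exp (-δ * t) := by rw [mul_assoc, mul_comm (Real.exp _), hexp, mul_one]
    _ ≤ _ := by gcongr

theorem conclusion_of_liftable (A : S.WeightFamily) (h1 : S.CA1) (h2 : S.CA2) {p q : ℝ≥0∞}
    (hp : 1 ≤ p) (hpq : p < q) {NY : Set S.Y → ((S.Y → ℝ) → ℝ≥0∞) → Prop}
    {NX : Set S.X → ((S.X → ℝ) → ℝ≥0∞) → Prop} (hLift : Liftable S A q NY NX) :
    S.Conclusion p q NY NX :=
  ⟨fun hH _ hE => pointwiseClose_of_liftable A h1 h2 hp hpq hLift hH hE,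
    fun hH _ hE => uniformlyClose_of_liftable A h1 h2 hp hpq hLift hH hE⟩

end Conclusion

end DualitySetting

namespace DualitySetting

/-! ### Lebesgue spaces: indicator weights and tube lifts. -/

section Lebesgue

variable {G : Type*} [Group G] [TopologicalSpace G] [MeasurableSpace G] {S : DualitySetting G}
variable [IsTopologicalGroup G] [T2Space G] [LocallyCompactSpace G] [SecondCountableTopology G]
  [BorelSpace G]

lemma periodize_le_mul_of_le {Ω : Set G} {N : ℕ} (hN : ∀ y, S.periodize (Ω.indicator 1) y ≤ N)
    {f : G → ℝ≥0∞} (hf : ∀ g, g ∉ Ω → f g = 0) {M : ℝ≥0∞} {u : G} (hM : ∀ γ : S.Γ, f (u * γ) ≤ M) :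
    S.periodize f (S.projY u) ≤ M * N := by
  calc S.periodize f (S.projY u) ≤ M * S.periodize (Ω.indicator 1) (S.projY u) := by
        rw [periodize_projY, periodize_projY, ← ENNReal.tsum_mul_left]
        refine ENNReal.tsum_le_tsum fun γ => ?_
        by_cases h : u * (γ : G) ∈ Ω
        · simpa [h] using hM γ
        · simp [h, hf _ h]
    _ ≤ M * N := by gcongr; exact hN _

/-- Periodization of functions supported in a fixed compact set is bounded on `L^q`. -/
lemma exists_eLpNorm_periodize_le {Ω : Set G} (hΩ : IsCompact Ω) {q : ℝ≥0∞} (hq : 1 ≤ q) :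
    ∃ N : ℕ, ∀ f : G → ℝ≥0∞, AEMeasurable f S.m → (∀ g, g ∉ Ω → f g = 0) →
      eLpNorm (S.periodize f) q S.μ ≤ N * eLpNorm f q S.m := by
  obtain ⟨N, hN⟩ := S.exists_periodize_indicator_bound hΩ
  refine ⟨N, fun f hf hfΩ => ?_⟩
  have hq0 : q ≠ 0 := (zero_lt_one.trans_le hq).ne'
  rcases eq_or_ne q ⊤ with rfl | hqt
  · rw [eLpNorm_exponent_top, eLpNorm_exponent_top]
    refine essSup_le_of_ae_le _ (S.ae_of_ae_projY ?_)
    have h : ∀ᵐ g ∂S.m, f g ≤ eLpNormEssSup f S.m := ae_le_eLpNormEssSup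
    filter_upwards [ae_forall_mul_lattice h] with u hu
    rw [mul_comm]
    exact periodize_le_mul_of_le hN hfΩ hu
  · have hq1 : 0 < q.toReal := ENNReal.toReal_pos hq0 hqt
    rw [eLpNorm_eq_lintegral_rpow_enorm_toReal hq0 hqt, eLpNorm_eq_lintegral_rpow_enorm_toReal hq0 hqt]
    simp only [enorm_eq_self]
    have hunf : ∫⁻ y, S.periodize (fun g => f g ^ q.toReal) y ∂S.μ = ∫⁻ g, f g ^ q.toReal ∂S.m := by
      have hae : (fun g => f g ^ q.toReal) =ᵐ[S.m] fun g => hf.mk f g ^ q.toReal := by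
        filter_upwards [hf.ae_eq_mk] with g hg
        rw [hg]
      rw [lintegral_congr_ae (S.periodize_mul_left_eq_of_ae hae), lintegral_congr_ae hae,
        S.lintegral_periodize (hf.measurable_mk.pow_const _)]
    -- At most `N` terms of the periodization are nonzero, and each is at most the `ℓ^q` norm of the
    -- orbit. Hence the `q`-th power of the sum is at most `N^q` times the periodization of `f^q`,
    -- which unfolds.
    calc (∫⁻ y, S.periodize f y ^ q.toReal ∂S.μ) ^ (1 / q.toReal)
        ≤ (∫⁻ y, (N : ℝ≥0∞) ^ q.toReal * S.periodize (fun g => f g ^ q.toReal) y ∂S.μ) ^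
          (1 / q.toReal) := by
          gcongr with y
          obtain ⟨u, rfl⟩ := S.projY_surjective y
          rw [← ENNReal.rpow_le_rpow_iff (show 0 < 1 / q.toReal by positivity), ← ENNReal.rpow_mul,
            ENNReal.mul_rpow_of_nonneg _ _ (by positivity), ← ENNReal.rpow_mul, one_div,
            mul_inv_cancel₀ hq1.ne', ENNReal.rpow_one, ENNReal.rpow_one, mul_comm]
          refine periodize_le_mul_of_le hN hfΩ fun γ => ?_
          calc f (u * γ) = (f (u * γ) ^ q.toReal) ^ (q.toReal)⁻¹ := by
                rw [← ENNReal.rpow_mul, mul_inv_cancel₀ hq1.ne', ENNReal.rpow_one]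
            _ ≤ _ := by
                gcongr
                rw [periodize_projY]
                exact ENNReal.le_tsum (f := fun γ : S.Γ => f (u * γ) ^ q.toReal) γ
      _ = N * (∫⁻ g, f g ^ q.toReal ∂S.m) ^ (1 / q.toReal) := by
          rw [lintegral_const_mul' _ _ (by finiteness), hunf,
            ENNReal.mul_rpow_of_nonneg _ _ (by positivity), ← ENNReal.rpow_mul, one_div,
            mul_inv_cancel₀ hq1.ne', ENNReal.rpow_one]

/-- The weights are the normalised indicator functions of (closures of) the sets `O_ε`. -/
lemma exists_weightFamily {O : ℝ → Set G} (h2 : S.CA2) (hO : IsSymmetricBasis O)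
    (hL : S.LipschitzBalls O) (hcov : HasCovers O) : Nonempty S.WeightFamily := by
  obtain ⟨c, hc, hL⟩ := hL
  obtain ⟨d, hcov⟩ := hcov
  obtain ⟨Ω, hΩ, hΩn⟩ := exists_compact_mem_nhds (1 : G)
  obtain ⟨C, hC⟩ := hcov Ω hΩ
  have hne : (S.ball S.t₀).Nonempty := by
    by_contra h
    have := h2.1 S.t₀ le_rfl
    simp [vol, not_nonempty_iff_eq_empty.1 h] at this
  obtain ⟨b₀, hb₀⟩ := hne
  have hε : ∀ k : ℕ, 2 ≤ k → ((k : ℝ)⁻¹) ∈ Ioo (0 : ℝ) 1 := fun k hk => by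
    have : (2 : ℝ) ≤ k := by exact_mod_cast hk
    exact ⟨by positivity, inv_lt_one_of_one_lt₀ (by linarith)⟩
  have hε' : ∀ k : ℕ, 2 ≤ k → ((k : ℝ)⁻¹) ∈ Ioc (0 : ℝ) 1 := fun k hk => Ioo_subset_Ioc_self (hε k hk)
  have h1O : ∀ k : ℕ, 2 ≤ k → (1 : G) ∈ O (k : ℝ)⁻¹ := fun k hk => mem_of_mem_nhds (hO.1 _ (hε' k hk)).1
  set P : ℕ → Set G := fun k => closure (O (k : ℝ)⁻¹) with hP
  -- Relative compactness of the neighbourhoods comes from well-roundedness: for a point `b₀` of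
  -- `G_{t₀}`, the set `O_ε b₀` lies in the compact set `G_{t₀ + c}`.
  set K₀ : Set G := S.ball (S.t₀ + c) * {b₀⁻¹} with hK₀
  have hK₀c : IsCompact K₀ := (S.isCompact_ball _).mul isCompact_singleton
  have hPK : ∀ k ≥ 2, P k ⊆ K₀ := by
    intro k hk
    refine closure_minimal (fun g hg => ?_) hK₀c.isClosed
    refine Set.mem_mul.2 ⟨g * b₀, ?_, b₀⁻¹, rfl, by group⟩
    have h := hL _ (hε k hk) S.t₀ le_rfl (Set.mul_mem_mul (Set.mul_mem_mul hg hb₀) (h1O k hk))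
    rw [mul_one] at h
    refine S.monotone_ball ?_ h
    have := mul_le_mul_of_nonneg_left (hε k hk).2.le hc.le
    linarith
  have hPc : ∀ k ≥ 2, IsCompact (P k) := fun k hk => hK₀c.of_isClosed_subset isClosed_closure (hPK k hk)
  have hPm : ∀ k ≥ 2, 0 < S.m (P k) ∧ S.m (P k) < ⊤ := fun k hk =>
    ⟨Measure.measure_pos_of_mem_nhds S.m (Filter.mem_of_superset (hO.1 _ (hε' k hk)).1 subset_closure),
      (hPc k hk).measure_lt_top⟩
  have hPinv : ∀ k ≥ 2, ∀ g, g⁻¹ ∈ P k ↔ g ∈ P k := by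
    intro k hk g
    have h := (hO.1 _ (hε' k hk)).2
    have : (P k)⁻¹ = P k := by
      rw [hP]; dsimp only
      rw [inv_closure, h]
    rw [← Set.mem_inv, this]
  have hΩ0 : 0 < S.m Ω := Measure.measure_pos_of_mem_nhds S.m hΩn
  -- A fixed compact neighbourhood is covered by at most `|C| k^d` translates, so each translate
  -- carries at least a polynomially small share of its measure. This bounds the height of the
  -- normalised indicator.
  have hlow : ∀ k : ℕ, k ≥ 2 → S.m Ω ≤ ENNReal.ofReal (|C| * (k : ℝ) ^ d) * S.m (P k) := by
    intro k hk
    obtain ⟨T, hT, hT'⟩ := hC _ (hε k hk)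
    calc S.m Ω ≤ S.m (⋃ v ∈ T, v • P k) := by
          refine measure_mono (hT'.trans ?_)
          gcongr
          exact subset_closure
      _ ≤ ∑ v ∈ T, S.m (v • P k) := measure_biUnion_finset_le _ _
      _ = T.card * S.m (P k) := by simp [measure_smul]
      _ ≤ _ := by
          gcongr
          rw [← ENNReal.ofReal_natCast]
          refine ENNReal.ofReal_le_ofReal (hT.trans ?_)
          rw [Real.inv_rpow (by positivity), Real.rpow_neg (by positivity), inv_inv]
          gcongr
          exact le_abs_self _
  -- Indices start at 2 because the admissibility and covering hypotheses concern `ε = 1/k` strictly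
  -- below one. The maximum with zero keeps `κ` nonnegative when `d` is negative.
  refine ⟨{ b := fun k => (P k).indicator fun _ => (S.m (P k))⁻¹
            P := P, K₀ := K₀, k₀ := 2, κ := max d 0, β := |C| / (S.m Ω).toReal, c := c
            one_le_k₀ := one_le_two, κ_nonneg := le_max_right _ _, c_pos := hc
            isWeight := fun k hk => ?_, le := fun k hk g => ?_
            isCompact_K₀ := hK₀c, subset := hPK, thick := fun k hk t ht => ?_ }⟩
  · refine ⟨measurable_const.indicator (hPc k hk).measurableSet, fun g => ?_, ?_, fun g hg => ?_,
      subset_closure (h1O k hk), fun g hg => (hPinv k hk g).2 hg⟩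
    · by_cases h : g ∈ P k
      · rw [indicator_of_mem h, indicator_of_mem ((hPinv k hk g).2 h)]
      · rw [indicator_of_notMem h, indicator_of_notMem (fun h' => h ((hPinv k hk g).1 h'))]
    · rw [lintegral_indicator_const (hPc k hk).measurableSet]
      exact ENNReal.inv_mul_cancel (hPm k hk).1.ne' (hPm k hk).2.ne
    · by_contra h
      exact hg (indicator_of_notMem h _)
  · refine (indicator_le_self' (fun _ _ => zero_le) g).trans ?_
    have hk1 : (1 : ℝ) ≤ k := by exact_mod_cast one_le_two.trans hk
    have hΩt : S.m Ω ≠ ⊤ := hΩ.measure_lt_top.ne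
    have hΩr : 0 < (S.m Ω).toReal := ENNReal.toReal_pos hΩ0.ne' hΩt
    calc (S.m (P k))⁻¹ ≤ ENNReal.ofReal (|C| * (k : ℝ) ^ d) / S.m Ω := by
          rw [ENNReal.le_div_iff_mul_le (Or.inl hΩ0.ne') (Or.inl hΩt)]
          calc _ ≤ (S.m (P k))⁻¹ * (ENNReal.ofReal (|C| * (k : ℝ) ^ d) * S.m (P k)) := by
                gcongr; exact hlow k hk
            _ = ENNReal.ofReal (|C| * (k : ℝ) ^ d) * ((S.m (P k))⁻¹ * S.m (P k)) := by ring
            _ = _ := by rw [ENNReal.inv_mul_cancel (hPm k hk).1.ne' (hPm k hk).2.ne, mul_one]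
      _ = ENNReal.ofReal (|C| * (k : ℝ) ^ d / (S.m Ω).toReal) := by
          rw [ENNReal.ofReal_div_of_pos hΩr, ENNReal.ofReal_toReal hΩt]
      _ ≤ _ := by
          refine ENNReal.ofReal_le_ofReal ?_
          rw [mul_div_right_comm]
          gcongr
          exact le_max_left _ _
  · have hcl : IsClosed (S.ball (t + c / k)) := (S.isCompact_ball _).isClosed
    have h := hL _ (hε k hk) t ht
    rw [← div_eq_mul_inv] at h
    rintro _ ⟨_, ⟨a, ha, x, hx, rfl⟩, b, hb, rfl⟩
    have h1 : ∀ a' ∈ O (k : ℝ)⁻¹, a' * x * b ∈ S.ball (t + c / k) := fun a' ha' =>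
      (closure_minimal (t := (fun b => a' * x * b) ⁻¹' S.ball (t + c / k))
        (fun b' hb' => h (Set.mul_mem_mul (Set.mul_mem_mul ha' hx) hb'))
        (hcl.preimage (by fun_prop))) hb
    exact (closure_minimal (t := (fun a => a * x * b) ⁻¹' S.ball (t + c / k)) h1
      (hcl.preimage (by fun_prop))) ha

lemma quasiMeasurePreserving_projX : Measure.QuasiMeasurePreserving S.projX S.m S.ξ := by
  refine ⟨measurable_projX, Measure.AbsolutelyContinuous.mk fun Z hZ hZ0 => ?_⟩
  rw [Measure.map_apply measurable_projX hZ, ← lintegral_indicator_one (measurable_projX hZ),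
    S.decomposition _ (measurable_one.indicator (measurable_projX hZ))]
  refine lintegral_eq_zero_of_ae_eq_zero ?_
  filter_upwards [measure_eq_zero_iff_ae_notMem.1 hZ0] with x hx
  simp [indicator, projX_coe_mul, projX_s, hx]

/-- The function `φ` on `X`, restricted to a tube around the section and normalised. -/
def tubeLift (S : DualitySetting G) (W : Set S.H) (φ : S.X → ℝ) : G → ℝ :=
  {g | g * (S.s (S.projX g))⁻¹ ∈ (fun h : S.H => (h : G)) '' W}.indicator
    fun g => (S.ρ.real W)⁻¹ * φ (S.projX g)

lemma measurableSet_tube {W : Set S.H} (hW : IsCompact W) :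
    MeasurableSet {g | g * (S.s (S.projX g))⁻¹ ∈ (fun h : S.H => (h : G)) '' W} := by
  have h := (hW.image continuous_subtype_val).measurableSet
  have hm := S.measurable_s
  have hp := measurable_projX (S := S)
  have : Measurable fun g => g * (S.s (S.projX g))⁻¹ := by fun_prop
  exact this h

lemma coe_mul_s_mem_tube {W : Set S.H} (h : S.H) (x : S.X) :
    (h : G) * S.s x ∈ {g | g * (S.s (S.projX g))⁻¹ ∈ (fun h : S.H => (h : G)) '' W} ↔ h ∈ W := by
  simp [projX_coe_mul, projX_s]

/-- The fibre of the tube over `x` is `W s(x)`, which has the same `ρ`-mass for every `x`, so the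
image measure is a multiple of `ξ`. This compares the `L^q`-norms of the lift and of `φ`. -/
lemma map_projX_tube {W : Set S.H} (hW : IsCompact W) :
    (S.m.restrict {g | g * (S.s (S.projX g))⁻¹ ∈ (fun h : S.H => (h : G)) '' W}).map S.projX =
      S.ρ W • S.ξ := by
  ext A hA
  have hT := measurableSet_tube hW
  have hm := (measurable_projX (S := S)) hA
  rw [Measure.map_apply measurable_projX hA, Measure.restrict_apply hm,
    ← lintegral_indicator_one (hm.inter hT), S.decomposition _ (measurable_one.indicator (hm.inter hT)),
    Measure.smul_apply, smul_eq_mul, ← lintegral_indicator_one hA,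
    ← lintegral_const_mul _ (measurable_one.indicator hA)]
  refine lintegral_congr fun x => ?_
  by_cases hx : x ∈ A
  · rw [indicator_of_mem hx, Pi.one_apply, mul_one, ← lintegral_indicator_one hW.measurableSet]
    refine lintegral_congr fun h => ?_
    have : (h : G) * S.s x ∈ S.projX ⁻¹' A := by simpa [projX_coe_mul, projX_s] using hx
    by_cases hh : h ∈ W
    · rw [indicator_of_mem hh, indicator_of_mem (Set.mem_inter this ((coe_mul_s_mem_tube h x).2 hh)), Pi.one_apply, Pi.one_apply]
    · rw [indicator_of_notMem hh, indicator_of_notMem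
        (fun h' => hh ((coe_mul_s_mem_tube h x).1 h'.2))]
  · rw [indicator_of_notMem hx, mul_zero]
    refine lintegral_eq_zero_of_ae_eq_zero (ae_of_all _ fun h => ?_)
    have : (h : G) * S.s x ∉ S.projX ⁻¹' A := by simpa [projX_coe_mul, projX_s] using hx
    simp [this]

/-- Writing `g = h₀ s(x)`, the point `h⁻¹g` lies in the tube exactly when `h⁻¹h₀ ∈ W`, equivalently
`h₀⁻¹h ∈ W` as `W` is symmetric. The coset integral is then computed by left invariance of `ρ`
alone. -/
lemma isLift_tubeLift {W : Set S.H} (hW : IsCompact W) (hWn : W ∈ 𝓝 1) (hWi : W⁻¹ = W)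
    (q : ℝ≥0∞) (D : Set S.X) :
    ∃ C : ℝ≥0, IsLift S q (PositiveCone S.ξ D fun φ => eLpNorm φ q S.ξ) (fun φ => eLpNorm φ q S.ξ)
      ((fun h : S.H => (h : G)) '' W * closure (S.s '' D)) (tubeLift S W) C := by
  have hT := measurableSet_tube hW
  have hρ0 : S.ρ W ≠ 0 := (Measure.measure_pos_of_mem_nhds S.ρ hWn).ne'
  have hρt : S.ρ W ≠ ⊤ := hW.measure_lt_top.ne
  have hρr : 0 < S.ρ.real W := ENNReal.toReal_pos hρ0 hρt
  have hCt : ‖(S.ρ.real W)⁻¹‖ₑ * S.ρ W ^ (1 / q).toReal ≠ ⊤ :=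
    ENNReal.mul_ne_top enorm_ne_top (ENNReal.rpow_ne_top_of_nonneg ENNReal.toReal_nonneg hρt)
  refine ⟨(‖(S.ρ.real W)⁻¹‖ₑ * S.ρ W ^ (1 / q).toReal).toNNReal, ?_, ?_, ?_, ?_, ?_⟩
  · rintro φ ⟨hφm, -, -, -⟩
    exact ((hφm.comp_quasiMeasurePreserving quasiMeasurePreserving_projX).const_mul _).indicator hT
  · rintro φ ⟨-, hφ0, -, -⟩ g
    exact indicator_nonneg (fun g _ => mul_nonneg (inv_nonneg.2 hρr.le) (hφ0 _)) g
  · rintro φ ⟨-, -, hφD, -⟩ g hg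
    rw [tubeLift]
    by_cases hgT : g ∈ {g | g * (S.s (S.projX g))⁻¹ ∈ (fun h : S.H => (h : G)) '' W}
    · rw [indicator_of_mem hgT, hφD, mul_zero]
      intro hD
      refine hg (Set.mem_mul.2 ⟨_, hgT, S.s (S.projX g), subset_closure ⟨_, hD, rfl⟩, by group⟩)
    · rw [indicator_of_notMem hgT]
  · rintro φ ⟨-, hφ0, -, -⟩ g
    obtain ⟨h₀, hh₀⟩ : ∃ h₀ : S.H, (h₀ : G) * S.s (S.projX g) = g :=
      ⟨⟨g * (S.s (S.projX g))⁻¹, projX_eq_iff.1 (projX_s _)⟩, by simp⟩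
    have h1 : ∀ h : S.H, ENNReal.ofReal (tubeLift S W φ ((h : G)⁻¹ * g)) =
        (W.indicator (fun _ => ENNReal.ofReal ((S.ρ.real W)⁻¹ * φ (S.projX g)))) (h₀⁻¹ * h) := by
      intro h
      have e : (h : G)⁻¹ * g = ((h⁻¹ * h₀ : S.H) : G) * S.s (S.projX g) := by
        rw [← hh₀]; simp [mul_assoc, projX_coe_mul, projX_s]
      have hiff : h⁻¹ * h₀ ∈ W ↔ h₀⁻¹ * h ∈ W := by
        rw [← hWi, Set.mem_inv]; simp [hWi]
      have hpr : S.projX ((h : G)⁻¹ * g) = S.projX g := by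
        rw [e, projX_coe_mul, projX_s]
      rw [tubeLift]
      by_cases hh : h₀⁻¹ * h ∈ W
      · rw [indicator_of_mem hh, indicator_of_mem, hpr]
        rw [e]
        exact (coe_mul_s_mem_tube _ _).2 (hiff.2 hh)
      · rw [indicator_of_notMem hh, indicator_of_notMem, ENNReal.ofReal_zero]
        rw [e]
        exact fun h' => hh (hiff.1 ((coe_mul_s_mem_tube _ _).1 h'))
    unfold cosetInt
    simp_rw [h1]
    rw [lintegral_mul_left_eq_self (μ := S.ρ) _ h₀⁻¹, lintegral_indicator_const hW.measurableSet,
      ENNReal.ofReal_mul (inv_nonneg.2 hρr.le), ENNReal.ofReal_inv_of_pos hρr, mul_right_comm,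
      ofReal_measureReal hρt, ENNReal.inv_mul_cancel hρ0 hρt, one_mul]
  · rintro φ ⟨hφm, -, -, -⟩
    rw [tubeLift, eLpNorm_indicator_eq_eLpNorm_restrict hT, ENNReal.coe_toNNReal hCt]
    refine (eLpNorm_const_smul_le (c := (S.ρ.real W)⁻¹) (f := fun g => φ (S.projX g))).trans ?_
    rw [mul_assoc]
    gcongr
    have h2 : AEStronglyMeasurable φ (S.ρ W • S.ξ) := hφm.mono_ac Measure.smul_absolutelyContinuous
    rw [← map_projX_tube hW] at h2
    have h3 := eLpNorm_map_measure (p := q) h2 measurable_projX.aemeasurable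
    rw [map_projX_tube hW, eLpNorm_smul_measure_of_ne_zero hρ0] at h3
    exact h3.symm.le

/-- Multiplication by a weight costs its supremum, of order `k^κ`, and periodization over a fixed
compact support is bounded on `L^q`. -/
theorem liftable_lebesgue (A : S.WeightFamily) {q : ℝ≥0∞} (hq : 1 ≤ q) :
    Liftable S A q (IsLebesgueNorm S.μ q) (IsLebesgueNorm S.ξ q) := by
  rintro D hD _ rfl
  obtain ⟨W, hW, hWn, hWi⟩ := exists_compact_nhd_one (S := S)
  obtain ⟨C, hL⟩ := isLift_tubeLift hW hWn hWi q D
  have hΩ := isCompact_coe_mul_closure (S := S) hW hD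
  refine ⟨_, tubeLift S W, C, hΩ, hL, ?_⟩
  rintro B - - _ rfl K -
  obtain ⟨M, hM⟩ := exists_eLpNorm_periodize_le (S := S) hΩ hq
  refine ⟨M * (A.β.toNNReal * C), fun φ hφ k hk v _ => ?_⟩
  have hk0 : (0 : ℝ) ≤ (k : ℝ) ^ A.κ := by positivity
  set F : G → ℝ≥0∞ := fun g => ENNReal.ofReal (tubeLift S W φ g) * A.b k (v⁻¹ * g) with hF
  have hb := (A.isWeight k hk).measurable
  have hFm : AEMeasurable F S.m :=
    (hL.aestronglyMeasurable φ hφ).aemeasurable.ennreal_ofReal.mul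
      (hb.comp (measurable_const_mul _)).aemeasurable
  have hFb : eLpNorm F q S.m ≤ ENNReal.ofReal (A.β * (k : ℝ) ^ A.κ) * eLpNorm (tubeLift S W φ) q S.m := by
    have : ENNReal.ofReal (A.β * (k : ℝ) ^ A.κ) = ((A.β * (k : ℝ) ^ A.κ).toNNReal : ℝ≥0∞) := rfl
    rw [this, ← smul_eq_mul, ← ENNReal.smul_def]
    refine eLpNorm_le_nnreal_smul_eLpNorm_of_ae_le_mul' (ae_of_all _ fun g => ?_) q
    rw [← this, enorm_eq_self, Real.enorm_eq_ofReal (hL.nonneg φ hφ g), mul_comm]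
    exact mul_le_mul' le_rfl (A.le k hk _)
  calc eLpNorm (fun y => (S.periodize F y).toReal) q S.μ ≤ eLpNorm (S.periodize F) q S.μ := by
        refine eLpNorm_mono_enorm fun y => ?_
        rw [Real.enorm_eq_ofReal ENNReal.toReal_nonneg, enorm_eq_self]
        exact ENNReal.ofReal_toReal_le
    _ ≤ M * eLpNorm F q S.m := hM F hFm fun g hg => by
        rw [hF]; simp [hL.eq_zero φ hφ g hg]
    _ ≤ M * (ENNReal.ofReal (A.β * (k : ℝ) ^ A.κ) * (C * eLpNorm φ q S.ξ)) := by
        gcongr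
        exact hFb.trans (by gcongr; exact hL.eLpNorm_le φ hφ)
    _ = _ := by
        rw [ENNReal.ofReal_mul' hk0]
        push_cast
        rw [ENNReal.ofReal]
        ring

theorem conclusion_lebesgue {p q : ℝ≥0∞} (hp : 1 ≤ p) (hpq : p < q) {O : ℝ → Set G} (h1 : S.CA1)
    (h2 : S.CA2) (hO : IsSymmetricBasis O) (hL : S.LipschitzBalls O) (hcov : HasCovers O) :
    S.Conclusion p q (IsLebesgueNorm S.μ q) (IsLebesgueNorm S.ξ q) := by
  obtain ⟨A⟩ := exists_weightFamily h2 hO hL hcov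
  exact conclusion_of_liftable A h1 h2 hp hpq (liftable_lebesgue A (hp.trans hpq.le))

end Lebesgue

end DualitySetting

/-! ### Calculus of iterated partial derivatives. -/

section PartialDerivatives

variable {d : ℕ}

lemma contDiff_partialD (i : Fin d) {f : EuclideanSpace ℝ (Fin d) → ℝ} (hf : ContDiff ℝ ∞ f) :
    ContDiff ℝ ∞ (partialD i f) := by
  unfold partialD
  exact (hf.fderiv_right (m := ∞) (by simp)).clm_apply contDiff_const

lemma HasCompactSupport.partialD (i : Fin d) {f : EuclideanSpace ℝ (Fin d) → ℝ}
    (hf : HasCompactSupport f) : HasCompactSupport (partialD i f) :=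
  (hf.fderiv (𝕜 := ℝ)).comp_left (g := fun L : EuclideanSpace ℝ (Fin d) →L[ℝ] ℝ =>
    L (EuclideanSpace.single i 1)) rfl

lemma tsupport_partialD_subset (i : Fin d) (f : EuclideanSpace ℝ (Fin d) → ℝ) :
    tsupport (partialD i f) ⊆ tsupport f := by
  refine (closure_mono fun x hx => ?_).trans (tsupport_fderiv_subset ℝ (f := f))
  intro h
  exact hx (by simp [partialD, h])

lemma partialD_comm (i j : Fin d) {f : EuclideanSpace ℝ (Fin d) → ℝ} (hf : ContDiff ℝ ∞ f) :
    partialD i (partialD j f) = partialD j (partialD i f) := by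
  have hd : Differentiable ℝ (fderiv ℝ f) :=
    (hf.fderiv_right (m := ∞) (by simp)).differentiable (by simp)
  have key : ∀ a b : Fin d, ∀ x, partialD a (partialD b f) x =
      fderiv ℝ (fderiv ℝ f) x (EuclideanSpace.single a 1) (EuclideanSpace.single b 1) := by
    intro a b x
    unfold partialD
    rw [fderiv_clm_apply (hd x) (differentiableAt_const _)]
    simp
  ext x
  rw [key, key]
  exact (hf.contDiffAt.isSymmSndFDerivAt (by
    simpa using (by exact_mod_cast (le_top : (2 : ℕ∞) ≤ ⊤) : ((2 : ℕ∞) : WithTop ℕ∞) ≤ ((⊤ : ℕ∞) : WithTop ℕ∞)))).eq _ _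

lemma partialD_mul (i : Fin d) {a f : EuclideanSpace ℝ (Fin d) → ℝ} (ha : ContDiff ℝ ∞ a)
    (hf : ContDiff ℝ ∞ f) (x : EuclideanSpace ℝ (Fin d)) :
    partialD i (fun x => a x * f x) x = a x * partialD i f x + partialD i a x * f x := by
  unfold partialD
  rw [fderiv_fun_mul (ha.differentiable (by simp) x) (hf.differentiable (by simp) x)]
  simp [mul_comm]

lemma contDiff_partialD_iterate (i : Fin d) (k : ℕ) {f : EuclideanSpace ℝ (Fin d) → ℝ}
    (hf : ContDiff ℝ ∞ f) : ContDiff ℝ ∞ ((partialD i)^[k] f) := by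
  induction k with
  | zero => exact hf
  | succ k ih => rw [Function.iterate_succ_apply']; exact contDiff_partialD i ih

lemma partialD_iterate_comm (i j : Fin d) (k : ℕ) {f : EuclideanSpace ℝ (Fin d) → ℝ}
    (hf : ContDiff ℝ ∞ f) :
    (partialD j)^[k] (partialD i f) = partialD i ((partialD j)^[k] f) := by
  induction k with
  | zero => rfl
  | succ k ih =>
    rw [Function.iterate_succ_apply', Function.iterate_succ_apply', ih, partialD_comm]
    exact contDiff_partialD_iterate j k hf

lemma contDiff_foldr_partialD (L : List (Fin d)) (α : Fin d → ℕ)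
    {f : EuclideanSpace ℝ (Fin d) → ℝ} (hf : ContDiff ℝ ∞ f) :
    ContDiff ℝ ∞ (L.foldr (fun i g => (partialD i)^[α i] g) f) := by
  induction L with
  | nil => exact hf
  | cons j L ih => exact contDiff_partialD_iterate j _ ih

lemma foldr_partialD_partialD (L : List (Fin d)) (α : Fin d → ℕ) (i : Fin d)
    {f : EuclideanSpace ℝ (Fin d) → ℝ} (hf : ContDiff ℝ ∞ f) :
    L.foldr (fun i g => (partialD i)^[α i] g) (partialD i f) =
      partialD i (L.foldr (fun i g => (partialD i)^[α i] g) f) := by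
  induction L with
  | nil => rfl
  | cons j L ih =>
    rw [List.foldr_cons, List.foldr_cons, ih, partialD_iterate_comm]
    exact contDiff_foldr_partialD L α hf

lemma foldr_partialD_add_single (L : List (Fin d)) (hL : L.Nodup) (α : Fin d → ℕ) (i : Fin d)
    {f : EuclideanSpace ℝ (Fin d) → ℝ} (hf : ContDiff ℝ ∞ f) :
    L.foldr (fun j g => (partialD j)^[(α + Pi.single i 1 : Fin d → ℕ) j] g) f = if i ∈ L then
      partialD i (L.foldr (fun i g => (partialD i)^[α i] g) f) else
      L.foldr (fun i g => (partialD i)^[α i] g) f := by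
  induction L with
  | nil => simp
  | cons j L ih =>
    rw [List.nodup_cons] at hL
    rw [List.foldr_cons, List.foldr_cons, ih hL.2]
    have hs := contDiff_foldr_partialD L α hf
    by_cases hij : i = j
    · subst hij
      simp only [hL.1, if_false, List.mem_cons_self, if_true]
      rw [← Function.iterate_succ_apply' (partialD i)]
      simp
    · by_cases hi : i ∈ L
      · simp only [hi, if_true, List.mem_cons, or_true]
        rw [← partialD_iterate_comm _ _ _ hs]
        simp [Pi.single_apply, Ne.symm hij]
      · simp [hi, hij, Pi.single_apply, Ne.symm hij]

/-- The iterated derivative is taken in a fixed order of the coordinates; symmetry of second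
derivatives brings the additional one to the front. -/
lemma multiD_add_single (α : Fin d → ℕ) (i : Fin d) {f : EuclideanSpace ℝ (Fin d) → ℝ}
    (hf : ContDiff ℝ ∞ f) : multiD (α + Pi.single i 1) f = partialD i (multiD α f) := by
  unfold multiD
  rw [foldr_partialD_add_single _ (List.nodup_finRange d) α i hf]
  simp

lemma multiD_partialD (α : Fin d → ℕ) (i : Fin d) {f : EuclideanSpace ℝ (Fin d) → ℝ}
    (hf : ContDiff ℝ ∞ f) : multiD α (partialD i f) = partialD i (multiD α f) :=
  foldr_partialD_partialD _ α i hf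

lemma multiD_zero (f : EuclideanSpace ℝ (Fin d) → ℝ) : multiD (0 : Fin d → ℕ) f = f := by
  unfold multiD
  simp only [Pi.zero_apply, Function.iterate_zero, id_eq]
  induction List.finRange d with
  | nil => rfl
  | cons j L ih => exact ih

lemma contDiff_multiD (α : Fin d → ℕ) {f : EuclideanSpace ℝ (Fin d) → ℝ} (hf : ContDiff ℝ ∞ f) :
    ContDiff ℝ ∞ (multiD α f) :=
  contDiff_foldr_partialD _ α hf

lemma tsupport_multiD_subset (α : Fin d → ℕ) (f : EuclideanSpace ℝ (Fin d) → ℝ) :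
    tsupport (multiD α f) ⊆ tsupport f := by
  unfold multiD
  induction List.finRange d with
  | nil => exact subset_rfl
  | cons j L ih =>
    rw [List.foldr_cons]
    generalize α j = k
    induction k with
    | zero => exact ih
    | succ k ihk =>
      rw [Function.iterate_succ_apply']
      exact (tsupport_partialD_subset _ _).trans ihk

lemma HasCompactSupport.multiD (α : Fin d → ℕ) {f : EuclideanSpace ℝ (Fin d) → ℝ}
    (hf : HasCompactSupport f) : HasCompactSupport (multiD α f) :=
  hf.of_isClosed_subset (isClosed_tsupport _) (tsupport_multiD_subset α f)

end PartialDerivatives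

/-! ### An inductive form of Sobolev bounds. -/

section SobBound

variable {d : ℕ}

/-- `v` is the weak partial derivative of `u` in the `i`-th direction. -/
def WeakPartial (i : Fin d) (u v : EuclideanSpace ℝ (Fin d) → ℝ) : Prop :=
  ∀ η : EuclideanSpace ℝ (Fin d) → ℝ, ContDiff ℝ ∞ η → HasCompactSupport η →
    ∫ x, u x * partialD i η x = -∫ x, v x * η x

/-- `u` vanishes outside `K`, and its weak derivatives of order at most `l` have `L^q`-norms at
most `M`. -/
def SobBound (q : ℝ≥0∞) (K : Set (EuclideanSpace ℝ (Fin d))) :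
    ℕ → ℝ≥0∞ → (EuclideanSpace ℝ (Fin d) → ℝ) → Prop
  | 0, M, u => MemLp u q ∧ (∀ x, x ∉ K → u x = 0) ∧ eLpNorm u q ≤ M
  | l + 1, M, u => (MemLp u q ∧ (∀ x, x ∉ K → u x = 0) ∧ eLpNorm u q ≤ M) ∧
      ∀ i, ∃ v, WeakPartial i u v ∧ SobBound q K l M v

variable {q : ℝ≥0∞} {K : Set (EuclideanSpace ℝ (Fin d))} {l : ℕ} {M M' : ℝ≥0∞}
  {u u' v : EuclideanSpace ℝ (Fin d) → ℝ}

lemma SobBound.base (h : SobBound q K l M u) :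
    MemLp u q ∧ (∀ x, x ∉ K → u x = 0) ∧ eLpNorm u q ≤ M := by
  cases l with
  | zero => exact h
  | succ l => exact h.1

lemma SobBound.mono (h : SobBound q K l M u) (hM : M ≤ M') : SobBound q K l M' u := by
  induction l generalizing u with
  | zero => exact ⟨h.1, h.2.1, h.2.2.trans hM⟩
  | succ l ih =>
    refine ⟨⟨h.1.1, h.1.2.1, h.1.2.2.trans hM⟩, fun i => ?_⟩
    obtain ⟨v, hv, hv'⟩ := h.2 i
    exact ⟨v, hv, ih hv'⟩

lemma SobBound.mono_set {K' : Set (EuclideanSpace ℝ (Fin d))} (h : SobBound q K l M u)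
    (hK : K ⊆ K') : SobBound q K' l M u := by
  induction l generalizing u with
  | zero => exact ⟨h.1, fun x hx => h.2.1 x fun h' => hx (hK h'), h.2.2⟩
  | succ l ih =>
    refine ⟨⟨h.1.1, fun x hx => h.1.2.1 x fun h' => hx (hK h'), h.1.2.2⟩, fun i => ?_⟩
    obtain ⟨v, hv, hv'⟩ := h.2 i
    exact ⟨v, hv, ih hv'⟩

lemma SobBound.of_succ (h : SobBound q K (l + 1) M u) : SobBound q K l M u := by
  induction l generalizing u with
  | zero => exact h.1
  | succ l ih =>
    refine ⟨h.1, fun i => ?_⟩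
    obtain ⟨v, hv, hv'⟩ := h.2 i
    exact ⟨v, hv, ih hv'⟩

lemma SobBound.congr_ae (h : SobBound q K l M u) (hu : u =ᵐ[volume] u') (h0 : ∀ x, x ∉ K → u' x = 0) :
    SobBound q K l M u' := by
  have hb : MemLp u' q ∧ (∀ x, x ∉ K → u' x = 0) ∧ eLpNorm u' q ≤ M :=
    ⟨h.base.1.ae_eq hu, h0, by rw [← eLpNorm_congr_ae hu]; exact h.base.2.2⟩
  cases l with
  | zero => exact hb
  | succ l =>
    refine ⟨hb, fun i => ?_⟩
    obtain ⟨v, hv, hv'⟩ := h.2 i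
    refine ⟨v, fun η hη hηc => ?_, hv'⟩
    rw [← hv η hη hηc]
    refine integral_congr_ae ?_
    filter_upwards [hu] with x hx
    rw [hx]

lemma MeasureTheory.MemLp.integrable_of_eq_zero (hu : MemLp u q) (hq : 1 ≤ q) (hK : IsCompact K)
    (h0 : ∀ x, x ∉ K → u x = 0) : Integrable u := by
  have h1 : IntegrableOn u K := by
    have : IsFiniteMeasure (volume.restrict K) := ⟨by simpa using hK.measure_lt_top⟩
    exact (hu.restrict K).integrable hq
  rw [← integrable_indicator_iff hK.measurableSet] at h1
  rwa [indicator_eq_self.2 fun x hx => by_contra fun h => hx (h0 x h)] at h1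

lemma SobBound.integrable (h : SobBound q K l M u) (hq : 1 ≤ q) (hK : IsCompact K) :
    Integrable u :=
  h.base.1.integrable_of_eq_zero hq hK h.base.2.1

lemma MeasureTheory.Integrable.mul_of_hasCompactSupport (hu : Integrable u)
    {η : EuclideanSpace ℝ (Fin d) → ℝ} (hη : Continuous η) (hηc : HasCompactSupport η) :
    Integrable fun x => u x * η x := by
  have := hu.locallyIntegrable.integrable_smul_right_of_hasCompactSupport hη hηc
  simpa [mul_comm] using this

lemma WeakPartial.add {i : Fin d} {v' : EuclideanSpace ℝ (Fin d) → ℝ} (hu : Integrable u)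
    (hu' : Integrable u') (hv : Integrable v) (hv' : Integrable v') (h : WeakPartial i u v)
    (h' : WeakPartial i u' v') : WeakPartial i (fun x => u x + u' x) (fun x => v x + v' x) := by
  intro η hη hηc
  have hp := (contDiff_partialD i hη).continuous
  simp_rw [add_mul]
  rw [integral_add (hu.mul_of_hasCompactSupport hp (hηc.partialD i))
    (hu'.mul_of_hasCompactSupport hp (hηc.partialD i)),
    integral_add (hv.mul_of_hasCompactSupport hη.continuous hηc)
    (hv'.mul_of_hasCompactSupport hη.continuous hηc), h η hη hηc, h' η hη hηc]
  ring

lemma SobBound.add (hq : 1 ≤ q) (hK : IsCompact K) (h : SobBound q K l M u)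
    (h' : SobBound q K l M' u') : SobBound q K l (M + M') fun x => u x + u' x := by
  have hbase : ∀ {u u' : EuclideanSpace ℝ (Fin d) → ℝ}
      (_ : MemLp u q ∧ (∀ x, x ∉ K → u x = 0) ∧ eLpNorm u q ≤ M)
      (_ : MemLp u' q ∧ (∀ x, x ∉ K → u' x = 0) ∧ eLpNorm u' q ≤ M'),
      MemLp (fun x => u x + u' x) q ∧ (∀ x, x ∉ K → u x + u' x = 0) ∧
        eLpNorm (fun x => u x + u' x) q ≤ M + M' := fun h h' =>
    ⟨h.1.add h'.1, fun x hx => by simp [h.2.1 x hx, h'.2.1 x hx],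
      (eLpNorm_add_le h.1.1 h'.1.1 hq).trans (add_le_add h.2.2 h'.2.2)⟩
  induction l generalizing u u' with
  | zero => exact hbase h h'
  | succ l ih =>
    refine ⟨hbase h.1 h'.1, fun i => ?_⟩
    obtain ⟨v, hv, hvb⟩ := h.2 i
    obtain ⟨v', hv', hvb'⟩ := h'.2 i
    exact ⟨_, hv.add (h.integrable hq hK) (h'.integrable hq hK) (hvb.integrable hq hK)
      (hvb'.integrable hq hK) hv', ih hvb hvb'⟩

lemma SobBound.zero : SobBound q K l 0 (0 : EuclideanSpace ℝ (Fin d) → ℝ) := by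
  induction l with
  | zero => exact ⟨MemLp.zero', fun _ _ => rfl, by simp⟩
  | succ l ih =>
    exact ⟨⟨MemLp.zero', fun _ _ => rfl, by simp⟩, fun i => ⟨0, fun η _ _ => by simp, ih⟩⟩

lemma SobBound.sum {ι : Type*} (hq : 1 ≤ q) (hK : IsCompact K) (s : Finset ι) {M : ι → ℝ≥0∞}
    {u : ι → EuclideanSpace ℝ (Fin d) → ℝ} (h : ∀ i ∈ s, SobBound q K l (M i) (u i)) :
    SobBound q K l (∑ i ∈ s, M i) fun x => ∑ i ∈ s, u i x := by
  classical
  induction s using Finset.induction_on with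
  | empty => simp only [Finset.sum_empty]; exact SobBound.zero
  | insert a s ha ih =>
    simp_rw [Finset.sum_insert ha]
    exact SobBound.add hq hK (h a (Finset.mem_insert_self a s))
      (ih fun i hi => h i (Finset.mem_insert_of_mem hi))

/-- The product `aη` is itself an admissible test function, so the definition for `u`, tested on it,
gives the product rule. -/
lemma WeakPartial.mul {i : Fin d} (hu : Integrable u) (hv : Integrable v) (h : WeakPartial i u v)
    {a : EuclideanSpace ℝ (Fin d) → ℝ} (ha : ContDiff ℝ ∞ a) :
    WeakPartial i (fun x => a x * u x) (fun x => a x * v x + partialD i a x * u x) := by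
  intro η hη hηc
  have hpa := contDiff_partialD i ha
  have h1 := h (fun x => a x * η x) (ha.mul hη) (hηc.mul_left (f := a))
  have h2 : ∀ x, u x * partialD i (fun x => a x * η x) x =
      a x * u x * partialD i η x + u x * (partialD i a x * η x) := fun x => by
    rw [partialD_mul i ha hη]; ring
  have i1 : Integrable fun x => a x * u x * partialD i η x := by
    have := hu.mul_of_hasCompactSupport (ha.continuous.mul (contDiff_partialD i hη).continuous)
      ((hηc.partialD i).mul_left (f := a))
    refine this.congr (ae_of_all _ fun x => ?_)
    simp only [Pi.mul_apply]; ring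
  have i2 : Integrable fun x => u x * (partialD i a x * η x) :=
    hu.mul_of_hasCompactSupport (hpa.continuous.mul hη.continuous) (hηc.mul_left (f := partialD i a))
  have i3 : Integrable fun x => v x * (a x * η x) :=
    hv.mul_of_hasCompactSupport (ha.continuous.mul hη.continuous) (hηc.mul_left (f := a))
  simp_rw [h2] at h1
  rw [integral_add i1 i2] at h1
  have h3 : ∀ x, (a x * v x + partialD i a x * u x) * η x =
      v x * (a x * η x) + u x * (partialD i a x * η x) := fun x => by ring
  simp_rw [h3]
  rw [integral_add i3 i2]
  linarith

lemma norm_iteratedFDeriv_partialD_le (i : Fin d) {a : EuclideanSpace ℝ (Fin d) → ℝ}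
    (ha : ContDiff ℝ ∞ a) (m : ℕ) (x : EuclideanSpace ℝ (Fin d)) :
    ‖iteratedFDeriv ℝ m (partialD i a) x‖ ≤ ‖iteratedFDeriv ℝ (m + 1) a x‖ := by
  have hd : ContDiff ℝ ∞ (fderiv ℝ a) := ha.fderiv_right (by simp)
  set L := ContinuousLinearMap.apply ℝ ℝ (EuclideanSpace.single i (1 : ℝ)) with hL
  have e : partialD i a = L ∘ fderiv ℝ a := rfl
  have hLn : ‖L‖ ≤ 1 := by
    refine ContinuousLinearMap.opNorm_le_bound _ zero_le_one fun T => ?_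
    rw [hL, ContinuousLinearMap.apply_apply, one_mul]
    refine (ContinuousLinearMap.le_opNorm _ _).trans ?_
    simp
  rw [e, ← norm_iteratedFDeriv_fderiv (𝕜 := ℝ) (f := a)]
  refine (L.norm_iteratedFDeriv_comp_left (hd.contDiffAt (x := x))
    (by exact_mod_cast le_top)).trans ?_
  exact mul_le_of_le_one_left (norm_nonneg _) hLn

/-- Multiplication by a smooth function with bounded derivatives. -/
lemma SobBound.mul (hq : 1 ≤ q) (hK : IsCompact K) {A : ℝ} {a : EuclideanSpace ℝ (Fin d) → ℝ}
    (ha : ContDiff ℝ ∞ a) (hA : ∀ m ≤ l, ∀ x, ‖iteratedFDeriv ℝ m a x‖ ≤ A)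
    (h : SobBound q K l M u) :
    SobBound q K l (2 ^ l * (ENNReal.ofReal A * M)) fun x => a x * u x := by
  have hbase : ∀ {l : ℕ} {a : EuclideanSpace ℝ (Fin d) → ℝ} (_ : ContDiff ℝ ∞ a)
      (_ : ∀ x, ‖iteratedFDeriv ℝ 0 a x‖ ≤ A) {u : EuclideanSpace ℝ (Fin d) → ℝ}
      (_ : MemLp u q ∧ (∀ x, x ∉ K → u x = 0) ∧ eLpNorm u q ≤ M),
      MemLp (fun x => a x * u x) q ∧ (∀ x, x ∉ K → a x * u x = 0) ∧
        eLpNorm (fun x => a x * u x) q ≤ 2 ^ l * (ENNReal.ofReal A * M) := by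
    intro l a ha hA u h
    have hb : ∀ x, ‖a x * u x‖ ≤ A * ‖u x‖ := fun x => by
      rw [norm_mul]
      gcongr
      simpa using hA x
    refine ⟨h.1.of_le_mul (ha.continuous.aestronglyMeasurable.mul h.1.1) (ae_of_all _ hb),
      fun x hx => by simp [h.2.1 x hx], ?_⟩
    refine (eLpNorm_le_mul_eLpNorm_of_ae_le_mul (ae_of_all _ hb) q).trans ?_
    calc _ ≤ 1 * (ENNReal.ofReal A * M) := by rw [one_mul]; gcongr; exact h.2.2
      _ ≤ _ := by
        gcongr
        exact one_le_pow₀ one_le_two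
  induction l generalizing u a with
  | zero => exact hbase ha (hA 0 le_rfl) h
  | succ l ih =>
    refine ⟨hbase ha (hA 0 (by omega)) h.1, fun i => ?_⟩
    obtain ⟨v, hv, hvb⟩ := h.2 i
    refine ⟨_, hv.mul (h.integrable hq hK) (hvb.integrable hq hK) ha, ?_⟩
    have h1 := ih ha (fun m hm => hA m (by omega)) hvb
    -- The product rule leaves two terms at order `l`, each bounded by the induction hypothesis;
    -- this doubling is the source of `2 ^ l`.
    have h2 := ih (contDiff_partialD i ha) (fun m hm x =>
      (norm_iteratedFDeriv_partialD_le i ha m x).trans (hA (m + 1) (by omega) x)) h.of_succ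
    refine (h1.add hq hK h2).mono (le_of_eq ?_)
    ring

end SobBound

/-! ### Equivalence of the inductive bounds with the Sobolev norm. -/

section SobolevNorm

variable {d : ℕ} {q : ℝ≥0∞} {K : Set (EuclideanSpace ℝ (Fin d))} {l : ℕ} {M : ℝ≥0∞}
  {u v v' : EuclideanSpace ℝ (Fin d) → ℝ} {α : Fin d → ℕ}

/-- Peel one direction `i` with `α i ≥ 1` off the multi-index: the inductive bound supplies the
first partial derivative, and testing it against the remaining iterated derivative of `η` composes
the two. -/
lemma exists_isWeakDeriv_of_sobBound (hq : 1 ≤ q) (hK : IsCompact K) (h : SobBound q K l M u)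
    (hα : ∑ i, α i ≤ l) : ∃ v, IsWeakDeriv α u v ∧ eLpNorm v q ≤ M := by
  induction l generalizing u α with
  | zero =>
    have : α = 0 := by
      ext i
      exact Nat.le_zero.1 ((Finset.single_le_sum (fun _ _ => Nat.zero_le _) (Finset.mem_univ i)).trans hα)
    subst this
    have hl := (h.integrable hq hK).locallyIntegrable
    exact ⟨u, ⟨hl, hl, fun η _ _ => by simp [multiD_zero]⟩, h.2.2⟩
  | succ l ih =>
    by_cases h0 : α = 0
    · exact ih h.of_succ (by simp [h0])
    obtain ⟨i, hi⟩ := Function.ne_iff.1 h0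
    have hi : 1 ≤ α i := Nat.one_le_iff_ne_zero.2 hi
    obtain ⟨β, rfl⟩ : ∃ β : Fin d → ℕ, α = β + Pi.single i 1 :=
      ⟨α - Pi.single i 1, (tsub_add_cancel_of_le fun j => by
        by_cases hj : j = i
        · subst hj; simpa using hi
        · simp [Pi.single_apply, hj]).symm⟩
    have hsum : ∑ j, (β + Pi.single i 1 : Fin d → ℕ) j = ∑ j, β j + 1 := by
      simp [Finset.sum_add_distrib]
    obtain ⟨v, hv, hvb⟩ := h.2 i
    obtain ⟨w, hw, hwM⟩ := ih hvb (α := β) (by omega)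
    refine ⟨w, ⟨(h.integrable hq hK).locallyIntegrable, hw.2.1, fun η hη hηc => ?_⟩, hwM⟩
    rw [multiD_add_single β i hη, hv _ (contDiff_multiD β hη) (hηc.multiD β), hw.2.2 η hη hηc, hsum,
      pow_succ]
    ring

/-- The number of multi-indices of order at most `l`. -/
def multiIndexCount (d l : ℕ) : ℕ :=
  ∑ k ∈ Finset.range (l + 1), (Finset.piAntidiag (Finset.univ : Finset (Fin d)) k).card

lemma sobolevNorm_le_of_sobBound (hq : 1 ≤ q) (hK : IsCompact K) (h : SobBound q K l M u) :
    sobolevNorm l q u ≤ multiIndexCount d l * M := by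
  unfold sobolevNorm multiIndexCount
  push_cast
  rw [Finset.sum_mul]
  refine Finset.sum_le_sum fun k hk => ?_
  rw [← nsmul_eq_mul]
  refine Finset.sum_le_card_nsmul _ _ _ fun α hα => ?_
  rw [Finset.mem_piAntidiag] at hα
  obtain ⟨v, hv, hvM⟩ := exists_isWeakDeriv_of_sobBound hq hK h (α := α)
    (by rw [hα.1]; exact Nat.lt_succ_iff.1 (Finset.mem_range.1 hk))
  exact (iInf₂_le v hv).trans hvM

lemma IsWeakDeriv.ae_eq (h : IsWeakDeriv α u v) (h' : IsWeakDeriv α u v') : v =ᵐ[volume] v' := by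
  refine ae_eq_of_integral_contDiff_smul_eq h.2.1 h'.2.1 fun η hη hηc => ?_
  have h1 := h.2.2 η hη hηc
  rw [h'.2.2 η hη hηc] at h1
  have h2 : ((-1 : ℝ) ^ ∑ i, α i) ≠ 0 := by positivity
  simpa [mul_comm] using (mul_left_cancel₀ h2 h1).symm

/-- Derivatives of a test function supported off `K` remain supported off `K`, where `u` vanishes.
-/
lemma IsWeakDeriv.ae_eq_zero (h : IsWeakDeriv α u v) (hK : IsClosed K)
    (h0 : ∀ x, x ∉ K → u x = 0) : ∀ᵐ x, x ∉ K → v x = 0 := by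
  refine hK.isOpen_compl.ae_eq_zero_of_integral_contDiff_smul_eq_zero
    (h.2.1.locallyIntegrableOn _) fun η hη hηc hηK => ?_
  have h1 := h.2.2 η hη hηc
  have h2 : ∀ x, u x * multiD α η x = 0 := fun x => by
    by_cases hx : x ∈ K
    · have : multiD α η x = 0 := by
        by_contra hne
        exact hηK (tsupport_multiD_subset α η (subset_tsupport _ hne)) hx
      rw [this, mul_zero]
    · rw [h0 x hx, zero_mul]
  simp only [h2, integral_zero] at h1
  have h3 : ((-1 : ℝ) ^ ∑ i, α i) ≠ 0 := by positivity
  have := (mul_eq_zero.1 h1.symm).resolve_left h3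
  simpa [mul_comm] using this

/-- A function of finite Sobolev norm, vanishing outside a compact set. -/
lemma sobBound_of_sobolevNorm (hK : IsCompact K) (h0 : ∀ x, x ∉ K → u x = 0)
    (hfin : sobolevNorm l q u ≠ ⊤) : SobBound q K l (sobolevNorm l q u) u := by
  have hle : ∀ α : Fin d → ℕ, ∑ i, α i ≤ l →
      (⨅ (v : EuclideanSpace ℝ (Fin d) → ℝ) (_ : IsWeakDeriv α u v), eLpNorm v q volume) ≤
        sobolevNorm l q u := by
    intro α hα
    unfold sobolevNorm
    refine le_trans ?_ (Finset.single_le_sum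
      (f := fun k => ∑ α ∈ Finset.piAntidiag (Finset.univ : Finset (Fin d)) k,
        ⨅ (v : EuclideanSpace ℝ (Fin d) → ℝ) (_ : IsWeakDeriv α u v), eLpNorm v q volume)
      (fun _ _ => zero_le) (Finset.mem_range.2 (Nat.lt_succ_iff.2 hα)))
    exact Finset.single_le_sum (f := fun α : Fin d → ℕ =>
      ⨅ (v : EuclideanSpace ℝ (Fin d) → ℝ) (_ : IsWeakDeriv α u v), eLpNorm v q volume)
      (fun _ _ => zero_le) (Finset.mem_piAntidiag.2 ⟨rfl, fun _ _ => Finset.mem_univ _⟩)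
  have hex : ∀ α : Fin d → ℕ, ∑ i, α i ≤ l → ∃ v, IsWeakDeriv α u v ∧ (∀ x, x ∉ K → v x = 0) ∧
      MemLp v q ∧ eLpNorm v q ≤ sobolevNorm l q u := by
    intro α hα
    obtain ⟨v, hv⟩ : ∃ v, IsWeakDeriv α u v := by
      by_contra! hcon
      have := hle α hα
      simp [hcon] at this
      exact hfin this
    have hind : K.indicator v =ᵐ[volume] v := by
      filter_upwards [hv.ae_eq_zero hK.isClosed h0] with x hx
      by_cases h : x ∈ K
      · simp [h]
      · simp [h, hx h]
    have hvm : AEStronglyMeasurable v volume := hv.2.1.aestronglyMeasurable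
    have hv' : IsWeakDeriv α u (K.indicator v) := by
      refine ⟨hv.1, (locallyIntegrable_congr hind).2 hv.2.1, fun η hη hηc => ?_⟩
      rw [hv.2.2 η hη hηc]
      congr 1
      refine integral_congr_ae ?_
      filter_upwards [hind] with x hx
      rw [hx]
    -- Weak derivatives are unique almost everywhere, so the infimum in the Sobolev norm is attained
    -- by any of them, including the version cut off to vanish outside `K`.
    have hnorm : eLpNorm (K.indicator v) q ≤ sobolevNorm l q u := by
      refine le_trans (le_iInf₂ fun w hw => ?_) (hle α hα)
      exact (eLpNorm_congr_ae (hv'.ae_eq hw)).le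
    exact ⟨_, hv', fun x hx => indicator_of_notMem hx _,
      ⟨hvm.indicator hK.measurableSet, hnorm.trans_lt hfin.lt_top⟩, hnorm⟩
  -- The inductive bound follows because `D (α + eᵢ)` is a weak `i`-th partial derivative of `D α`:
  -- test the identity for `α` on `∂ᵢ η`.
  choose! D hD using hex
  have key : ∀ j, ∀ α : Fin d → ℕ, ∑ i, α i + j ≤ l → SobBound q K j (sobolevNorm l q u) (D α) := by
    intro j
    induction j with
    | zero =>
      intro α hα
      obtain ⟨-, h1, h2, h3⟩ := hD α hα
      exact ⟨h2, h1, h3⟩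
    | succ j ih =>
      intro α hα
      obtain ⟨h4, h1, h2, h3⟩ := hD α (by omega)
      refine ⟨⟨h2, h1, h3⟩, fun i => ⟨D (α + Pi.single i 1), fun η hη hηc => ?_, ?_⟩⟩
      · have hsum : ∑ j, (α + Pi.single i 1 : Fin d → ℕ) j = ∑ j, α j + 1 := by
          simp [Finset.sum_add_distrib]
        obtain ⟨h5, -⟩ := hD (α + Pi.single i 1) (by omega)
        have h6 := h4.2.2 _ (contDiff_partialD i hη) (hηc.partialD i)
        have h7 := h5.2.2 η hη hηc
        rw [multiD_add_single α i hη, ← multiD_partialD α i hη, h6, hsum, pow_succ] at h7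
        have h8 : ((-1 : ℝ) ^ ∑ i, α i) ≠ 0 := by positivity
        apply mul_left_cancel₀ h8
        linarith
      · refine ih _ ?_
        have hsum : ∑ j, (α + Pi.single i 1 : Fin d → ℕ) j = ∑ j, α j + 1 := by
          simp [Finset.sum_add_distrib]
        omega
  have h1 := hD 0 (by simp)
  have hu : IsWeakDeriv 0 u u := ⟨h1.1.1, h1.1.1, fun η _ _ => by simp [multiD_zero]⟩
  exact (key l 0 (by simp)).congr_ae (h1.1.ae_eq hu) h0

end SobolevNorm

/-! ### Smooth approximation in `L^1`. -/

section Mollification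

variable {d : ℕ} {u v : EuclideanSpace ℝ (Fin d) → ℝ}

/-- Translations act continuously on integrable functions. -/
lemma exists_lintegral_translate_sub_le (hu : Integrable u) {ε : ℝ≥0∞} (hε : ε ≠ 0) :
    ∃ δ > 0, ∀ h : EuclideanSpace ℝ (Fin d), ‖h‖ < δ → ∫⁻ x, ‖u (x - h) - u x‖ₑ ≤ ε := by
  have hε3 : ε / 3 ≠ 0 := by simp [hε]
  obtain ⟨g, hgc, hug, hg, hgi⟩ := hu.exists_hasCompactSupport_lintegral_sub_le hε3
  set K := Metric.cthickening 1 (tsupport g) with hK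
  have hKc : IsCompact K := hgc.isCompact.cthickening
  obtain ⟨η, hη, hηK⟩ := ENNReal.exists_nnreal_pos_mul_lt
    (hKc.measure_lt_top (μ := volume)).ne hε3
  obtain ⟨δ, hδ, hgδ⟩ := Metric.uniformContinuous_iff.1 (hgc.uniformContinuous_of_continuous hg)
    η (by exact_mod_cast hη)
  refine ⟨min δ 1, by positivity, fun h hh => ?_⟩
  have h1 : ∀ x, ‖g (x - h) - g x‖ₑ ≤ K.indicator (fun _ => (η : ℝ≥0∞)) x := by
    intro x
    by_cases hx : x ∈ K
    · rw [indicator_of_mem hx]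
      have := hgδ (a := x - h) (b := x) (by
        rw [dist_eq_norm]; simpa using hh.trans_le (min_le_left _ _))
      rw [dist_eq_norm] at this
      rw [← enorm_norm, Real.enorm_eq_ofReal (norm_nonneg _)]
      exact ENNReal.ofReal_le_of_le_toReal (by simpa using this.le)
    · have h2 : g x = 0 := by
        by_contra hne
        exact hx (Metric.self_subset_cthickening _ (subset_tsupport _ hne))
      have h3 : g (x - h) = 0 := by
        by_contra hne
        refine hx (Metric.mem_cthickening_of_dist_le x (x - h) 1 _ (subset_tsupport _ hne) ?_)
        rw [dist_eq_norm]
        simpa using (hh.trans_le (min_le_right _ _)).le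
      simp [h2, h3]
  have h2 : ∫⁻ x, ‖u (x - h) - g (x - h)‖ₑ ≤ ε / 3 := by
    rw [lintegral_sub_right_eq_self (fun x => ‖u x - g x‖ₑ) h]
    exact hug
  have hm : AEMeasurable (fun x => ‖u (x - h) - g (x - h)‖ₑ) :=
    ((hu.sub hgi).comp_sub_right h).aestronglyMeasurable.enorm
  calc ∫⁻ x, ‖u (x - h) - u x‖ₑ
      ≤ ∫⁻ x, (‖u (x - h) - g (x - h)‖ₑ + (‖g (x - h) - g x‖ₑ + ‖u x - g x‖ₑ)) := by
        refine lintegral_mono fun x => ?_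
        have e : u (x - h) - u x = (u (x - h) - g (x - h)) + ((g (x - h) - g x) + -(u x - g x)) := by
          ring
        rw [e]
        refine (enorm_add_le _ _).trans ?_
        gcongr
        refine (enorm_add_le _ _).trans ?_
        rw [enorm_neg]
    _ = (∫⁻ x, ‖u (x - h) - g (x - h)‖ₑ) + ((∫⁻ x, ‖g (x - h) - g x‖ₑ) + ∫⁻ x, ‖u x - g x‖ₑ) := by
        have := hg.measurable
        rw [lintegral_add_left' hm,
          lintegral_add_left (by fun_prop : Measurable fun x => g (x - h) - g x).enorm]
    _ ≤ ε / 3 + (ε / 3 + ε / 3) := by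
        gcongr
        refine (lintegral_mono h1).trans ?_
        rw [lintegral_indicator_const hKc.measurableSet]
        exact hηK.le
    _ = ε := by rw [← add_assoc]; exact ENNReal.add_thirds ε

/-- The convolution of `u` with a smooth function. -/
def smoothed (ρ u : EuclideanSpace ℝ (Fin d) → ℝ) : EuclideanSpace ℝ (Fin d) → ℝ :=
  convolution u ρ (ContinuousLinearMap.lsmul ℝ ℝ) volume

lemma smoothed_apply (ρ u : EuclideanSpace ℝ (Fin d) → ℝ) (x : EuclideanSpace ℝ (Fin d)) :
    smoothed ρ u x = ∫ t, u t * ρ (x - t) := rfl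

lemma contDiff_smoothed (hu : Integrable u) {ρ : EuclideanSpace ℝ (Fin d) → ℝ}
    (hρ : ContDiff ℝ ∞ ρ) (hρc : HasCompactSupport ρ) : ContDiff ℝ ∞ (smoothed ρ u) :=
  hρc.contDiff_convolution_right _ hu.locallyIntegrable hρ

/-- Differentiation falls on the kernel, and `t ↦ ρ(x - t)` is a test function, so the weak
derivative of `u` can be used with a fixed `x`. -/
lemma partialD_smoothed {i : Fin d} (hu : Integrable u) (h : WeakPartial i u v)
    {ρ : EuclideanSpace ℝ (Fin d) → ℝ} (hρ : ContDiff ℝ ∞ ρ) (hρc : HasCompactSupport ρ) :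
    partialD i (smoothed ρ u) = smoothed ρ v := by
  ext x
  have hρ1 : ContDiff ℝ 1 ρ := hρ.of_le (by exact_mod_cast le_top)
  have h1 := hρc.hasFDerivAt_convolution_right (ContinuousLinearMap.lsmul ℝ ℝ) hu.locallyIntegrable
    hρ1 x
  have h2 : partialD i (smoothed ρ u) x = ∫ t, u t * partialD i ρ (x - t) := by
    unfold partialD smoothed
    rw [h1.fderiv, convolution_precompR_apply _ hu.locallyIntegrable (hρc.fderiv ℝ)
      (hρ1.continuous_fderiv one_ne_zero)]
    rfl
  have hη : ContDiff ℝ ∞ fun t => ρ (x - t) := hρ.comp (contDiff_const.sub contDiff_id)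
  have hηc : HasCompactSupport fun t => ρ (x - t) := hρc.comp_homeomorph (Homeomorph.subLeft x)
  have h3 := h _ hη hηc
  have h4 : ∀ t, partialD i (fun t => ρ (x - t)) t = -partialD i ρ (x - t) := by
    intro t
    unfold partialD
    have hd : HasFDerivAt (fun t => x - t) (-ContinuousLinearMap.id ℝ _) t := by
      simpa using (hasFDerivAt_id t).const_sub x
    have := ((hρ.differentiable (by simp) (x - t)).hasFDerivAt.comp t hd).fderiv
    change fderiv ℝ (ρ ∘ fun t => x - t) t _ = _
    rw [this]
    simp
  simp_rw [h4, mul_neg, integral_neg, neg_inj] at h3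
  rw [h2, smoothed_apply, h3]

/-- A convolution is an average of translates by small vectors, each of which is close to `u` in
`L^1`. -/
lemma exists_lintegral_smoothed_sub_le (hu : Integrable u) {ε : ℝ≥0∞} (hε : ε ≠ 0) :
    ∃ δ > 0, ∀ ρ : EuclideanSpace ℝ (Fin d) → ℝ, Continuous ρ → HasCompactSupport ρ →
      (∀ x, 0 ≤ ρ x) → ∫ x, ρ x = 1 → (∀ x, ρ x ≠ 0 → ‖x‖ < δ) →
      ∫⁻ x, ‖smoothed ρ u x - u x‖ₑ ≤ ε := by
  obtain ⟨δ, hδ, H⟩ := exists_lintegral_translate_sub_le hu hε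
  refine ⟨δ, hδ, fun ρ hρ hρc hρ0 hρ1 hρδ => ?_⟩
  -- Exchanging the integrals over `x` and `h` needs joint measurability of `w(x - h)`, so a
  -- measurable version is used.
  set w := hu.1.mk u with hw
  have huw : u =ᵐ[volume] w := hu.1.ae_eq_mk
  have hwm : Measurable w := hu.1.stronglyMeasurable_mk.measurable
  have hwi : Integrable w := hu.congr huw
  have hsm : ∀ x, smoothed ρ u x = smoothed ρ w x := fun x => by
    rw [smoothed_apply, smoothed_apply]
    refine integral_congr_ae ?_
    filter_upwards [huw] with t ht
    rw [ht]
  have hpt : ∀ x, smoothed ρ w x - w x = ∫ h, (w (x - h) - w x) * ρ h := by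
    intro x
    have hi1 : Integrable fun h => w (x - h) * ρ h :=
      (hwi.comp_sub_left x).mul_of_hasCompactSupport hρ hρc
    have hi2 : Integrable fun h => w x * ρ h :=
      (hρ.integrable_of_hasCompactSupport hρc).const_mul _
    simp_rw [sub_mul]
    rw [integral_sub hi1 hi2, integral_const_mul, hρ1, mul_one]
    congr 1
    exact convolution_eq_swap _
  have hρe : ∫⁻ h, ENNReal.ofReal (ρ h) = 1 := by
    rw [← ofReal_integral_eq_lintegral_ofReal (hρ.integrable_of_hasCompactSupport hρc)
      (ae_of_all _ hρ0), hρ1, ENNReal.ofReal_one]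
  have hρm := hρ.measurable
  calc ∫⁻ x, ‖smoothed ρ u x - u x‖ₑ = ∫⁻ x, ‖∫ h, (w (x - h) - w x) * ρ h‖ₑ := by
        refine lintegral_congr_ae ?_
        filter_upwards [huw] with x hx
        rw [hsm, hx, hpt]
    _ ≤ ∫⁻ x, ∫⁻ h, ‖w (x - h) - w x‖ₑ * ENNReal.ofReal (ρ h) := by
        refine lintegral_mono fun x => (enorm_integral_le_lintegral_enorm _).trans_eq ?_
        refine lintegral_congr fun h => ?_
        rw [enorm_mul, Real.enorm_eq_ofReal (hρ0 h)]
    _ = ∫⁻ h, ∫⁻ x, ‖w (x - h) - w x‖ₑ * ENNReal.ofReal (ρ h) := by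
        refine lintegral_lintegral_swap (Measurable.aemeasurable ?_)
        have : Measurable fun z : EuclideanSpace ℝ (Fin d) × EuclideanSpace ℝ (Fin d) =>
            w (z.1 - z.2) - w z.1 := by fun_prop
        exact this.enorm.mul (by fun_prop)
    _ ≤ ∫⁻ h, ε * ENNReal.ofReal (ρ h) := by
        refine lintegral_mono fun h => ?_
        dsimp only
        rw [lintegral_mul_const' _ _ ENNReal.ofReal_ne_top]
        by_cases h0 : ρ h = 0
        · simp [h0]
        gcongr
        refine le_trans (le_of_eq ?_) (H h (hρδ h h0))
        refine lintegral_congr_ae ?_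
        have h5 : (fun x => u (x - h)) =ᵐ[volume] fun x => w (x - h) :=
          (measurePreserving_sub_right volume h).quasiMeasurePreserving.ae_eq_comp huw
        filter_upwards [huw, h5] with x hx hx'
        rw [hx, hx']
    _ = ε := by
        rw [lintegral_const_mul _ (by fun_prop), hρe, mul_one]

/-- Smooth approximation in `L¹` of a function together with its weak derivatives. -/
lemma exists_smooth_approx {v : Fin d → EuclideanSpace ℝ (Fin d) → ℝ} (hu : Integrable u)
    (hv : ∀ j, Integrable (v j)) (h : ∀ j, WeakPartial j u (v j)) {ε : ℝ≥0∞} (hε : ε ≠ 0) :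
    ∃ w : EuclideanSpace ℝ (Fin d) → ℝ, ContDiff ℝ ∞ w ∧ Integrable w ∧
      (∀ j, Integrable (partialD j w)) ∧ ∫⁻ x, ‖w x - u x‖ₑ ≤ ε ∧
      ∀ j, ∫⁻ x, ‖partialD j w x - v j x‖ₑ ≤ ε := by
  obtain ⟨δ, hδ, H⟩ := exists_lintegral_smoothed_sub_le hu hε
  choose δ' hδ' H' using fun j => exists_lintegral_smoothed_sub_le (hv j) hε
  obtain ⟨r, hr, hrδ, hrδ'⟩ : ∃ r > 0, r < δ ∧ ∀ j, r < δ' j := by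
    have h1 : ∀ᶠ r in 𝓝[>] (0 : ℝ), r < δ := nhdsWithin_le_nhds (gt_mem_nhds hδ)
    have h2 : ∀ᶠ r in 𝓝[>] (0 : ℝ), ∀ j, r < δ' j :=
      eventually_all.2 fun j => nhdsWithin_le_nhds (gt_mem_nhds (hδ' j))
    obtain ⟨r, hr⟩ := (h1.and (h2.and self_mem_nhdsWithin)).exists
    exact ⟨r, hr.2.2, hr.1, hr.2.1⟩
  set b : ContDiffBump (0 : EuclideanSpace ℝ (Fin d)) := ⟨r / 2, r, by positivity, by linarith⟩
  set ρ := b.normed volume with hρd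
  have hρ : ContDiff ℝ ∞ ρ := b.contDiff_normed
  have hρc : HasCompactSupport ρ := b.hasCompactSupport_normed
  have hsupp : ∀ x, ρ x ≠ 0 → ‖x‖ < r := fun x hx => by
    have : x ∈ Function.support ρ := hx
    rw [hρd, b.support_normed_eq] at this
    simpa using this
  have hρi := b.integrable_normed (μ := volume)
  have hp : ∀ j, partialD j (smoothed ρ u) = smoothed ρ (v j) := fun j =>
    partialD_smoothed hu (h j) hρ hρc
  refine ⟨smoothed ρ u, contDiff_smoothed hu hρ hρc, hu.integrable_convolution _ hρi, fun j => ?_,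
    H ρ hρ.continuous hρc b.nonneg_normed (b.integral_normed) fun x hx => (hsupp x hx).trans hrδ,
    fun j => ?_⟩
  · rw [hp]; exact (hv j).integrable_convolution _ hρi
  · rw [hp]
    exact H' j ρ hρ.continuous hρc b.nonneg_normed (b.integral_normed)
      fun x hx => (hsupp x hx).trans (hrδ' j)

end Mollification

/-! ### Pulling back Sobolev functions along submersions. -/

section Composition

variable {d e : ℕ}

/-- The image under `Q` of the restriction of `ν` to `T` has a bounded density. -/
def PushBound {X : Type*} [MeasurableSpace X] (ν : Measure X) (Q : X → EuclideanSpace ℝ (Fin d))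
    (T : Set X) (C : ℝ≥0) : Prop :=
  ∀ A : Set (EuclideanSpace ℝ (Fin d)), ν (T ∩ Q ⁻¹' A) ≤ C * volume A

/-- The image measure is dominated by a multiple of Lebesgue measure, so `w ∘ Q` inherits
measurability and an `L^q` bound from `w`. The dimensions may differ, hence no change of variables
is involved. The maximum with one makes the exponent `1/q ≤ 1` harmless. -/
lemma PushBound.memLp_mul_comp {X : Type*} [MeasurableSpace X] {ν : Measure X}
    {Q : X → EuclideanSpace ℝ (Fin d)} {T : Set X} {C : ℝ≥0} (hP : PushBound ν Q T C)
    (hT : MeasurableSet T) (hQ : AEMeasurable Q (ν.restrict T)) {a : X → ℝ} {Z : ℝ}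
    (ha : AEStronglyMeasurable a ν) (haZ : ∀ x, ‖a x‖ ≤ Z) (ha0 : ∀ x, x ∉ T → a x = 0)
    {q : ℝ≥0∞} (hq : 1 ≤ q) {w : EuclideanSpace ℝ (Fin d) → ℝ} (hw : MemLp w q) :
    MemLp (fun x => a x * w (Q x)) q ν ∧
      eLpNorm (fun x => a x * w (Q x)) q ν ≤ ENNReal.ofReal Z * (max C 1 : ℝ≥0) * eLpNorm w q := by
  have hC1 : (1 : ℝ≥0∞) ≤ (max C 1 : ℝ≥0) := by exact_mod_cast le_max_right C 1
  have hmap : (ν.restrict T).map Q ≤ ((max C 1 : ℝ≥0) : ℝ≥0∞) • volume := by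
    refine Measure.le_iff.2 fun A hA => ?_
    rw [Measure.map_apply_of_aemeasurable hQ hA, Measure.smul_apply, smul_eq_mul,
      Measure.restrict_apply' hT, inter_comm]
    refine (hP A).trans ?_
    gcongr
    exact le_max_left _ _
  have hwm : AEStronglyMeasurable w ((ν.restrict T).map Q) :=
    (hw.1.mono_ac Measure.smul_absolutelyContinuous).mono_measure hmap
  have hwQ : AEStronglyMeasurable (fun x => w (Q x)) (ν.restrict T) := hwm.comp_aemeasurable hQ
  have hind : (fun x => a x * w (Q x)) = T.indicator fun x => a x * w (Q x) := by
    ext x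
    by_cases hx : x ∈ T
    · simp [hx]
    · simp [hx, ha0 x hx]
  have hb : ∀ x, ‖a x * w (Q x)‖ ≤ Z * ‖w (Q x)‖ := fun x => by
    rw [norm_mul]; gcongr; exact haZ x
  have hnorm : eLpNorm (fun x => w (Q x)) q (ν.restrict T) ≤ (max C 1 : ℝ≥0) * eLpNorm w q := by
    have e1 : eLpNorm (fun x => w (Q x)) q (ν.restrict T) = eLpNorm w q ((ν.restrict T).map Q) :=
      (eLpNorm_map_measure hwm hQ).symm
    rw [e1]
    refine (eLpNorm_mono_measure _ hmap).trans ?_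
    rw [eLpNorm_smul_measure_of_ne_zero (zero_lt_one.trans_le hC1).ne', smul_eq_mul]
    gcongr
    calc _ ≤ ((max C 1 : ℝ≥0) : ℝ≥0∞) ^ (1 : ℝ) := by
          refine ENNReal.rpow_le_rpow_of_exponent_le hC1 ?_
          refine ENNReal.toReal_le_of_le_ofReal zero_le_one ?_
          simpa using hq
      _ = _ := ENNReal.rpow_one _
  have hle : eLpNorm (fun x => a x * w (Q x)) q ν ≤
      ENNReal.ofReal Z * (max C 1 : ℝ≥0) * eLpNorm w q := by
    rw [hind, eLpNorm_indicator_eq_eLpNorm_restrict hT]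
    refine (eLpNorm_le_mul_eLpNorm_of_ae_le_mul (ae_of_all _ hb) q).trans ?_
    rw [mul_assoc]
    gcongr
  refine ⟨⟨?_, hle.trans_lt ?_⟩, hle⟩
  · rw [hind]
    exact (aestronglyMeasurable_indicator_iff hT).2 (ha.restrict.mul hwQ)
  · exact (ENNReal.mul_ne_top (ENNReal.mul_ne_top ENNReal.ofReal_ne_top ENNReal.coe_ne_top)
      hw.2.ne).lt_top

lemma contDiff_of_tsupport' {E : Type*} [NormedAddCommGroup E] [NormedSpace ℝ E] {a : E → ℝ}
    (h : ∀ x ∈ tsupport a, ContDiffAt ℝ ∞ a x) : ContDiff ℝ ∞ a := by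
  refine contDiff_iff_contDiffAt.2 fun x => ?_
  by_cases hx : x ∈ tsupport a
  · exact h x hx
  · exact contDiffAt_const.congr_of_eventuallyEq (notMem_tsupport_iff_eventuallyEq.1 hx)

/-- The products `a · ∂ᵢ Qⱼ`, which occur in the chain rule. -/
def mulPartial (a : EuclideanSpace ℝ (Fin e) → ℝ)
    (Q : EuclideanSpace ℝ (Fin e) → EuclideanSpace ℝ (Fin d)) (i : Fin e) (j : Fin d) :
    EuclideanSpace ℝ (Fin e) → ℝ :=
  fun x => a x * fderiv ℝ Q x (EuclideanSpace.single i 1) j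

variable {Q : EuclideanSpace ℝ (Fin e) → EuclideanSpace ℝ (Fin d)}
  {T : Set (EuclideanSpace ℝ (Fin e))} {a : EuclideanSpace ℝ (Fin e) → ℝ}

lemma tsupport_mulPartial_subset (i : Fin e) (j : Fin d) : tsupport (mulPartial a Q i j) ⊆ tsupport a :=
  closure_mono fun x hx h => hx (by simp [mulPartial, h])

lemma contDiff_mulPartial (ha : ContDiff ℝ ∞ a) (haT : tsupport a ⊆ T)
    (hQ : ∀ x ∈ T, ContDiffAt ℝ ∞ Q x) (i : Fin e) (j : Fin d) : ContDiff ℝ ∞ (mulPartial a Q i j) := by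
  refine contDiff_of_tsupport' fun x hx => ?_
  have hQx := hQ x (haT (tsupport_mulPartial_subset i j hx))
  have h1 : ContDiffAt ℝ ∞ (fun x => fderiv ℝ Q x (EuclideanSpace.single i 1)) x :=
    (hQx.fderiv_right (m := ∞) (by simp)).clm_apply contDiffAt_const
  have h2 : ContDiffAt ℝ ∞ (fun x => fderiv ℝ Q x (EuclideanSpace.single i 1) j) x :=
    (contDiffAt_piLp_apply (p := 2) (i := j)).comp x h1
  exact ha.contDiffAt.mul h2

lemma contDiff_mul_comp (ha : ContDiff ℝ ∞ a) (haT : tsupport a ⊆ T)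
    (hQ : ∀ x ∈ T, ContDiffAt ℝ ∞ Q x) {w : EuclideanSpace ℝ (Fin d) → ℝ} (hw : ContDiff ℝ ∞ w) :
    ContDiff ℝ ∞ fun x => a x * w (Q x) := by
  refine contDiff_of_tsupport' fun x hx => ?_
  have hx' : x ∈ tsupport a := tsupport_mul_subset_left (f := a) (g := fun x => w (Q x)) hx
  exact ha.contDiffAt.mul (hw.contDiffAt.comp x (hQ x (haT hx')))

lemma sum_mul_partialD (w : EuclideanSpace ℝ (Fin d) → ℝ) (y v : EuclideanSpace ℝ (Fin d)) :
    fderiv ℝ w y v = ∑ j, v j * partialD j w y := by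
  conv_lhs => rw [← (EuclideanSpace.basisFun (Fin d) ℝ).sum_repr v]
  rw [map_sum]
  refine Finset.sum_congr rfl fun j _ => ?_
  rw [map_smul]
  simp [partialD]

/-- Regularity of `Q` is available only on `T`; off the support of `a` the function vanishes near
the point and both sides are zero. -/
lemma partialD_mul_comp (ha : ContDiff ℝ ∞ a) (haT : tsupport a ⊆ T)
    (hQ : ∀ x ∈ T, ContDiffAt ℝ ∞ Q x) {w : EuclideanSpace ℝ (Fin d) → ℝ} (hw : ContDiff ℝ ∞ w)
    (i : Fin e) (x : EuclideanSpace ℝ (Fin e)) :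
    partialD i (fun x => a x * w (Q x)) x =
      partialD i a x * w (Q x) + ∑ j, mulPartial a Q i j x * partialD j w (Q x) := by
  by_cases hx : x ∈ tsupport a
  · have hQx := (hQ x (haT hx)).differentiableAt (by simp)
    have hwx := hw.differentiable (by simp) (Q x)
    have h1 : partialD i (fun x => a x * w (Q x)) x =
        a x * fderiv ℝ (fun x => w (Q x)) x (EuclideanSpace.single i 1) + partialD i a x * w (Q x) := by
      unfold partialD
      rw [fderiv_fun_mul (d := fun x => w (Q x)) (ha.differentiable (by simp) x) (hwx.comp x hQx)]
      simp [mul_comm]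
    have h2 : fderiv ℝ (fun x => w (Q x)) x = (fderiv ℝ w (Q x)).comp (fderiv ℝ Q x) :=
      fderiv_comp x hwx hQx
    rw [h1, h2, ContinuousLinearMap.comp_apply, sum_mul_partialD, Finset.mul_sum, add_comm]
    simp [mulPartial, mul_assoc]
  · have h0 : a =ᶠ[𝓝 x] 0 := notMem_tsupport_iff_eventuallyEq.1 hx
    have h1 : (fun x => a x * w (Q x)) =ᶠ[𝓝 x] fun _ => 0 := by
      filter_upwards [h0] with y hy
      simp [hy]
    unfold partialD mulPartial
    rw [h1.fderiv_eq, h0.fderiv_eq, h0.self_of_nhds]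
    simp

lemma integral_mul_partialD {f η : EuclideanSpace ℝ (Fin e) → ℝ} (hf : ContDiff ℝ ∞ f)
    (hη : ContDiff ℝ ∞ η) (hηc : HasCompactSupport η) (i : Fin e) :
    ∫ x, f x * partialD i η x = -∫ x, partialD i f x * η x := by
  unfold partialD
  refine integral_mul_fderiv_eq_neg_fderiv_mul_of_integrable ?_ ?_ ?_
    (fun x _ => hf.differentiable (by simp) x) (fun x _ => hη.differentiable (by simp) x)
  · exact ((contDiff_partialD i hf).continuous.mul hη.continuous).integrable_of_hasCompactSupport
      (hηc.mul_left (f := partialD i f))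
  · exact (hf.continuous.mul (contDiff_partialD i hη).continuous).integrable_of_hasCompactSupport
      ((hηc.partialD i).mul_left (f := f))
  · exact (hf.continuous.mul hη.continuous).integrable_of_hasCompactSupport (hηc.mul_left (f := f))

variable {C : ℝ≥0} {q : ℝ≥0∞}

lemma aemeasurable_of_contDiffAt (hT : IsCompact T) (hQ : ∀ x ∈ T, ContDiffAt ℝ ∞ Q x) :
    AEMeasurable Q (volume.restrict T) :=
  ContinuousOn.aemeasurable (fun x hx => (hQ x hx).continuousAt.continuousWithinAt) hT.measurableSet

lemma exists_bound_of_tsupport {a : EuclideanSpace ℝ (Fin e) → ℝ} (hT : IsCompact T)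
    (ha : Continuous a) (haT : tsupport a ⊆ T) : ∃ Z : ℝ≥0, ∀ x, ‖a x‖ ≤ Z := by
  obtain ⟨Z, hZ⟩ := (HasCompactSupport.of_support_subset_isCompact hT
    ((subset_tsupport a).trans haT)).exists_bound_of_continuous ha
  exact ⟨Z.toNNReal, fun x => (hZ x).trans (Real.le_coe_toNNReal Z)⟩

/-- Closeness in `L¹` of `w` and `u` implies closeness of the integrals of `a · w∘Q · η`. -/
lemma exists_abs_integral_sub_le (hP : PushBound volume Q T C) (hT : IsCompact T)
    (hQ : ∀ x ∈ T, ContDiffAt ℝ ∞ Q x) (ha : ContDiff ℝ ∞ a) (haT : tsupport a ⊆ T)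
    {η : EuclideanSpace ℝ (Fin e) → ℝ} (hη : Continuous η) :
    ∃ Z : ℝ≥0, ∀ u : EuclideanSpace ℝ (Fin d) → ℝ, Integrable u →
      Integrable (fun x => a x * u (Q x) * η x) ∧
      ∀ w : EuclideanSpace ℝ (Fin d) → ℝ, Integrable w →
        ENNReal.ofReal |(∫ x, a x * w (Q x) * η x) - ∫ x, a x * u (Q x) * η x| ≤
          Z * ∫⁻ x, ‖w x - u x‖ₑ := by
  have hc : Continuous fun x => a x * η x := ha.continuous.mul hη
  have hs : tsupport (fun x => a x * η x) ⊆ T := (tsupport_mul_subset_left).trans haT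
  obtain ⟨Z, hZ⟩ := exists_bound_of_tsupport hT hc hs
  have hz : ∀ x, x ∉ T → a x * η x = 0 := fun x hx => by
    by_contra h
    exact hx (hs (subset_tsupport _ h))
  have key : ∀ u : EuclideanSpace ℝ (Fin d) → ℝ, Integrable u →
      Integrable (fun x => a x * η x * u (Q x)) ∧ ∫⁻ x, ‖a x * η x * u (Q x)‖ₑ ≤
        ENNReal.ofReal Z * (max C 1 : ℝ≥0) * ∫⁻ x, ‖u x‖ₑ := by
    intro u hu
    have := hP.memLp_mul_comp hT.measurableSet (aemeasurable_of_contDiffAt hT hQ)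
      hc.aestronglyMeasurable hZ hz le_rfl (memLp_one_iff_integrable.2 hu)
    rw [memLp_one_iff_integrable, eLpNorm_one_eq_lintegral_enorm, eLpNorm_one_eq_lintegral_enorm] at this
    exact this
  have hcomm : ∀ (u : EuclideanSpace ℝ (Fin d) → ℝ) x, a x * u (Q x) * η x =
      a x * η x * u (Q x) := fun u x => by ring
  refine ⟨Z * max C 1, fun u hu => ⟨by simp_rw [hcomm]; exact (key u hu).1, fun w hw => ?_⟩⟩
  simp_rw [hcomm]
  rw [← integral_sub (key w hw).1 (key u hu).1, ← Real.norm_eq_abs, ofReal_norm]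
  refine (enorm_integral_le_lintegral_enorm _).trans ?_
  have := (key (fun x => w x - u x) (hw.sub hu)).2
  simp_rw [mul_sub] at this
  refine this.trans (le_of_eq ?_)
  rw [ENNReal.ofReal_coe_nnreal]
  push_cast
  rfl

/-- The chain rule for weak derivatives. -/
lemma WeakPartial.mul_comp (hP : PushBound volume Q T C) (hT : IsCompact T)
    (hQ : ∀ x ∈ T, ContDiffAt ℝ ∞ Q x) (ha : ContDiff ℝ ∞ a) (haT : tsupport a ⊆ T)
    {u : EuclideanSpace ℝ (Fin d) → ℝ} {v : Fin d → EuclideanSpace ℝ (Fin d) → ℝ} (hu : Integrable u)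
    (hv : ∀ j, Integrable (v j)) (h : ∀ j, WeakPartial j u (v j)) (i : Fin e) :
    WeakPartial i (fun x => a x * u (Q x))
      (fun x => partialD i a x * u (Q x) + ∑ j, mulPartial a Q i j x * v j (Q x)) := by
  intro η hη hηc
  obtain ⟨Z₁, h₁⟩ := exists_abs_integral_sub_le hP hT hQ ha haT (contDiff_partialD i hη).continuous
  obtain ⟨Z₂, h₂⟩ := exists_abs_integral_sub_le hP hT hQ (contDiff_partialD i ha)
    ((tsupport_partialD_subset i a).trans haT) hη.continuous
  choose Z₃ h₃ using fun j => exists_abs_integral_sub_le hP hT hQ (contDiff_mulPartial ha haT hQ i j)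
    ((tsupport_mulPartial_subset i j).trans haT) hη.continuous
  have hsplit : ∀ (u : EuclideanSpace ℝ (Fin d) → ℝ) (v : Fin d → EuclideanSpace ℝ (Fin d) → ℝ),
      Integrable u → (∀ j, Integrable (v j)) →
      ∫ x, (partialD i a x * u (Q x) + ∑ j, mulPartial a Q i j x * v j (Q x)) * η x =
        (∫ x, partialD i a x * u (Q x) * η x) + ∑ j, ∫ x, mulPartial a Q i j x * v j (Q x) * η x := by
    intro u v hu hv
    simp_rw [add_mul, Finset.sum_mul]
    rw [integral_add (h₂ u hu).1 (integrable_finsetSum _ fun j _ => (h₃ j _ (hv j)).1),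
      integral_finsetSum _ fun j _ => (h₃ j _ (hv j)).1]
  rw [hsplit u v hu hv]
  set Zs : ℝ≥0 := Z₁ + (Z₂ + ∑ j, Z₃ j) with hZs
  have key : ∀ ε : ℝ≥0, 0 < ε → |(∫ x, a x * u (Q x) * partialD i η x) +
      ((∫ x, partialD i a x * u (Q x) * η x) + ∑ j, ∫ x, mulPartial a Q i j x * v j (Q x) * η x)| ≤
      Zs * ε := by
    intro ε hε
    obtain ⟨w, hw, hwi, hwp, hwu, hwv⟩ := exists_smooth_approx hu hv h
      (ε := ε) (by exact_mod_cast hε.ne')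
    -- For smooth `w` the identity is integration by parts and the classical chain rule. Each
    -- integral in it changes by at most a constant times `ε` when `w` and its partial derivatives
    -- are replaced by `u` and the `v j`.
    have hcl := integral_mul_partialD (contDiff_mul_comp ha haT hQ hw) hη hηc i
    simp_rw [partialD_mul_comp ha haT hQ hw i] at hcl
    rw [hsplit w _ hwi hwp] at hcl
    have conv : ∀ (Z : ℝ≥0) (r : ℝ) (m : ℝ≥0∞), ENNReal.ofReal |r| ≤ Z * m → m ≤ ε → |r| ≤ Z * ε := by
      intro Z r m h1 h2
      have h3 : ENNReal.ofReal |r| ≤ ((Z * ε : ℝ≥0) : ℝ≥0∞) := by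
        push_cast
        exact h1.trans (by gcongr)
      rw [ENNReal.ofReal, ENNReal.coe_le_coe, Real.toNNReal_le_iff_le_coe] at h3
      exact_mod_cast h3
    have e1 := conv _ _ _ ((h₁ u hu).2 w hwi) hwu
    have e2 := conv _ _ _ ((h₂ u hu).2 w hwi) hwu
    have e3 : |(∑ j, ∫ x, mulPartial a Q i j x * partialD j w (Q x) * η x) -
        ∑ j, ∫ x, mulPartial a Q i j x * v j (Q x) * η x| ≤ (∑ j, Z₃ j : ℝ≥0) * ε := by
      rw [← Finset.sum_sub_distrib]
      refine (Finset.abs_sum_le_sum_abs _ _).trans ?_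
      push_cast
      rw [Finset.sum_mul]
      exact Finset.sum_le_sum fun j _ => conv _ _ _ ((h₃ j _ (hv j)).2 _ (hwp j)) (hwv j)
    rw [hZs]
    push_cast at e3 ⊢
    rw [abs_le] at e1 e2 e3 ⊢
    constructor <;> nlinarith
  have h0 : (∫ x, a x * u (Q x) * partialD i η x) +
      ((∫ x, partialD i a x * u (Q x) * η x) + ∑ j, ∫ x, mulPartial a Q i j x * v j (Q x) * η x) = 0 := by
    by_contra hne
    have hpos := abs_pos.2 hne
    set R := |(∫ x, a x * u (Q x) * partialD i η x) +
      ((∫ x, partialD i a x * u (Q x) * η x) + ∑ j, ∫ x, mulPartial a Q i j x * v j (Q x) * η x)| with hR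
    have hR0 : 0 < R / (2 * ((Zs : ℝ) + 1)) := by positivity
    have := key (R / (2 * ((Zs : ℝ) + 1))).toNNReal (Real.toNNReal_pos.2 hR0)
    rw [Real.coe_toNNReal _ hR0.le] at this
    have hZ0 : (0 : ℝ) ≤ Zs := Zs.2
    have h4 : (Zs : ℝ) * (R / (2 * ((Zs : ℝ) + 1))) ≤ R / 2 := by
      rw [mul_div_assoc', div_le_div_iff₀ (by positivity) (by norm_num)]
      nlinarith
    linarith
  linarith

/-- Composition with a map along which the Lebesgue measure is pushed forward to a measure of
bounded density. -/
theorem exists_sobBound_mul_comp (hq : 1 ≤ q) (hP : PushBound volume Q T C) (hT : IsCompact T)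
    (hQ : ∀ x ∈ T, ContDiffAt ℝ ∞ Q x) {K : Set (EuclideanSpace ℝ (Fin d))} (hK : IsCompact K)
    (l : ℕ) (ha : ContDiff ℝ ∞ a) (haT : tsupport a ⊆ T) :
    ∃ c : ℝ≥0, ∀ (u : EuclideanSpace ℝ (Fin d) → ℝ) (M : ℝ≥0∞), SobBound q K l M u →
      SobBound q T l (c * M) fun x => a x * u (Q x) := by
  have hbase : ∀ {a : EuclideanSpace ℝ (Fin e) → ℝ}, ContDiff ℝ ∞ a → tsupport a ⊆ T →
      ∃ c : ℝ≥0, ∀ (u : EuclideanSpace ℝ (Fin d) → ℝ) (M : ℝ≥0∞), MemLp u q → eLpNorm u q ≤ M →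
        MemLp (fun x => a x * u (Q x)) q ∧ (∀ x, x ∉ T → a x * u (Q x) = 0) ∧
          eLpNorm (fun x => a x * u (Q x)) q ≤ c * M := by
    intro a ha haT
    obtain ⟨Z, hZ⟩ := exists_bound_of_tsupport hT ha.continuous haT
    have hz : ∀ x, x ∉ T → a x = 0 := fun x hx => by
      by_contra h
      exact hx (haT (subset_tsupport _ h))
    refine ⟨Z * max C 1, fun u M hu hM => ?_⟩
    obtain ⟨h1, h2⟩ := hP.memLp_mul_comp hT.measurableSet (aemeasurable_of_contDiffAt hT hQ)
      ha.continuous.aestronglyMeasurable hZ hz hq hu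
    refine ⟨h1, fun x hx => by simp [hz x hx], h2.trans ?_⟩
    rw [ENNReal.ofReal_coe_nnreal]
    push_cast
    gcongr
  -- The chain rule produces the coefficients `∂ᵢ a` and `a ∂ᵢ Qⱼ`, again smooth and supported in
  -- `T`; this is why the induction runs over all `a`.
  induction l generalizing a with
  | zero =>
    obtain ⟨c, hc⟩ := hbase ha haT
    exact ⟨c, fun u M h => hc u M h.1 h.2.2⟩
  | succ l ih =>
    obtain ⟨c₀, hc₀⟩ := hbase ha haT
    choose c₁ hc₁ using fun i => ih (contDiff_partialD i ha) ((tsupport_partialD_subset i a).trans haT)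
    choose c₂ hc₂ using fun i j => ih (contDiff_mulPartial ha haT hQ i j)
      ((tsupport_mulPartial_subset i j).trans haT)
    refine ⟨c₀ + ∑ i, (c₁ i + ∑ j, c₂ i j), fun u M h => ⟨?_, fun i => ?_⟩⟩
    · obtain ⟨h1, h2, h3⟩ := hc₀ u M h.1.1 h.1.2.2
      refine ⟨h1, h2, h3.trans ?_⟩
      gcongr
      exact le_self_add
    · choose v hv hvb using h.2
      refine ⟨_, WeakPartial.mul_comp hP hT hQ ha haT (h.integrable hq hK)
        (fun j => (hvb j).integrable hq hK) hv i, ?_⟩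
      refine ((hc₁ i u M h.of_succ).add hq hT
        (SobBound.sum hq hT Finset.univ fun j _ => hc₂ i j (v j) M (hvb j))).mono ?_
      rw [← Finset.sum_mul, ← add_mul]
      gcongr
      have : c₁ i + ∑ j, c₂ i j ≤ c₀ + ∑ i, (c₁ i + ∑ j, c₂ i j) :=
        (Finset.single_le_sum (f := fun i => c₁ i + ∑ j, c₂ i j) (fun _ _ => zero_le)
          (Finset.mem_univ i)).trans le_add_self
      exact_mod_cast this

end Composition

/-! ### Bounded densities of image measures. -/

section PushBounds

variable {d : ℕ} {X : Type*} [TopologicalSpace X] [MeasurableSpace X] {ν : Measure X}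
  {Q : X → EuclideanSpace ℝ (Fin d)}

/-- Bounds add over finite unions, so compactness reduces the question to neighbourhoods of points.
-/
lemma exists_pushBound_of_forall_nhds {T : Set X} (hT : IsCompact T)
    (h : ∀ x ∈ T, ∃ V ∈ 𝓝 x, ∃ C, PushBound ν Q V C) : ∃ C, PushBound ν Q T C := by
  refine hT.induction_on (p := fun T => ∃ C, PushBound ν Q T C) ⟨0, fun A => by simp⟩ ?_ ?_ ?_
  · rintro s t hst ⟨C, hC⟩
    exact ⟨C, fun A => (measure_mono (by gcongr)).trans (hC A)⟩
  · rintro s t ⟨C, hC⟩ ⟨C', hC'⟩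
    refine ⟨C + C', fun A => ?_⟩
    rw [union_inter_distrib_right, ENNReal.coe_add, add_mul]
    exact (measure_union_le _ _).trans (add_le_add (hC A) (hC' A))
  · intro x hx
    obtain ⟨V, hV, hC⟩ := h x hx
    exact ⟨V, mem_nhdsWithin_of_mem_nhds hV, hC⟩

/-- A map `Q` that, along a family `T_e` of measure preserving maps, moves with derivative the
identity in `e`, pushes the measure forward to a measure of bounded density. -/
lemma exists_pushBound_nhds [BorelSpace X] [SecondCountableTopology X] [SFinite ν]
    [IsLocallyFiniteMeasure ν] {T T' : EuclideanSpace ℝ (Fin d) → X → X}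
    (hTm : ∀ e, MeasurePreserving (T e) ν ν) (hTT' : ∀ e x, T' e (T e x) = x) {r₀ : ℝ} (hr₀ : 0 < r₀)
    (hTc : ContinuousOn (Function.uncurry T) (Metric.ball 0 r₀ ×ˢ univ))
    (hTc' : ContinuousOn (Function.uncurry T') (Metric.ball 0 r₀ ×ˢ univ)) {x₀ : X}
    (hT0' : T' 0 x₀ = x₀) (hQ : ∀ᶠ x in 𝓝 x₀, ContinuousAt Q x)
    {E : Type*} [NormedAddCommGroup E] [NormedSpace ℝ E] {c : E → X} {y₀ : E}
    (hc : 𝓝 x₀ ≤ map c (𝓝 y₀)) {D : E × EuclideanSpace ℝ (Fin d) →L[ℝ] EuclideanSpace ℝ (Fin d)}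
    (hD : HasStrictFDerivAt (fun z : E × EuclideanSpace ℝ (Fin d) => Q (T z.2 (c z.1))) D (y₀, 0))
    (hDid : ∀ e, D (0, e) = e) : ∃ V ∈ 𝓝 x₀, ∃ C, PushBound ν Q V C := by
  -- A map sufficiently close to the identity at linear order shrinks volumes by a factor of at most
  -- two. Strict differentiability makes `e ↦ Q(T_e x)` such a map, uniformly for `x` near `x₀`.
  -- Here `x` is written as `c y`, so that the derivative makes sense when `X` is only a manifold.
  obtain ⟨δ, hδ, hδ0⟩ := ((mul_le_addHaar_image_of_lt_det (volume : Measure (EuclideanSpace ℝ (Fin d)))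
    (ContinuousLinearMap.id ℝ _) (m := 1 / 2) (by
      simp only [ContinuousLinearMap.det, ContinuousLinearMap.coe_id, LinearMap.det_id, abs_one,
        ENNReal.ofReal_one]
      exact ENNReal.coe_lt_one_iff.2 (by norm_num))).and self_mem_nhdsWithin).exists
  obtain ⟨s, hs, hsD⟩ := hD.approximates_deriv_on_nhds (c := δ) (Or.inr hδ0)
  obtain ⟨N, hN, s₂, hs₂, hNs⟩ := mem_nhds_prod_iff.1 hs
  obtain ⟨r, hr, hrs⟩ := Metric.mem_nhds_iff.1 hs₂
  have happ : ∀ y ∈ N, ∀ t ⊆ Metric.ball (0 : EuclideanSpace ℝ (Fin d)) r,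
      volume t ≤ 2 * volume ((fun e => Q (T e (c y))) '' t) := by
    intro y hy t ht
    have h1 : ApproximatesLinearOn (fun e => Q (T e (c y))) (ContinuousLinearMap.id ℝ _) t δ := by
      intro a ha b hb
      have := hsD _ (hNs (Set.mk_mem_prod hy (hrs (ht ha)))) _ (hNs (Set.mk_mem_prod hy (hrs (ht hb))))
      have e1 : ((y, a) : E × EuclideanSpace ℝ (Fin d)) - (y, b) = (0, a - b) := by simp
      rw [e1, hDid] at this
      simpa [Prod.norm_def] using this
    have h2 := hδ t _ h1
    have h3 : (2 : ℝ≥0∞) * ((1 / 2 : ℝ≥0) : ℝ≥0∞) = 1 := by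
      rw [← ENNReal.coe_ofNat, ← ENNReal.coe_mul]; norm_num
    calc volume t = 2 * (((1 / 2 : ℝ≥0) : ℝ≥0∞) * volume t) := by rw [← mul_assoc, h3, one_mul]
      _ ≤ _ := by gcongr
  obtain ⟨O, hO, hOo, hxO⟩ := eventually_nhds_iff.1 hQ
  have hQO : ContinuousOn Q O := fun x hx => (hO x hx).continuousWithinAt
  have hcN : c '' N ∈ 𝓝 x₀ := hc (image_mem_map hN)
  obtain ⟨V₂, hxV₂, hV₂o, hV₂ν⟩ := ν.exists_isOpen_measure_lt_top x₀
  obtain ⟨V₁, hV₁s, hV₁o, hxV₁⟩ := mem_nhds_iff.1 (Filter.inter_mem hcN (hV₂o.mem_nhds hxV₂))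
  have hV₁ν : ν V₁ ≠ ⊤ := ne_top_of_le_ne_top hV₂ν.ne (measure_mono (hV₁s.trans inter_subset_right))
  -- a smaller neighbourhood
  have hcont : ContinuousAt (Function.uncurry T') (0, x₀) :=
    hTc'.continuousAt (prod_mem_nhds (Metric.ball_mem_nhds _ hr₀) univ_mem)
  have hpre : Function.uncurry T' ⁻¹' V₁ ∈ 𝓝 ((0 : EuclideanSpace ℝ (Fin d)), x₀) := by
    refine hcont.preimage_mem_nhds ?_
    simpa [Function.uncurry, hT0'] using hV₁o.mem_nhds hxV₁
  obtain ⟨t₁, ht₁, V₃, hV₃, htV⟩ := mem_nhds_prod_iff.1 hpre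
  obtain ⟨r', hr', hrt⟩ := Metric.mem_nhds_iff.1 ht₁
  obtain ⟨V, hVs, hVo, hxV⟩ := mem_nhds_iff.1 (Filter.inter_mem hV₃ (hOo.mem_nhds hxO))
  set ε := min r (min r' r₀) with hε
  have hε0 : 0 < ε := by positivity
  set U := Metric.ball (0 : EuclideanSpace ℝ (Fin d)) ε with hU
  have hU0 : volume U ≠ 0 := (Metric.measure_ball_pos volume _ hε0).ne'
  have hUt : volume U ≠ ⊤ := measure_ball_lt_top.ne
  have hUr : U ⊆ Metric.ball 0 r := Metric.ball_subset_ball (min_le_left _ _)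
  have hUr' : U ⊆ Metric.ball 0 r' :=
    Metric.ball_subset_ball ((min_le_right _ _).trans (min_le_left _ _))
  have hUr₀ : U ⊆ Metric.ball 0 r₀ :=
    Metric.ball_subset_ball ((min_le_right _ _).trans (min_le_right _ _))
  -- the estimate for open sets
  have hopen : ∀ A : Set (EuclideanSpace ℝ (Fin d)), IsOpen A →
      volume U * ν (V ∩ Q ⁻¹' A) ≤ 2 * ν V₁ * volume A := by
    intro A hA
    have hW : IsOpen (V ∩ Q ⁻¹' A) :=
      (hQO.mono (hVs.trans inter_subset_right)).isOpen_inter_preimage hVo hA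
    set W := V ∩ Q ⁻¹' A with hWd
    set S := (U ×ˢ V₁) ∩ Function.uncurry T ⁻¹' W with hS
    have hSo : IsOpen S := (hTc.mono (prod_mono hUr₀ (subset_univ _))).isOpen_inter_preimage
      (Metric.isOpen_ball.prod hV₁o) hW
    -- Since `T e` preserves `ν`, the set `W` has the measure of its preimage, and that preimage
    -- stays inside `V₁` because `T' e` maps `V` into `V₁` for small `e`.
    have h1 : ∀ e ∈ U, ν W ≤ ν (Prod.mk e ⁻¹' S) := by
      intro e he
      rw [← (hTm e).measure_preimage hW.measurableSet.nullMeasurableSet]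
      refine measure_mono fun x hx => ⟨⟨he, ?_⟩, hx⟩
      have := htV (Set.mk_mem_prod (hrt (hUr' he)) (hVs hx.1).1)
      simpa [Function.uncurry, hTT'] using this
    have h2 : ∀ x, volume ((fun e => (e, x)) ⁻¹' S) ≤ V₁.indicator (fun _ => 2 * volume A) x := by
      intro x
      by_cases hx : x ∈ V₁
      · rw [indicator_of_mem hx]
        obtain ⟨y, hy, rfl⟩ := (hV₁s hx).1
        refine (happ y hy _ fun e he => hUr he.1.1).trans ?_
        gcongr
        rintro _ ⟨e, he, rfl⟩
        exact he.2.2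
      · rw [indicator_of_notMem hx]
        have : (fun e => (e, x)) ⁻¹' S = ∅ := by
          ext e
          simp only [mem_preimage, mem_empty_iff_false, iff_false]
          exact fun he => hx he.1.2
        rw [this, measure_empty]
    -- Fubini for the pairs `(e, x)` with `T_e x ∈ W`: slices in `x` have measure at least `ν W`,
    -- while slices in `e` are mapped into `A` by an almost isometric map and so have volume at most
    -- `2 volume A`.
    calc volume U * ν W = ∫⁻ _ in U, ν W := by
          rw [lintegral_const, Measure.restrict_apply_univ, mul_comm]
      _ ≤ ∫⁻ e in U, ν (Prod.mk e ⁻¹' S) :=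
          setLIntegral_mono' Metric.isOpen_ball.measurableSet h1
      _ ≤ ∫⁻ e, ν (Prod.mk e ⁻¹' S) := setLIntegral_le_lintegral _ _
      _ = ∫⁻ x, volume ((fun e => (e, x)) ⁻¹' S) ∂ν := by
          rw [← Measure.prod_apply hSo.measurableSet, Measure.prod_apply_symm hSo.measurableSet]
      _ ≤ ∫⁻ x, V₁.indicator (fun _ => 2 * volume A) x ∂ν := lintegral_mono h2
      _ = _ := by rw [lintegral_indicator_const hV₁o.measurableSet]; ring
  have hne : 2 * ν V₁ / volume U + 1 ≠ ⊤ := ENNReal.add_ne_top.2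
    ⟨ENNReal.div_ne_top (ENNReal.mul_ne_top (by simp) hV₁ν) hU0, by simp⟩
  refine ⟨V, hVo.mem_nhds hxV, (2 * ν V₁ / volume U + 1).toNNReal, fun A => ?_⟩
  rw [ENNReal.coe_toNNReal hne, A.measure_eq_iInf_isOpen volume]
  -- Openness served only to make the sets measurable; outer regularity of Lebesgue measure extends
  -- the bound to arbitrary `A`.
  have hopen' : ∀ A : Set (EuclideanSpace ℝ (Fin d)), IsOpen A →
      ν (V ∩ Q ⁻¹' A) ≤ (2 * ν V₁ / volume U + 1) * volume A := by
    intro A hA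
    calc ν (V ∩ Q ⁻¹' A) = volume U * ν (V ∩ Q ⁻¹' A) / volume U := by
          rw [mul_comm, ENNReal.mul_div_cancel_right hU0 hUt]
      _ ≤ (2 * ν V₁ * volume A) / volume U := ENNReal.div_le_div_right (hopen A hA) _
      _ = 2 * ν V₁ / volume U * volume A := by rw [div_eq_mul_inv, div_eq_mul_inv]; ring
      _ ≤ _ := by gcongr; exact le_self_add
  have h0 : 2 * ν V₁ / volume U + 1 ≠ 0 := by simp
  simp_rw [ENNReal.mul_iInf_of_ne h0 hne]
  refine le_iInf fun B => le_iInf fun hAB => le_iInf fun hB => ?_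
  exact (measure_mono (by gcongr)).trans (hopen' B hB)

end PushBounds

/-! ### Smooth functions measuring the distance to the identity. -/

section Gauge

variable {n : ℕ} {G : Type*} [Group G] [TopologicalSpace G] [IsTopologicalGroup G] [T2Space G]
  [ChartedSpace (EuclideanSpace ℝ (Fin n)) G] [LieGroup (𝓡 n) ∞ G]

/-- Global smooth functions whose smallness controls the Riemannian distance to the identity. -/
lemma exists_global_coordinates
    [Bundle.RiemannianBundle (fun x : G => TangentSpace (𝓡 n) x)]
    [IsContMDiffRiemannianBundle (𝓡 n) ∞ (EuclideanSpace ℝ (Fin n))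
      (fun x : G => TangentSpace (𝓡 n) x)] :
    ∃ (Θ : G → EuclideanSpace ℝ (Fin n)) (ϑ : G → ℝ) (K : Set G), ContMDiff (𝓡 n) (𝓡 n) ∞ Θ ∧
      ContMDiff (𝓡 n) 𝓘(ℝ, ℝ) ∞ ϑ ∧ Θ 1 = 0 ∧ ϑ 1 = 0 ∧ IsCompact K ∧ ∃ (C : ℝ≥0) (ε₀ : ℝ), 0 < ε₀ ∧
      ∀ ε, 0 < ε → ε ≤ ε₀ → ∀ g, ‖Θ g‖ ≤ ε → |ϑ g| ≤ ε →
        g ∈ K ∧ Manifold.riemannianEDist (𝓡 n) 1 g ≤ C * ENNReal.ofReal ε := by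
  have hLC : LocallyCompactSpace G := Manifold.locallyCompact_of_finiteDimensional (𝓡 n)
  obtain ⟨ζ⟩ : Nonempty (SmoothBumpFunction (𝓡 n) (1 : G)) := inferInstance
  set e := extChartAt (𝓡 n) (1 : G) with he
  have : IsContinuousRiemannianBundle (EuclideanSpace ℝ (Fin n))
      (fun x : G => TangentSpace (𝓡 n) x) := by
    obtain ⟨g, hg, hg'⟩ := IsContMDiffRiemannianBundle.exists_contMDiff (IB := 𝓡 n) (n := ∞)
      (F := EuclideanSpace ℝ (Fin n)) (E := fun x : G => TangentSpace (𝓡 n) x)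
    exact ⟨g, hg.continuous, hg'⟩
  obtain ⟨C, hC0, hC⟩ := eventually_riemannianEDist_le_edist_extChartAt (𝓡 n) (1 : G)
  have hcont : ContinuousAt e.symm (e 1) := continuousAt_extChartAt_symm (1 : G)
  have hpre := hcont.preimage_mem_nhds (t := {g | _}) (by rw [he, extChartAt_to_inv]; exact hC)
  obtain ⟨δ, hδ, hδs⟩ := Metric.mem_nhds_iff.1 hpre
  -- The chart is cut off by a bump `ζ`, and `1 - ζ` is kept as a second function: when it is at
  -- most `1/2` the point lies in the chart and `ζ ≥ 1/2`, so smallness of `ζ (e - e 1)` implies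
  -- smallness of `e - e 1`.
  refine ⟨fun g => ζ g • (e g - e 1), fun g => 1 - ζ g, tsupport ζ, ?_, ?_, by simp, ?_,
    ζ.hasCompactSupport, 2 * C, min (1 / 2) (δ / 3), by positivity, ?_⟩
  · exact ζ.contMDiff_smul (contMDiffOn_extChartAt.sub contMDiffOn_const)
  · exact contMDiff_const.sub ζ.contMDiff
  · simp [ζ.eq_one]
  · intro ε hε hε' g h1 h2
    have h3 : 1 / 2 ≤ ζ g := by
      have := (abs_le.1 (h2.trans (hε'.trans (min_le_left _ _)))).2
      linarith
    have hg : g ∈ Function.support ζ := fun h => by rw [h] at h3; norm_num at h3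
    have hgs : g ∈ e.source := by
      rw [he, extChartAt_source]
      exact ζ.tsupport_subset_chartAt_source (subset_tsupport _ hg)
    have h4 : ‖e g - e 1‖ ≤ 2 * ε := by
      rw [norm_smul, Real.norm_of_nonneg ζ.nonneg] at h1
      nlinarith [norm_nonneg (e g - e 1)]
    have h5 : e g ∈ Metric.ball (e 1) δ := by
      rw [mem_ball_iff_norm]
      have := hε'.trans (min_le_right _ _)
      linarith
    refine ⟨subset_tsupport _ hg, ?_⟩
    have h6 := hδs h5
    simp only [mem_preimage, mem_ofPred_eq] at h6
    rw [e.left_inv hgs] at h6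
    refine h6.trans ?_
    push_cast
    rw [mul_comm (2 : ℝ≥0∞), mul_assoc]
    gcongr
    rw [edist_comm, edist_eq_enorm_sub, ← ofReal_norm]
    calc ENNReal.ofReal ‖e g - e 1‖ ≤ ENNReal.ofReal (2 * ε) := ENNReal.ofReal_le_ofReal h4
      _ = 2 * ENNReal.ofReal ε := by
        rw [ENNReal.ofReal_mul (by norm_num)]; norm_num

/-- Sets cut out by a smooth function vanishing at the identity have polynomially large measure. -/
lemma exists_le_measure_norm_le [MeasurableSpace G] [BorelSpace G] [SecondCountableTopology G]
    (m : Measure G) [m.IsHaarMeasure] {F : Type*} [NormedAddCommGroup F] [NormedSpace ℝ F] {Θ : G → F}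
    (hΘ : ContMDiff (𝓡 n) 𝓘(ℝ, F) ∞ Θ) (h1 : Θ 1 = 0) :
    ∃ c > 0, ∃ ε₀ > 0, ∀ ε, 0 < ε → ε ≤ ε₀ → ENNReal.ofReal (c * ε ^ n) ≤ m {g | ‖Θ g‖ ≤ ε} := by
  have hLC : LocallyCompactSpace G := Manifold.locallyCompact_of_finiteDimensional (𝓡 n)
  set e := extChartAt (𝓡 n) (1 : G) with he
  set f : EuclideanSpace ℝ (Fin n) × EuclideanSpace ℝ (Fin n) → F :=
    fun z => Θ ((e.symm z.1)⁻¹ * e.symm z.2) with hf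
  have het : e.target ∈ 𝓝 (e 1) := extChartAt_target_mem_nhds (1 : G)
  have hsymm : ContMDiffAt (𝓡 n) (𝓡 n) ∞ e.symm (e 1) :=
    (contMDiffOn_extChartAt_symm (1 : G)).contMDiffAt het
  have hfs : ContDiffAt ℝ 1 f (e 1, e 1) := by
    rw [← contMDiffAt_iff_contDiffAt]
    have h2 : ContMDiffAt 𝓘(ℝ, EuclideanSpace ℝ (Fin n) × EuclideanSpace ℝ (Fin n)) (𝓡 n) ∞
        (fun z : EuclideanSpace ℝ (Fin n) × EuclideanSpace ℝ (Fin n) => e.symm z.1) (e 1, e 1) :=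
      ContMDiffAt.comp (e 1, e 1) (I' := 𝓡 n) (g := e.symm) (f := Prod.fst) hsymm contDiff_fst.contMDiff.contMDiffAt
    have h3 : ContMDiffAt 𝓘(ℝ, EuclideanSpace ℝ (Fin n) × EuclideanSpace ℝ (Fin n)) (𝓡 n) ∞
        (fun z : EuclideanSpace ℝ (Fin n) × EuclideanSpace ℝ (Fin n) => e.symm z.2) (e 1, e 1) :=
      ContMDiffAt.comp (e 1, e 1) (I' := 𝓡 n) (g := e.symm) (f := Prod.snd) hsymm contDiff_snd.contMDiff.contMDiffAt
    exact (hΘ.contMDiffAt.comp (e 1, e 1) (h2.inv.mul h3)).of_le (by norm_cast)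
  obtain ⟨L, t, ht, hL⟩ := hfs.exists_lipschitzOnWith
  obtain ⟨t₁, ht₁, t₂, ht₂, htt⟩ := mem_nhds_prod_iff.1 ht
  obtain ⟨r, hr, hrs⟩ := Metric.mem_nhds_iff.1 (Filter.inter_mem (Filter.inter_mem ht₁ ht₂) het)
  have hbound : ∀ x ∈ Metric.ball (e 1) r, ∀ y ∈ Metric.ball (e 1) r,
      ‖Θ ((e.symm x)⁻¹ * e.symm y)‖ ≤ L * ‖y - x‖ := by
    intro x hx y hy
    have h2 := hL.dist_le_mul (x, y) (htt (Set.mk_mem_prod (hrs hx).1.1 (hrs hy).1.2)) (x, x)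
      (htt (Set.mk_mem_prod (hrs hx).1.1 (hrs hx).1.2))
    rw [dist_eq_norm, dist_eq_norm] at h2
    simpa [hf, h1, Prod.norm_def] using h2
  -- compare by integrating over translates
  set B := Metric.ball (e 1) r with hB
  set V := e.symm '' Metric.ball (e 1) (r / 2) with hV
  have hVn : V ∈ 𝓝 (1 : G) := by
    have := map_extChartAt_symm_nhdsWithin_range (I := 𝓡 n) (1 : G)
    rw [ModelWithCorners.range_eq_univ, nhdsWithin_univ] at this
    rw [← this]
    exact image_mem_map (Metric.ball_mem_nhds _ (half_pos hr))
  obtain ⟨V', hV'V, hV'o, h1V'⟩ := mem_nhds_iff.1 hVn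
  obtain ⟨V'', hV''n, hV''s, hV''c⟩ := local_compact_nhds (hV'o.mem_nhds h1V')
  have hV''V : V'' ⊆ V := hV''s.trans hV'V
  -- Extending the inverse chart by `1` outside the ball makes it Borel on the whole space, as
  -- Fubini requires.
  set v : EuclideanSpace ℝ (Fin n) → G := B.mulIndicator e.symm with hv
  have hvm : Measurable v := by
    refine measurable_of_isOpen fun O hO => ?_
    have h2 : ContinuousOn e.symm B :=
      (continuousOn_extChartAt_symm (1 : G)).mono fun x hx => (hrs hx).2
    have h3 := h2.isOpen_inter_preimage Metric.isOpen_ball hO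
    have : v ⁻¹' O = (B ∩ e.symm ⁻¹' O) ∪ (Bᶜ ∩ {_x | (1 : G) ∈ O}) := by
      ext x
      by_cases hx : x ∈ B <;> simp [hv, hx]
    rw [this]
    exact h3.measurableSet.union (Metric.isOpen_ball.measurableSet.compl.inter (MeasurableSet.const _))
  have hvB : ∀ x ∈ B, v x = e.symm x := fun x hx => mulIndicator_of_mem hx _
  have hBt : volume B ≠ ⊤ := measure_ball_lt_top.ne
  have hB0 : volume B ≠ 0 := (Metric.measure_ball_pos volume _ hr).ne'
  have hb0 : volume (Metric.ball (0 : EuclideanSpace ℝ (Fin n)) 1) ≠ 0 :=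
    (Metric.measure_ball_pos volume _ one_pos).ne'
  have hbt : volume (Metric.ball (0 : EuclideanSpace ℝ (Fin n)) 1) ≠ ⊤ := measure_ball_lt_top.ne
  have hV0 : m V'' ≠ 0 := (Measure.measure_pos_of_mem_nhds m hV''n).ne'
  have hVt : m V'' ≠ ⊤ := hV''c.measure_lt_top.ne
  set L' : ℝ := L + 1 with hL'
  have hL'0 : 0 < L' := by positivity
  -- No density of Haar measure in the chart is needed. Integrate the indicator of `v(x)⁻¹g ∈ U`
  -- over `x ∈ B` and `g`: left invariance gives `volume B * m U`, while for each `g = e.symm y` in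
  -- a fixed neighbourhood the Lipschitz bound admits all `x` in a ball of radius `ε / L'` about
  -- `y`.
  have hmain : ∀ ε, 0 < ε → ε ≤ r / 2 →
      ENNReal.ofReal ((ε / L') ^ n) * (volume (Metric.ball (0 : EuclideanSpace ℝ (Fin n)) 1) * m V'') ≤
        volume B * m {g | ‖Θ g‖ ≤ ε} := by
    intro ε hε hεr
    set U := {g | ‖Θ g‖ ≤ ε} with hU
    have hUc : IsClosed U := isClosed_le hΘ.continuous.norm continuous_const
    have hS : MeasurableSet {z : EuclideanSpace ℝ (Fin n) × G | z.1 ∈ B ∧ (v z.1)⁻¹ * z.2 ∈ U} :=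
      (measurable_fst Metric.isOpen_ball.measurableSet).inter
        (((hvm.comp measurable_fst).inv.mul measurable_snd) hUc.measurableSet)
    have h2 : ∀ g ∈ V'', ENNReal.ofReal ((ε / L') ^ n) *
        volume (Metric.ball (0 : EuclideanSpace ℝ (Fin n)) 1) ≤
        volume ((fun x => (x, g)) ⁻¹' {z : EuclideanSpace ℝ (Fin n) × G | z.1 ∈ B ∧ (v z.1)⁻¹ * z.2 ∈ U}) := by
      intro g hg
      obtain ⟨y, hy, rfl⟩ := hV''V hg
      have h3 := Measure.addHaar_ball_of_pos (volume : Measure (EuclideanSpace ℝ (Fin n))) y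
        (show 0 < ε / L' by positivity)
      rw [finrank_euclideanSpace_fin] at h3
      rw [← h3]
      refine measure_mono fun x hx => ?_
      have hεL : ε / L' ≤ ε := div_le_self hε.le (by rw [hL']; linarith [L.coe_nonneg])
      have hxB : x ∈ B := by
        rw [hB, Metric.mem_ball] at *
        linarith [dist_triangle x y (e 1)]
      have hyB : y ∈ B := Metric.ball_subset_ball (by linarith) hy
      refine ⟨hxB, ?_⟩
      change ‖Θ _‖ ≤ ε
      dsimp only
      rw [hvB x hxB]
      refine (hbound x hxB y hyB).trans ?_
      rw [Metric.mem_ball, dist_eq_norm, norm_sub_rev, lt_div_iff₀ hL'0] at hx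
      nlinarith [norm_nonneg (y - x)]
    calc _ = ∫⁻ _ in V'', ENNReal.ofReal ((ε / L') ^ n) *
        volume (Metric.ball (0 : EuclideanSpace ℝ (Fin n)) 1) ∂m := by
          rw [lintegral_const, Measure.restrict_apply_univ, mul_assoc]
      _ ≤ ∫⁻ g in V'', volume ((fun x => (x, g)) ⁻¹'
          {z : EuclideanSpace ℝ (Fin n) × G | z.1 ∈ B ∧ (v z.1)⁻¹ * z.2 ∈ U}) ∂m :=
          setLIntegral_mono (measurable_measure_prodMk_right hS) h2
      _ ≤ ∫⁻ g, volume ((fun x => (x, g)) ⁻¹'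
          {z : EuclideanSpace ℝ (Fin n) × G | z.1 ∈ B ∧ (v z.1)⁻¹ * z.2 ∈ U}) ∂m :=
          setLIntegral_le_lintegral _ _
      _ = ∫⁻ x, m (Prod.mk x ⁻¹' {z : EuclideanSpace ℝ (Fin n) × G | z.1 ∈ B ∧ (v z.1)⁻¹ * z.2 ∈ U}) := by
          rw [← Measure.prod_apply_symm hS, Measure.prod_apply hS]
      _ = ∫⁻ x, B.indicator (fun _ => m U) x := by
          refine lintegral_congr fun x => ?_
          by_cases hx : x ∈ B
          · rw [indicator_of_mem hx]
            have : Prod.mk x ⁻¹' {z : EuclideanSpace ℝ (Fin n) × G | z.1 ∈ B ∧ (v z.1)⁻¹ * z.2 ∈ U} =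
                (fun g => (v x)⁻¹ * g) ⁻¹' U := by ext g; simp [hx]
            rw [this, measure_preimage_mul]
          · rw [indicator_of_notMem hx]
            convert measure_empty (μ := m)
            ext g; simp [hx]
      _ = _ := by rw [lintegral_indicator_const Metric.isOpen_ball.measurableSet, mul_comm]
  set c₀ := volume (Metric.ball (0 : EuclideanSpace ℝ (Fin n)) 1) * m V'' / volume B with hc₀
  have hc₀0 : c₀ ≠ 0 := ENNReal.div_ne_zero.2 ⟨mul_ne_zero hb0 hV0, hBt⟩
  have hc₀t : c₀ ≠ ⊤ := ENNReal.div_ne_top (ENNReal.mul_ne_top hbt hVt) hB0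
  refine ⟨c₀.toReal / L' ^ n, div_pos (ENNReal.toReal_pos hc₀0 hc₀t) (by positivity), r / 2,
    by positivity, fun ε hε hεr => ?_⟩
  have h2 := hmain ε hε hεr
  rw [mul_comm (volume B), ← ENNReal.div_le_iff hB0 hBt, mul_div_assoc, ← hc₀] at h2
  rwa [div_mul_eq_mul_div, mul_div_assoc, ← div_pow, mul_comm, ENNReal.ofReal_mul (by positivity),
    ENNReal.ofReal_toReal hc₀t]

end Gauge

namespace DualitySetting

/-! ### Smooth weights at scale `1/k`. -/

section SmoothWeights

variable {n : ℕ} {G : Type*} [Group G] [TopologicalSpace G] [IsTopologicalGroup G] [T2Space G]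
  [SecondCountableTopology G] [MeasurableSpace G] [BorelSpace G]
  [ChartedSpace (EuclideanSpace ℝ (Fin n)) G] [LieGroup (𝓡 n) ∞ G]
  {S : DualitySetting G}

/-- The weights are of the form `h (k² ϖ)`, up to normalisation, where `ϖ` vanishes quadratically at
the identity; their derivatives up to order `l` grow polynomially in `k`. -/
structure SmoothWeights (A : S.WeightFamily) (n l : ℕ) [ChartedSpace (EuclideanSpace ℝ (Fin n)) G]
    (ϖ : G → ℝ) (h : ℝ → ℝ) (N : ℕ → ℝ) (C : ℝ) : Prop where
  smooth_gauge : ContMDiff (𝓡 n) 𝓘(ℝ, ℝ) ∞ ϖ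
  smooth_profile : ContDiff ℝ ∞ h
  hasCompactSupport_profile : HasCompactSupport h
  profile_nonneg : ∀ x, 0 ≤ h x
  factor_nonneg : ∀ k, 0 ≤ N k
  eq : ∀ k g, A.b k g = ENNReal.ofReal (h ((k : ℝ) ^ 2 * ϖ g) * N k)
  le : ∀ k ≥ A.k₀, N k * (k : ℝ) ^ (2 * l) ≤ C * (k : ℝ) ^ A.κ

/-- A smooth profile of `k² ϖ`, with `ϖ` a symmetrised sum of squares of global coordinates, is
supported at Riemannian distance `O(1/k)` and equals one on a set of measure at least a multiple of
`k^{-n}`. The normalising factor is therefore `O(k^n)`. -/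
theorem exists_smoothWeights
    [Bundle.RiemannianBundle (fun x : G => TangentSpace (𝓡 n) x)]
    [IsContMDiffRiemannianBundle (𝓡 n) ∞ (EuclideanSpace ℝ (Fin n))
      (fun x : G => TangentSpace (𝓡 n) x)] (hL : S.LipschitzBalls (riemannianNhd n G)) (l : ℕ) :
    ∃ (A : S.WeightFamily) (ϖ : G → ℝ) (h : ℝ → ℝ) (N : ℕ → ℝ) (C : ℝ),
      SmoothWeights A n l ϖ h N C := by
  obtain ⟨c, hc, hL⟩ := hL
  obtain ⟨Θ, ϑ, K, hΘ, hϑ, hΘ1, hϑ1, hK, C, ε₀, hε₀, hC⟩ := exists_global_coordinates (n := n) (G := G)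
  have hinv : ContMDiff (𝓡 n) (𝓡 n) ∞ (fun g : G => g⁻¹) := contMDiff_inv _ _
  have hΘi := hΘ.comp hinv
  have hϑi := hϑ.comp hinv
  obtain ⟨c', hc', ε₁, hε₁, hc'm⟩ := exists_le_measure_norm_le S.m
    (Θ := fun g => ((Θ g, ϑ g), (Θ g⁻¹, ϑ g⁻¹)))
    ((hΘ.prodMk_space hϑ).prodMk_space (hΘi.prodMk_space hϑi)) (by simp [hΘ1, hϑ1])
  set ϖ : G → ℝ := fun g => ‖Θ g‖ ^ 2 + ϑ g ^ 2 + (‖Θ g⁻¹‖ ^ 2 + ϑ g⁻¹ ^ 2) with hϖ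
  have hϖs : ContMDiff (𝓡 n) 𝓘(ℝ, ℝ) ∞ ϖ := by
    have h1 : ContDiff ℝ ∞ (fun z : EuclideanSpace ℝ (Fin n) => ‖z‖ ^ 2) := contDiff_norm_sq ℝ
    have h2 : ContDiff ℝ ∞ (fun z : ℝ => z ^ 2) := by fun_prop
    exact ((h1.contMDiff.comp hΘ).add (h2.contMDiff.comp hϑ)).add
      ((h1.contMDiff.comp hΘi).add (h2.contMDiff.comp hϑi))
  have hϖ0 : ∀ g, 0 ≤ ϖ g := fun g => by positivity
  have hϖi : ∀ g, ϖ g⁻¹ = ϖ g := fun g => by simp only [hϖ, inv_inv]; ring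
  let h : ContDiffBump (0 : ℝ) := ⟨1, 2, one_pos, one_lt_two⟩
  -- From `k² ϖ < 2` each coordinate function is at most `2/k`, so the distance is at most `2C/k`;
  -- the extra one makes the inequality strict and keeps `L'` positive.
  set L' : ℝ := 2 * C + 1 with hL'
  have hL'0 : 0 < L' := by positivity
  obtain ⟨k₀, hk₀⟩ := exists_nat_ge (2 / ε₀ + 1 / ε₁ + L' + 1)
  have hk : ∀ k : ℕ, k₀ ≤ k → (0 : ℝ) < k ∧ 2 / k ≤ ε₀ ∧ 1 / (2 * k) ≤ ε₁ ∧ L' / k < 1 := by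
    intro k hk
    have h0 : (2 / ε₀ + 1 / ε₁ + L' + 1) ≤ (k : ℝ) := hk₀.trans (by exact_mod_cast hk)
    have h1 : 0 < 2 / ε₀ := by positivity
    have h2 : 0 < 1 / ε₁ := by positivity
    have h3 : (0 : ℝ) < k := by linarith
    refine ⟨h3, ?_, ?_, ?_⟩
    · rw [div_le_iff₀ h3, ← div_le_iff₀' hε₀]; linarith
    · rw [div_le_iff₀ (by positivity), ← div_le_iff₀' hε₁]; linarith
    · rw [div_lt_one h3]; linarith
  set P : ℕ → Set G := fun k => {g | (k : ℝ) ^ 2 * ϖ g < 2} with hP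
  have hPi : ∀ k g, g ∈ P k → g⁻¹ ∈ P k := fun k g hg => by
    simp only [hP, mem_ofPred_eq, hϖi] at hg ⊢; exact hg
  have hPK : ∀ k ≥ k₀, ∀ g ∈ P k, g ∈ K ∧ Manifold.riemannianEDist (𝓡 n) 1 g < ENNReal.ofReal (L' / k) := by
    intro k hkk g hg
    obtain ⟨h0, h1, -, -⟩ := hk k hkk
    have hg2 : ϖ g ≤ (2 / k) ^ 2 := by
      rw [div_pow, le_div_iff₀ (by positivity), mul_comm]
      exact hg.le.trans (by norm_num)
    simp only [hϖ] at hg2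
    obtain ⟨h2, h3⟩ := hC (2 / k) (by positivity) h1 g
      (pow_le_pow_iff_left₀ (norm_nonneg _) (by positivity) two_ne_zero |>.1
        (by linarith [sq_nonneg (ϑ g), sq_nonneg ‖Θ g⁻¹‖, sq_nonneg (ϑ g⁻¹)]))
      (abs_le_of_sq_le_sq (by linarith [sq_nonneg ‖Θ g‖, sq_nonneg ‖Θ g⁻¹‖, sq_nonneg (ϑ g⁻¹)])
        (by positivity))
    refine ⟨h2, h3.trans_lt ?_⟩
    rw [← ENNReal.ofReal_coe_nnreal, ← ENNReal.ofReal_mul C.coe_nonneg]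
    refine (ENNReal.ofReal_lt_ofReal_iff (by positivity)).2 ?_
    rw [mul_div_assoc', div_lt_div_iff_of_pos_right h0]
    linarith
  have hPn : ∀ k ≥ k₀, P k ⊆ riemannianNhd n G (L' / k) := fun k hkk g hg =>
    ⟨(hPK k hkk g hg).2, (hPK k hkk _ (hPi k g hg)).2⟩
  have hsupp : ∀ (k : ℕ) g, h ((k : ℝ) ^ 2 * ϖ g) ≠ 0 → g ∈ P k := by
    intro k g hg
    have : (k : ℝ) ^ 2 * ϖ g ∈ Function.support h := hg
    rw [h.support_eq, Metric.mem_ball, dist_zero_right, Real.norm_eq_abs] at this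
    exact (le_abs_self _).trans_lt this
  have hhm : ∀ k : ℕ, Measurable fun g => ENNReal.ofReal (h ((k : ℝ) ^ 2 * ϖ g)) := fun k =>
    (ENNReal.measurable_ofReal.comp (h.continuous.measurable.comp
      (hϖs.continuous.measurable.const_mul _)))
  set I : ℕ → ℝ≥0∞ := fun k => ∫⁻ g, ENNReal.ofReal (h ((k : ℝ) ^ 2 * ϖ g)) ∂S.m with hI
  have hIt : ∀ k ≥ k₀, I k ≠ ⊤ := by
    intro k hkk
    refine ne_top_of_le_ne_top hK.measure_lt_top.ne (b := S.m K) ?_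
    rw [← lintegral_indicator_one hK.measurableSet]
    refine lintegral_mono fun g => ?_
    by_cases hg : h ((k : ℝ) ^ 2 * ϖ g) = 0
    · simp [hg]
    · rw [indicator_of_mem (hPK k hkk g (hsupp k g hg)).1, Pi.one_apply]
      exact ENNReal.ofReal_le_one.2 h.le_one
  have hIlow : ∀ k ≥ k₀, ENNReal.ofReal (c' * (1 / (2 * k)) ^ n) ≤ I k := by
    intro k hkk
    obtain ⟨h0, -, h1, -⟩ := hk k hkk
    have hcl : IsClosed {g | ‖((Θ g, ϑ g), (Θ g⁻¹, ϑ g⁻¹))‖ ≤ 1 / (2 * k)} :=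
      isClosed_le (((hΘ.prodMk_space hϑ).prodMk_space (hΘi.prodMk_space hϑi)).continuous.norm)
        continuous_const
    refine (hc'm _ (by positivity) h1).trans ?_
    rw [← lintegral_indicator_one hcl.measurableSet]
    refine lintegral_mono fun g => ?_
    by_cases hg : g ∈ {g | ‖((Θ g, ϑ g), (Θ g⁻¹, ϑ g⁻¹))‖ ≤ 1 / (2 * k)}
    · rw [indicator_of_mem hg]
      simp only [mem_ofPred_eq, Prod.norm_def, max_le_iff, Real.norm_eq_abs] at hg
      obtain ⟨⟨g1, g2⟩, g3, g4⟩ := hg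
      have e1 : ϖ g ≤ 4 * (1 / (2 * k)) ^ 2 := by
        have := pow_le_pow_left₀ (norm_nonneg _) g1 2
        have := pow_le_pow_left₀ (abs_nonneg _) g2 2
        have := pow_le_pow_left₀ (norm_nonneg _) g3 2
        have := pow_le_pow_left₀ (abs_nonneg _) g4 2
        simp only [sq_abs] at *
        simp only [hϖ]; linarith
      have e2 : (k : ℝ) ^ 2 * ϖ g ≤ 1 := by
        calc (k : ℝ) ^ 2 * ϖ g ≤ (k : ℝ) ^ 2 * (4 * (1 / (2 * k)) ^ 2) := by gcongr
          _ = 1 := by field_simp; norm_num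
      rw [h.one_of_mem_closedBall]
      · simp
      · rw [mem_closedBall_zero_iff, Real.norm_of_nonneg (by have := hϖ0 g; positivity)]
        exact e2
    · rw [indicator_of_notMem hg]; exact zero_le
  have hI0 : ∀ k ≥ k₀, I k ≠ 0 := by
    intro k hkk h0
    have := hIlow k hkk
    rw [h0, nonpos_iff_eq_zero, ENNReal.ofReal_eq_zero] at this
    have h1 := (hk k hkk).1
    have : 0 < c' * (1 / (2 * (k : ℝ))) ^ n := by positivity
    linarith
  set N : ℕ → ℝ := fun k => (I k).toReal⁻¹ with hN
  have hN0 : ∀ k, 0 ≤ N k := fun k => inv_nonneg.2 ENNReal.toReal_nonneg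
  have hNle : ∀ k ≥ k₀, N k ≤ 2 ^ n / c' * (k : ℝ) ^ n := by
    intro k hkk
    have h1 := (hk k hkk).1
    have := (ENNReal.ofReal_le_iff_le_toReal (hIt k hkk)).1 (hIlow k hkk)
    calc N k ≤ (c' * (1 / (2 * k)) ^ n)⁻¹ := inv_anti₀ (by positivity) this
      _ = _ := by
        rw [one_div, inv_pow, mul_pow, mul_inv, inv_inv]; ring
  -- The exponent `κ = n + 2l` pays for the normalisation `k^n` and for `l` derivatives of a
  -- function of `k² ϖ`.
  refine ⟨{ b := fun k g => ENNReal.ofReal (h ((k : ℝ) ^ 2 * ϖ g) * N k)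
            P := P, K₀ := K, k₀ := max k₀ 1, κ := (n : ℝ) + 2 * l, β := 2 ^ n / c', c := c * L'
            one_le_k₀ := le_max_right _ _, κ_nonneg := by positivity, c_pos := by positivity
            isWeight := fun k hkk => ?_, le := fun k hkk g => ?_
            isCompact_K₀ := hK, subset := fun k hkk g hg => ?_, thick := fun k hkk t ht => ?_ },
          ϖ, h, N, 2 ^ n / c', hϖs, h.contDiff, h.hasCompactSupport, fun _ => h.nonneg, hN0,
          fun k g => rfl, fun k hkk => ?_⟩
  · have hkk := (le_max_left _ _).trans hkk
    simp_rw [ENNReal.ofReal_mul h.nonneg]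
    refine ⟨(hhm k).mul_const _, fun g => by rw [hϖi], ?_, fun g hg => ?_, ?_, hPi k⟩
    · rw [lintegral_mul_const _ (hhm k)]
      change I k * ENNReal.ofReal (I k).toReal⁻¹ = 1
      rw [ENNReal.ofReal_inv_of_pos (ENNReal.toReal_pos (hI0 k hkk) (hIt k hkk)),
        ENNReal.ofReal_toReal (hIt k hkk), ENNReal.mul_inv_cancel (hI0 k hkk) (hIt k hkk)]
    · exact hsupp k g fun h0 => hg (by simp [h0])
    · simp [hP, hϖ, hΘ1, hϑ1]
  · have hkk' := (le_max_left _ _).trans hkk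
    have hk1 : (1 : ℝ) ≤ k := by exact_mod_cast (le_max_right _ _).trans hkk
    refine ENNReal.ofReal_le_ofReal ?_
    calc h ((k : ℝ) ^ 2 * ϖ g) * N k ≤ 1 * N k := mul_le_mul_of_nonneg_right h.le_one (hN0 k)
      _ ≤ 2 ^ n / c' * (k : ℝ) ^ n := by rw [one_mul]; exact hNle k hkk'
      _ ≤ _ := by
        rw [← Real.rpow_natCast (k : ℝ) n]
        gcongr
        linarith [(Nat.cast_nonneg l : (0 : ℝ) ≤ l)]
  · exact (hPK k ((le_max_left _ _).trans hkk) g hg).1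
  · have hkk := (le_max_left _ _).trans hkk
    obtain ⟨h0, -, -, h1⟩ := hk k hkk
    have h2 := hL (L' / k) ⟨by positivity, h1⟩ t ht
    rw [mul_div_assoc]
    refine Subset.trans ?_ h2
    gcongr
    · exact hPn k hkk
    · exact hPn k hkk
  · have hkk' := (le_max_left _ _).trans hkk
    have h1 := (hk k hkk').1
    change N k * (k : ℝ) ^ (2 * l) ≤ 2 ^ n / c' * (k : ℝ) ^ ((n : ℝ) + 2 * l)
    rw [Real.rpow_add h1, Real.rpow_natCast, ← mul_assoc]
    have : (k : ℝ) ^ (2 * (l : ℝ)) = (k : ℝ) ^ (2 * l) := by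
      rw [← Real.rpow_natCast]; push_cast; rfl
    rw [this]
    gcongr
    exact hNle k hkk'

end SmoothWeights

end DualitySetting

/-! ### Smooth cutoffs and derivative bounds uniform in a parameter. -/

section UniformBounds

variable {n e : ℕ} {G : Type*} [TopologicalSpace G] [ChartedSpace (EuclideanSpace ℝ (Fin n)) G]

lemma contMDiff_of_tsupport_contMDiffAt {E M : Type*} [NormedAddCommGroup E] [NormedSpace ℝ E]
    {H : Type*} [TopologicalSpace H] {I : ModelWithCorners ℝ E H} [TopologicalSpace M]
    [ChartedSpace H M] {a : M → ℝ} (h : ∀ x ∈ tsupport a, ContMDiffAt I 𝓘(ℝ, ℝ) ∞ a x) :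
    ContMDiff I 𝓘(ℝ, ℝ) ∞ a := by
  intro x
  by_cases hx : x ∈ tsupport a
  · exact h x hx
  · exact contMDiffAt_const.congr_of_eventuallyEq (notMem_tsupport_iff_eventuallyEq.1 hx)

lemma exists_finite_partition {L : Set (EuclideanSpace ℝ (Fin e))} (hL : IsCompact L)
    (U : EuclideanSpace ℝ (Fin e) → Set (EuclideanSpace ℝ (Fin e))) (hU : ∀ x ∈ L, U x ∈ 𝓝 x) :
    ∃ (s : Finset (EuclideanSpace ℝ (Fin e)))
      (η : EuclideanSpace ℝ (Fin e) → EuclideanSpace ℝ (Fin e) → ℝ),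
      (∀ i ∈ s, i ∈ L ∧ ContDiff ℝ ∞ (η i) ∧ IsCompact (tsupport (η i)) ∧
        tsupport (η i) ⊆ interior (U i) ∧ ∀ x, 0 ≤ η i x) ∧ ∀ x ∈ L, ∑ i ∈ s, η i x = 1 := by
  classical
  -- Intersecting with unit balls forces the members of the partition to have compact support.
  obtain ⟨s, hsL, hs⟩ := hL.elim_nhds_subcover (fun x => interior (U x) ∩ Metric.ball x 1)
    fun x hx => Filter.inter_mem (interior_mem_nhds.2 (hU x hx)) (Metric.ball_mem_nhds _ one_pos)
  obtain ⟨f, hf⟩ := SmoothPartitionOfUnity.exists_isSubordinate 𝓘(ℝ, EuclideanSpace ℝ (Fin e))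
    hL.isClosed (fun i : s => interior (U i) ∩ Metric.ball (i : EuclideanSpace ℝ (Fin e)) 1)
    (fun i => isOpen_interior.inter Metric.isOpen_ball) (by
      intro x hx
      obtain ⟨i, hi, hxi⟩ := mem_iUnion₂.1 (hs hx)
      exact mem_iUnion.2 ⟨⟨i, hi⟩, hxi⟩)
  refine ⟨s, fun i => if h : i ∈ s then f ⟨i, h⟩ else 0, fun i hi => ?_, fun x hx => ?_⟩
  · simp only [hi, dif_pos]
    refine ⟨hsL i hi, (f ⟨i, hi⟩).contMDiff.contDiff, ?_, fun x hx => (hf ⟨i, hi⟩ hx).1,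
      fun x => f.nonneg _ _⟩
    exact Metric.isCompact_of_isClosed_isBounded (isClosed_tsupport _)
      (Metric.isBounded_ball.subset fun x hx => (hf ⟨i, hi⟩ hx).2)
  · have := f.sum_eq_one hx
    rw [finsum_eq_sum_of_fintype] at this
    rw [← this, ← Finset.sum_coe_sort s]
    exact Finset.sum_congr rfl fun i _ => by simp

lemma exists_cutoff {T U : Set (EuclideanSpace ℝ (Fin e))} (hT : IsCompact T) (hU : IsOpen U)
    (hTU : T ⊆ U) : ∃ c : EuclideanSpace ℝ (Fin e) → ℝ, ContDiff ℝ ∞ c ∧ IsCompact (tsupport c) ∧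
      tsupport c ⊆ U ∧ ∀ x ∈ T, c x = 1 := by
  obtain ⟨s, η, hη, h1⟩ := exists_finite_partition hT (fun _ => U) fun x hx => hU.mem_nhds (hTU hx)
  have hsub : tsupport (fun x => ∑ i ∈ s, η i x) ⊆ ⋃ i ∈ s, tsupport (η i) := by
    refine closure_minimal (fun x hx => ?_)
      (isClosed_biUnion_finset fun i _ => isClosed_tsupport _)
    obtain ⟨i, hi, hne⟩ := Finset.exists_ne_zero_of_sum_ne_zero hx
    exact mem_iUnion₂.2 ⟨i, hi, subset_tsupport _ hne⟩
  refine ⟨fun x => ∑ i ∈ s, η i x, ContDiff.sum fun i hi => (hη i hi).2.1,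
    (s.isCompact_biUnion fun i hi => (hη i hi).2.2.1).of_isClosed_subset (isClosed_tsupport _) hsub,
    hsub.trans (iUnion₂_subset fun i hi => (hη i hi).2.2.2.1.trans interior_subset), h1⟩

/-- The derivatives in the vector variable of a smooth function on a product are bounded locally
uniformly in the first variable. -/
lemma exists_bound_iteratedFDeriv [IsManifold (𝓡 n) ∞ G] {f : G → EuclideanSpace ℝ (Fin e) → ℝ}
    (hf : ContMDiff ((𝓡 n).prod (𝓡 e)) 𝓘(ℝ, ℝ) ∞ fun z : G × EuclideanSpace ℝ (Fin e) => f z.1 z.2)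
    {T : Set (EuclideanSpace ℝ (Fin e))} (hT : IsCompact T) (h0 : ∀ v w, w ∉ T → f v w = 0)
    {K : Set G} (hK : IsCompact K) (l : ℕ) :
    ∃ C : ℝ, ∀ v ∈ K, ∀ m ≤ l, ∀ w, ‖iteratedFDeriv ℝ m (f v) w‖ ≤ C := by
  refine hK.induction_on (p := fun K => ∃ C : ℝ, ∀ v ∈ K, ∀ m ≤ l, ∀ w,
    ‖iteratedFDeriv ℝ m (f v) w‖ ≤ C) ⟨0, by simp⟩ ?_ ?_ ?_
  · rintro s t hst ⟨C, hC⟩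
    exact ⟨C, fun v hv => hC v (hst hv)⟩
  · rintro s t ⟨C, hC⟩ ⟨C', hC'⟩
    refine ⟨max C C', fun v hv m hm w => ?_⟩
    rcases hv with hv | hv
    · exact (hC v hv m hm w).trans (le_max_left _ _)
    · exact (hC' v hv m hm w).trans (le_max_right _ _)
  · intro v₀ _
    set ch := extChartAt (𝓡 n) v₀ with hch
    obtain ⟨c, hc, hcc, hcs, hc1⟩ : ∃ c : EuclideanSpace ℝ (Fin n) → ℝ, ContDiff ℝ ∞ c ∧
        IsCompact (tsupport c) ∧ tsupport c ⊆ ch.target ∧ ∀ᶠ y in 𝓝 (ch v₀), c y = 1 := by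
      obtain ⟨r, hr, hrs⟩ := Metric.nhds_basis_closedBall.mem_iff.1
        (extChartAt_target_mem_nhds (I := 𝓡 n) v₀)
      obtain ⟨c, h1, h2, h3, h4⟩ := exists_cutoff (isCompact_closedBall (ch v₀) r)
        (isOpen_extChartAt_target (I := 𝓡 n) v₀) hrs
      exact ⟨c, h1, h2, h3, by
        filter_upwards [Metric.closedBall_mem_nhds (ch v₀) hr] with y hy using h4 y hy⟩
    -- In a chart for the parameter, and after a cutoff, `f` becomes a smooth function of compact
    -- support on a product of vector spaces. Its total derivatives are bounded, and the derivatives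
    -- in `w` are their restrictions to the second factor.
    set F : EuclideanSpace ℝ (Fin n) × EuclideanSpace ℝ (Fin e) → ℝ :=
      fun z => c z.1 * f (ch.symm z.1) z.2 with hF
    have hFsub : tsupport F ⊆ tsupport c ×ˢ T := by
      refine closure_minimal (fun z hz => ?_) ((isClosed_tsupport _).prod hT.isClosed)
      refine ⟨subset_tsupport _ (left_ne_zero_of_mul hz), ?_⟩
      by_contra h
      exact right_ne_zero_of_mul hz (h0 _ _ h)
    have hFs : ContDiff ℝ ∞ F := by
      refine contDiff_of_tsupport' fun z hz => ?_
      have hz1 := hcs (hFsub hz).1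
      refine (hc.contDiffAt.comp z contDiffAt_fst).mul ?_
      rw [← contMDiffAt_iff_contDiffAt]
      have h1 : ContMDiffAt 𝓘(ℝ, EuclideanSpace ℝ (Fin n) × EuclideanSpace ℝ (Fin e)) (𝓡 n) ∞
          (fun z : EuclideanSpace ℝ (Fin n) × EuclideanSpace ℝ (Fin e) => ch.symm z.1) z :=
        ContMDiffAt.comp z (I' := 𝓡 n) (g := ch.symm) (f := Prod.fst)
          ((contMDiffOn_extChartAt_symm v₀).contMDiffAt
            ((isOpen_extChartAt_target (I := 𝓡 n) v₀).mem_nhds hz1)) contDiff_fst.contMDiff.contMDiffAt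
      have h2 : ContMDiffAt 𝓘(ℝ, EuclideanSpace ℝ (Fin n) × EuclideanSpace ℝ (Fin e)) (𝓡 e) ∞
          (fun z : EuclideanSpace ℝ (Fin n) × EuclideanSpace ℝ (Fin e) => z.2) z :=
        contDiff_snd.contMDiff.contMDiffAt
      exact ContMDiffAt.comp z (I' := (𝓡 n).prod (𝓡 e))
        (g := fun z : G × EuclideanSpace ℝ (Fin e) => f z.1 z.2) hf.contMDiffAt (h1.prodMk h2)
    have hFc : HasCompactSupport F := (hcc.prod hT).of_isClosed_subset (isClosed_tsupport _) hFsub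
    have hbd : ∀ m : ℕ, ∃ C, ∀ z, ‖iteratedFDeriv ℝ m F z‖ ≤ C := fun m =>
      (hFc.iteratedFDeriv m).exists_bound_of_continuous
        (hFs.continuous_iteratedFDeriv (m := m) (by exact_mod_cast le_top))
    choose C hC using hbd
    have hev : ∀ᶠ v in 𝓝 v₀, v ∈ ch.source ∧ c (ch v) = 1 :=
      Filter.Eventually.and (extChartAt_source_mem_nhds (I := 𝓡 n) v₀)
        ((continuousAt_extChartAt (I := 𝓡 n) v₀).eventually hc1)
    refine ⟨_, mem_nhdsWithin_of_mem_nhds hev, ∑ m ∈ Finset.range (l + 1), C m, ?_⟩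
    rintro v ⟨hv, hcv⟩ m hm w
    have hfv : f v = (fun z => F ((ch v, 0) + z)) ∘
        ContinuousLinearMap.inr ℝ (EuclideanSpace ℝ (Fin n)) (EuclideanSpace ℝ (Fin e)) := by
      ext w
      simp [hF, hcv, ch.left_inv hv]
    have hC0 : ∀ m, 0 ≤ C m := fun m => (norm_nonneg _).trans (hC m 0)
    have hFs' : ContDiff ℝ ∞ fun z => F ((ch v, 0) + z) := hFs.comp (contDiff_const.add contDiff_id)
    rw [hfv, ContinuousLinearMap.iteratedFDeriv_comp_right _ hFs' w (i := m)
      (by exact_mod_cast le_top)]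
    refine (ContinuousMultilinearMap.norm_compContinuousLinearMap_le _ _).trans ?_
    rw [iteratedFDeriv_comp_add_left]
    calc _ ≤ C m * ∏ _i : Fin m, (1 : ℝ) := by
          gcongr
          · exact hC0 m
          · exact hC m _
          · exact ContinuousLinearMap.norm_inr_le_one ..
      _ = C m := by simp
      _ ≤ _ := Finset.single_le_sum (f := C) (fun i _ => hC0 i) (Finset.mem_range.2 (by omega))

end UniformBounds

/-! ### The translated smooth weights as multipliers in charts. -/

namespace DualitySetting

variable {n : ℕ} {G : Type*} [Group G] [TopologicalSpace G] [IsTopologicalGroup G] [T2Space G]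
  [SecondCountableTopology G] [MeasurableSpace G] [BorelSpace G]
  [ChartedSpace (EuclideanSpace ℝ (Fin n)) G] [LieGroup (𝓡 n) ∞ G]
  {S : DualitySetting G}

/-- Multiplication by the translated weights, in local coordinates. -/
lemma SmoothWeights.exists_sobBound_mul {A : S.WeightFamily} {l : ℕ} {ϖ : G → ℝ} {h : ℝ → ℝ}
    {N : ℕ → ℝ} {C₀ : ℝ} (hA : SmoothWeights A n l ϖ h N C₀) {e : ℕ}
    {σ : EuclideanSpace ℝ (Fin e) → G} {U T : Set (EuclideanSpace ℝ (Fin e))} (hU : IsOpen U)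
    (hσ : ContMDiffOn (𝓡 e) (𝓡 n) ∞ σ U) (hT : IsCompact T) (hTU : T ⊆ U) (γ : G) {K : Set G}
    (hK : IsCompact K) {q : ℝ≥0∞} (hq : 1 ≤ q) :
    ∃ C : ℝ≥0, ∀ k ≥ A.k₀, ∀ v ∈ K, ∀ u M, SobBound q T l M u →
      SobBound q T l (C * ENNReal.ofReal ((k : ℝ) ^ A.κ) * M)
        fun w => (A.b k (v⁻¹ * (σ w * γ))).toReal * u w := by
  -- The lift `σ` is smooth only on `U`. The cutoff makes the gauge globally smooth in `w`, and it
  -- equals one on `T`, the only place where `u` can be nonzero.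
  obtain ⟨c, hc, hcc, hcU, hc1⟩ := exists_cutoff hT hU hTU
  set f : G → EuclideanSpace ℝ (Fin e) → ℝ := fun v w => c w * ϖ (v⁻¹ * (σ w * γ)) with hf
  have hfs : ContMDiff ((𝓡 n).prod (𝓡 e)) 𝓘(ℝ, ℝ) ∞
      fun z : G × EuclideanSpace ℝ (Fin e) => f z.1 z.2 := by
    refine contMDiff_of_tsupport_contMDiffAt fun z hz => ?_
    have hz2 : z.2 ∈ U := by
      refine hcU ?_
      refine closure_minimal (t := Prod.snd ⁻¹' tsupport c) (fun z hz => ?_)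
        ((isClosed_tsupport c).preimage continuous_snd) hz
      exact subset_tsupport _ (left_ne_zero_of_mul hz)
    have h1 : ContMDiffAt ((𝓡 n).prod (𝓡 e)) 𝓘(ℝ, ℝ) ∞
        (fun z : G × EuclideanSpace ℝ (Fin e) => c z.2) z :=
      hc.contMDiff.contMDiffAt.comp z contMDiffAt_snd
    have h2 : ContMDiffAt ((𝓡 n).prod (𝓡 e)) (𝓡 n) ∞
        (fun z : G × EuclideanSpace ℝ (Fin e) => σ z.2) z :=
      ContMDiffAt.comp z (g := σ) (hσ.contMDiffAt (hU.mem_nhds hz2)) contMDiffAt_snd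
    have h3 : ContMDiffAt ((𝓡 n).prod (𝓡 e)) (𝓡 n) ∞
        (fun z : G × EuclideanSpace ℝ (Fin e) => z.1⁻¹ * (σ z.2 * γ)) z :=
      contMDiffAt_fst.inv.mul (h2.mul contMDiffAt_const)
    exact h1.mul (hA.smooth_gauge.contMDiffAt.comp z h3)
  obtain ⟨C₁, hC₁⟩ := exists_bound_iteratedFDeriv hfs hcc (fun v w hw => by
    simp only [hf]; rw [image_eq_zero_of_notMem_tsupport hw, zero_mul]) hK l
  have hbd : ∀ m : ℕ, ∃ C, ∀ z, ‖iteratedFDeriv ℝ m h z‖ ≤ C := fun m =>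
    (hA.hasCompactSupport_profile.iteratedFDeriv m).exists_bound_of_continuous
      (hA.smooth_profile.continuous_iteratedFDeriv (m := m) (by exact_mod_cast le_top))
  choose C₂ hC₂ using hbd
  have hC₂0 : ∀ m, 0 ≤ C₂ m := fun m => (norm_nonneg _).trans (hC₂ m 0)
  set C₃ := ∑ m ∈ Finset.range (l + 1), C₂ m with hC₃
  have hC₃0 : 0 ≤ C₃ := Finset.sum_nonneg fun m _ => hC₂0 m
  set D := max C₁ 1 with hD
  have hD1 : 1 ≤ D := le_max_right _ _
  set Z : ℝ := l.factorial * C₃ * D ^ l * |C₀| with hZ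
  have hZ0 : 0 ≤ Z := by positivity
  refine ⟨2 ^ l * Z.toNNReal, fun k hk v hv u M hu => ?_⟩
  have hk1 : (1 : ℝ) ≤ k := by exact_mod_cast A.one_le_k₀.trans hk
  have hfv : ContDiff ℝ ∞ (f v) := by
    rw [← contMDiff_iff_contDiff]
    exact hfs.comp (contMDiff_const.prodMk contMDiff_id)
  have hgv : ContDiff ℝ ∞ fun w => (k : ℝ) ^ 2 * f v w := contDiff_const.mul hfv
  have ha : ContDiff ℝ ∞ fun w => N k * h ((k : ℝ) ^ 2 * f v w) :=
    contDiff_const.mul (hA.smooth_profile.comp hgv)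
  have hkD : 1 ≤ (k : ℝ) ^ 2 * D := one_le_mul_of_one_le_of_one_le (one_le_pow₀ hk1) hD1
  have hder : ∀ m ≤ l, ∀ w, ‖iteratedFDeriv ℝ m (fun w => N k * h ((k : ℝ) ^ 2 * f v w)) w‖ ≤
      Z * (k : ℝ) ^ A.κ := by
    intro m hm w
    have h1 : iteratedFDeriv ℝ m (fun w => N k * h ((k : ℝ) ^ 2 * f v w)) w =
        N k • iteratedFDeriv ℝ m (h ∘ fun w => (k : ℝ) ^ 2 * f v w) w :=
      iteratedFDeriv_const_smul_apply (a := N k) (f := h ∘ fun w => (k : ℝ) ^ 2 * f v w)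
        ((hA.smooth_profile.comp hgv).of_le (by exact_mod_cast le_top)).contDiffAt
    have h2 : ∀ i, 1 ≤ i → i ≤ m → ‖iteratedFDeriv ℝ i (fun w => (k : ℝ) ^ 2 * f v w) w‖ ≤
        ((k : ℝ) ^ 2 * D) ^ i := by
      intro i hi him
      have h3 : iteratedFDeriv ℝ i (fun w => (k : ℝ) ^ 2 * f v w) w =
          (k : ℝ) ^ 2 • iteratedFDeriv ℝ i (f v) w :=
        iteratedFDeriv_const_smul_apply (a := (k : ℝ) ^ 2) (f := f v)
          (hfv.of_le (by exact_mod_cast le_top)).contDiffAt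
      rw [h3, norm_smul, Real.norm_of_nonneg (by positivity)]
      calc (k : ℝ) ^ 2 * ‖iteratedFDeriv ℝ i (f v) w‖ ≤ (k : ℝ) ^ 2 * D := by
            gcongr
            exact (hC₁ v hv i (him.trans hm) w).trans (le_max_left _ _)
        _ ≤ _ := le_self_pow₀ hkD (by omega)
    have h4 : ∀ i ≤ m, ‖iteratedFDeriv ℝ i h ((k : ℝ) ^ 2 * f v w)‖ ≤ C₃ := fun i hi =>
      (hC₂ i _).trans (Finset.single_le_sum (f := C₂) (fun i _ => hC₂0 i)
        (Finset.mem_range.2 (by omega)))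
    -- Differentiating the profile of `k² f v` up to `m` times costs `(k² D)^m`. The bound `D ≥ 1`
    -- allows the `i`-th derivative of the inner function to be majorised by the `i`-th power, as
    -- the estimate for compositions demands.
    have h5 := norm_iteratedFDeriv_comp_le hA.smooth_profile hgv (n := m) (by exact_mod_cast le_top) w h4 h2
    rw [h1, norm_smul, Real.norm_of_nonneg (hA.factor_nonneg k)]
    calc _ ≤ N k * (m.factorial * C₃ * ((k : ℝ) ^ 2 * D) ^ m) := by
          gcongr
          exact hA.factor_nonneg k
      _ ≤ N k * (l.factorial * C₃ * ((k : ℝ) ^ 2 * D) ^ l) := by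
          gcongr
          exact hA.factor_nonneg k
      _ = l.factorial * C₃ * D ^ l * (N k * (k : ℝ) ^ (2 * l)) := by ring
      _ ≤ l.factorial * C₃ * D ^ l * (|C₀| * (k : ℝ) ^ A.κ) := by
          refine mul_le_mul_of_nonneg_left ((hA.le k hk).trans ?_) (by positivity)
          gcongr
          exact le_abs_self _
      _ = _ := by rw [hZ]; ring
  have h6 := SobBound.mul hq hT ha hder hu
  convert h6 using 1
  · rw [ENNReal.ofReal_mul hZ0]
    simp only [ENNReal.ofReal]
    push_cast
    ring
  · ext w
    by_cases hw : w ∈ T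
    · rw [hA.eq, ENNReal.toReal_ofReal (mul_nonneg (hA.profile_nonneg _) (hA.factor_nonneg k))]
      simp only [hf, hc1 w hw, one_mul]
      ring
    · rw [hu.base.2.1 w hw, mul_zero, mul_zero]

end DualitySetting

lemma IsQuotientChart.exists_isOpen_lift {n d : ℕ} {G Z : Type*} [TopologicalSpace G]
    [ChartedSpace (EuclideanSpace ℝ (Fin n)) G] [TopologicalSpace Z] {pr : G → Z}
    {κ : EuclideanSpace ℝ (Fin d) → Z} (hκ : IsQuotientChart n pr κ) (z : EuclideanSpace ℝ (Fin d)) :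
    ∃ U, IsOpen U ∧ z ∈ U ∧ ∃ σ : EuclideanSpace ℝ (Fin d) → G, ContMDiffOn (𝓡 d) (𝓡 n) ∞ σ U ∧
      ∀ w ∈ U, pr (σ w) = κ w := by
  obtain ⟨U, hU, σ, hσ, h⟩ := hκ.smooth z
  exact ⟨interior U, isOpen_interior, mem_interior_iff_mem_nhds.2 hU, σ, hσ.mono interior_subset,
    fun w hw => h w (interior_subset hw)⟩

/-! ### Smooth tubes above charts of `X`. -/

namespace DualitySetting

variable {n d : ℕ} {G : Type*} [Group G] [TopologicalSpace G] [IsTopologicalGroup G] [T2Space G]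
  [SecondCountableTopology G] [MeasurableSpace G] [BorelSpace G]
  [ChartedSpace (EuclideanSpace ℝ (Fin n)) G] [LieGroup (𝓡 n) ∞ G]
  {S : DualitySetting G} {κ : EuclideanSpace ℝ (Fin d) → S.X} {τ : S.X → EuclideanSpace ℝ (Fin d)}

/-- Two points above the same point of `X` differ by an element of `H`, and left multiplication by
it moves one local lift onto another. -/
lemma exists_lift_through (hκ : IsQuotientChart n S.projX κ) {z : EuclideanSpace ℝ (Fin d)} {g₀ : G}
    (hg₀ : S.projX g₀ = κ z) : ∃ U, IsOpen U ∧ z ∈ U ∧ ∃ σ : EuclideanSpace ℝ (Fin d) → G,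
      ContMDiffOn (𝓡 d) (𝓡 n) ∞ σ U ∧ (∀ w ∈ U, S.projX (σ w) = κ w) ∧ σ z = g₀ := by
  obtain ⟨U, hU, hz, σ, hσ, hσκ⟩ := hκ.exists_isOpen_lift z
  have hh : g₀ * (σ z)⁻¹ ∈ S.H := projX_eq_iff.1 ((hσκ z hz).trans hg₀.symm)
  refine ⟨U, hU, hz, fun w => (g₀ * (σ z)⁻¹) * σ w, contMDiffOn_const.mul hσ, fun w hw => ?_, by simp⟩
  rw [← hσκ w hw]
  exact projX_coe_mul ⟨_, hh⟩ (σ w)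

lemma lintegral_bump_pos [LocallyCompactSpace G] {χ : G → ℝ} (hχ : Continuous χ) (hχc : HasCompactSupport χ)
    (h1 : 0 < χ 1) : ∫⁻ h : S.H, ENNReal.ofReal (χ (h : G)⁻¹) ∂S.ρ ≠ 0 ∧
      ∫⁻ h : S.H, ENNReal.ofReal (χ (h : G)⁻¹) ∂S.ρ ≠ ⊤ := by
  have := S.haar_ρ
  have hLH : LocallyCompactSpace S.H := S.isClosed_H.isClosedEmbedding_subtypeVal.locallyCompactSpace
  have hcont : Continuous fun h : S.H => χ (h : G)⁻¹ := by fun_prop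
  constructor
  · intro h0
    rw [lintegral_eq_zero_iff (by fun_prop)] at h0
    have hopen : IsOpen {h : S.H | 0 < χ (h : G)⁻¹} := isOpen_lt continuous_const hcont
    have hpos := hopen.measure_pos S.ρ ⟨1, by simpa using h1⟩
    refine hpos.ne' (measure_mono_null (fun h hh => ?_) h0)
    have : 0 < χ (h : G)⁻¹ := hh
    simp [this]
  · have hcs : HasCompactSupport fun h : S.H => χ (h : G)⁻¹ :=
      hχc.comp_isClosedEmbedding (g := fun h : S.H => (h : G)⁻¹)
        ((Homeomorph.inv G).isClosedEmbedding.comp S.isClosed_H.isClosedEmbedding_subtypeVal)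
    exact (hcont.integrable_of_hasCompactSupport hcs).lintegral_lt_top.ne

/-- A smooth function on `G`, compactly supported above a chart, whose integrals over the cosets of
`H` are one above a given compact set. -/
theorem exists_smooth_tube (hκ : IsQuotientChart n S.projX κ) (hτ : ∀ z, τ (κ z) = z)
    (hτs : ContMDiffOn (𝓡 n) (𝓡 d) ∞ (τ ∘ S.projX) (S.projX ⁻¹' range κ))
    {L : Set (EuclideanSpace ℝ (Fin d))} (hL : IsCompact L) :
    ∃ a : G → ℝ, ContMDiff (𝓡 n) 𝓘(ℝ, ℝ) ∞ a ∧ HasCompactSupport a ∧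
      tsupport a ⊆ S.projX ⁻¹' range κ ∧ (∀ g, 0 ≤ a g) ∧
      ∀ z ∈ L, ∀ g, S.projX g = κ z → S.cosetInt (fun g => ENNReal.ofReal (a g)) g = 1 := by
  classical
  have := S.haar_ρ
  have hLC : LocallyCompactSpace G := Manifold.locallyCompact_of_finiteDimensional (𝓡 n)
  choose U hU hzU σ hσ hσκ using hκ.exists_isOpen_lift
  obtain ⟨s, η, hη, hη1⟩ := exists_finite_partition hL U fun x _ => (hU x).mem_nhds (hzU x)
  obtain ⟨χ⟩ : Nonempty (SmoothBumpFunction (𝓡 n) (1 : G)) := inferInstance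
  obtain ⟨hI0, hIt⟩ := lintegral_bump_pos (S := S) χ.contMDiff.continuous χ.hasCompactSupport
    (by rw [χ.eq_one]; exact one_pos)
  set I := ∫⁻ h : S.H, ENNReal.ofReal (χ (h : G)⁻¹) ∂S.ρ with hI
  set P := τ ∘ S.projX with hP
  have hRo : IsOpen (S.projX ⁻¹' range κ) := hκ.isOpenEmbedding.isOpen_range.preimage continuous_projX
  -- Locally `g = h σᵢ(P g)` with `h ∈ H`, and the function is a normalised bump in `h` times a
  -- cutoff in the coordinate `P g`. Its integral over the coset above `z` is `ηᵢ(z)`, and these sum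
  -- to one on `L`.
  set a : EuclideanSpace ℝ (Fin d) → G → ℝ := fun i => (S.projX ⁻¹' range κ).indicator fun g =>
    η i (P g) * (I.toReal⁻¹ * χ (g * (σ i (P g))⁻¹)) with ha
  have hsub : ∀ i ∈ s, ∃ C, IsCompact C ∧ tsupport (a i) ⊆ C ∩ S.projX ⁻¹' (κ '' tsupport (η i)) := by
    intro i hi
    obtain ⟨-, -, hc, hU', -⟩ := hη i hi
    have hc2 : IsCompact (σ i '' tsupport (η i)) :=
      hc.image_of_continuousOn ((hσ i).continuousOn.mono (hU'.trans interior_subset))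
    have hC : IsCompact (tsupport χ * σ i '' tsupport (η i)) := χ.hasCompactSupport.mul hc2
    refine ⟨_, hC, closure_minimal (fun g hg => ?_) (hC.isClosed.inter
      ((hc.image hκ.isOpenEmbedding.continuous).isClosed.preimage continuous_projX))⟩
    have hgR : g ∈ S.projX ⁻¹' range κ := mem_of_indicator_ne_zero hg
    rw [Function.mem_support, ha] at hg
    dsimp only at hg
    rw [indicator_of_mem hgR] at hg
    have h1 := subset_tsupport _ (left_ne_zero_of_mul hg)
    have h2 := subset_tsupport _ (right_ne_zero_of_mul (right_ne_zero_of_mul hg))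
    refine ⟨Set.mem_mul.2 ⟨_, h2, _, mem_image_of_mem _ h1, by group⟩, ?_⟩
    obtain ⟨z, hz⟩ := hgR
    refine ⟨P g, h1, ?_⟩
    simp [hP, ← hz, hτ]
  have hsm : ∀ i ∈ s, ContMDiff (𝓡 n) 𝓘(ℝ, ℝ) ∞ (a i) := by
    intro i hi
    obtain ⟨C, -, hC⟩ := hsub i hi
    obtain ⟨-, hηs, hc, hU', -⟩ := hη i hi
    refine contMDiff_of_tsupport_contMDiffAt fun g hg => ?_
    obtain ⟨z, hz, hzg⟩ := (hC hg).2
    have hgR : g ∈ S.projX ⁻¹' range κ := ⟨z, hzg⟩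
    have hPg : P g = z := by simp [hP, ← hzg, hτ]
    have h1 : ContMDiffAt (𝓡 n) (𝓡 d) ∞ P g := hτs.contMDiffAt (hRo.mem_nhds hgR)
    have h2 : ContMDiffAt (𝓡 n) (𝓡 n) ∞ (fun g => σ i (P g)) g :=
      ContMDiffAt.comp g (g := σ i) ((hσ i).contMDiffAt ((hU i).mem_nhds (by
        rw [hPg]; exact interior_subset (hU' hz)))) h1
    have h3 : ContMDiffAt (𝓡 n) 𝓘(ℝ, ℝ) ∞ (fun g => η i (P g)) g :=
      hηs.contMDiff.contMDiffAt.comp g h1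
    refine (h3.mul ((contMDiffAt_const (c := I.toReal⁻¹)).mul (χ.contMDiff.contMDiffAt.comp g
      (contMDiffAt_id.mul h2.inv)))).congr_of_eventuallyEq ?_
    filter_upwards [hRo.mem_nhds hgR] with g' hg'
    simp only [ha]
    rw [indicator_of_mem hg']
    rfl
  have hnn : ∀ i ∈ s, ∀ g, 0 ≤ a i g := fun i hi g => indicator_nonneg (fun g _ =>
    mul_nonneg ((hη i hi).2.2.2.2 _) (mul_nonneg (inv_nonneg.2 ENNReal.toReal_nonneg) χ.nonneg)) g
  have hsupp : tsupport (fun g => ∑ i ∈ s, a i g) ⊆ ⋃ i ∈ s, tsupport (a i) := by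
    refine closure_minimal (fun x hx => ?_)
      (isClosed_biUnion_finset fun i _ => isClosed_tsupport _)
    obtain ⟨i, hi, hne⟩ := Finset.exists_ne_zero_of_sum_ne_zero hx
    exact mem_iUnion₂.2 ⟨i, hi, subset_tsupport _ hne⟩
  refine ⟨fun g => ∑ i ∈ s, a i g, contMDiff_finsetSum hsm, ?_, ?_,
    fun g => Finset.sum_nonneg fun i hi => hnn i hi g, ?_⟩
  · refine (s.isCompact_biUnion fun i hi => ?_).of_isClosed_subset (isClosed_tsupport _) hsupp
    obtain ⟨C, hC, hCs⟩ := hsub i hi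
    exact hC.of_isClosed_subset (isClosed_tsupport _) (hCs.trans inter_subset_left)
  · refine hsupp.trans (iUnion₂_subset fun i hi => ?_)
    obtain ⟨C, hC, hCs⟩ := hsub i hi
    exact fun g hg => image_subset_range _ _ (hCs hg).2
  · intro z hz g hg
    have hterm : ∀ i ∈ s, S.cosetInt (fun g => ENNReal.ofReal (a i g)) g = ENNReal.ofReal (η i z) := by
      intro i hi
      have e1 : ∀ h : S.H, S.projX ((h : G)⁻¹ * g) = κ z := fun h => by
        rw [← hg]; exact projX_coe_mul h⁻¹ g
      have e2 : ∀ h : S.H, P ((h : G)⁻¹ * g) = z := fun h => by simp [hP, e1, hτ]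
      have e3 : ∀ h : S.H, a i ((h : G)⁻¹ * g) =
          η i z * (I.toReal⁻¹ * χ ((h : G)⁻¹ * g * (σ i z)⁻¹)) := fun h => by
        simp only [ha]
        rw [indicator_of_mem (by rw [mem_preimage, e1]; exact mem_range_self z), e2]
      unfold cosetInt
      by_cases hzi : η i z = 0
      · simp [e3, hzi]
      · have hzU' : z ∈ U i := interior_subset ((hη i hi).2.2.2.1 (subset_tsupport _ hzi))
        have hh₀ : g * (σ i z)⁻¹ ∈ S.H := projX_eq_iff.1 ((hσκ i z hzU').trans hg.symm)
        have e4 : ∀ h : S.H, ENNReal.ofReal (a i ((h : G)⁻¹ * g)) =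
            ENNReal.ofReal (η i z) * I⁻¹ * ENNReal.ofReal (χ (((⟨_, hh₀⟩ : S.H)⁻¹ * h : S.H) : G)⁻¹) := by
          intro h
          have e5 : (((⟨_, hh₀⟩ : S.H)⁻¹ * h : S.H) : G)⁻¹ = (h : G)⁻¹ * g * (σ i z)⁻¹ := by
            simp [mul_assoc]
          rw [e5, e3, ENNReal.ofReal_mul ((hη i hi).2.2.2.2 _), ENNReal.ofReal_mul
            (inv_nonneg.2 ENNReal.toReal_nonneg), ENNReal.ofReal_inv_of_pos
            (ENNReal.toReal_pos hI0 hIt), ENNReal.ofReal_toReal hIt, mul_assoc (ENNReal.ofReal _)]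
        simp_rw [e4]
        rw [lintegral_const_mul' _ _ (by finiteness),
          lintegral_mul_left_eq_self (μ := S.ρ) (fun h : S.H => ENNReal.ofReal (χ (h : G)⁻¹)),
          mul_assoc, ENNReal.inv_mul_cancel hI0 hIt, mul_one]
    have hm : ∀ i ∈ s, Measurable fun h : S.H => ENNReal.ofReal (a i ((h : G)⁻¹ * g)) := by
      intro i hi
      have := (hsm i hi).continuous
      fun_prop
    unfold cosetInt at hterm ⊢
    simp_rw [ENNReal.ofReal_sum_of_nonneg fun i hi => hnn i hi _]
    rw [lintegral_finsetSum s hm, Finset.sum_congr rfl hterm,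
      ← ENNReal.ofReal_sum_of_nonneg fun i hi => (hη i hi).2.2.2.2 z, hη1 z hz, ENNReal.ofReal_one]

end DualitySetting

/-- A map that is a translate of the identity along a slice has the identity as partial derivative. -/
lemma HasStrictFDerivAt.apply_inr_eq {E F : Type*} [NormedAddCommGroup E] [NormedSpace ℝ E]
    [NormedAddCommGroup F] [NormedSpace ℝ F] {f : E × F → F} {D : E × F →L[ℝ] F} {y₀ : E} {z₀ : F}
    (hD : HasStrictFDerivAt f D (y₀, 0)) (h : ∀ᶠ e in 𝓝 (0 : F), f (y₀, e) = z₀ + e) (e : F) :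
    D (0, e) = e := by
  have h1 : HasFDerivAt (fun e : F => (y₀, e)) (ContinuousLinearMap.inr ℝ E F) 0 :=
    hasFDerivAt_prodMk_right y₀ 0
  have h2 : HasFDerivAt (fun e => f (y₀, e)) (D.comp (ContinuousLinearMap.inr ℝ E F)) 0 :=
    hD.hasFDerivAt.comp (0 : F) h1
  have h3 : HasFDerivAt (fun e => f (y₀, e)) (ContinuousLinearMap.id ℝ F) 0 :=
    ((hasFDerivAt_id (0 : F)).const_add z₀).congr_of_eventuallyEq h
  simpa using congrArg (fun L : F →L[ℝ] F => L e) (h2.unique h3)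

/-! ### Bounded densities for the coordinates on `X`. -/

namespace DualitySetting

variable {n d : ℕ} {G : Type*} [Group G] [TopologicalSpace G] [IsTopologicalGroup G] [T2Space G]
  [SecondCountableTopology G] [MeasurableSpace G] [BorelSpace G]
  [ChartedSpace (EuclideanSpace ℝ (Fin n)) G] [LieGroup (𝓡 n) ∞ G]
  {S : DualitySetting G} {κ : EuclideanSpace ℝ (Fin d) → S.X} {τ : S.X → EuclideanSpace ℝ (Fin d)}

/-- The coordinates of the projection to `X` push Haar measure forward to a measure of locally bounded
density. -/
theorem exists_pushBound_projX (hκ : IsQuotientChart n S.projX κ) (hτ : ∀ z, τ (κ z) = z)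
    (hτs : ContMDiffOn (𝓡 n) (𝓡 d) ∞ (τ ∘ S.projX) (S.projX ⁻¹' range κ))
    {T : Set G} (hT : IsCompact T) (hTκ : T ⊆ S.projX ⁻¹' range κ) :
    ∃ C, PushBound S.m (τ ∘ S.projX) T C := by
  have := S.haar_m
  have hLC : LocallyCompactSpace G := Manifold.locallyCompact_of_finiteDimensional (𝓡 n)
  have hRo : IsOpen (S.projX ⁻¹' range κ) := hκ.isOpenEmbedding.isOpen_range.preimage continuous_projX
  refine exists_pushBound_of_forall_nhds hT fun g₀ hg₀ => ?_
  obtain ⟨z₀, hz₀⟩ := hTκ hg₀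
  obtain ⟨U, hU, hzU, σ, hσ, hσκ, hσ0⟩ := exists_lift_through hκ hz₀.symm
  obtain ⟨r₀, hr₀, hrU⟩ := Metric.isOpen_iff.1 hU z₀ hzU
  -- Left translation by `β e` preserves Haar measure and carries `g₀` to a point above `κ(z₀ + e)`,
  -- so the coordinate at `g₀` moves exactly by `e`.
  set β : EuclideanSpace ℝ (Fin d) → G := fun e => σ (z₀ + e) * g₀⁻¹ with hβ
  have hβ0 : β 0 = 1 := by simp [hβ, hσ0]
  have hβU : ∀ e ∈ Metric.ball (0 : EuclideanSpace ℝ (Fin d)) r₀, z₀ + e ∈ U := fun e he =>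
    hrU (by simpa using he)
  have hβs : ContMDiffOn (𝓡 d) (𝓡 n) ∞ β (Metric.ball 0 r₀) :=
    (hσ.comp (contDiff_const.add contDiff_id).contMDiff.contMDiffOn hβU).mul contMDiffOn_const
  have hβc : ContinuousOn (fun z : EuclideanSpace ℝ (Fin d) × G => β z.1)
      (Metric.ball 0 r₀ ×ˢ univ) := hβs.continuousOn.comp continuousOn_fst fun z hz => hz.1
  set ch := extChartAt (𝓡 n) g₀ with hch
  have hmap : map ch.symm (𝓝 (ch g₀)) = 𝓝 g₀ := by
    have := map_extChartAt_symm_nhdsWithin_range (I := 𝓡 n) g₀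
    rwa [ModelWithCorners.range_eq_univ, nhdsWithin_univ] at this
  have hch0 : ch.symm (ch g₀) = g₀ := extChartAt_to_inv g₀
  have hsm : ContDiffAt ℝ ∞ (fun z : EuclideanSpace ℝ (Fin n) × EuclideanSpace ℝ (Fin d) =>
      (τ ∘ S.projX) (β z.2 * ch.symm z.1)) (ch g₀, 0) := by
    rw [← contMDiffAt_iff_contDiffAt]
    have h1 : ContMDiffAt 𝓘(ℝ, EuclideanSpace ℝ (Fin n) × EuclideanSpace ℝ (Fin d)) (𝓡 n) ∞
        (fun z : EuclideanSpace ℝ (Fin n) × EuclideanSpace ℝ (Fin d) => ch.symm z.1) (ch g₀, 0) :=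
      ContMDiffAt.comp (ch g₀, 0) (I' := 𝓡 n) (g := ch.symm) (f := Prod.fst)
        ((contMDiffOn_extChartAt_symm g₀).contMDiffAt
          (show ch.target ∈ 𝓝 (ch g₀) from extChartAt_target_mem_nhds (I := 𝓡 n) g₀))
        contDiff_fst.contMDiff.contMDiffAt
    have h2 : ContMDiffAt 𝓘(ℝ, EuclideanSpace ℝ (Fin n) × EuclideanSpace ℝ (Fin d)) (𝓡 n) ∞
        (fun z : EuclideanSpace ℝ (Fin n) × EuclideanSpace ℝ (Fin d) => β z.2) (ch g₀, 0) :=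
      ContMDiffAt.comp (ch g₀, 0) (I' := 𝓡 d) (g := β) (f := Prod.snd)
        (hβs.contMDiffAt (Metric.ball_mem_nhds _ hr₀)) contDiff_snd.contMDiff.contMDiffAt
    have h3 := h2.mul h1
    refine ContMDiffAt.comp (ch g₀, 0) (g := τ ∘ S.projX) (I' := 𝓡 n) ?_ h3
    refine hτs.contMDiffAt (hRo.mem_nhds ?_)
    simp only [hβ0, hch0, one_mul]
    exact ⟨z₀, hz₀⟩
  have hD := hsm.hasStrictFDerivAt (by simp)
  refine exists_pushBound_nhds (T := fun e g => β e * g) (T' := fun e g => (β e)⁻¹ * g)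
    (fun e => measurePreserving_mul_left S.m (β e)) (fun e g => by simp) hr₀ ?_ ?_ (by simp [hβ0])
    ?_ hmap.ge hD (hD.apply_inr_eq (z₀ := z₀) ?_)
  · exact hβc.mul continuousOn_snd
  · exact hβc.inv.mul continuousOn_snd
  · filter_upwards [hRo.mem_nhds ⟨z₀, hz₀⟩] with g hg
    exact (hτs.continuousOn.continuousAt (hRo.mem_nhds hg))
  · filter_upwards [Metric.ball_mem_nhds _ hr₀] with e he
    simp [hβ, hch0, hσκ _ (hβU e he), hτ]

variable {d' : ℕ} {κ' : EuclideanSpace ℝ (Fin d') → S.Y}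

/-- Near a point of a chart of `Y` the coordinates on `X` of a translated local lift have a smooth right
inverse, and push Lebesgue measure forward to a measure of locally bounded density. -/
theorem exists_pushBound_lift (hκ : IsQuotientChart n S.projX κ) (hτ : ∀ z, τ (κ z) = z)
    (hτs : ContMDiffOn (𝓡 n) (𝓡 d) ∞ (τ ∘ S.projX) (S.projX ⁻¹' range κ))
    (hκ' : IsQuotientChart n S.projY κ') {U : Set (EuclideanSpace ℝ (Fin d'))} (hU : IsOpen U)
    {σ : EuclideanSpace ℝ (Fin d') → G} (hσ : ContMDiffOn (𝓡 d') (𝓡 n) ∞ σ U)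
    (hσκ : ∀ w ∈ U, S.projY (σ w) = κ' w) (γ : S.Γ) {T : Set (EuclideanSpace ℝ (Fin d'))}
    (hT : IsCompact T) (hTU : T ⊆ U) (hTκ : ∀ w ∈ T, S.projX (σ w * γ) ∈ range κ) :
    (∀ w ∈ T, ContDiffAt ℝ ∞ (fun w => (τ ∘ S.projX) (σ w * γ)) w) ∧
      ∃ C, PushBound volume (fun w => (τ ∘ S.projX) (σ w * γ)) T C := by
  have hLC : LocallyCompactSpace G := Manifold.locallyCompact_of_finiteDimensional (𝓡 n)
  have hRo : IsOpen (S.projX ⁻¹' range κ) := hκ.isOpenEmbedding.isOpen_range.preimage continuous_projX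
  have hV : IsOpen (U ∩ (fun w => σ w * γ) ⁻¹' (S.projX ⁻¹' range κ)) :=
    (hσ.continuousOn.mul continuousOn_const).isOpen_inter_preimage hU hRo
  have hQ : ∀ w ∈ U ∩ (fun w => σ w * γ) ⁻¹' (S.projX ⁻¹' range κ),
      ContDiffAt ℝ ∞ (fun w => (τ ∘ S.projX) (σ w * γ)) w := by
    intro w hw
    rw [← contMDiffAt_iff_contDiffAt]
    exact ContMDiffAt.comp w (g := τ ∘ S.projX) (I' := 𝓡 n) (hτs.contMDiffAt (hRo.mem_nhds hw.2))
      ((hσ.contMDiffAt (hU.mem_nhds hw.1)).mul contMDiffAt_const)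
  refine ⟨fun w hw => hQ w ⟨hTU hw, hTκ w hw⟩, exists_pushBound_of_forall_nhds hT fun w₀ hw₀ => ?_⟩
  obtain ⟨z₀, hz₀⟩ := hTκ w₀ hw₀
  obtain ⟨U₁, hU₁, hzU₁, σ₁, hσ₁, hσ₁κ, hσ₁0⟩ := exists_lift_through hκ hz₀.symm
  obtain ⟨τ', hτ', hτs'⟩ := hκ'.smooth_inv
  have hRo' : IsOpen (S.projY ⁻¹' range κ') :=
    hκ'.isOpenEmbedding.isOpen_range.preimage S.continuous_projY
  have h0 : S.projY (σ₁ z₀ * (γ : G)⁻¹) = κ' w₀ := by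
    rw [hσ₁0, mul_inv_cancel_right]; exact hσκ w₀ (hTU hw₀)
  -- the right inverse
  set b : EuclideanSpace ℝ (Fin d) → EuclideanSpace ℝ (Fin d') :=
    fun z => (τ' ∘ S.projY) (σ₁ z * (γ : G)⁻¹) with hb
  have hb0 : b z₀ = w₀ := by simp [hb, h0, hτ']
  have hσ₁s : ContMDiffAt (𝓡 d) (𝓡 n) ∞ (fun z => σ₁ z * (γ : G)⁻¹) z₀ :=
    (hσ₁.contMDiffAt (hU₁.mem_nhds hzU₁)).mul contMDiffAt_const
  have hbs : ContDiffAt ℝ ∞ b z₀ := by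
    rw [← contMDiffAt_iff_contDiffAt]
    exact ContMDiffAt.comp z₀ (g := τ' ∘ S.projY) (I' := 𝓡 n)
      (hτs'.contMDiffAt (hRo'.mem_nhds ⟨w₀, h0.symm⟩)) hσ₁s
  have hσc : ContinuousAt σ (b z₀) := by
    rw [hb0]; exact hσ.continuousOn.continuousAt (hU.mem_nhds (hTU hw₀))
  have hσb : ContinuousAt (fun z => σ (b z)) z₀ := ContinuousAt.comp (g := σ) hσc hbs.continuousAt
  -- The points `σ(b z)` and `σ₁(z) γ⁻¹` have the same image in `Y` and are close to each other.
  -- Discreteness of `Γ` forces them to be equal, so `b` is a right inverse of the coordinate map.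
  have hdisc : ∃ O ∈ 𝓝 (1 : G), ∀ x ∈ O, x ∈ S.Γ → x = 1 := by
    have := S.discrete_Γ
    obtain ⟨O, hO, h1⟩ := (discreteTopology_subtype_iff'.1 S.discrete_Γ) 1 S.Γ.one_mem
    refine ⟨O, hO.mem_nhds (by have : (1 : G) ∈ O ∩ S.Γ := by rw [h1]; rfl
                               exact this.1), fun x hx hxΓ => ?_⟩
    have : x ∈ O ∩ S.Γ := ⟨hx, hxΓ⟩
    rw [h1] at this
    exact this
  obtain ⟨O, hO, hOΓ⟩ := hdisc
  have hQb : ∀ᶠ z in 𝓝 z₀, (τ ∘ S.projX) (σ (b z) * γ) = z := by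
    have e1 : ∀ᶠ z in 𝓝 z₀, (σ (b z))⁻¹ * (σ₁ z * (γ : G)⁻¹) ∈ O := by
      refine (hσb.inv.mul hσ₁s.continuousAt).eventually_mem ?_
      simpa [hb0, hσ₁0] using hO
    have e2 : ∀ᶠ z in 𝓝 z₀, b z ∈ U :=
      hbs.continuousAt.eventually_mem (by rw [hb0]; exact hU.mem_nhds (hTU hw₀))
    have e3 : ∀ᶠ z in 𝓝 z₀, σ₁ z * (γ : G)⁻¹ ∈ S.projY ⁻¹' range κ' :=
      hσ₁s.continuousAt.eventually_mem (hRo'.mem_nhds ⟨w₀, h0.symm⟩)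
    filter_upwards [e1, e2, e3, hU₁.mem_nhds hzU₁] with z h1 h2 h3 h4
    obtain ⟨w, hw⟩ := h3
    have h5 : S.projY (σ (b z)) = S.projY (σ₁ z * (γ : G)⁻¹) := by
      rw [hσκ _ h2, ← hw]
      simp [hb, ← hw, hτ']
    have h6 := hOΓ _ h1 (QuotientGroup.eq.1 h5)
    have h7 : σ (b z) = σ₁ z * (γ : G)⁻¹ := inv_mul_eq_one.1 h6
    simp [h7, hσ₁κ z h4, hτ]
  set B := fderiv ℝ b z₀ with hB
  have hbd : HasFDerivAt b B z₀ := (hbs.differentiableAt (by simp)).hasFDerivAt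
  have hQ0 := hQ w₀ ⟨hTU hw₀, z₀, hz₀⟩
  have hQd := hQ0.hasStrictFDerivAt (n := ∞) (by simp)
  set A := fderiv ℝ (fun w => (τ ∘ S.projX) (σ w * γ)) w₀ with hA
  have hAB : ∀ e, A (B e) = e := by
    have h1 : HasFDerivAt (fun z => (τ ∘ S.projX) (σ (b z) * γ)) (A.comp B) z₀ :=
      HasFDerivAt.comp z₀ (g := fun w => (τ ∘ S.projX) (σ w * γ)) (by rw [hb0]; exact hQd.hasFDerivAt) hbd
    have h2 : HasFDerivAt (fun z => (τ ∘ S.projX) (σ (b z) * γ)) (ContinuousLinearMap.id ℝ _) z₀ :=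
      (hasFDerivAt_id z₀).congr_of_eventuallyEq hQb
    intro e
    simpa using congrArg (fun L : EuclideanSpace ℝ (Fin d) →L[ℝ] EuclideanSpace ℝ (Fin d) => L e)
      (h1.unique h2)
  have hlin : HasStrictFDerivAt (fun z : EuclideanSpace ℝ (Fin d') × EuclideanSpace ℝ (Fin d) =>
      z.1 + B z.2) (ContinuousLinearMap.fst ℝ _ _ + B.comp (ContinuousLinearMap.snd ℝ _ _)) (w₀, 0) :=
    (ContinuousLinearMap.fst ℝ _ _ + B.comp (ContinuousLinearMap.snd ℝ _ _)).hasStrictFDerivAt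
  have hD := HasStrictFDerivAt.comp (w₀, (0 : EuclideanSpace ℝ (Fin d)))
    (g := fun w => (τ ∘ S.projX) (σ w * γ)) (g' := A) (by simpa using hQd) hlin
  -- Lebesgue measure is invariant under `w ↦ w + B e`, with `B` the derivative of the right
  -- inverse; because `A B` is the identity, the coordinate then moves by `e` to first order.
  refine exists_pushBound_nhds (T := fun e w => w + B e) (T' := fun e w => w - B e)
    (fun e => measurePreserving_add_right volume (B e)) (fun e w => by simp) one_pos ?_ ?_ (by simp)
    ?_ (c := fun w => w) (by rw [Filter.map_id']) hD (fun e => by simp [hAB])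
  · exact Continuous.continuousOn (by fun_prop)
  · exact Continuous.continuousOn (by fun_prop)
  · filter_upwards [hV.mem_nhds ⟨hTU hw₀, z₀, hz₀⟩] with w hw
    exact (hQ w hw).continuousAt

end DualitySetting

/-! ### Sobolev norms of periodized localisations. -/

namespace DualitySetting

variable {n d d' : ℕ} {G : Type*} [Group G] [TopologicalSpace G] [IsTopologicalGroup G] [T2Space G]
  [SecondCountableTopology G] [MeasurableSpace G] [BorelSpace G]
  [ChartedSpace (EuclideanSpace ℝ (Fin n)) G] [LieGroup (𝓡 n) ∞ G]
  {S : DualitySetting G}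

/-- One term of a periodization, in local coordinates on `Y`. -/
lemma SmoothWeights.exists_sobBound_term {A : S.WeightFamily} {l : ℕ} {ϖ : G → ℝ} {h : ℝ → ℝ}
    {N : ℕ → ℝ} {C₀ : ℝ} (hA : SmoothWeights A n l ϖ h N C₀)
    {κ : EuclideanSpace ℝ (Fin d) → S.X} {τ : S.X → EuclideanSpace ℝ (Fin d)}
    (hκ : IsQuotientChart n S.projX κ) (hτ : ∀ z, τ (κ z) = z)
    (hτs : ContMDiffOn (𝓡 n) (𝓡 d) ∞ (τ ∘ S.projX) (S.projX ⁻¹' range κ))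
    {a : G → ℝ} (ha : ContMDiff (𝓡 n) 𝓘(ℝ, ℝ) ∞ a) (haκ : tsupport a ⊆ S.projX ⁻¹' range κ)
    {κ' : EuclideanSpace ℝ (Fin d') → S.Y} (hκ' : IsQuotientChart n S.projY κ') {ψ : S.Y → ℝ}
    (hψ : ContMDiff (𝓡 n) 𝓘(ℝ, ℝ) ∞ (ψ ∘ S.projY)) {U : Set (EuclideanSpace ℝ (Fin d'))}
    (hU : IsOpen U) {σ : EuclideanSpace ℝ (Fin d') → G} (hσ : ContMDiffOn (𝓡 d') (𝓡 n) ∞ σ U)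
    (hσκ : ∀ w ∈ U, S.projY (σ w) = κ' w) {θ : EuclideanSpace ℝ (Fin d') → ℝ} (hθ : ContDiff ℝ ∞ θ)
    (hθc : IsCompact (tsupport θ)) (hθU : tsupport θ ⊆ U) (γ : S.Γ) {K : Set G} (hK : IsCompact K)
    {L : Set (EuclideanSpace ℝ (Fin d))} (hL : IsCompact L) {q : ℝ≥0∞} (hq : 1 ≤ q) :
    ∃ c : ℝ≥0, ∀ k ≥ A.k₀, ∀ v ∈ K, ∀ u M, SobBound q L l M u →
      SobBound q (tsupport θ) l (c * ENNReal.ofReal ((k : ℝ) ^ A.κ) * M) fun w =>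
        (A.b k (v⁻¹ * (σ w * γ))).toReal *
          (θ w * ψ (κ' w) * a (σ w * γ) * u (τ (S.projX (σ w * γ)))) := by
  -- On `T` the lifted point `σ(w)γ` lies in the support of the tube function, hence above the chart
  -- of `X`, which is where the coordinate map is smooth.
  set T := tsupport θ ∩ (fun w => σ w * (γ : G)) ⁻¹' tsupport a with hTd
  have hσγ : ContinuousOn (fun w => σ w * (γ : G)) (tsupport θ) :=
    (hσ.continuousOn.mono hθU).mul continuousOn_const
  have hT : IsCompact T := hθc.of_isClosed_subset
    (hσγ.preimage_isClosed_of_isClosed (isClosed_tsupport _) (isClosed_tsupport _)) inter_subset_left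
  have hTU : T ⊆ U := inter_subset_left.trans hθU
  set α : EuclideanSpace ℝ (Fin d') → ℝ := fun w => θ w * ψ (κ' w) * a (σ w * γ) with hα
  have hαT : tsupport α ⊆ T := closure_minimal (fun w hw =>
    ⟨subset_tsupport _ (left_ne_zero_of_mul (left_ne_zero_of_mul hw)),
      subset_tsupport _ (right_ne_zero_of_mul hw)⟩) hT.isClosed
  have hαs : ContDiff ℝ ∞ α := by
    refine contDiff_of_tsupport' fun w hw => ?_
    have hwU := hTU (hαT hw)
    have hσw := hσ.contMDiffAt (hU.mem_nhds hwU)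
    rw [← contMDiffAt_iff_contDiffAt]
    have h1 : ContMDiffAt (𝓡 d') 𝓘(ℝ, ℝ) ∞ (fun w => (ψ ∘ S.projY) (σ w)) w :=
      hψ.contMDiffAt.comp w hσw
    have h2 : ContMDiffAt (𝓡 d') 𝓘(ℝ, ℝ) ∞ (fun w => ψ (κ' w)) w := by
      refine h1.congr_of_eventuallyEq ?_
      filter_upwards [hU.mem_nhds hwU] with w' hw'
      simp [hσκ w' hw']
    have h3 : ContMDiffAt (𝓡 d') 𝓘(ℝ, ℝ) ∞ (fun w => a (σ w * γ)) w :=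
      ha.contMDiffAt.comp w (hσw.mul contMDiffAt_const)
    exact (hθ.contMDiff.contMDiffAt.mul h2).mul h3
  obtain ⟨hQ, C, hC⟩ := exists_pushBound_lift hκ hτ hτs hκ' hU hσ hσκ γ hT hTU fun w hw => haκ hw.2
  obtain ⟨c₁, hc₁⟩ := exists_sobBound_mul_comp hq hC hT hQ hL l hαs hαT
  obtain ⟨c₂, hc₂⟩ := hA.exists_sobBound_mul hU hσ hT hTU (γ : G) hK hq
  refine ⟨c₂ * c₁, fun k hk v hv u M hu => ?_⟩
  have := (hc₂ k hk v hv _ _ (hc₁ u M hu)).mono_set inter_subset_left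
  refine this.mono (le_of_eq ?_)
  push_cast
  ring

/-- The Sobolev norm, in a chart of `Y`, of a periodized localisation of a function on `G` that is
given by functions on charts of `X`. -/
theorem SmoothWeights.exists_sobolevNorm_periodize_le {A : S.WeightFamily} {l : ℕ} {ϖ : G → ℝ}
    {h : ℝ → ℝ} {N : ℕ → ℝ} {C₀ : ℝ} (hA : SmoothWeights A n l ϖ h N C₀) {J : Type*} [Fintype J]
    {κ : J → EuclideanSpace ℝ (Fin d) → S.X} {τ : J → S.X → EuclideanSpace ℝ (Fin d)}
    (hκ : ∀ j, IsQuotientChart n S.projX (κ j)) (hτ : ∀ j z, τ j (κ j z) = z)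
    (hτs : ∀ j, ContMDiffOn (𝓡 n) (𝓡 d) ∞ (τ j ∘ S.projX) (S.projX ⁻¹' range (κ j)))
    {a : J → G → ℝ} (ha : ∀ j, ContMDiff (𝓡 n) 𝓘(ℝ, ℝ) ∞ (a j))
    (hac : ∀ j, HasCompactSupport (a j)) (haκ : ∀ j, tsupport (a j) ⊆ S.projX ⁻¹' range (κ j))
    {κ' : EuclideanSpace ℝ (Fin d') → S.Y} (hκ' : IsQuotientChart n S.projY κ') {ψ : S.Y → ℝ}
    (hψ : ContMDiff (𝓡 n) 𝓘(ℝ, ℝ) ∞ (ψ ∘ S.projY)) (hψκ : tsupport ψ ⊆ range κ')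
    {K : Set G} (hK : IsCompact K) {L : J → Set (EuclideanSpace ℝ (Fin d))}
    (hL : ∀ j, IsCompact (L j)) {q : ℝ≥0∞} (hq : 1 ≤ q) :
    ∃ c : ℝ≥0, ∀ k ≥ A.k₀, ∀ v ∈ K, ∀ u : J → EuclideanSpace ℝ (Fin d) → ℝ, ∀ M,
      (∀ j, SobBound q (L j) l M (u j)) → (∀ g, 0 ≤ ∑ j, a j g * u j (τ j (S.projX g))) →
      sobolevNorm l q (fun w => (S.periodize (fun g =>
        ENNReal.ofReal (∑ j, a j g * u j (τ j (S.projX g))) * A.b k (v⁻¹ * g)) (κ' w)).toReal *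
          ψ (κ' w)) ≤ c * ENNReal.ofReal ((k : ℝ) ^ A.κ) * M := by
  classical
  have hLC : LocallyCompactSpace G := Manifold.locallyCompact_of_finiteDimensional (𝓡 n)
  set Ω := ⋃ j, tsupport (a j) with hΩd
  have hΩ : IsCompact Ω := isCompact_iUnion fun j => hac j
  have hL' : IsCompact (κ' ⁻¹' (tsupport ψ ∩ S.projY '' Ω)) := by
    refine hκ'.isOpenEmbedding.isInducing.isCompact_preimage' ?_ (inter_subset_left.trans hψκ)
    exact (hΩ.image S.continuous_projY).inter_left (isClosed_tsupport _)
  choose U hU hzU σ hσ hσκ using hκ'.exists_isOpen_lift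
  obtain ⟨s, θ, hθ, hθ1⟩ := exists_finite_partition hL' U fun x _ => (hU x).mem_nhds (hzU x)
  have hθU : ∀ r ∈ s, tsupport (θ r) ⊆ U r := fun r hr => (hθ r hr).2.2.2.1.trans interior_subset
  -- Over the compact support of a cutoff only finitely many lattice elements bring the local lift
  -- into `Ω`, so in coordinates the periodization is a finite sum. The set of these elements is
  -- independent of `k`, `v` and `u`.
  have hfin : ∀ r ∈ s, ∃ R : Finset S.Γ, ∀ w ∈ tsupport (θ r), ∀ γ : S.Γ, σ r w * γ ∈ Ω → γ ∈ R := by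
    intro r hr
    have hc : IsCompact (σ r '' tsupport (θ r)) :=
      (hθ r hr).2.2.1.image_of_continuousOn ((hσ r).continuousOn.mono (hθU r hr))
    refine ⟨(S.finite_lattice_inter (hc.inv.mul hΩ)).toFinset, fun w hw γ hγ => ?_⟩
    simp only [Finite.mem_toFinset, mem_ofPred_eq]
    exact Set.mem_mul.2 ⟨(σ r w)⁻¹, Set.inv_mem_inv.2 (mem_image_of_mem _ hw), _, hγ, by group⟩
  choose! R hR using hfin
  have hterm : ∀ r (γ : S.Γ) j, ∃ c : ℝ≥0, r ∈ s → ∀ k ≥ A.k₀, ∀ v ∈ K, ∀ u M, SobBound q (L j) l M u →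
      SobBound q (tsupport (θ r)) l (c * ENNReal.ofReal ((k : ℝ) ^ A.κ) * M) fun w =>
        (A.b k (v⁻¹ * (σ r w * γ))).toReal *
          (θ r w * ψ (κ' w) * a j (σ r w * γ) * u (τ j (S.projX (σ r w * γ)))) := by
    intro r γ j
    by_cases hr : r ∈ s
    · obtain ⟨c, hc⟩ := hA.exists_sobBound_term (hκ j) (hτ j) (hτs j) (ha j) (haκ j) hκ' hψ (hU r)
        (hσ r) (hσκ r) (hθ r hr).2.1 (hθ r hr).2.2.1 (hθU r hr) γ hK (hL j) hq
      exact ⟨c, fun _ => hc⟩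
    · exact ⟨0, fun h => absurd h hr⟩
  choose c hc using hterm
  set K' := ⋃ r ∈ s, tsupport (θ r) with hK'd
  have hK' : IsCompact K' := s.isCompact_biUnion fun r hr => (hθ r hr).2.2.1
  refine ⟨multiIndexCount d' l * ∑ r ∈ s, ∑ γ ∈ R r, ∑ j, c r γ j, fun k hk v hv u M hu hnn => ?_⟩
  set f : G → ℝ := fun g => ∑ j, a j g * u j (τ j (S.projX g)) with hf
  have hfΩ : ∀ g, g ∉ Ω → f g = 0 := fun g hg => Finset.sum_eq_zero fun j _ => by
    rw [image_eq_zero_of_notMem_tsupport fun h' => hg (mem_iUnion.2 ⟨j, h'⟩), zero_mul]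
  set F : S.Y → ℝ := fun y =>
    (S.periodize (fun g => ENNReal.ofReal (f g) * A.b k (v⁻¹ * g)) y).toReal with hF
  have hbt : ∀ g, A.b k g ≠ ⊤ := fun g => ne_top_of_le_ne_top ENNReal.ofReal_ne_top (A.le k hk g)
  have hFΩ : ∀ y, y ∉ S.projY '' Ω → F y = 0 := by
    intro y hy
    obtain ⟨g, rfl⟩ := S.projY_surjective y
    simp only [hF]
    rw [periodize_projY, ENNReal.tsum_eq_zero.2 fun γ => ?_, ENNReal.toReal_zero]
    rw [hfΩ, ENNReal.ofReal_zero, zero_mul]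
    exact fun h' => hy ⟨_, h', QuotientGroup.eq.2 (by simp)⟩
  have hFσ : ∀ r ∈ s, ∀ w, θ r w * F (κ' w) =
      ∑ γ ∈ R r, θ r w * (f (σ r w * γ) * (A.b k (v⁻¹ * (σ r w * γ))).toReal) := by
    intro r hr w
    by_cases hw : θ r w = 0
    · simp [hw]
    have hwT : w ∈ tsupport (θ r) := subset_tsupport _ hw
    rw [← Finset.mul_sum]
    congr 1
    simp only [hF]
    rw [← hσκ r w (hθU r hr hwT), periodize_projY, tsum_eq_sum (s := R r) fun γ hγ => by
      rw [hfΩ _ fun h' => hγ (hR r hr w hwT γ h'), ENNReal.ofReal_zero, zero_mul],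
      ENNReal.toReal_sum fun γ _ => ENNReal.mul_ne_top ENNReal.ofReal_ne_top (hbt _)]
    exact Finset.sum_congr rfl fun γ _ => by
      rw [ENNReal.toReal_mul, ENNReal.toReal_ofReal (hnn _)]
  have hEq : (fun w => F (κ' w) * ψ (κ' w)) = fun w => ∑ r ∈ s, ∑ γ ∈ R r, ∑ j,
      (A.b k (v⁻¹ * (σ r w * γ))).toReal *
        (θ r w * ψ (κ' w) * a j (σ r w * γ) * u j (τ j (S.projX (σ r w * γ)))) := by
    ext w
    have h1 : F (κ' w) * ψ (κ' w) = ∑ r ∈ s, (θ r w * F (κ' w)) * ψ (κ' w) := by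
      rw [← Finset.sum_mul, ← Finset.sum_mul]
      by_cases hw : w ∈ κ' ⁻¹' (tsupport ψ ∩ S.projY '' Ω)
      · rw [hθ1 w hw, one_mul]
      · by_cases h2 : κ' w ∈ tsupport ψ
        · rw [hFΩ _ fun h' => hw ⟨h2, h'⟩]; simp
        · rw [image_eq_zero_of_notMem_tsupport h2]; simp
    rw [h1]
    refine Finset.sum_congr rfl fun r hr => ?_
    rw [hFσ r hr, Finset.sum_mul]
    refine Finset.sum_congr rfl fun γ _ => ?_
    simp only [hf]
    rw [Finset.sum_mul, Finset.mul_sum, Finset.sum_mul]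
    exact Finset.sum_congr rfl fun j _ => by ring
  have hsob : SobBound q K' l (∑ r ∈ s, ∑ γ ∈ R r, ∑ j, c r γ j * ENNReal.ofReal ((k : ℝ) ^ A.κ) * M)
      fun w => F (κ' w) * ψ (κ' w) := by
    rw [hEq]
    refine SobBound.sum hq hK' s fun r hr => SobBound.sum hq hK' _ fun γ _ =>
      SobBound.sum hq hK' _ fun j _ => ?_
    exact (hc r γ j hr k hk v hv (u j) M (hu j)).mono_set (subset_biUnion_of_mem (u := fun r => tsupport (θ r)) hr)
  refine (sobolevNorm_le_of_sobBound hq hK' hsob).trans (le_of_eq ?_)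
  simp_rw [← Finset.sum_mul]
  push_cast
  ring

end DualitySetting

/-! ### Lifts and conclusion for Sobolev spaces. -/

namespace DualitySetting

variable {n : ℕ} {G : Type*} [Group G] [TopologicalSpace G] [IsTopologicalGroup G] [T2Space G]
  [SecondCountableTopology G] [MeasurableSpace G] [BorelSpace G]
  [ChartedSpace (EuclideanSpace ℝ (Fin n)) G] [LieGroup (𝓡 n) ∞ G]
  {S : DualitySetting G}

/-- The lift is the sum over charts of `a_j` times the pullback of `φ ψ_j`. Since `a_j` has coset
integral one wherever `φ ψ_j` is nonzero, the coset integrals of the lift add up to `φ`. Its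
`L^q`-norm is bounded through the bounded density of the coordinate projections. -/
theorem liftable_sobolev {A : S.WeightFamily} {l : ℕ} {ϖ : G → ℝ} {h : ℝ → ℝ} {N : ℕ → ℝ} {C₀ : ℝ}
    (hA : SmoothWeights A n l ϖ h N C₀) {q : ℝ≥0∞} (hq : 1 ≤ q) :
    Liftable S A q (IsSobolevNorm n S.projY l q) (IsSobolevNorm n S.projX l q) := by
  classical
  have := S.haar_ρ
  have := S.haar_m
  have hLC : LocallyCompactSpace G := Manifold.locallyCompact_of_finiteDimensional (𝓡 n)
  rintro D hD _ ⟨d, m, 𝒞, rfl⟩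
  choose τ hτ hτs using fun j => (𝒞.isChart j).smooth_inv
  -- Outside this compact set the local expression of `φ ψ_j` vanishes, so its finite Sobolev norm
  -- converts into an inductive bound, and the tubes need only be normalised above it.
  set L : Fin m → Set (EuclideanSpace ℝ (Fin d)) := fun j => 𝒞.chart j ⁻¹' (tsupport (𝒞.ψ j) ∩ D) with hLd
  have hL : ∀ j, IsCompact (L j) := fun j =>
    (𝒞.isChart j).isOpenEmbedding.isInducing.isCompact_preimage' (hD.inter_left (isClosed_tsupport _))
      (inter_subset_left.trans (𝒞.tsupport_subset j))
  choose a ha hac haκ ha0 ha1 using fun j => exists_smooth_tube (𝒞.isChart j) (hτ j) (hτs j) (hL j)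
  set u : (S.X → ℝ) → Fin m → EuclideanSpace ℝ (Fin d) → ℝ :=
    fun φ j w => φ (𝒞.chart j w) * 𝒞.ψ j (𝒞.chart j w) with hu
  set lift : (S.X → ℝ) → G → ℝ := fun φ g => ∑ j, a j g * u φ j (τ j (S.projX g)) with hlift
  -- The left inverse `τ j` is meaningful only on the range of its chart; elsewhere both sides
  -- vanish because `a j` does.
  have hau : ∀ φ j g, a j g * u φ j (τ j (S.projX g)) =
      a j g * (φ (S.projX g) * 𝒞.ψ j (S.projX g)) := by
    intro φ j g
    by_cases hg : a j g = 0
    · simp [hg]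
    · obtain ⟨z, hz⟩ := haκ j (subset_tsupport _ hg)
      simp only [hu]
      rw [← hz, hτ]
  set Nφ := 𝒞.norm l q with hN
  have hsob : ∀ φ ∈ PositiveCone S.ξ D Nφ, ∀ j, SobBound q (L j) l (Nφ φ) (u φ j) := by
    intro φ hφ j
    have hle : sobolevNorm l q (u φ j) ≤ Nφ φ :=
      Finset.single_le_sum (f := fun j => sobolevNorm l q (u φ j)) (fun _ _ => zero_le)
        (Finset.mem_univ j)
    refine (sobBound_of_sobolevNorm (hL j) (fun w hw => ?_) (ne_top_of_le_ne_top hφ.2.2.2 hle)).mono hle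
    simp only [hu]
    by_cases h1 : 𝒞.chart j w ∈ D
    · rw [image_eq_zero_of_notMem_tsupport fun h2 => hw ⟨h2, h1⟩, mul_zero]
    · rw [hφ.2.2.1 _ h1, zero_mul]
  have hnn : ∀ φ ∈ PositiveCone S.ξ D Nφ, ∀ j g, 0 ≤ a j g * u φ j (τ j (S.projX g)) :=
    fun φ hφ j g => mul_nonneg (ha0 j g) (mul_nonneg (hφ.2.1 _) (𝒞.nonneg j _))
  have hRo : ∀ j, IsOpen (S.projX ⁻¹' range (𝒞.chart j)) := fun j =>
    (𝒞.isChart j).isOpenEmbedding.isOpen_range.preimage continuous_projX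
  have hpush : ∀ j, ∃ c : ℝ≥0, ∀ φ ∈ PositiveCone S.ξ D Nφ,
      MemLp (fun g => a j g * u φ j (τ j (S.projX g))) q S.m ∧
        eLpNorm (fun g => a j g * u φ j (τ j (S.projX g))) q S.m ≤ c * Nφ φ := by
    intro j
    obtain ⟨C, hC⟩ := exists_pushBound_projX (𝒞.isChart j) (hτ j) (hτs j) (hac j) (haκ j)
    obtain ⟨Z, hZ⟩ := (hac j).exists_bound_of_continuous (ha j).continuous
    refine ⟨Z.toNNReal * max C 1, fun φ hφ => ?_⟩
    have hb := (hsob φ hφ j).base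
    obtain ⟨h1, h2⟩ := hC.memLp_mul_comp (isClosed_tsupport (a j)).measurableSet
      (((hτs j).continuousOn.mono (haκ j)).aemeasurable (isClosed_tsupport (a j)).measurableSet)
      (ha j).continuous.aestronglyMeasurable hZ (fun g hg => image_eq_zero_of_notMem_tsupport hg) hq hb.1
    refine ⟨h1, h2.trans ?_⟩
    rw [ENNReal.coe_mul, ENNReal.ofReal]
    gcongr
    exact hb.2.2
  choose c hc using hpush
  refine ⟨⋃ j, tsupport (a j), lift, ∑ j, c j, isCompact_iUnion hac, ⟨?_, ?_, ?_, ?_, ?_⟩, ?_⟩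
  · intro φ hφ
    exact Finset.aestronglyMeasurable_fun_sum _ fun j _ => (hc j φ hφ).1.1
  · exact fun φ hφ g => Finset.sum_nonneg fun j _ => hnn φ hφ j g
  · intro φ _ g hg
    refine Finset.sum_eq_zero fun j _ => ?_
    rw [image_eq_zero_of_notMem_tsupport fun h' => hg (mem_iUnion.2 ⟨j, h'⟩), zero_mul]
  · intro φ hφ g
    have e1 : ∀ h : S.H, S.projX ((h : G)⁻¹ * g) = S.projX g := fun h => projX_coe_mul h⁻¹ g
    have hφψ : ∀ j, 0 ≤ φ (S.projX g) * 𝒞.ψ j (S.projX g) := fun j => mul_nonneg (hφ.2.1 _) (𝒞.nonneg j _)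
    have hterm : ∀ j, ENNReal.ofReal (φ (S.projX g) * 𝒞.ψ j (S.projX g)) *
        S.cosetInt (fun g => ENNReal.ofReal (a j g)) g =
        ENNReal.ofReal (φ (S.projX g) * 𝒞.ψ j (S.projX g)) := by
      intro j
      by_cases h0 : φ (S.projX g) * 𝒞.ψ j (S.projX g) = 0
      · simp [h0]
      · have h1 : S.projX g ∈ tsupport (𝒞.ψ j) := subset_tsupport _ (right_ne_zero_of_mul h0)
        have h2 : S.projX g ∈ D := by
          by_contra h2; exact left_ne_zero_of_mul h0 (hφ.2.2.1 _ h2)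
        obtain ⟨z, hz⟩ := 𝒞.tsupport_subset j h1
        rw [ha1 j z (by simp only [hLd, mem_preimage, hz]; exact ⟨h1, h2⟩) g hz.symm, mul_one]
    have hm : ∀ j ∈ Finset.univ, Measurable fun h : S.H => ENNReal.ofReal (a j ((h : G)⁻¹ * g)) := by
      intro j _
      have := (ha j).continuous
      fun_prop
    have hsum : φ (S.projX g) = ∑ j, φ (S.projX g) * 𝒞.ψ j (S.projX g) := by
      rw [← Finset.mul_sum]
      by_cases h2 : S.projX g ∈ D
      · rw [𝒞.sum_eq_one _ h2, mul_one]
      · rw [hφ.2.2.1 _ h2, zero_mul]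
    conv_rhs => rw [hsum, ENNReal.ofReal_sum_of_nonneg fun j _ => hφψ j]
    rw [← Finset.sum_congr rfl fun j _ => hterm j]
    unfold cosetInt
    simp only [hlift, hau, e1]
    simp_rw [ENNReal.ofReal_sum_of_nonneg fun j _ => mul_nonneg (ha0 j _) (hφψ j),
      ENNReal.ofReal_mul (ha0 _ _)]
    rw [lintegral_finsetSum _ fun j hj => (hm j hj).mul_const _]
    refine Finset.sum_congr rfl fun j hj => ?_
    rw [lintegral_mul_const _ (hm j hj), mul_comm]
  · intro φ hφ
    have h := eLpNorm_sum_le (f := fun j g => a j g * u φ j (τ j (S.projX g)))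
      (s := Finset.univ) (fun j _ => (hc j φ hφ).1.1) hq
    have e : (∑ j, fun g => a j g * u φ j (τ j (S.projX g))) = lift φ := by
      ext g; simp [hlift]
    rw [e] at h
    refine h.trans ?_
    push_cast
    rw [Finset.sum_mul]
    exact Finset.sum_le_sum fun j _ => (hc j φ hφ).2
  · rintro B - - _ ⟨d', m', 𝒞', rfl⟩ K hK
    choose c' hc' using fun i => hA.exists_sobolevNorm_periodize_le (fun j => 𝒞.isChart j) hτ hτs ha hac
      haκ (𝒞'.isChart i) (𝒞'.smooth i) (𝒞'.tsupport_subset i) hK hL hq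
    refine ⟨∑ i, c' i, fun φ hφ k hk v hv => ?_⟩
    push_cast
    rw [Finset.sum_mul, Finset.sum_mul]
    exact Finset.sum_le_sum fun i _ => hc' i k hk v hv (u φ) _ (hsob φ hφ)
      fun g => Finset.sum_nonneg fun j _ => hnn φ hφ j g

theorem conclusion_sobolev {p q : ℝ≥0∞} (hp : 1 ≤ p) (hpq : p < q)
    [Bundle.RiemannianBundle (fun x : G => TangentSpace (𝓡 n) x)]
    [IsContMDiffRiemannianBundle (𝓡 n) ∞ (EuclideanSpace ℝ (Fin n))
      (fun x : G => TangentSpace (𝓡 n) x)] (l : ℕ) (h1 : S.CA1) (h2 : S.CA2)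
    (hL : S.LipschitzBalls (riemannianNhd n G)) :
    S.Conclusion p q (IsSobolevNorm n S.projY l q) (IsSobolevNorm n S.projX l q) := by
  have hLC : LocallyCompactSpace G := Manifold.locallyCompact_of_finiteDimensional (𝓡 n)
  obtain ⟨A, ϖ, h, N, C, hA⟩ := exists_smoothWeights hL l
  exact conclusion_of_liftable A h1 h2 hp hpq (liftable_sobolev hA (hp.trans hpq.le))

end DualitySetting

end

theorem theorem7p1 (p q : ℝ≥0∞) (hp : 1 ≤ p) (hpq : p < q) :
    -- Lebesgue spaces (`l = 0`), for a locally compact second countable group `G`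
    (∀ (G : Type*) [Group G] [TopologicalSpace G] [IsTopologicalGroup G] [T2Space G]
        [LocallyCompactSpace G] [SecondCountableTopology G] [MeasurableSpace G] [BorelSpace G]
        (S : DualitySetting G) (O : ℝ → Set G),
      S.CA1 → S.CA2 → DualitySetting.IsSymmetricBasis O → S.LipschitzBalls O →
      S.HasBumps O q → DualitySetting.HasCovers O → S.HasLipschitzSections O →
      S.Conclusion p q (IsLebesgueNorm S.μ q) (IsLebesgueNorm S.ξ q)) ∧
    -- Sobolev spaces (`l ≥ 1`), for a connected Lie group `G` with a Riemannian metric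
    (∀ (n : ℕ) (G : Type*) [Group G] [TopologicalSpace G] [IsTopologicalGroup G] [T2Space G]
        [SecondCountableTopology G] [ConnectedSpace G] [MeasurableSpace G] [BorelSpace G]
        [ChartedSpace (EuclideanSpace ℝ (Fin n)) G] [LieGroup (𝓡 n) ∞ G]
        [Bundle.RiemannianBundle (fun x : G => TangentSpace (𝓡 n) x)]
        [IsContMDiffRiemannianBundle (𝓡 n) ∞ (EuclideanSpace ℝ (Fin n))
          (fun x : G => TangentSpace (𝓡 n) x)]
        (S : DualitySetting G) (l : ℕ),
      1 ≤ l → S.CA1 → S.CA2 → S.LipschitzBalls (riemannianNhd n G) →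
      S.Conclusion p q (IsSobolevNorm n S.projY l q) (IsSobolevNorm n S.projX l q)) := by
  refine ⟨?_, ?_⟩
  · intro G _ _ _ _ _ _ _ _ S O h1 h2 hO hL _ hcov _
    exact DualitySetting.conclusion_lebesgue hp hpq h1 h2 hO hL hcov
  · intro n G _ _ _ _ _ _ _ _ _ _ _ _ S l _ h1 h2 hL
    exact DualitySetting.conclusion_sobolev hp hpq l h1 h2 hL
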